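/- Let $(R,\mathfrak m)$ be a Noetherian local ring and let $M$ be a finite $R$-module. We use the conventions $\dim(\emptyset)=-\infty$ and $\operatorname{depth}(0)=\infty$. A finite module $N$ over a Noetherian local ring is *Cohen--Macaulay* if $N=0$ or $\operatorname{depth}(N)=\dim(\operatorname{Supp}(N))$. A coherent module $\mathscr F$ on a locally Noetherian scheme $X$ is *Cohen--Macaulay* if, for every $x\in X$, the stalk $\mathscr F_x$ is a Cohen--Macaulay $\mathscr O_{X,x}$-module. A sequence $r_1,\dots,r_s\in\mathfrak m$ (with $s\ge 0$) is *secant for $M$* if $$\dim(\operatorname{Supp}(M/(r_1,\dots,r_i)M))<\dim(\operatorname{Supp}(M/(r_1,\dots,r_{i-1})M))\qquad\text{for every } 1\le i\le s,$$ and it is *CM-secant for $M$* if it is secant for $M$, the $R$-module $M/(r_1,\dots,r_s)M$ is Cohen--Macaulay, and $$r_i\in\prod_{0\le j<\dim(\operatorname{Supp}(M/(r_1,\dots,r_{i-1})M))}\operatorname{Ann}_R\bigl(H^j_{\mathfrak m}(R,\,M/(r_1,\dots,r_{i-1})M)\bigr)\qquad\text{for every } 1\le i\le s,$$ where $H^j_{\mathfrak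 m}(R,-)$ is local cohomology. For an ideal $I\subset R$, let $\operatorname{Bl}_I(R)=\operatorname{Proj}\bigl(\bigoplus_{n\ge 0}I^n\bigr)$ be the blowing up of $\operatorname{Spec}(R)$ along $I$, and let $\operatorname{Bl}_I(M)$ be the quasi-coherent module on $\operatorname{Bl}_I(R)$ associated to the graded $\bigl(\bigoplus_{n\ge 0}I^n\bigr)$-module $\bigoplus_{n\ge 0}I^nM$ (the strict transform of $M$). **Theorem (Kawasaki).** If $r_1,\dots,r_s\in\mathfrak m$ is a CM-secant sequence for $M$ and $I=\prod_{i=1}^{s}(r_1,\dots,r_i)$, then $\operatorname{Bl}_I(M)$ is a Cohen--Macaulay module on $\operatorname{Bl}_I(R)$: the scheme $\operatorname{Bl}_I(R)$ is locally Noetherian, the module $\operatorname{Bl}_I(M)$ is coherent, and for every $x\in\operatorname{Bl}_I(R)$ the stalk $\operatorname{Bl}_I(M)_x$ is a Cohen--Macaulay module over the local ring $\mathscr O_{\operatorname{Bl}_I(R),x}$. -/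

import Mathlib

open AlgebraicGeometry TopologicalSpace CategoryTheory Opposite
open scoped Polynomial

universe u

noncomputable section

/-! ## Sheaf of modules on `Proj` associated with a graded module -/

namespace ProjModule

section

variable {A σ τ : Type u} [CommRing A] [SetLike σ A] [AddSubgroupClass σ A]
  (𝒜 : ℕ → σ) [GradedRing 𝒜]

/-- The complement of the homogeneous prime ideal `x`. -/
abbrev compl (x : ProjectiveSpectrum.top 𝒜) : Submonoid A :=
  haveI : x.asHomogeneousIdeal.toIdeal.IsPrime := ProjectiveSpectrum.isPrime (𝒜 := 𝒜) x
  x.asHomogeneousIdeal.toIdeal.primeCompl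

/-- The localization of the `A`-module `N` at the homogeneous prime ideal `x`. -/
abbrev Localizations (N : Type u) [AddCommGroup N] [Module A N]
    (x : ProjectiveSpectrum.top 𝒜) : Type u :=
  LocalizedModule (compl 𝒜 x) N

variable {N : Type u} [AddCommGroup N] [Module A N] [SetLike τ N] [AddSubgroupClass τ N]
  (𝒩 : ℕ → τ) 

/-- The function `f` on `U` is given by a single fraction `n / s` with `n ∈ N` and `s ∈ A`
homogeneous of the same degree. -/
def IsFraction {U : Opens (ProjectiveSpectrum.top 𝒜)}
    (f : ∀ x : U, Localizations 𝒜 N x.1) : Prop :=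
  ∃ (i : ℕ) (n : 𝒩 i) (s : 𝒜 i), ∀ x : U,
    ∃ hs : s.1 ∈ compl 𝒜 x.1, f x = LocalizedModule.mk n.1 ⟨s.1, hs⟩

/-- The property of being given by a single fraction passes to smaller open subsets. -/
def isFractionPrelocal : TopCat.PrelocalPredicate (Localizations 𝒜 N) where
  pred {_} f := IsFraction 𝒜 𝒩 f
  res := by
    rintro V U i f ⟨j, n, s, w⟩
    exact ⟨j, n, s, fun x => w (i x)⟩

/-- The property of being locally given by fractions of degree `0`. -/
def isLocallyFraction : TopCat.LocalPredicate (Localizations 𝒜 N) :=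
  (isFractionPrelocal 𝒜 𝒩).sheafify

/-- The sheaf of sets of functions that are locally fractions of degree `0`. -/
def sheafInType : TopCat.Sheaf (Type u) (ProjectiveSpectrum.top 𝒜) :=
  TopCat.subsheafToTypes (isLocallyFraction 𝒜 𝒩)

variable [SetLike.GradedSMul 𝒜 𝒩]

/-- The functions that are locally fractions of degree `0` form a subgroup. -/
def sectionsSubgroup (U : Opens (ProjectiveSpectrum.top 𝒜)) :
    AddSubgroup (∀ x : U, Localizations 𝒜 N x.1) where
  carrier := {f | (isLocallyFraction 𝒜 𝒩).pred f}
  zero_mem' := fun x => ⟨U, x.2, 𝟙 _, 0, ⟨0, zero_mem _⟩, ⟨1, SetLike.GradedOne.one_mem⟩,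
    fun y => ⟨one_mem _, by simp⟩⟩
  add_mem' := by
    intro a b ha hb x
    obtain ⟨Va, ma, ia, da, ra, sa, wa⟩ := ha x
    obtain ⟨Vb, mb, ib, db, rb, sb, wb⟩ := hb x
    refine ⟨Va ⊓ Vb, ⟨ma, mb⟩, Opens.infLELeft _ _ ≫ ia, da + db,
      ⟨sb.1 • ra.1 + sa.1 • rb.1, add_mem ?_ ?_⟩,
      ⟨sa.1 * sb.1, SetLike.mul_mem_graded sa.2 sb.2⟩, fun y => ?_⟩
    · rw [add_comm da db]
      exact SetLike.GradedSMul.smul_mem sb.2 ra.2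
    · exact SetLike.GradedSMul.smul_mem sa.2 rb.2
    · obtain ⟨hsa, ea⟩ := wa ⟨y.1, y.2.1⟩
      obtain ⟨hsb, eb⟩ := wb ⟨y.1, y.2.2⟩
      exact ⟨mul_mem hsa hsb, congr($ea + $eb).trans (LocalizedModule.mk_add_mk ..)⟩
  neg_mem' := by
    intro a ha x
    obtain ⟨V, m, i, d, r, s, w⟩ := ha x
    refine ⟨V, m, i, d, ⟨-r.1, neg_mem r.2⟩, s, fun y => ?_⟩
    obtain ⟨hs, e⟩ := w y
    exact ⟨hs, congr(-$e).trans LocalizedModule.mk_neg.symm⟩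

instance (U : (Opens (ProjectiveSpectrum.top 𝒜))ᵒᵖ) :
    AddCommGroup ((sheafInType 𝒜 𝒩).obj.obj U) :=
  inferInstanceAs (AddCommGroup (sectionsSubgroup 𝒜 𝒩 U.unop))

/-- The presheaf of abelian groups underlying the sheaf of functions that are locally fractions
of degree `0`. -/
def presheafInAb : TopCat.Presheaf Ab.{u} (ProjectiveSpectrum.top 𝒜) where
  obj U := AddCommGrpCat.of ((sheafInType 𝒜 𝒩).obj.obj U)
  map i := AddCommGrpCat.ofHom
    { toFun := (sheafInType 𝒜 𝒩).obj.map i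
      map_zero' := rfl
      map_add' := fun _ _ => rfl }

/-- A section `a` of the structure sheaf acts on a function `f` that is locally a fraction by
`(a • f) x = a x • f x`, where `a x` is viewed in the full localization of `A` at `x`. -/
instance (U : (Opens (ProjectiveSpectrum.top 𝒜))ᵒᵖ) :
    SMul ((Proj 𝒜).presheaf.obj U) ((sheafInType 𝒜 𝒩).obj.obj U) where
  smul a f := ⟨fun x => (show Localization (compl 𝒜 x.1) from (a.1 x).val) • f.1 x, by
    intro x
    obtain ⟨Va, ma, ia, da, ra, sa, ha, wa⟩ := a.2 x
    obtain ⟨Vb, mb, ib, db, rb, sb, wb⟩ := f.2 x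
    refine ⟨Va ⊓ Vb, ⟨ma, mb⟩, Opens.infLELeft _ _ ≫ ia, da + db,
      ⟨ra.1 • rb.1, SetLike.GradedSMul.smul_mem ra.2 rb.2⟩,
      ⟨sa.1 * sb.1, SetLike.mul_mem_graded sa.2 sb.2⟩, fun y => ?_⟩
    obtain ⟨hsb, eb⟩ := wb ⟨y.1, y.2.2⟩
    have ea := wa ⟨y.1, y.2.1⟩
    refine ⟨mul_mem (ha ⟨y.1, y.2.1⟩) hsb, ?_⟩
    exact (congrArg₂ (fun (p : Localization (compl 𝒜 y.1)) (q : Localizations 𝒜 N y.1) => p • q)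
      (congrArg HomogeneousLocalization.val ea) eb).trans
        (LocalizedModule.mk_smul_mk _ _ _ _)⟩


instance (U : (Opens (ProjectiveSpectrum.top 𝒜))ᵒᵖ) :
    Module ((Proj 𝒜).presheaf.obj U) ((sheafInType 𝒜 𝒩).obj.obj U) where
  one_smul f := by
    refine Subtype.ext (funext fun x => ?_)
    exact (congrArg (fun p : Localization (compl 𝒜 x.1) => p • f.1 x)
      HomogeneousLocalization.val_one).trans (one_smul _ _)
  mul_smul a b f := by
    refine Subtype.ext (funext fun x => ?_)
    exact (congrArg (fun p : Localization (compl 𝒜 x.1) => p • f.1 x)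
      (HomogeneousLocalization.val_mul (a.1 x) (b.1 x))).trans (mul_smul _ _ _)
  smul_zero a := Subtype.ext (funext fun x => smul_zero _)
  smul_add a f g := Subtype.ext (funext fun x => smul_add _ _ _)
  add_smul a b f := by
    refine Subtype.ext (funext fun x => ?_)
    exact (congrArg (fun p : Localization (compl 𝒜 x.1) => p • f.1 x)
      (HomogeneousLocalization.val_add (a.1 x) (b.1 x))).trans (add_smul _ _ _)
  zero_smul f := by
    refine Subtype.ext (funext fun x => ?_)
    exact (congrArg (fun p : Localization (compl 𝒜 x.1) => p • f.1 x)
      HomogeneousLocalization.val_zero).trans (zero_smul _ _)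

/-- The presheaf of modules on `Proj 𝒜` associated with the graded module `𝒩`. -/
def presheafOfModules :
    PresheafOfModules.{u} ((Proj 𝒜).presheaf ⋙ forget₂ CommRingCat RingCat) :=
  letI M : (Opens (Proj 𝒜))ᵒᵖ ⥤ Ab.{u} := presheafInAb 𝒜 𝒩
  letI (U : (Opens (Proj 𝒜))ᵒᵖ) :
      Module (((Proj 𝒜).presheaf ⋙ forget₂ CommRingCat RingCat).obj U) (M.obj U) :=
    (show Module ((Proj 𝒜).presheaf.obj (show (Opens (ProjectiveSpectrum.top 𝒜))ᵒᵖ from U))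
      ((sheafInType 𝒜 𝒩).obj.obj (show (Opens (ProjectiveSpectrum.top 𝒜))ᵒᵖ from U)) from inferInstance)
  .ofPresheaf M fun _ _ _ _ _ => rfl

/-- The quasi-coherent sheaf of modules on `Proj 𝒜` associated with the graded module
`N = ⨁ 𝒩 n`: its sections over `U` are the functions on `U` with values in the localizations
`N_x` that are locally of the form `n / s` with `n ∈ N` and `s ∈ A` homogeneous of the same degree
(so that its stalk at `x` is the degree `0` part of the localization of `N` at the homogeneous
elements of `A` outside `x`). -/
def associatedSheaf [DirectSum.Decomposition 𝒩] : (Proj 𝒜).Modules where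
  val := presheafOfModules 𝒜 𝒩
  isSheaf := (TopCat.Presheaf.isSheaf_iff_isSheaf_comp (forget AddCommGrpCat) _).2
    (sheafInType 𝒜 𝒩).2

end
end ProjModule

/-! ## Blowing up a ring and a module along an ideal -/

namespace BlowingUp

variable {R : Type u} [CommRing R] (I : Ideal R)

/-- The degree `n` part `I ^ n` of the Rees algebra `⨁ n, I ^ n`. -/
def reesGrading (n : ℕ) : Submodule R (reesAlgebra I) where
  carrier := {f | ∀ m, m ≠ n → f.1.coeff m = 0}
  zero_mem' m _ := Polynomial.coeff_zero m
  add_mem' {f g} hf hg m hm := by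
    change (f.1 + g.1).coeff m = 0
    rw [Polynomial.coeff_add, hf m hm, hg m hm, add_zero]
  smul_mem' r f hf m hm := by
    change (r • f.1).coeff m = 0
    rw [Polynomial.coeff_smul, hf m hm, smul_zero]

theorem reesGrading_isInternal : DirectSum.IsInternal (reesGrading I) := by
  classical
  have key : ∀ (x : DirectSum ℕ fun n => reesGrading I n) (n : ℕ),
      (DirectSum.coeAddMonoidHom (reesGrading I) x).1.coeff n = (x n).1.1.coeff n := by
    intro x n
    induction x using DirectSum.induction_on with
    | zero => rfl
    | of i y =>
      rw [DirectSum.coeAddMonoidHom_of]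
      by_cases h : i = n
      · subst h
        rw [DirectSum.of_eq_same]
      · rw [DirectSum.of_eq_of_ne _ _ _ (Ne.symm h)]
        exact y.2 n (Ne.symm h)
    | add x y hx hy =>
      rw [AddMonoidHom.map_add, DirectSum.add_apply]
      exact (Polynomial.coeff_add _ _ _).trans
        ((congrArg₂ (· + ·) hx hy).trans (Polynomial.coeff_add _ _ _).symm)
  refine ⟨fun x y hxy => ?_, fun f => ?_⟩
  · refine DFinsupp.ext fun n => Subtype.ext (Subtype.ext (Polynomial.ext fun m => ?_))
    by_cases h : m = n
    · subst h
      exact (key x m).symm.trans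
        ((congrArg (fun p : reesAlgebra I => p.1.coeff m) hxy).trans (key y m))
    · exact ((x n).2 m h).trans ((y n).2 m h).symm
  · let y : DirectSum ℕ fun n => reesGrading I n :=
      DirectSum.mk _ f.1.support fun n =>
        ⟨⟨Polynomial.monomial n (f.1.coeff n), reesAlgebra.monomial_mem.2 (f.2 n)⟩, fun m hm =>
          Polynomial.coeff_monomial_of_ne _ hm⟩
    refine ⟨y, Subtype.ext (Polynomial.ext fun n => (key y n).trans ?_)⟩
    by_cases h : n ∈ f.1.support
    · rw [DirectSum.mk_apply_of_mem h]
      exact Polynomial.coeff_monomial_same _ _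
    · rw [DirectSum.mk_apply_of_notMem h]
      exact (Polynomial.notMem_support_iff.1 h).symm

instance : SetLike.GradedMonoid (reesGrading I) where
  one_mem m hm := (Polynomial.coeff_one (R := R)).trans (if_neg hm)
  mul_mem i j f g hf hg m hm := by
    refine (Polynomial.coeff_mul f.1 g.1 m).trans (Finset.sum_eq_zero fun p hp => ?_)
    have hp := Finset.HasAntidiagonal.mem_antidiagonal.1 hp
    by_cases h : p.1 = i
    · rw [hg p.2 (fun h' => hm (by rw [← hp, h, h'])), mul_zero]
    · rw [hf p.1 h, zero_mul]

instance : GradedRing (reesGrading I) where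
  toDecomposition := (reesGrading_isInternal I).chooseDecomposition

/-- The blowing up `Bl_I(R) = Proj (⨁ n, I ^ n)`. -/
def blowup : Scheme.{u} := Proj (reesGrading I)

variable (M : Type u) [AddCommGroup M] [Module R M]

/-- The graded module `⨁ n, I ^ n M` over the Rees algebra `⨁ n, I ^ n`. -/
abbrev reesModule : Submodule (reesAlgebra I) (PolynomialModule R M) :=
  (I.stableFiltration (⊤ : Submodule R M)).submodule

/-- The degree `n` part `I ^ n M` of `⨁ n, I ^ n M`. -/
def reesModuleGrading (n : ℕ) : AddSubgroup (reesModule I M) where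
  carrier := {f | ∀ m, m ≠ n → f.1.coeff m = 0}
  zero_mem' m _ := rfl
  add_mem' {f g} hf hg m hm := by
    change f.1.coeff m + g.1.coeff m = 0
    rw [hf m hm, hg m hm, add_zero]
  neg_mem' {f} hf m hm := by
    change - f.1.coeff m = 0
    rw [hf m hm, neg_zero]

theorem reesModuleGrading_isInternal : DirectSum.IsInternal (reesModuleGrading I M) := by
  classical
  have key : ∀ (x : DirectSum ℕ fun n => reesModuleGrading I M n) (n : ℕ),
      (DirectSum.coeAddMonoidHom (reesModuleGrading I M) x).1.coeff n = (x n).1.1.coeff n := by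
    intro x n
    induction x using DirectSum.induction_on with
    | zero => rfl
    | of i y =>
      rw [DirectSum.coeAddMonoidHom_of]
      by_cases h : i = n
      · subst h
        rw [DirectSum.of_eq_same]
      · rw [DirectSum.of_eq_of_ne _ _ _ (Ne.symm h)]
        exact y.2 n (Ne.symm h)
    | add x y hx hy =>
      rw [AddMonoidHom.map_add, DirectSum.add_apply]
      exact congrArg₂ (· + ·) hx hy
  refine ⟨fun x y hxy => ?_, fun f => ?_⟩
  · refine DFinsupp.ext fun n => Subtype.ext (Subtype.ext (PolynomialModule.ext (Finsupp.ext fun m => ?_)))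
    by_cases h : m = n
    · subst h
      exact (key x m).symm.trans
        ((congrArg (fun p : reesModule I M => p.1.coeff m) hxy).trans (key y m))
    · exact ((x n).2 m h).trans ((y n).2 m h).symm
  · let y : DirectSum ℕ fun n => reesModuleGrading I M n :=
      DirectSum.mk _ f.1.coeff.support fun n =>
        ⟨⟨PolynomialModule.single R n (f.1.coeff n), fun m => by
          rw [PolynomialModule.coeff_single, Finsupp.single_apply]
          split_ifs with h
          · exact h ▸ f.2 n
          · exact zero_mem _⟩, fun m hm => by
          change (PolynomialModule.single R n (f.1.coeff n)).coeff m = 0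
          rw [PolynomialModule.coeff_single, Finsupp.single_eq_of_ne hm]⟩
    refine ⟨y, Subtype.ext (PolynomialModule.ext (Finsupp.ext fun n => (key y n).trans ?_))⟩
    by_cases h : n ∈ f.1.coeff.support
    · rw [DirectSum.mk_apply_of_mem h]
      change (PolynomialModule.single R n (f.1.coeff n)).coeff n = f.1.coeff n
      rw [PolynomialModule.coeff_single, Finsupp.single_eq_same]
    · rw [DirectSum.mk_apply_of_notMem h]
      exact (Finsupp.notMem_support_iff.1 h).symm

instance : DirectSum.Decomposition (reesModuleGrading I M) :=
  (reesModuleGrading_isInternal I M).chooseDecomposition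

instance : SetLike.GradedSMul (reesGrading I) (reesModuleGrading I M) where
  smul_mem := by
    intro i j f g hf hg m hm
    refine (PolynomialModule.smul_apply f.1 g.1 m).trans (Finset.sum_eq_zero fun p hp => ?_)
    have hp := Finset.HasAntidiagonal.mem_antidiagonal.1 hp
    by_cases h : p.1 = i
    · rw [hg p.2 (fun h' => hm (by rw [← hp, h, h', vadd_eq_add])), smul_zero]
    · rw [hf p.1 h, zero_smul]

/-- The module `Bl_I(M)` on `Bl_I(R)` associated with the graded module `⨁ n, I ^ n M`, that is,
the strict transform of `M`. -/
def blowupModule : (blowup I).Modules :=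
  ProjModule.associatedSheaf (reesGrading I) (reesModuleGrading I M)

end BlowingUp

/-! ## Cohen--Macaulay modules -/

namespace CohenMacaulay

section

variable (R N : Type*) [CommRing R] [IsLocalRing R] [AddCommGroup N] [Module R N]

/-- The depth of a finite module `N` over a Noetherian local ring `R`: the supremum of the lengths
of the `N`-regular sequences in the maximal ideal (with the convention that the depth of the zero
module is `∞`). For `N ≠ 0` the condition `N ≠ (r₁, …, rₙ) N` in the definition of a regular
sequence is automatic by the Nakayama lemma. -/
def depth : ℕ∞ :=
  ⨆ (rs : List R) (_ : ∀ r ∈ rs, r ∈ IsLocalRing.maximalIdeal R)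
    (_ : RingTheory.Sequence.IsWeaklyRegular N rs), (rs.length : ℕ∞)

/-- A finite module `N` over a Noetherian local ring `R` is Cohen--Macaulay if it is zero or its
depth is the dimension of its support. -/
def IsCohenMacaulayModule : Prop :=
  Subsingleton N ∨ (depth R N : WithBot ℕ∞) = Module.supportDim R N

end

variable {X : Scheme.{u}} (F : X.Modules)

/-- The stalk of a sheaf of modules is a module over the stalk of the structure sheaf. -/
instance stalkModule (x : X) : Module (X.presheaf.stalk x) (F.presheaf.stalk x) :=
  letI P : PresheafOfModules.{u} (X.presheaf ⋙ forget₂ CommRingCat RingCat) := F.val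
  inferInstanceAs (Module (X.presheaf.stalk x) (TopCat.Presheaf.stalk (C := Ab.{u}) P.presheaf x))

/-- A Cohen--Macaulay module on a scheme: the scheme is locally Noetherian, the module is coherent
(that is, quasi-coherent and of finite type), and all its stalks are Cohen--Macaulay. -/
structure IsCohenMacaulaySheaf : Prop where
  isLocallyNoetherian : IsLocallyNoetherian X
  isQuasicoherent : F.IsQuasicoherent
  isFiniteType : F.IsFiniteType
  stalk (x : X) : IsCohenMacaulayModule (X.presheaf.stalk x) (F.presheaf.stalk x)

end CohenMacaulay

/-! ## CM-secant sequences -/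

namespace CMSecant

variable {R : Type u} [CommRing R] {s : ℕ} (r : Fin s → R)

/-- The ideal `(r₁, …, rᵢ)` generated by the first `i` terms `r 0, …, r (i - 1)` of the
sequence `r`. -/
def initialIdeal (i : ℕ) : Ideal R :=
  Ideal.span {a | ∃ j : Fin s, j.1 < i ∧ r j = a}

/-- The quotient `M / (r₁, …, rᵢ) M`. -/
abbrev initialQuotient (M : Type u) [AddCommGroup M] [Module R M] (i : ℕ) : Type u :=
  M ⧸ (initialIdeal r i • ⊤ : Submodule R M)

variable [IsLocalRing R] (M : Type u) [AddCommGroup M] [Module R M]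

/-- The product `∏_{j < dim (Supp N)} Ann_R (H^j_𝔪 (R, N))` over `0 ≤ j < dim (Supp N)`. -/
def cohomologyAnnihilator (N : Type u) [AddCommGroup N] [Module R N] : Ideal R :=
  ∏ j ∈ Finset.range ((Module.supportDim R N).unbotD 0).toNat,
    Module.annihilator R
      ((localCohomology (IsLocalRing.maximalIdeal R) j).obj (ModuleCat.of R N))

/-- The sequence `r` is secant for `M`: its terms lie in the maximal ideal and each of them lowers
the dimension of the support. -/
def IsSecant : Prop :=
  (∀ i, r i ∈ IsLocalRing.maximalIdeal R) ∧
    ∀ i : Fin s, Module.supportDim R (initialQuotient r M (i + 1)) <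
      Module.supportDim R (initialQuotient r M i)

/-- The sequence `r` is CM-secant for `M`. -/
structure IsCMSecant : Prop where
  isSecant : IsSecant r M
  isCohenMacaulay : CohenMacaulay.IsCohenMacaulayModule R (initialQuotient r M s)
  mem (i : Fin s) : r i ∈ cohomologyAnnihilator (initialQuotient r M i)

/-- The product ideal `∏_{i = 1}^s (r₁, …, rᵢ)`. -/
def productIdeal : Ideal R :=
  ∏ i ∈ Finset.Icc 1 s, initialIdeal r i

end CMSecant

end

/-! Number the given sequence `x 0, …, x (s - 1)` and append a maximal regular sequence `x s, …, x
(n - 1)` on the Cohen-Macaulay quotient of `M`. The blown-up ideal is then the product of the ideals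
`(x 0, …, x (k - 1))` for `1 ≤ k ≤ s`, and all the `x k` together generate an ideal that contains a
power of the maximal ideal modulo `Ann M` (`CMSecant.exists_isSecantSystem`).

Cohomological input. If `z₁, …, z_l` generate an ideal that is primary to the maximal ideal modulo
`Ann N`, then the product of the annihilators of the local cohomology of `N` in degrees below `l`
kills `((z₁, …, z_{l-1})N : z_l) / (z₁, …, z_{l-1})N` (`LocalCohomology.smul_mem_of_smul_mem`). The
Koszul complex has torsion cohomology, so multipliers can be pushed through its cycles and
boundaries. As the `x k` lie in such products, they form an unconditioned strong d-sequence on `M`: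
`x i x j a ∈ U` with `i ≤ j` implies `x i a ∈ U`, for `U` generated by arbitrary powers of the other
terms (`IsSecantSystem.isAdmissible`).

Algebra of strong d-sequences. Powers of the ideals they generate meet the submodules generated by
some of the terms in the expected way (`IsGoodFamily.powSum_inter`), and the property passes to `X /
x i X` and, less obviously, to `X / (x p X + (0 : x p))` (`IsStrongDSeq.quotient_colonSum`).

Charts. An affine chart selects a pivot `x (f k)` in each factor of the ideal, with `f 1 = 0` and `f
(k + 1)` equal to `f k` or to `k`; it is generated by coordinates `c k`, equal to `x k / x (f k)` if
the pivot is kept and to `x (f k) / x k` if it changes. Dividing by the first coordinate gives a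
chart of `X / x i X` in the first case and of `X / (x p X + (0 : x p))` in the second, whence by
induction `c 1, …, c (s - 1), x (f s), x s, …, x (n - 1)` is weakly regular
(`IsChart.isWeaklyRegular`).

Points. At a given point the coordinates need not vanish. Pivots can be chosen so that those of the
second kind do (`exists_pivot`). For the first kind, `c k` is replaced by a monic polynomial in `c
k`; over a finite free extension `B` it splits into factors `c k - τ`, which are the coordinates of
a chart for the sequence `x k - τ x (f k)`. This change is unitriangular, so the previous results
apply on `B ⊗ M`, and regularity descends (`IsAffineChart.isWeaklyRegular`). The sequence cuts the
support down to the closed point, which gives the Cohen-Macaulay property at suitable closed points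
of the closed fibre. Every point of the blowing up lies in a chart in which it specializes to such a
closed point (`BlowingUp.exists_chart`), and Cohen-Macaulay modules localize.

Geometry. The stalks, quasi-coherence and finiteness of the sheaf on `Proj` are read off from a
criterion for a sheaf on `Spec B` to be the one associated with a given `B`-module
(`Scheme.Modules.IsLocalizing`). -/

/-! ## Sums of multiples of a submodule -/

namespace VarSum

open scoped Pointwise

section

variable {B X Y : Type*} [CommRing B] [AddCommGroup X] [Module B X] [AddCommGroup Y] [Module B Y]

/-- The submodule `∑_{i ∈ Γ} z i • N`. -/
def varSum (z : ℕ → B) (Γ : Finset ℕ) (N : Submodule B X) : Submodule B X :=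
  Γ.sup fun i => z i • N

variable {z : ℕ → B} {Γ Δ E : Finset ℕ} {N N' : Submodule B X}

@[simp] theorem varSum_empty : varSum z ∅ N = ⊥ := Finset.sup_empty

theorem varSum_insert (i : ℕ) : varSum z (insert i Γ) N = z i • N ⊔ varSum z Γ N :=
  Finset.sup_insert

theorem varSum_singleton (i : ℕ) : varSum z {i} N = z i • N := Finset.sup_singleton

theorem smul_le_varSum {i : ℕ} (hi : i ∈ Γ) : z i • N ≤ varSum z Γ N :=
  Finset.le_sup (f := fun i => z i • N) hi

theorem smul_mem_varSum {i : ℕ} (hi : i ∈ Γ) {n : X} (hn : n ∈ N) : z i • n ∈ varSum z Γ N :=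
  smul_le_varSum hi (Submodule.smul_mem_pointwise_smul n (z i) N hn)

theorem varSum_le_iff {P : Submodule B X} :
    varSum z Γ N ≤ P ↔ ∀ i ∈ Γ, ∀ n ∈ N, z i • n ∈ P := by
  refine Finset.sup_le_iff.trans (forall₂_congr fun i _ => ?_)
  constructor
  · exact fun h n hn => h (Submodule.smul_mem_pointwise_smul n (z i) N hn)
  · intro h y hy
    obtain ⟨n, hn, rfl⟩ := (Submodule.mem_smul_pointwise_iff_exists _ _ _).1 hy
    exact h n hn

theorem varSum_mono (hΓ : Γ ⊆ Δ) (hN : N ≤ N') : varSum z Γ N ≤ varSum z Δ N' :=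
  varSum_le_iff.2 fun _ hi _ hn => smul_mem_varSum (hΓ hi) (hN hn)

theorem varSum_le : varSum z Γ N ≤ N :=
  varSum_le_iff.2 fun i _ _ hn => N.smul_mem (z i) hn

theorem mem_varSum_insert {i : ℕ} {a : X} :
    a ∈ varSum z (insert i Γ) N ↔ ∃ n ∈ N, ∃ b ∈ varSum z Γ N, z i • n + b = a := by
  rw [varSum_insert, Submodule.mem_sup]
  constructor
  · rintro ⟨y, hy, b, hb, rfl⟩
    obtain ⟨n, hn, rfl⟩ := (Submodule.mem_smul_pointwise_iff_exists _ _ _).1 hy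
    exact ⟨n, hn, b, hb, rfl⟩
  · rintro ⟨n, hn, b, hb, rfl⟩
    exact ⟨_, Submodule.smul_mem_pointwise_smul n (z i) N hn, b, hb, rfl⟩

theorem mem_varSum_singleton {i : ℕ} {a : X} :
    a ∈ varSum z {i} N ↔ ∃ n ∈ N, z i • n = a := by
  rw [varSum_singleton, Submodule.mem_smul_pointwise_iff_exists]

theorem smul_mem_varSum_of_le {c : B} (h : ∀ n ∈ N, c • n ∈ N') {a : X}
    (ha : a ∈ varSum z Γ N) : c • a ∈ varSum z Γ N' := by
  have : varSum z Γ N ≤ (varSum z Γ N').comap (LinearMap.lsmul B X c) :=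
    varSum_le_iff.2 fun i hi n hn => by
      change c • z i • n ∈ varSum z Γ N'
      rw [smul_comm]
      exact smul_mem_varSum hi (h n hn)
  exact this ha

theorem varSum_congr {z' : ℕ → B} (h : ∀ i ∈ Γ, z i = z' i) :
    varSum z Γ N = varSum z' Γ N :=
  Finset.sup_congr rfl fun i hi => by rw [h i hi]

theorem map_varSum (f : X →ₗ[B] Y) : (varSum z Γ N).map f = varSum z Γ (N.map f) := by
  apply le_antisymm
  · rw [Submodule.map_le_iff_le_comap]
    refine varSum_le_iff.2 fun i hi n hn => ?_
    rw [Submodule.mem_comap, map_smul]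
    exact smul_mem_varSum hi (Submodule.mem_map_of_mem hn)
  · refine varSum_le_iff.2 fun i hi n hn => ?_
    obtain ⟨m, hm, rfl⟩ := hn
    rw [← map_smul]
    exact Submodule.mem_map_of_mem (smul_mem_varSum hi hm)

theorem mkQ_mem_varSum_iff (K : Submodule B X) {a : X} :
    K.mkQ a ∈ varSum z Γ (⊤ : Submodule B (X ⧸ K)) ↔ a ∈ varSum z Γ ⊤ ⊔ K := by
  have h : varSum z Γ (⊤ : Submodule B (X ⧸ K)) = (varSum z Γ ⊤).map K.mkQ := by
    rw [map_varSum, Submodule.map_top, Submodule.range_mkQ]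
  rw [h, ← Submodule.mem_comap, Submodule.comap_map_mkQ, sup_comm]

/-! ### Filtered families -/

/-- The family `q ↦ I ^ q N`, where `I` is the ideal generated by the `z i` with `i ∈ E`. -/
def powSum (z : ℕ → B) (E : Finset ℕ) (N : Submodule B X) (q : ℕ) : Submodule B X :=
  (varSum z E)^[q] N

theorem powSum_zero : powSum z E N 0 = N := rfl

theorem powSum_succ (q : ℕ) : powSum z E N (q + 1) = varSum z E (powSum z E N q) :=
  Function.iterate_succ_apply' _ _ _

/-- The family `N` of submodules is compatible with the variables in `E`, and colon ideals
behave well along the family, relative to the index `a`. -/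
structure IsGoodFamily (z : ℕ → B) (E : Finset ℕ) (a : ℕ) (N : ℕ → Submodule B X) : Prop where
  smul_mem : ∀ p, ∀ i ∈ E, ∀ n ∈ N p, z i • n ∈ N (p + 1)
  colon : ∀ Γ ⊆ E, a ∈ Γ → ∀ i ∈ E, ∀ j ∈ E, i ≤ j → i ∉ Γ → j ∉ Γ → ∀ p, ∀ y ∈ N p,
    z i • z j • y ∈ varSum z Γ (N (p + 1)) → z i • y ∈ varSum z Γ (N p)
  inter : ∀ q, ∀ y, z a • y ∈ N (q + 1) → ∃ n ∈ N q, z a • y = z a • n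

namespace IsGoodFamily

variable {a : ℕ} {N : ℕ → Submodule B X}

theorem powSum_le (h : IsGoodFamily z E a N) (p q : ℕ) : powSum z E (N p) q ≤ N (p + q) := by
  induction q with
  | zero => exact le_rfl
  | succ q ih =>
    rw [powSum_succ]
    exact varSum_le_iff.2 fun i hi n hn => h.smul_mem _ i hi n (ih hn)

/-- Write `e = z i • n + b` with `b` in the sum over `Γ`. Only `z i • n` matters, and `z m • z i •
n` lies in the sum over `Γ` one degree higher, so the colon condition applies to it. -/
theorem mem_of_mem_insert (h : IsGoodFamily z E a N) (hΓ : Γ ⊆ E) (ha : a ∈ Γ) {i m p : ℕ}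
    (hi : i ∈ E) (hm : m ∈ E) (him : i ≤ m) (hiΓ : i ∉ Γ) (hmΓ : m ∉ Γ) {e : X}
    (he : e ∈ varSum z (insert i Γ) (N p)) (hme : z m • e ∈ varSum z Γ (N (p + 1))) :
    e ∈ varSum z Γ (N p) := by
  obtain ⟨n, hn, b, hb, rfl⟩ := mem_varSum_insert.1 he
  refine add_mem (h.colon Γ hΓ ha i hi m hm him hiΓ hmΓ p n hn ?_) hb
  rw [smul_add] at hme
  rw [smul_comm]
  exact (Submodule.add_mem_iff_left _ (smul_mem_varSum_of_le (h.smul_mem p m hm) hb)).1 hme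

/-- The indices outside `Γ` are discarded one at a time, `m` being the first to go. Maximality of
`m` supplies the inequality `i ≤ m` needed to discard `i`. -/
theorem mem_of_max_smul_mem (h : IsGoodFamily z E a N) (hΓ : Γ ⊆ E) (ha : a ∈ Γ) {m p : ℕ}
    (hm : m ∈ E) (hmΓ : m ∉ Γ) (hmax : ∀ i ∈ E, i ∉ Γ → i ≤ m) {e : X}
    (he : e ∈ varSum z E (N p)) (hme : z m • e ∈ varSum z Γ (N (p + 1))) :
    e ∈ varSum z Γ (N p) := by
  have key : ∀ Δ : Finset ℕ, Δ ⊆ E → m ∉ Δ → e ∈ varSum z (Γ ∪ Δ) (N p) →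
      e ∈ varSum z Γ (N p) := by
    intro Δ
    induction Δ using Finset.induction_on with
    | empty => intro _ _ h'; simpa using h'
    | insert i Δ hiΔ ih =>
      intro hΔ hmΔ h'
      rw [Finset.mem_insert, not_or] at hmΔ
      have hΔ' : Δ ⊆ E := (Finset.subset_insert i Δ).trans hΔ
      refine ih hΔ' hmΔ.2 ?_
      rw [Finset.union_insert] at h'
      by_cases hiΓ : i ∈ Γ ∪ Δ
      · rwa [Finset.insert_eq_of_mem hiΓ] at h'
      · have hiE : i ∈ E := hΔ (Finset.mem_insert_self i Δ)
        refine h.mem_of_mem_insert (Finset.union_subset hΓ hΔ') (Finset.mem_union_left _ ha) hiE hm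
          (hmax i hiE fun hi => hiΓ (Finset.mem_union_left _ hi)) hiΓ ?_ h'
          (varSum_mono Finset.subset_union_left le_rfl hme)
        rw [Finset.mem_union, not_or]
        exact ⟨hmΓ, hmΔ.2⟩
  have hsub : Γ ⊆ E.erase m := fun i hi => Finset.mem_erase.2 ⟨fun h' => hmΓ (h' ▸ hi), hΓ hi⟩
  refine key (E.erase m) (Finset.erase_subset _ _) (Finset.notMem_erase _ _) ?_
  rw [Finset.union_eq_right.2 hsub]
  refine h.mem_of_mem_insert (Finset.erase_subset _ _) (hsub ha) hm hm le_rfl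
    (Finset.notMem_erase _ _) (Finset.notMem_erase _ _) ?_ (varSum_mono hsub le_rfl hme)
  rwa [Finset.insert_erase hm]

/-- For the constant family this is the d-sequence property `I ^ (q + 1) X ∩ (z_Γ) X ⊆ (z_Γ) I ^ q
X`. The proof is by induction on `q` and, for each `q`, by descending induction on `Γ` starting from
`E`. With `m` the largest missing index, `y = z m • e + c` where `c` is already of the desired form;
then `z m • e`, hence `e` by maximality of `m`, lies in the sum over `Γ`, and the case of `q`
applies to `e`. -/
theorem powSum_inter (h : IsGoodFamily z E a N) (p q : ℕ) :
    ∀ Γ ⊆ E, a ∈ Γ → ∀ y ∈ powSum z E (N p) (q + 1), y ∈ varSum z Γ (N (p + q)) →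
      y ∈ varSum z Γ (powSum z E (N p) q) := by
  induction q with
  | zero => exact fun Γ _ _ y _ hy => hy
  | succ q ih =>
    intro Γ
    induction hn : (E \ Γ).card generalizing Γ with
    | zero =>
      intro hΓ _ y hy _
      have : Γ = E := hΓ.antisymm (Finset.sdiff_eq_empty_iff_subset.1 (Finset.card_eq_zero.1 hn))
      rwa [this, ← powSum_succ]
    | succ n ihn =>
      intro hΓ ha y hy hy'
      have hne : (E \ Γ).Nonempty := Finset.card_pos.1 (by omega)
      obtain ⟨hmE, hmΓ⟩ := Finset.mem_sdiff.1 ((E \ Γ).max'_mem hne)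
      set m := (E \ Γ).max' hne
      have hmax : ∀ i ∈ E, i ∉ Γ → i ≤ m := fun i hi hi' =>
        Finset.le_max' _ i (Finset.mem_sdiff.2 ⟨hi, hi'⟩)
      have hcard : (E \ insert m Γ).card = n := by
        rw [Finset.sdiff_insert, Finset.card_erase_of_mem (Finset.mem_sdiff.2 ⟨hmE, hmΓ⟩), hn]
        rfl
      have h1 := ihn (insert m Γ) hcard (Finset.insert_subset hmE hΓ)
        (Finset.mem_insert_of_mem ha) y hy (varSum_mono (Finset.subset_insert _ _) le_rfl hy')
      obtain ⟨e, he, c, hc, rfl⟩ := mem_varSum_insert.1 h1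
      refine add_mem ?_ hc
      have hle := h.powSum_le p (q + 1)
      have hme : z m • e ∈ varSum z Γ (N (p + q + 1)) :=
        (Submodule.add_mem_iff_left _ (varSum_mono subset_rfl hle hc)).1 hy'
      have he' : e ∈ varSum z Γ (N (p + q)) := by
        refine h.mem_of_max_smul_mem hΓ ha hmE hmΓ hmax ?_ hme
        rw [powSum_succ] at he
        exact varSum_mono subset_rfl (h.powSum_le p q) he
      refine smul_mem_varSum_of_le (fun n hn => ?_) (ih Γ hΓ ha e he he')
      rw [powSum_succ]
      exact smul_mem_varSum hmE hn

/-- Passing from a good family `N` to the family `q ↦ I ^ q (N p)`. -/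
theorem powSum (h : IsGoodFamily z E a N) (ha : a ∈ E) (hΔ : Δ ⊆ E) (p : ℕ) :
    IsGoodFamily z Δ a (powSum z E (N p)) where
  smul_mem q i hi n hn := by
    rw [powSum_succ]
    exact smul_mem_varSum (hΔ hi) hn
  colon Γ hΓ haΓ i hi j hj hij hiΓ hjΓ q y hy hxy := by
    refine h.powSum_inter p q Γ (hΓ.trans hΔ) haΓ _ ?_ ?_
    · rw [powSum_succ]
      exact smul_mem_varSum (hΔ hi) hy
    · exact h.colon Γ (hΓ.trans hΔ) haΓ i (hΔ hi) j (hΔ hj) hij hiΓ hjΓ _ y (h.powSum_le p q hy)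
        (varSum_mono subset_rfl (h.powSum_le p (q + 1)) hxy)
  inter q y hy := by
    -- The given family provides a cofactor in `N (p + q)`; the intersection lemma for the singleton
    -- `{a}` then replaces it by one in the power.
    obtain ⟨n, hn, hyn⟩ := h.inter (p + q) y (h.powSum_le p (q + 1) hy)
    have := h.powSum_inter p q {a} (Finset.singleton_subset_iff.2 ha) (Finset.mem_singleton_self a)
      _ hy (by rw [hyn]; exact smul_mem_varSum (Finset.mem_singleton_self a) hn)
    obtain ⟨n', hn', e⟩ := mem_varSum_singleton.1 this
    exact ⟨n', hn', e.symm⟩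

end IsGoodFamily

end

end VarSum

/-! ### Unconditioned strong d-sequences and their characterization by initial colon conditions. -/

namespace VarSum

open scoped Pointwise

section

variable {B X Y : Type*} [CommRing B] [AddCommGroup X] [Module B X] [AddCommGroup Y] [Module B Y]

/-- The submodule `∑_{k ∈ Γ} x k ^ e k • X`. -/
def powerSum (X : Type*) [AddCommGroup X] [Module B X] (x : ℕ → B) (e : ℕ → ℕ) (Γ : Finset ℕ) :
    Submodule B X :=
  varSum (fun k => x k ^ e k) Γ ⊤

variable {x : ℕ → B} {e : ℕ → ℕ} {Γ Δ E : Finset ℕ}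

theorem powerSum_congr {e' : ℕ → ℕ} (h : ∀ k ∈ Γ, e k = e' k) :
    powerSum X x e Γ = powerSum X x e' Γ :=
  varSum_congr fun k hk => by rw [h k hk]

theorem mem_powerSum_insert {l : ℕ} {a : X} :
    a ∈ powerSum X x e (insert l Γ) ↔ ∃ n, ∃ b ∈ powerSum X x e Γ, x l ^ e l • n + b = a := by
  simp only [powerSum, mem_varSum_insert, Submodule.mem_top, true_and]

theorem mem_powerSum_update {l m : ℕ} (hl : l ∉ Γ) {a : X} :
    a ∈ powerSum X x (Function.update e l m) (insert l Γ) ↔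
      ∃ n, ∃ b ∈ powerSum X x e Γ, x l ^ m • n + b = a := by
  rw [mem_powerSum_insert, Function.update_self,
      powerSum_congr (e := Function.update e l m) (e' := e)]
  intro k hk
  exact Function.update_of_ne (fun h : k = l => hl (h ▸ hk)) _ _

theorem powerSum_mono (h : Γ ⊆ Δ) : powerSum X x e Γ ≤ powerSum X x e Δ :=
  varSum_mono h le_rfl

/-- The colon condition at the index `i` modulo `∑_{k ∈ Γ} x k ^ e k • X`. -/
def ColonAt (X : Type*) [AddCommGroup X] [Module B X] (x : ℕ → B) (E : Finset ℕ) (e : ℕ → ℕ)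
    (Γ : Finset ℕ) (i : ℕ) : Prop :=
  ∀ j ∈ E, i ≤ j → j ∉ Γ → ∀ a : X, x i • x j • a ∈ powerSum X x e Γ → x i • a ∈ powerSum X x e Γ

/-- The elements `x i` with `i ∈ E` form an unconditioned strong d-sequence on `X`:
`x i • x j • a ∈ U` implies `x i • a ∈ U` for `i ≤ j` and all `U = ∑_{k ∈ Γ} x k ^ e k • X`
with `i, j ∉ Γ`. -/
def IsStrongDSeq (X : Type*) [AddCommGroup X] [Module B X] (x : ℕ → B) (E : Finset ℕ) : Prop :=
  ∀ e : ℕ → ℕ, (∀ k, e k ≠ 0) → ∀ Γ ⊆ E, ∀ i ∈ E, i ∉ Γ → ColonAt X x E e Γ i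

theorem ColonAt.smul_mem_of_pow {i : ℕ} (h : ColonAt X x E e Γ i) (hi : i ∈ E) (hiΓ : i ∉ Γ)
    {m : ℕ} {a : X} (ha : x i ^ (m + 1) • a ∈ powerSum X x e Γ) :
    x i • a ∈ powerSum X x e Γ := by
  induction m with
  | zero => simpa using ha
  | succ m ih =>
    refine ih ?_
    rw [pow_succ', mul_smul] at ha ⊢
    rw [pow_succ', mul_smul] at ha
    exact h i hi le_rfl hiΓ _ ha

theorem ColonAt.smul_mem_of_le {i j : ℕ} (h : ColonAt X x E e Γ i) (hj : j ∈ E) (hij : i ≤ j)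
    (hjΓ : j ∉ Γ) {a : X} (ha : x j • a ∈ powerSum X x e Γ) :
    x i • a ∈ powerSum X x e Γ :=
  h j hj hij hjΓ a (Submodule.smul_mem _ _ ha)

theorem ColonAt.smul_mem_of_pow_of_le {i j : ℕ} (h : ColonAt X x E e Γ i)
    (hj : j ∈ E) (hij : i ≤ j) (hjΓ : j ∉ Γ) {m : ℕ} {a : X}
    (ha : x j ^ m • x i • a ∈ powerSum X x e Γ) : x i • a ∈ powerSum X x e Γ := by
  induction m with
  | zero => simpa using ha
  | succ m ih =>
    refine ih ?_
    rw [smul_comm]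
    refine h j hj hij hjΓ _ ?_
    rwa [show x i • x j • x j ^ m • a = x j ^ (m + 1) • x i • a by module]

/-- The hypothesis is the case in which `Γ` contains all smaller indices with exponent `1`. -/
theorem isStrongDSeq_of_initial {n : ℕ}
    (H : ∀ e : ℕ → ℕ, (∀ k, e k ≠ 0) → ∀ Γ ⊆ Finset.range n, ∀ i ∈ Finset.range n, i ∉ Γ →
      (∀ l < i, l ∈ Γ ∧ e l = 1) → ColonAt X x (Finset.range n) e Γ i) :
    IsStrongDSeq X x (Finset.range n) := by
  suffices h : ∀ i ∈ Finset.range n, ∀ e : ℕ → ℕ, (∀ k, e k ≠ 0) → ∀ Γ ⊆ Finset.range n, i ∉ Γ →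
      ColonAt X x (Finset.range n) e Γ i from fun e he Γ hΓ i hi hiΓ => h i hi e he Γ hΓ hiΓ
  intro i
  induction i using Nat.strong_induction_on with
  | _ i IH =>
  intro hi e he Γ
  -- The measure counts how far `Γ` is from containing all indices below `i` with exponent `1`: a
  -- missing index costs `1`, a present one the excess of its exponent.
  induction hμ : ∑ l ∈ Finset.range i, (if l ∈ Γ then e l - 1 else 1) using
    Nat.strong_induction_on generalizing e Γ with
  | _ μ IHμ =>
  intro hΓ hiΓ
  by_cases hA : ∃ l < i, l ∉ Γ
  -- A missing index `l` is adjoined with exponent `1`, which lowers the measure. The extra term `x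
  -- l • t` is then removed by the colon condition at the smaller index `l`.
  · obtain ⟨l, hli, hlΓ⟩ := hA
    have hlE : l ∈ Finset.range n := Finset.mem_range.2 (hli.trans (Finset.mem_range.1 hi))
    have hcol : ColonAt X x (Finset.range n) (Function.update e l 1) (insert l Γ) i := by
      refine IHμ _ ?_ _ (fun k => ?_) _ rfl (Finset.insert_subset hlE hΓ) ?_
      · rw [← hμ]
        refine Finset.sum_lt_sum (fun k _ => ?_) ⟨l, Finset.mem_range.2 hli, ?_⟩
        · by_cases hk : k = l
          · subst hk; simp
          · simp [hk]
        · simp [hlΓ]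
      · by_cases hk : k = l
        · subst hk; simp
        · simpa [hk] using he k
      · rw [Finset.mem_insert, not_or]
        exact ⟨hli.ne', hiΓ⟩
    intro j hj hij hjΓ a ha
    have hjΓ' : j ∉ insert l Γ := by
      rw [Finset.mem_insert, not_or]
      exact ⟨(hli.trans_le hij).ne', hjΓ⟩
    obtain ⟨t, b, hb, htb⟩ := (mem_powerSum_update hlΓ).1 (hcol j hj hij hjΓ' a
      ((mem_powerSum_update hlΓ).2 ⟨0, _, ha, by simp⟩))
    rw [← htb, pow_one]
    refine add_mem (IH l hli hlE e he Γ hΓ hlΓ j hj (hli.le.trans hij) hjΓ t ?_) hb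
    rw [show x l • x j • t = x i • x j • a - x j • b by rw [smul_comm (x i), ← htb]; module]
    exact sub_mem ha (Submodule.smul_mem _ _ hb)
  by_cases hB : ∃ l < i, e l ≠ 1
  swap
  · push Not at hA hB
    exact H e he Γ hΓ i hi hiΓ fun l hl => ⟨hA l hl, hB l hl⟩
  push Not at hA
  obtain ⟨l, hli, hel⟩ := hB
  have hlE : l ∈ Finset.range n := Finset.mem_range.2 (hli.trans (Finset.mem_range.1 hi))
  have hlΓ : l ∈ Γ := hA l hli
  obtain ⟨m, hm⟩ : ∃ m, e l = m + 2 := ⟨e l - 2, by have := he l; omega⟩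
  obtain ⟨Γ₀, hl₀, rfl⟩ : ∃ Γ₀, l ∉ Γ₀ ∧ insert l Γ₀ = Γ :=
    ⟨Γ.erase l, Finset.notMem_erase _ _, Finset.insert_erase hlΓ⟩
  have hΓ₀ : Γ₀ ⊆ Finset.range n := (Finset.subset_insert _ _).trans hΓ
  have hi₀ : i ∉ Γ₀ := fun h => hiΓ (Finset.mem_insert_of_mem h)
  have hcol : ∀ k, k ≠ 0 → k < m + 2 → ColonAt X x (Finset.range n) (Function.update e l k)
      (insert l Γ₀) i := by
    intro k hk hk'
    refine IHμ _ ?_ _ (fun k' => ?_) _ rfl hΓ hiΓ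
    · rw [← hμ]
      refine Finset.sum_lt_sum (fun k' _ => ?_) ⟨l, Finset.mem_range.2 hli, ?_⟩
      · by_cases hkl : k' = l
        · subst hkl; simp only [Function.update_self]; split_ifs <;> omega
        · simp [hkl]
      · simp only [hlΓ, Function.update_self, if_true]; omega
    · by_cases hkl : k' = l
      · subst hkl; simpa using hk
      · simpa [hkl] using he k'
  have hT : ∀ k ∈ Finset.range n, i ≤ k → k ∉ Γ₀ → ∀ q, q ≠ 0 →
      ColonAt X x (Finset.range n) (Function.update e k q) (insert k Γ₀) l := by
    intro k hk hik hkΓ q hq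
    refine IH l hli hlE _ (fun k' => ?_) _ (Finset.insert_subset hk hΓ₀) ?_
    · by_cases hkl : k' = k
      · subst hkl; simpa using hq
      · simpa [hkl] using he k'
    · rw [Finset.mem_insert, not_or]
      exact ⟨(hli.trans_le hik).ne, hl₀⟩
  have hT₀ : ColonAt X x (Finset.range n) e Γ₀ l := IH l hli hlE e he Γ₀ hΓ₀ hl₀
  have hins : ∀ k, i ≤ k → l ∉ insert k Γ₀ := fun k hk => by
    rw [Finset.mem_insert, not_or]
    exact ⟨(hli.trans_le hk).ne, hl₀⟩
  intro j hj hij hjΓ a ha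
  have hj₀ : j ∉ Γ₀ := fun h => hjΓ (Finset.mem_insert_of_mem h)
  have hlj : l ≤ j := hli.le.trans hij
  -- `S` omits the index `l`, whose exponent is `m + 2`. By the case of exponent `m + 1`, `x i • a`
  -- is `x l ^ (m + 1) • t` modulo `S`. After multiplication by `x l` and modulo `S`, `t` can be
  -- replaced successively by `f'`, by `x i • α'` and by `x l • δ`; this turns `x l ^ (m + 1) • t`
  -- into a multiple of `x l ^ (m + 2)`. The colon conditions used are those at `l` (with `i` or `j`
  -- adjoined) and those at `i` with a smaller exponent at `l`.
  set S := powerSum X x e Γ₀ with hS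
  obtain ⟨f, u₀, hu₀, e₀⟩ := mem_powerSum_insert.1 ha
  rw [hm] at e₀
  obtain ⟨t, u, hu, e₁⟩ := (mem_powerSum_update hl₀).1 (hcol (m + 1) (by omega) (by omega) j hj hij
    hjΓ a ((mem_powerSum_update hl₀).2 ⟨x l • f, u₀, hu₀, by rw [← e₀]; module⟩))
  have s₂ : x l • (x j • t - x l • f) ∈ S := by
    refine hT₀.smul_mem_of_pow hlE hl₀ (m := m) ?_
    rw [show x l ^ (m + 1) • (x j • t - x l • f) = x j • (x l ^ (m + 1) • t + u) -
      (x l ^ (m + 2) • f + u₀) + (u₀ - x j • u) by module, e₁, e₀, smul_comm, sub_self, zero_add]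
    exact sub_mem hu₀ (Submodule.smul_mem _ _ hu)
  obtain ⟨f', u₁, hu₁, e₂⟩ := (mem_powerSum_update hj₀).1
    ((hT j hj hij hj₀ 1 one_ne_zero).smul_mem_of_pow hlE (hins j hij) (m := 1)
      ((mem_powerSum_update hj₀).2 ⟨x l • t, -(x l • (x j • t - x l • f)), neg_mem s₂,
        (by module : _ = x l ^ (1 + 1) • f)⟩))
  rw [pow_one] at e₂
  have s₄ : x l • (t - f') ∈ S := by
    refine hT₀ j hj hlj hj₀ _ ?_
    rw [show x l • x j • (t - f') = x l • (x j • t - (x j • f' + u₁)) + x l • u₁ by module, e₂]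
    exact add_mem s₂ (Submodule.smul_mem _ _ hu₁)
  obtain ⟨β, u₂, hu₂, e₃⟩ := (mem_powerSum_update hl₀).1 (hcol 1 one_ne_zero (by omega) j hj hij
    hjΓ f' ((mem_powerSum_update hl₀).2 ⟨x i • f, -(x i • u₁), neg_mem (Submodule.smul_mem _ _ hu₁),
      by rw [pow_one, smul_comm, ← e₂]; module⟩))
  rw [pow_one] at e₃
  obtain ⟨α, u₃, hu₃, e₄⟩ := (mem_powerSum_update hi₀).1
    ((hT i hi le_rfl hi₀ 1 one_ne_zero).smul_mem_of_pow hlE (hins i le_rfl) (m := m) (a := f')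
      ((mem_powerSum_update hi₀).2 ⟨a, -u - x l ^ m • (x l • (t - f')),
        sub_mem (neg_mem hu) (Submodule.smul_mem _ _ s₄), by rw [pow_one, ← e₁]; module⟩))
  rw [pow_one] at e₄
  obtain ⟨α', u₄, hu₄, e₅⟩ := (mem_powerSum_update hi₀).1
    ((hT i hi le_rfl hi₀ 2 two_ne_zero).smul_mem_of_pow hlE (hins i le_rfl) (m := 1) (a := β)
      ((mem_powerSum_update hi₀).2 ⟨α, x i • u₃ - x l • u₂,
        sub_mem (Submodule.smul_mem _ _ hu₃) (Submodule.smul_mem _ _ hu₂), by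
          rw [show x l ^ (1 + 1) • β = x l • (x l • β + u₂) - x l • u₂ by module, e₃, smul_comm,
            ← e₄]; module⟩))
  have s₈ : x l • (f' - x i • α') ∈ S := by
    refine hT₀ i hi hli.le hi₀ _ ?_
    rw [show x l • x i • (f' - x i • α') = x l • (x i • f' - (x i ^ 2 • α' + u₄)) + x l • u₄ by
      module, e₅, ← e₃, show x l • β + u₂ - x l • β = u₂ by abel]
    exact add_mem (Submodule.smul_mem _ _ hu₂) (Submodule.smul_mem _ _ hu₄)
  obtain ⟨δ, u₅, hu₅, e₆⟩ := (mem_powerSum_update hl₀).1 (hcol 1 one_ne_zero (by omega) i hi le_rfl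
    hiΓ α' ((mem_powerSum_update hl₀).2 ⟨β, -u₄, neg_mem hu₄, by rw [pow_one, ← e₅]; module⟩))
  rw [pow_one] at e₆
  refine mem_powerSum_insert.2 ⟨δ, x l ^ m • (x l • (t - f')) + x l ^ m • (x l • (f' - x i • α')) +
    x l ^ (m + 1) • u₅ + u, add_mem (add_mem (add_mem (Submodule.smul_mem _ _ s₄)
      (Submodule.smul_mem _ _ s₈)) (Submodule.smul_mem _ _ hu₅)) hu, ?_⟩
  rw [hm, ← e₁, ← e₆]
  module

end

end VarSum

/-! ### Intersections with squares of ideals, and quotients of strong d-sequences. -/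

namespace VarSum

open scoped Pointwise

section

variable {B X Y : Type*} [CommRing B] [AddCommGroup X] [Module B X] [AddCommGroup Y] [Module B Y]
variable {x : ℕ → B} {e : ℕ → ℕ} {Γ Δ E Λ Ω Θ : Finset ℕ}

namespace IsStrongDSeq

/-- The argument for good families again; with strong d-sequences an arbitrary power of `x m` can be
cancelled, because `x i` survives in front of the cofactor. -/
theorem mem_of_mem_insert (h : IsStrongDSeq X x E) (he : ∀ k, e k ≠ 0) (hΓ : Γ ⊆ E) {i m q : ℕ}
    (hi : i ∈ E) (hm : m ∈ E) (him : i ≤ m) (hiΓ : i ∉ Γ) (hmΓ : m ∉ Γ) {y : X}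
    (hy : y ∈ powerSum X x e (insert i Γ)) (hmy : x m ^ q • y ∈ powerSum X x e Γ) :
    y ∈ powerSum X x e Γ := by
  obtain ⟨n, b, hb, rfl⟩ := mem_powerSum_insert.1 hy
  refine add_mem ?_ hb
  obtain ⟨d, hd⟩ := Nat.exists_eq_succ_of_ne_zero (he i)
  rw [smul_add, Submodule.add_mem_iff_left _ (Submodule.smul_mem _ _ hb), hd, pow_succ',
    mul_smul] at hmy
  rw [hd, pow_succ', mul_smul]
  exact (h e he Γ hΓ i hi hiΓ).smul_mem_of_pow_of_le hm him hmΓ hmy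

theorem mem_of_max_smul_mem (h : IsStrongDSeq X x E) (he : ∀ k, e k ≠ 0) (hΓ : Γ ⊆ E)
    {m q : ℕ} (hm : m ∈ E) (hmΓ : m ∉ Γ) (hΛ : Λ ⊆ E) (hmax : ∀ i ∈ Λ, i ∉ Γ → i ≤ m) {y : X}
    (hy : y ∈ powerSum X x e (Γ ∪ Λ)) (hmy : x m ^ q • y ∈ powerSum X x e Γ) :
    y ∈ powerSum X x e Γ := by
  have key : ∀ Δ : Finset ℕ, Δ ⊆ Λ → m ∉ Δ → y ∈ powerSum X x e (Γ ∪ Δ) →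
      y ∈ powerSum X x e Γ := by
    intro Δ
    induction Δ using Finset.induction_on with
    | empty => intro _ _ h'; simpa using h'
    | insert i Δ hiΔ ih =>
      intro hΔ hmΔ h'
      rw [Finset.mem_insert, not_or] at hmΔ
      have hΔ' : Δ ⊆ Λ := (Finset.subset_insert i Δ).trans hΔ
      refine ih hΔ' hmΔ.2 ?_
      rw [Finset.union_insert] at h'
      by_cases hiΓ : i ∈ Γ ∪ Δ
      · rwa [Finset.insert_eq_of_mem hiΓ] at h'
      · have hiE : i ∈ Λ := hΔ (Finset.mem_insert_self i Δ)
        refine h.mem_of_mem_insert he (Finset.union_subset hΓ (hΔ'.trans hΛ)) (hΛ hiE) hm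
          (hmax i hiE fun hi => hiΓ (Finset.mem_union_left _ hi)) hiΓ ?_ h'
          (powerSum_mono Finset.subset_union_left hmy)
        rw [Finset.mem_union, not_or]
        exact ⟨hmΓ, hmΔ.2⟩
  refine key (Λ.erase m) (Finset.erase_subset _ _) (Finset.notMem_erase _ _) ?_
  by_cases hmΛ : m ∈ Λ
  · have hmΓΛ : m ∉ Γ ∪ Λ.erase m := by
      rw [Finset.mem_union, not_or]
      exact ⟨hmΓ, Finset.notMem_erase _ _⟩
    refine h.mem_of_mem_insert he (Finset.union_subset hΓ ((Finset.erase_subset _ _).trans hΛ))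
      hm hm le_rfl hmΓΛ hmΓΛ ?_ (powerSum_mono Finset.subset_union_left hmy)
    rwa [← Finset.union_insert, Finset.insert_erase hmΛ]
  · rwa [Finset.erase_eq_of_notMem hmΛ]

/-- Descending induction on `Θ`, as for powers of ideals. Let `J` be generated by the `x k ^ e k`
with `k ∈ Λ`. The cofactor `d` of the largest missing index lies in `J X` and in the submodule
attached to `Θ ∪ Ω`, so it splits as `t + w` with `t` coming from `Θ` and `w` from `Ω`. Since `t ∈ J
X`, also `w ∈ J X`, which accounts for the second summand of the conclusion. -/
theorem square_inter (h : IsStrongDSeq X x E) (he : ∀ k, e k ≠ 0) (hΛ : Λ ⊆ E) (hΩ : Ω ⊆ E)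
    (hΛΩ : Disjoint Λ Ω) : ∀ Θ ⊆ Λ, ∀ y ∈ varSum (fun k => x k ^ e k) Λ (powerSum X x e Λ),
      y ∈ powerSum X x e (Θ ∪ Ω) → y ∈ varSum (fun k => x k ^ e k) Θ (powerSum X x e Λ) ⊔
        varSum (fun k => x k ^ e k) Λ (powerSum X x e Λ ⊓ powerSum X x e Ω) := by
  intro Θ
  induction hn : (Λ \ Θ).card generalizing Θ with
  | zero =>
    intro hΘ y hy _
    have : Θ = Λ := hΘ.antisymm (Finset.sdiff_eq_empty_iff_subset.1 (Finset.card_eq_zero.1 hn))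
    rw [this]
    exact Submodule.mem_sup_left hy
  | succ n ih =>
    intro hΘ y hy hy'
    have hne : (Λ \ Θ).Nonempty := Finset.card_pos.1 (by omega)
    obtain ⟨hmΛ, hmΘ⟩ := Finset.mem_sdiff.1 ((Λ \ Θ).max'_mem hne)
    set m := (Λ \ Θ).max' hne
    have hmax : ∀ i ∈ Λ, i ∉ Θ → i ≤ m := fun i hi hi' =>
      Finset.le_max' _ i (Finset.mem_sdiff.2 ⟨hi, hi'⟩)
    have hcard : (Λ \ insert m Θ).card = n := by
      rw [Finset.sdiff_insert, Finset.card_erase_of_mem (Finset.mem_sdiff.2 ⟨hmΛ, hmΘ⟩), hn]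
      rfl
    have h1 := ih (insert m Θ) hcard (Finset.insert_subset hmΛ hΘ) y hy
      (powerSum_mono (Finset.union_subset_union_left (Finset.subset_insert _ _)) hy')
    obtain ⟨y₁, hy₁, y₂, hy₂, rfl⟩ := Submodule.mem_sup.1 h1
    obtain ⟨d, hd, c, hc, rfl⟩ := mem_varSum_insert.1 hy₁
    have hmΩ : m ∉ Θ ∪ Ω := by
      rw [Finset.mem_union, not_or]
      exact ⟨hmΘ, Finset.disjoint_left.1 hΛΩ hmΛ⟩
    have hc' : c ∈ powerSum X x e (Θ ∪ Ω) :=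
      varSum_mono Finset.subset_union_left le_top hc
    have hy₂' : y₂ ∈ powerSum X x e (Θ ∪ Ω) :=
      powerSum_mono Finset.subset_union_right
        ((varSum_le.trans (inf_le_right : _ ≤ powerSum X x e Ω)) hy₂)
    have hmd : x m ^ e m • d ∈ powerSum X x e (Θ ∪ Ω) := by
      rwa [Submodule.add_mem_iff_left _ hy₂', Submodule.add_mem_iff_left _ hc'] at hy'
    have hd' : d ∈ powerSum X x e (Θ ∪ Ω) :=
      h.mem_of_max_smul_mem he (Finset.union_subset (hΘ.trans hΛ) hΩ) (hΛ hmΛ) hmΩ hΛ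
        (fun i hi hi' => hmax i hi fun h' => hi' (Finset.mem_union_left _ h'))
        (powerSum_mono Finset.subset_union_right hd) hmd
    obtain ⟨t, ht, w, hw, rfl⟩ : ∃ t ∈ powerSum X x e Θ, ∃ w ∈ powerSum X x e Ω, t + w = d := by
      rw [← Submodule.mem_sup]
      simpa only [powerSum, varSum, Finset.sup_union] using hd'
    have hw' : w ∈ powerSum X x e Λ := by
      rwa [Submodule.add_mem_iff_right _ (powerSum_mono hΘ ht)] at hd
    refine add_mem (add_mem ?_ (Submodule.mem_sup_left hc)) (Submodule.mem_sup_right hy₂)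
    rw [smul_add]
    refine add_mem (Submodule.mem_sup_left ?_)
      (Submodule.mem_sup_right (smul_mem_varSum (z := fun k => x k ^ e k) hmΛ ⟨hw', hw⟩))
    refine smul_mem_varSum_of_le (fun n _ => ?_) ht
    exact smul_mem_varSum (z := fun k => x k ^ e k) hmΛ Submodule.mem_top

/-- If a multiple of `x j ^ e j` lies in `J ^ 2 X`, then it is a multiple of an element of
`J (J X : x j ^ e j)`, where `J` is generated by the `x k ^ e k` with `k ∈ Λ`. -/
theorem exists_of_smul_mem_square (h : IsStrongDSeq X x E) (he : ∀ k, e k ≠ 0) (hΛ : Λ ⊆ E)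
    {j : ℕ} (hj : j ∈ E) (hjΛ : j ∉ Λ) {y : X}
    (hy : x j ^ e j • y ∈ varSum (fun k => x k ^ e k) Λ (powerSum X x e Λ)) :
    ∃ y' ∈ varSum (fun k => x k ^ e k) Λ
      ((powerSum X x e Λ).comap (LinearMap.lsmul B X (x j ^ e j))),
      x j ^ e j • y = x j ^ e j • y' := by
  have h1 := h.square_inter he hΛ (Finset.singleton_subset_iff.2 hj)
    (Finset.disjoint_singleton_right.2 hjΛ) ∅ (Finset.empty_subset _) _ hy
    (by rw [Finset.empty_union]
        exact smul_mem_varSum (z := fun k => x k ^ e k) (Finset.mem_singleton_self j)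
          Submodule.mem_top)
  rw [varSum_empty, bot_sup_eq] at h1
  have hle : varSum (fun k => x k ^ e k) Λ (powerSum X x e Λ ⊓ powerSum X x e {j}) ≤
      (varSum (fun k => x k ^ e k) Λ ((powerSum X x e Λ).comap
        (LinearMap.lsmul B X (x j ^ e j)))).map (LinearMap.lsmul B X (x j ^ e j)) := by
    rw [map_varSum]
    refine varSum_mono subset_rfl ?_
    rintro n ⟨hn, hn'⟩
    obtain ⟨n', -, rfl⟩ := mem_varSum_singleton.1 hn'
    exact ⟨n', hn, rfl⟩
  obtain ⟨y', hy', e'⟩ := hle h1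
  exact ⟨y', hy', e'.symm⟩

/-- In `square_inter` with `Ω` empty the second summand vanishes; only `Θ = {p}` remains. -/
theorem exists_of_mem_square (h : IsStrongDSeq X x E) (he : ∀ k, e k ≠ 0) (hΛ : Λ ⊆ E)
    {p : ℕ} (hp : p ∈ Λ) {y : X}
    (hy : x p ^ e p • y ∈ varSum (fun k => x k ^ e k) Λ (powerSum X x e Λ)) :
    ∃ y' ∈ powerSum X x e Λ, x p ^ e p • y = x p ^ e p • y' := by
  have h1 := h.square_inter he hΛ (Finset.empty_subset _) (Finset.disjoint_empty_right _) {p}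
    (Finset.singleton_subset_iff.2 hp) _ hy
    (by rw [Finset.union_empty]
        exact smul_mem_varSum (z := fun k => x k ^ e k) (Finset.mem_singleton_self p)
          Submodule.mem_top)
  have h2 : powerSum X x e Λ ⊓ powerSum X x e ∅ = ⊥ := by
    rw [powerSum, powerSum, varSum_empty, inf_bot_eq]
  rw [h2, le_bot_iff.1 (varSum_le (N := (⊥ : Submodule B X))), sup_bot_eq] at h1
  obtain ⟨y', hy', e'⟩ := mem_varSum_singleton.1 h1
  exact ⟨y', hy', e'.symm⟩

end IsStrongDSeq

/-! ### Quotients -/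

theorem mkQ_mem_powerSum_iff (K : Submodule B X) {a : X} :
    K.mkQ a ∈ powerSum (X ⧸ K) x e Γ ↔ a ∈ powerSum X x e Γ ⊔ K :=
  mkQ_mem_varSum_iff K

/-- `x p X + (0 : x p)`. -/
def colonSum (X : Type*) [AddCommGroup X] [Module B X] (b : B) : Submodule B X :=
  b • (⊤ : Submodule B X) ⊔ LinearMap.ker (LinearMap.lsmul B X b)

/-- Multiplication by `x p` identifies `X / (0 : x p)` with `x p X`. Congruences modulo `colonSum`
thus become statements inside `X`, to which intersection results apply. -/
theorem mem_powerSum_sup_colonSum {p : ℕ} (hp : p ∉ Γ) {a : X} :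
    a ∈ powerSum X x e Γ ⊔ colonSum X (x p) ↔
      ∃ b ∈ powerSum X x (Function.update e p 1) (insert p Γ), x p • a = x p • b := by
  rw [colonSum, ← sup_assoc, Submodule.mem_sup]
  have hJ : powerSum X x (Function.update e p 1) (insert p Γ) =
      powerSum X x e Γ ⊔ x p • (⊤ : Submodule B X) := by
    ext y
    rw [mem_powerSum_update hp, Submodule.mem_sup]
    constructor
    · rintro ⟨n, b, hb, rfl⟩
      exact ⟨b, hb, _, Submodule.smul_mem_pointwise_smul n _ _ trivial, by rw [pow_one, add_comm]⟩
    · rintro ⟨b, hb, c, hc, rfl⟩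
      obtain ⟨n, -, rfl⟩ := (Submodule.mem_smul_pointwise_iff_exists _ _ _).1 hc
      exact ⟨n, b, hb, by rw [pow_one, add_comm]⟩
  rw [hJ]
  constructor
  · rintro ⟨b, hb, c, hc, rfl⟩
    exact ⟨b, hb, by rw [smul_add, show x p • c = 0 from hc, add_zero]⟩
  · rintro ⟨b, hb, hab⟩
    refine ⟨b, hb, a - b, ?_, by abel⟩
    change x p • (a - b) = 0
    rw [smul_sub, hab, sub_self]

namespace IsStrongDSeq

theorem quotient_smul (h : IsStrongDSeq X x E) {i : ℕ} (hi : i ∈ E) :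
    IsStrongDSeq (X ⧸ (x i • (⊤ : Submodule B X))) x (E.erase i) := by
  intro e he Γ hΓ k hk hkΓ j hj hkj hjΓ a
  obtain ⟨a, rfl⟩ := Submodule.mkQ_surjective _ a
  have hiΓ : i ∉ Γ := fun h => Finset.notMem_erase _ _ (hΓ h)
  have key : ∀ b : X, b ∈ powerSum X x e Γ ⊔ (x i • (⊤ : Submodule B X)) ↔
      b ∈ powerSum X x (Function.update e i 1) (insert i Γ) := by
    intro b
    rw [mem_powerSum_update hiΓ, Submodule.mem_sup]
    constructor
    · rintro ⟨b, hb, c, hc, rfl⟩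
      obtain ⟨n, -, rfl⟩ := (Submodule.mem_smul_pointwise_iff_exists _ _ _).1 hc
      exact ⟨n, b, hb, by rw [pow_one, add_comm]⟩
    · rintro ⟨n, b, hb, rfl⟩
      exact ⟨b, hb, _, Submodule.smul_mem_pointwise_smul n _ _ trivial, by rw [pow_one, add_comm]⟩
  rw [← map_smul, ← map_smul, ← map_smul, mkQ_mem_powerSum_iff, mkQ_mem_powerSum_iff, key, key]
  refine h _ (fun l => ?_) _ (Finset.insert_subset hi (hΓ.trans (Finset.erase_subset _ _))) k
    (Finset.mem_of_mem_erase hk) ?_ j (Finset.mem_of_mem_erase hj) hkj ?_ a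
  · by_cases hl : l = i
    · subst hl; simp
    · simpa [hl] using he l
  · rw [Finset.mem_insert, not_or]
    exact ⟨Finset.ne_of_mem_erase hk, hkΓ⟩
  · rw [Finset.mem_insert, not_or]
    exact ⟨Finset.ne_of_mem_erase hj, hjΓ⟩

/-- Let `J` be generated by `x p` and the `x k ^ e k` with `k ∈ Γ`. A relation for `x i • x j • a`
in the quotient says `x p • x i • x j • a ∈ x p J X`, and this lies in `J ^ 2 X`. Inside `J ^ 2 X`
the factor `x j` may be traded for `x i`, and then `x i ^ 2` for `x i`, since `x i` kills `(0 : x k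
^ q)` and carries `(J X : x k ^ q)` into `J X`. Finally `x p • x i • a ∈ J ^ 2 X` implies `x p • x i
• a ∈ x p J X`. -/
theorem quotient_colonSum (h : IsStrongDSeq X x E) {p : ℕ} (hp : p ∈ E) :
    IsStrongDSeq (X ⧸ colonSum X (x p)) x (E.erase p) := by
  intro e he Γ hΓ i hi hiΓ j hj hij hjΓ a
  obtain ⟨a, rfl⟩ := Submodule.mkQ_surjective _ a
  have hpΓ : p ∉ Γ := fun h => Finset.notMem_erase _ _ (hΓ h)
  rw [← map_smul, ← map_smul, ← map_smul, mkQ_mem_powerSum_iff, mkQ_mem_powerSum_iff,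
    mem_powerSum_sup_colonSum hpΓ, mem_powerSum_sup_colonSum hpΓ]
  rintro ⟨b, hb, hab⟩
  rw [Finset.mem_erase] at hi hj
  set Λ := insert p Γ with hΛdef
  have hΛ : Λ ⊆ E := Finset.insert_subset hp (hΓ.trans (Finset.erase_subset _ _))
  have hiΛ : i ∉ Λ := by
    rw [Finset.mem_insert, not_or]; exact ⟨hi.1, hiΓ⟩
  have hjΛ : j ∉ Λ := by
    rw [Finset.mem_insert, not_or]; exact ⟨hj.1, hjΓ⟩
  set f := Function.update e p 1 with hf
  have hf0 : ∀ k, f k ≠ 0 := fun k => by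
    by_cases hk : k = p
    · subst hk; simp [hf]
    · simpa [hf, hk] using he k
  have hfp : f p = 1 := Function.update_self _ _ _
  have hpΛ : p ∈ Λ := Finset.mem_insert_self _ _
  -- the step of removing a power of `x k` and replacing it by `x i`
  have step : ∀ k ∈ E, k ∉ Λ → i ≤ k → ∀ q, q ≠ 0 → ∀ n : X,
      x k ^ q • n ∈ varSum (fun k => x k ^ f k) Λ (powerSum X x f Λ) →
      x i • n ∈ varSum (fun k => x k ^ f k) Λ (powerSum X x f Λ) := by
    intro k hk hkΛ hik q hq n hn
    set g := Function.update f k q with hg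
    have hgf : ∀ l ∈ Λ, g l = f l := fun l hl =>
      Function.update_of_ne (fun h : l = k => hkΛ (h ▸ hl)) _ _
    have hg0 : ∀ l, g l ≠ 0 := fun l => by
      by_cases hl : l = k
      · subst hl; simpa [hg] using hq
      · simpa [hg, hl] using hf0 l
    have hgk : g k = q := Function.update_self _ _ _
    have hP : powerSum X x g Λ = powerSum X x f Λ := powerSum_congr hgf
    have hV : ∀ N : Submodule B X,
        varSum (fun k => x k ^ g k) Λ N = varSum (fun k => x k ^ f k) Λ N := fun N =>
      varSum_congr fun l hl => by rw [hgf l hl]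
    obtain ⟨n', hn', e'⟩ := h.exists_of_smul_mem_square hg0 hΛ hk hkΛ (y := n)
      (by rw [hV, hP, hgk]; exact hn)
    rw [hV, hP, hgk] at hn'
    rw [hgk] at e'
    obtain ⟨q', rfl⟩ := Nat.exists_eq_succ_of_ne_zero hq
    have key : ∀ Γ' ⊆ E, i ∉ Γ' → k ∉ Γ' → ∀ b : X, x k ^ (q' + 1) • b ∈ powerSum X x f Γ' →
        x i • b ∈ powerSum X x f Γ' := fun Γ' hΓ' hi' hk' b hb =>
      (h f hf0 Γ' hΓ' i hi.2 hi').smul_mem_of_pow_of_le hk hik hk'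
        (by rw [smul_comm]; exact Submodule.smul_mem _ _ hb)
    have h0 : x i • (n - n') ∈ powerSum X x f ∅ := by
      refine key ∅ (Finset.empty_subset _) (Finset.notMem_empty _) (Finset.notMem_empty _) _ ?_
      rw [smul_sub, e', sub_self]
      exact zero_mem _
    rw [powerSum, varSum_empty, Submodule.mem_bot, smul_sub, sub_eq_zero] at h0
    rw [h0]
    exact smul_mem_varSum_of_le (fun m hm => key Λ hΛ hiΛ hkΛ m hm) hn'
  have h1 : x i • x j • x p • a ∈ varSum (fun k => x k ^ f k) Λ (powerSum X x f Λ) := by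
    rw [show x i • x j • x p • a = x p • x i • x j • a by module, hab]
    have := smul_mem_varSum (z := fun k => x k ^ f k) hpΛ hb
    simpa only [hfp, pow_one] using this
  -- Removing `x j` introduces a second factor `x i`; the next application, with `k = i` and
  -- exponent `2`, takes it away.
  have h2 : x i ^ 2 • x p • a ∈ varSum (fun k => x k ^ f k) Λ (powerSum X x f Λ) := by
    have := step j hj.2 hjΛ hij 1 one_ne_zero (x i • x p • a)
      (by rw [pow_one, smul_comm]; exact h1)
    rwa [← mul_smul, ← pow_two] at this
  have h3 := step i hi.2 hiΛ le_rfl 2 two_ne_zero _ h2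
  obtain ⟨y', hy', e'⟩ := h.exists_of_mem_square hf0 hΛ hpΛ (y := x i • a)
    (by rw [hfp, pow_one, smul_comm]; exact h3)
  rw [hfp, pow_one] at e'
  exact ⟨y', hy', e'⟩

end IsStrongDSeq

end

end VarSum

/-! ### Strong d-sequences with a regular tail. -/

namespace VarSum

open scoped Pointwise

section

variable {B X Y : Type*} [CommRing B] [AddCommGroup X] [Module B X] [AddCommGroup Y] [Module B Y]
variable {x : ℕ → B} {e : ℕ → ℕ} {Γ Δ E Λ Ω Θ : Finset ℕ}

theorem varSum_eq_span_smul {z : ℕ → B} {N : Submodule B X} :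
    varSum z Γ N = Ideal.span (z '' (Γ : Set ℕ)) • N := by
  apply le_antisymm
  · exact varSum_le_iff.2 fun i hi n hn =>
      Submodule.smul_mem_smul (Ideal.subset_span (Set.mem_image_of_mem z hi)) hn
  · refine Submodule.smul_le.2 fun b hb n hn => ?_
    induction hb using Submodule.span_induction with
    | mem b hb => obtain ⟨i, hi, rfl⟩ := hb; exact smul_mem_varSum hi hn
    | zero => rw [zero_smul]; exact zero_mem _
    | add b c _ _ hb hc => rw [add_smul]; exact add_mem hb hc
    | smul b c _ hc => rw [smul_assoc]; exact Submodule.smul_mem _ _ hc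

/-- An unconditioned strong d-sequence whose terms of index at least `s` are regular modulo all the
preceding ones. -/
structure IsAdmissible (X : Type*) [AddCommGroup X] [Module B X] (x : ℕ → B) (E : Finset ℕ)
    (s : ℕ) : Prop where
  strong : IsStrongDSeq X x E
  regular : ∀ i ∈ E, s ≤ i → ∀ a : X, x i • a ∈ powerSum X x (fun _ => 1) (E.filter (· < i)) →
    a ∈ powerSum X x (fun _ => 1) (E.filter (· < i))

theorem insert_filter_erase {p i : ℕ} (hp : p ∈ E) (hpi : p < i) :
    insert p ((E.erase p).filter (· < i)) = E.filter (· < i) := by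
  ext k
  simp only [Finset.mem_insert, Finset.mem_filter, Finset.mem_erase]
  by_cases hk : k = p
  · subst hk; simp [hp, hpi]
  · simp [hk]

theorem update_one (p : ℕ) : Function.update (fun _ : ℕ => 1) p 1 = fun _ => 1 := by
  ext k
  by_cases hk : k = p
  · subst hk; simp
  · simp [hk]

theorem mem_powerSum_sup_smul {p : ℕ} (hp : p ∉ Γ) {a : X} :
    a ∈ powerSum X x e Γ ⊔ x p • (⊤ : Submodule B X) ↔
      a ∈ powerSum X x (Function.update e p 1) (insert p Γ) := by
  rw [mem_powerSum_update hp, Submodule.mem_sup]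
  constructor
  · rintro ⟨b, hb, c, hc, rfl⟩
    obtain ⟨n, -, rfl⟩ := (Submodule.mem_smul_pointwise_iff_exists _ _ _).1 hc
    exact ⟨n, b, hb, by rw [pow_one, add_comm]⟩
  · rintro ⟨n, b, hb, rfl⟩
    exact ⟨b, hb, _, Submodule.smul_mem_pointwise_smul n _ _ trivial, by rw [pow_one, add_comm]⟩

namespace IsAdmissible

theorem quotient_smul {s : ℕ} (h : IsAdmissible X x E s) {p : ℕ} (hp : p ∈ E) (hps : p < s) :
    IsAdmissible (X ⧸ (x p • (⊤ : Submodule B X))) x (E.erase p) s where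
  strong := h.strong.quotient_smul hp
  regular i hi hsi a := by
    obtain ⟨a, rfl⟩ := Submodule.mkQ_surjective _ a
    have hpΓ : p ∉ (E.erase p).filter (· < i) := by simp
    rw [← map_smul, mkQ_mem_powerSum_iff, mkQ_mem_powerSum_iff, mem_powerSum_sup_smul hpΓ,
      mem_powerSum_sup_smul hpΓ, update_one, insert_filter_erase hp (hps.trans_le hsi)]
    exact h.regular i (Finset.mem_of_mem_erase hi) hsi a

/-- Let `J` be generated by all `x k` with `k ∈ E`, `k < i`. As `x i` is regular modulo `J X`, the
intersection result gives `x i • x p • a = x i • n'` with `n' ∈ J ^ 2 X`. The difference `x p • a -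
n'` lies in `J X` and is killed by `x i`, whose index exceeds all those in `J`; hence it is zero,
and `x p • a ∈ J ^ 2 X` yields `x p • a ∈ x p J X`. -/
theorem quotient_colonSum {s : ℕ} (h : IsAdmissible X x E s) {p : ℕ} (hp : p ∈ E) (hps : p < s) :
    IsAdmissible (X ⧸ colonSum X (x p)) x (E.erase p) s where
  strong := h.strong.quotient_colonSum hp
  regular i hi hsi a := by
    obtain ⟨a, rfl⟩ := Submodule.mkQ_surjective _ a
    have hpΓ : p ∉ (E.erase p).filter (· < i) := by simp
    have hpi := hps.trans_le hsi
    have hiE := Finset.mem_of_mem_erase hi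
    rw [← map_smul, mkQ_mem_powerSum_iff, mkQ_mem_powerSum_iff, mem_powerSum_sup_colonSum hpΓ,
      mem_powerSum_sup_colonSum hpΓ, update_one, insert_filter_erase hp hpi]
    set Λ := E.filter (· < i) with hΛdef
    have hΛ : Λ ⊆ E := Finset.filter_subset _ _
    have hpΛ : p ∈ Λ := Finset.mem_filter.2 ⟨hp, hpi⟩
    have hiΛ : i ∉ Λ := by simp [hΛdef]
    rintro ⟨b, hb, hab⟩
    have h1 : x i ^ 1 • x p • a ∈
        varSum (fun k => x k ^ 1) Λ (powerSum X x (fun _ => 1) Λ) := by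
      rw [pow_one, smul_comm, hab]
      have := smul_mem_varSum (z := fun k => x k ^ 1) hpΛ hb
      simpa only [pow_one] using this
    obtain ⟨n', hn', e'⟩ := h.strong.exists_of_smul_mem_square (e := fun _ => 1)
      (fun _ => one_ne_zero) hΛ hiE hiΛ h1
    have hn'' : n' ∈ varSum (fun k => x k ^ 1) Λ (powerSum X x (fun _ => 1) Λ) := by
      refine varSum_mono subset_rfl (fun m hm => ?_) hn'
      refine h.regular i hiE hsi m ?_
      have : x i ^ 1 • m ∈ powerSum X x (fun _ => 1) Λ := hm
      rwa [pow_one] at this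
    have h2 : x p • a - n' ∈ powerSum X x (fun _ => 1) ∅ := by
      refine h.strong.mem_of_max_smul_mem (fun _ => one_ne_zero) (Finset.empty_subset _) (m := i)
        (q := 1) hiE (Finset.notMem_empty _) hΛ (fun k hk _ => (Finset.mem_filter.1 hk).2.le) ?_ ?_
      · rw [Finset.empty_union]
        refine sub_mem ?_ (varSum_le hn'')
        have := smul_mem_varSum (z := fun k => x k ^ 1) (N := ⊤) hpΛ (n := a) trivial
        simpa only [powerSum, pow_one] using this
      · rw [smul_sub, e', sub_self]
        exact zero_mem _
    rw [powerSum, varSum_empty, Submodule.mem_bot, sub_eq_zero] at h2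
    obtain ⟨y', hy', e''⟩ := h.strong.exists_of_mem_square (e := fun _ => 1)
      (fun _ => one_ne_zero) hΛ hpΛ (y := a) (by rw [pow_one, h2]; exact hn'')
    rw [pow_one] at e''
    exact ⟨y', hy', e''⟩

theorem isWeaklyRegular {s n : ℕ} (h : IsAdmissible X x (Finset.Ico s n) s) :
    RingTheory.Sequence.IsWeaklyRegular X ((List.range' s (n - s)).map x) := by
  refine ⟨fun j hj => ?_⟩
  rw [List.length_map, List.length_range'] at hj
  have hget : ((List.range' s (n - s)).map x)[j]'(by simpa using hj) = x (s + j) := by simp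
  have hset : (Finset.Ico s n).filter (· < s + j) = Finset.Ico s (s + j) := by
    ext k; simp only [Finset.mem_filter, Finset.mem_Ico]; omega
  have hsub : (Ideal.ofList (((List.range' s (n - s)).map x).take j) • ⊤ : Submodule B X) =
      powerSum X x (fun _ => 1) ((Finset.Ico s n).filter (· < s + j)) := by
    rw [hset, powerSum, varSum_eq_span_smul, Ideal.ofList]
    congr 2
    ext b
    simp only [pow_one, Set.mem_image, Finset.coe_Ico, Set.mem_Ico, Set.mem_ofPred_eq,
      ← List.map_take, List.mem_map]
    refine exists_congr fun k => and_congr_left fun _ => ?_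
    rw [List.take_range'_of_length_ge (by omega), List.mem_range'_1]
  rw [hget, hsub]
  refine isSMulRegular_iff_right_eq_zero_of_smul.2 fun a ha => ?_
  obtain ⟨a, rfl⟩ := Submodule.mkQ_surjective _ a
  rw [← map_smul, Submodule.mkQ_apply, Submodule.Quotient.mk_eq_zero] at ha
  rw [Submodule.mkQ_apply, Submodule.Quotient.mk_eq_zero]
  exact h.regular (s + j) (Finset.mem_Ico.2 ⟨by omega, by omega⟩) (by omega) a ha

end IsAdmissible

/-! ### Towers -/

/-- The submodule `I_k ^ t I_{k + 1} ^ t ⋯ I_{k + d - 1} ^ t X`, where `I_l` is generated by the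
`x j` with `j ∈ F l`. -/
def tower (X : Type*) [AddCommGroup X] [Module B X] (x : ℕ → B) (F : ℕ → Finset ℕ) (t : ℕ) :
    ℕ → ℕ → Submodule B X
  | _, 0 => ⊤
  | k, d + 1 => powSum x (F k) (tower X x F t (k + 1) d) t

variable {F : ℕ → Finset ℕ} {t : ℕ}

theorem smul_mem_powSum {N N' : Submodule B X} {c : B} (h : ∀ n ∈ N, c • n ∈ N') (q : ℕ) {y : X}
    (hy : y ∈ powSum x E N q) : c • y ∈ powSum x E N' q := by
  induction q generalizing y with
  | zero => exact h y hy
  | succ q ih =>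
    rw [powSum_succ] at hy ⊢
    exact smul_mem_varSum_of_le (fun n hn => ih hn) hy

theorem map_powSum (f : X →ₗ[B] Y) {N : Submodule B X} (q : ℕ) :
    (powSum x E N q).map f = powSum x E (N.map f) q := by
  induction q with
  | zero => rfl
  | succ q ih => rw [powSum_succ, powSum_succ, map_varSum, ih]

theorem map_tower (f : X →ₗ[B] Y) (hf : Function.Surjective f) (k d : ℕ) :
    (tower X x F t k d).map f = tower Y x F t k d := by
  induction d generalizing k with
  | zero => rw [tower, tower, Submodule.map_top, LinearMap.range_eq_top.2 hf]
  | succ d ih => rw [tower, tower, map_powSum, ih]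

theorem tower_zero (k d : ℕ) : tower X x F 0 k d = ⊤ := by
  induction d generalizing k with
  | zero => rfl
  | succ d ih => rw [tower, powSum_zero, ih]

theorem prod_smul_mem_tower {j : ℕ → ℕ} {k d : ℕ} (hj : ∀ l < d, j (k + l) ∈ F (k + l)) {y : X}
    (hy : y ∈ tower X x F t k d) :
    (∏ l ∈ Finset.range d, x (j (k + l))) • y ∈ tower X x F (t + 1) k d := by
  induction d generalizing k y with
  | zero => trivial
  | succ d ih =>
    rw [Finset.prod_range_succ', add_zero, mul_comm, mul_smul, tower, powSum_succ]
    refine smul_mem_varSum (hj 0 (Nat.succ_pos d)) (smul_mem_powSum (fun n hn => ?_) t hy)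
    have := ih (k := k + 1) (fun l hl => by
      rw [add_assoc, add_comm 1 l]; exact hj (l + 1) (by omega)) hn
    simpa only [add_assoc, add_comm 1] using this

/-- In a chart, `j` selects the pivots, and each pivot divides the other generators of its ideal.
Elements of the tower can therefore be divided by the corresponding power of the product of the
pivots, without leaving `Z`. -/
theorem map_tower_le {Z : Type*} [AddCommGroup Z] [Module B Z] (φ : X →ₗ[B] Z) {j : ℕ → ℕ}
    {k d : ℕ} (hj : ∀ l < d, ∀ i ∈ F (k + l), ∀ z : Z, ∃ z', x i • z = x (j (k + l)) • z')
    {y : X} (hy : y ∈ tower X x F t k d) :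
    ∃ z, φ y = (∏ l ∈ Finset.range d, x (j (k + l))) ^ t • z := by
  suffices h : (tower X x F t k d).map φ ≤
      ((∏ l ∈ Finset.range d, x (j (k + l))) ^ t) • ⊤ by
    obtain ⟨z, -, hz⟩ := (Submodule.mem_smul_pointwise_iff_exists _ _ _).1
      (h (Submodule.mem_map_of_mem hy))
    exact ⟨z, hz.symm⟩
  clear hy
  induction d generalizing k with
  | zero =>
    intro z _
    simp
  | succ d ih =>
    have ih' := ih (k := k + 1) fun l hl => by
      have := hj (l + 1) (by omega)
      simpa only [add_assoc, add_comm 1] using this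
    rw [tower, map_powSum, Finset.prod_range_succ', add_zero]
    simp only [add_assoc, add_comm 1] at ih'
    generalize (∏ l ∈ Finset.range d, x (j (k + (l + 1)))) = g at ih' ⊢
    have key : ∀ q, powSum x (F k) ((tower X x F t (k + 1) d).map φ) q ≤
        (g ^ t * x (j k) ^ q) • ⊤ := by
      intro q
      induction q with
      | zero => simpa [powSum_zero] using ih'
      | succ q ihq =>
        rw [powSum_succ]
        refine varSum_le_iff.2 fun i hi z hz => ?_
        obtain ⟨z, -, rfl⟩ := (Submodule.mem_smul_pointwise_iff_exists _ _ _).1 (ihq hz)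
        obtain ⟨z', hz'⟩ := hj 0 (Nat.succ_pos d) i hi z
        rw [smul_comm, hz', add_zero, smul_smul, mul_assoc, ← pow_succ]
        exact Submodule.smul_mem_pointwise_smul z' _ ⊤ trivial
    rw [mul_pow]
    exact key t

theorem IsGoodFamily.mono {a : ℕ} {N : ℕ → Submodule B X} (h : IsGoodFamily x E a N) (hΔ : Δ ⊆ E) :
    IsGoodFamily x Δ a N where
  smul_mem p i hi := h.smul_mem p i (hΔ hi)
  colon Γ hΓ haΓ i hi j hj := h.colon Γ (hΓ.trans hΔ) haΓ i (hΔ hi) j (hΔ hj)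
  inter := h.inter

/-- The ideals increase with the index, so a family that is good for the generators of the next
layer is good for those of the present one; `IsGoodFamily.powSum` is then applied once per layer,
starting from the innermost. -/
theorem IsGoodFamily.powSum_tower {a k d : ℕ}
    (h : IsGoodFamily x E a (fun _ => (⊤ : Submodule B X)))
    (hF : Monotone F) (ha : ∀ l, a ∈ F l ∨ l < k) (hFE : ∀ l ≤ k + d, F l ⊆ E) :
    IsGoodFamily x (F k) a (fun q => VarSum.powSum x (F k) (tower X x F t (k + 1) d) q) := by
  induction d generalizing k with
  | zero =>
    exact (h.mono (hFE k le_rfl)).powSum ((ha k).resolve_right (lt_irrefl k)) subset_rfl 0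
  | succ d ih =>
    have := ih (k := k + 1) (fun l => (ha l).imp_right fun h => h.trans (Nat.lt_succ_self k))
      (fun l hl => hFE l (by omega))
    exact (this.mono (hF (Nat.le_succ k))).powSum ((ha k).resolve_right (lt_irrefl k)) subset_rfl t

theorem IsStrongDSeq.isGoodFamily (h : IsStrongDSeq X x E) (a : ℕ) :
    IsGoodFamily x E a (fun _ => (⊤ : Submodule B X)) where
  smul_mem _ _ _ _ _ := trivial
  colon Γ hΓ _ i hi j hj hij hiΓ hjΓ _ y _ hy := by
    have := h (fun _ => 1) (fun _ => one_ne_zero) Γ hΓ i hi hiΓ j hj hij hjΓ y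
    simp only [powerSum, pow_one] at this
    exact this hy
  inter _ y _ := ⟨y, trivial, rfl⟩

/-- The sets `Γ` in question contain `p`. Adding `(0 : x p)` to the submodule generated by `Γ`
therefore amounts to working modulo `colonSum`, with `p` removed from `Γ`, and `quotient_colonSum`
applies. In `X` itself the relations needed for a changing pivot hold only up to `(0 : x p)`. -/
theorem IsStrongDSeq.isGoodFamily_quotient (h : IsStrongDSeq X x E) {p : ℕ} (hp : p ∈ E) :
    IsGoodFamily x E p
      (fun _ => (⊤ : Submodule B (X ⧸ LinearMap.ker (LinearMap.lsmul B X (x p))))) where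
  smul_mem _ _ _ _ _ := trivial
  colon Γ hΓ hpΓ i hi j hj hij hiΓ hjΓ _ y _ := by
    obtain ⟨y, rfl⟩ := Submodule.mkQ_surjective _ y
    have key : ∀ b : X, b ∈ varSum x Γ ⊤ ⊔ LinearMap.ker (LinearMap.lsmul B X (x p)) ↔
        b ∈ powerSum X x (fun _ => 1) (Γ.erase p) ⊔ colonSum X (x p) := by
      intro b
      have : varSum x Γ (⊤ : Submodule B X) =
          powerSum X x (fun _ => 1) (Γ.erase p) ⊔ x p • ⊤ := by
        rw [← Finset.insert_erase hpΓ, varSum_insert, Finset.insert_erase hpΓ, sup_comm]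
        simp only [powerSum, pow_one]
      rw [this, colonSum, sup_assoc]
    rw [← map_smul, ← map_smul, ← map_smul, mkQ_mem_varSum_iff, mkQ_mem_varSum_iff, key, key,
      ← mkQ_mem_powerSum_iff, ← mkQ_mem_powerSum_iff, map_smul, map_smul, map_smul]
    have hip : i ≠ p := fun h => hiΓ (h ▸ hpΓ)
    have hjp : j ≠ p := fun h => hjΓ (h ▸ hpΓ)
    exact h.quotient_colonSum hp _ (fun _ => one_ne_zero) _ (Finset.erase_subset_erase _ hΓ) i
      (Finset.mem_erase.2 ⟨hip, hi⟩) (fun h => hiΓ (Finset.mem_of_mem_erase h)) j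
      (Finset.mem_erase.2 ⟨hjp, hj⟩) hij (fun h => hjΓ (Finset.mem_of_mem_erase h)) _
  inter _ y _ := ⟨y, trivial, rfl⟩

theorem ColonAt.smul_mem_of_mem_closure {i : ℕ} (h : ColonAt X x E e Γ i) {b : B}
    (hb : b ∈ Submonoid.closure {b | ∃ j ∈ E, i ≤ j ∧ j ∉ Γ ∧ x j = b}) {a : X}
    (ha : x i • b • a ∈ powerSum X x e Γ) : x i • a ∈ powerSum X x e Γ := by
  induction hb using Submonoid.closure_induction generalizing a with
  | mem b hb =>
    obtain ⟨j, hj, hij, hjΓ, rfl⟩ := hb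
    exact h j hj hij hjΓ a ha
  | one => simpa using ha
  | mul b c _ _ hb hc => exact hc (hb (by rwa [mul_smul] at ha))

end

end VarSum

/-! ### Coordinates and charts with pivots. -/

namespace VarSum

open scoped Pointwise

section

variable {B A X Z : Type*} [CommRing B] [CommRing A] [Algebra B A] [AddCommGroup X] [Module B X]
  [AddCommGroup Z] [Module B Z] [Module A Z] [IsScalarTower B A Z]

/-- The coordinates `c k` of a chart with pivots `f k`. -/
def IsCoordinate (x : ℕ → B) (f : ℕ → ℕ) (c : ℕ → A) (i d : ℕ) : Prop :=
  ∀ k, i ≤ k → k < i + d →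
    (f (k + 1) = f k ∧ c k * algebraMap B A (x (f k)) = algebraMap B A (x k)) ∨
    (f (k + 1) = k ∧ c k * algebraMap B A (x k) = algebraMap B A (x (f k)))

/-- The `A`-module `Z` together with `φ : X → Z` is a chart of a blowing up of `X` with pivots
`f k` and coordinates `c k`. -/
structure IsChart (x : ℕ → B) (f : ℕ → ℕ) (c : ℕ → A) (i d : ℕ) (φ : X →ₗ[B] Z) : Prop where
  regular : ∀ k, i ≤ k → k ≤ i + d → ∀ z : Z, x (f k) • z = 0 → z = 0
  ker : ∀ y, φ y = 0 → x (f i) • y = 0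
  span : ∀ P : Submodule B Z, LinearMap.range φ ≤ P →
    (∀ k, i ≤ k → k < i + d → ∀ z ∈ P, c k • z ∈ P) → P = ⊤

variable {x : ℕ → B} {f : ℕ → ℕ} {c : ℕ → A} {i d : ℕ}

namespace IsCoordinate

theorem tail (h : IsCoordinate x f c i (d + 1)) : IsCoordinate x f c (i + 1) d :=
  fun k hk hk' => h k (by omega) (by omega)

theorem pivot_mem (h : IsCoordinate x f c i d) {k : ℕ} (hk : i ≤ k) (hk' : k ≤ i + d) :
    f k ∈ insert (f i) (Finset.Ico i k) := by
  induction k, hk using Nat.le_induction with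
  | base => exact Finset.mem_insert_self _ _
  | succ k hk ih =>
    rcases h k hk (by omega) with ⟨h', -⟩ | ⟨h', -⟩
    · rw [h']
      exact Finset.insert_subset_insert _ (Finset.Ico_subset_Ico_right (Nat.le_succ k))
        (ih (by omega))
    · rw [h']
      exact Finset.mem_insert_of_mem (Finset.mem_Ico.2 ⟨hk, Nat.lt_succ_self k⟩)

/-- At each step either the new variable is a multiple of the kept pivot, or the old pivot is a
multiple of the new one. Divisibility by the current pivot thus propagates to all variables met so
far. -/
theorem exists_eq (h : IsCoordinate x f c i d) {k : ℕ} (hk : i ≤ k) (hk' : k ≤ i + d) :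
    ∀ j ∈ insert (f i) (Finset.Ico i k), ∃ b : A,
      algebraMap B A (x j) = b * algebraMap B A (x (f k)) := by
  induction k, hk using Nat.le_induction with
  | base =>
    intro j hj
    rw [Finset.Ico_self, insert_empty_eq, Finset.mem_singleton] at hj
    exact ⟨1, by rw [hj, one_mul]⟩
  | succ k hk ih =>
    intro j hj
    have hj' : j = k ∨ j ∈ insert (f i) (Finset.Ico i k) := by
      simp only [Finset.mem_insert, Finset.mem_Ico] at hj ⊢
      omega
    rcases h k hk (by omega) with ⟨h', e⟩ | ⟨h', e⟩
    · rw [h']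
      rcases hj' with rfl | hj'
      · exact ⟨c j, e.symm⟩
      · exact ih (by omega) j hj'
    · rw [h']
      rcases hj' with rfl | hj'
      · exact ⟨1, (one_mul _).symm⟩
      · obtain ⟨b, hb⟩ := ih (by omega) j hj'
        exact ⟨b * c k, by rw [hb, ← e, mul_assoc]⟩

end IsCoordinate

namespace IsChart

variable {φ : X →ₗ[B] Z}

set_option linter.unusedSectionVars false in
theorem smul_pow_eq_zero (h : IsChart x f c i d φ) (t : ℕ) {z : Z}
    (hz : (∏ l ∈ Finset.range d, x (f (i + l + 1))) ^ t • z = 0) : z = 0 := by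
  have key : ∀ b ∈ Submonoid.closure {b | ∃ k, i ≤ k ∧ k ≤ i + d ∧ x (f k) = b}, ∀ z : Z,
      b • z = 0 → z = 0 := by
    intro b hb
    induction hb using Submonoid.closure_induction with
    | mem b hb => obtain ⟨k, hk, hk', rfl⟩ := hb; exact h.regular k hk hk'
    | one => intro z; simp
    | mul b c _ _ hb hc => intro z hz; exact hc z (hb _ (by rwa [mul_smul] at hz))
  refine key _ (pow_mem (Submonoid.prod_mem _ fun l hl => ?_) t) z hz
  have := Finset.mem_range.1 hl
  exact Submonoid.subset_closure ⟨i + l + 1, by omega, by omega, rfl⟩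

/-- The finite set of indices `≤ k`. -/
abbrev indices (f : ℕ → ℕ) (i k : ℕ) : Finset ℕ := insert (f i) (Finset.Ico i (k + 1))

theorem indices_mono : Monotone (indices f i) := fun _ _ h =>
  Finset.insert_subset_insert _ (Finset.Ico_subset_Ico_right (Nat.succ_le_succ h))

/-- The elements that can be written `φ y / g ^ t`, with `y` in the tower of `t`-th powers, form a
submodule containing the image of `φ`. It is stable under the coordinates, since multiplying by `c
(i + l)` exchanges one factor `x (f (i + l + 1))` of `g` for another generator of the same ideal.
The generation property of a chart concludes. -/
theorem exists_pow_smul_eq (hc : IsCoordinate x f c i d) (h : IsChart x f c i d φ) (z : Z) :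
    ∃ t, ∃ y ∈ tower X x (indices f i) t i d,
      (∏ l ∈ Finset.range d, x (f (i + l + 1))) ^ t • z = φ y := by
  set g := ∏ l ∈ Finset.range d, x (f (i + l + 1)) with hg
  have hpiv : ∀ l < d, f (i + l + 1) ∈ indices f i (i + l) := fun l hl =>
    hc.pivot_mem (k := i + l + 1) (by omega) (by omega)
  have hup : ∀ t, ∀ y ∈ tower X x (indices f i) t i d,
      g • y ∈ tower X x (indices f i) (t + 1) i d := fun t y hy => by
    have := prod_smul_mem_tower (j := fun k => f (k + 1)) hpiv hy
    exact this
  have hups : ∀ q t, ∀ y ∈ tower X x (indices f i) t i d,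
      g ^ q • y ∈ tower X x (indices f i) (t + q) i d := fun q => by
    induction q with
    | zero => intro t y hy; simpa using hy
    | succ q ih =>
      intro t y hy
      rw [pow_succ', mul_smul]
      exact hup _ _ (ih t y hy)
  let P : Submodule B Z :=
    { carrier := {z | ∃ t, ∃ y ∈ tower X x (indices f i) t i d, g ^ t • z = φ y}
      zero_mem' := ⟨0, 0, zero_mem _, by simp⟩
      add_mem' := by
        rintro z z' ⟨t, y, hy, e⟩ ⟨t', y', hy', e'⟩
        refine ⟨t + t', g ^ t' • y + g ^ t • y', add_mem (hups t' t y hy) ?_, ?_⟩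
        · rw [add_comm]; exact hups t t' y' hy'
        · rw [map_add, map_smul, map_smul, ← e, ← e']
          module
      smul_mem' := by
        rintro b z ⟨t, y, hy, e⟩
        exact ⟨t, b • y, Submodule.smul_mem _ _ hy, by rw [map_smul, ← e, smul_comm]⟩ }
  have hP : P = ⊤ := by
    refine h.span P ?_ ?_
    · rintro _ ⟨y, rfl⟩
      exact ⟨0, y, by rw [tower_zero]; trivial, by simp⟩
    · rintro k hk hk' z ⟨t, y, hy, e⟩
      obtain ⟨l, hl, rfl⟩ : ∃ l < d, k = i + l := ⟨k - i, by omega, by omega⟩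
      obtain ⟨m, hm, e'⟩ : ∃ m ∈ indices f i (i + l),
          c (i + l) * algebraMap B A (x (f (i + l + 1))) = algebraMap B A (x m) := by
        rcases hc (i + l) hk hk' with ⟨h', e'⟩ | ⟨h', e'⟩
        · exact ⟨i + l, Finset.mem_insert_of_mem (by simp), by rw [h', e']⟩
        · refine ⟨f (i + l), ?_, by rw [h', e']⟩
          exact Finset.insert_subset_insert _ (Finset.Ico_subset_Ico_right (Nat.le_succ _))
            (hc.pivot_mem hk hk'.le)
      -- `x m` is the numerator of the coordinate `c (i + l)`; it takes the place of the pivot in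
      -- position `l`, and the other factors of `g` stay.
      set j := Function.update (fun k => f (k + 1)) (i + l) m with hj
      refine ⟨t + 1, (∏ q ∈ Finset.range d, x (j (i + q))) • y,
        prod_smul_mem_tower (fun q hq => ?_) hy, ?_⟩
      · by_cases hql : q = l
        · subst hql; simpa [hj] using hm
        · rw [hj, Function.update_of_ne (by omega)]; exact hpiv q hq
      · have hprod : c (i + l) * algebraMap B A g =
            algebraMap B A (∏ q ∈ Finset.range d, x (j (i + q))) := by
          have h2 : ∏ q ∈ (Finset.range d).erase l, x (j (i + q)) =
              ∏ q ∈ (Finset.range d).erase l, x (f (i + q + 1)) := by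
            refine Finset.prod_congr rfl fun q hq => ?_
            have := Finset.ne_of_mem_erase hq
            rw [hj, Function.update_of_ne (by omega)]
          rw [hg, ← Finset.mul_prod_erase _ _ (Finset.mem_range.2 hl),
            ← Finset.mul_prod_erase _ _ (Finset.mem_range.2 hl), map_mul, map_mul, ← mul_assoc, e',
            h2, hj, Function.update_self]
        rw [map_smul, ← e, ← algebraMap_smul A (∏ q ∈ Finset.range d, x (j (i + q))), ← hprod,
          ← algebraMap_smul A (g ^ (t + 1)), ← algebraMap_smul A (g ^ t), map_pow, map_pow]
        module
  have : z ∈ P := by rw [hP]; trivial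
  exact this

theorem map_tower_eq (hc : IsCoordinate x f c i d) (φ : X →ₗ[B] Z) {t : ℕ} {y : X}
    (hy : y ∈ tower X x (indices f i) t i d) :
    ∃ z, φ y = (∏ l ∈ Finset.range d, x (f (i + l + 1))) ^ t • z := by
  refine map_tower_le φ (j := fun k => f (k + 1)) (fun l hl m hm z => ?_) hy
  obtain ⟨b, hb⟩ := hc.exists_eq (k := i + l + 1) (by omega) (by omega) m hm
  exact ⟨b • z, by rw [← algebraMap_smul A (x m), hb, mul_comm, mul_smul, algebraMap_smul]⟩

end IsChart

end

end VarSum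

/-! ### Dividing a chart by a coordinate, and regularity of the coordinates. -/

namespace VarSum

open scoped Pointwise

set_option linter.unusedSectionVars false

section

variable {B A : Type*} [CommRing B] [CommRing A] [Algebra B A]
variable {x : ℕ → B} {f : ℕ → ℕ} {c : ℕ → A} {i d : ℕ}

theorem mem_powerSum_singleton {X : Type*} [AddCommGroup X] [Module B X] {a : X} :
    a ∈ powerSum X x (fun _ => 1) {i} ↔ ∃ w, a = x i • w := by
  rw [powerSum, mem_varSum_singleton]
  simp only [Submodule.mem_top, true_and, pow_one, eq_comm]

theorem mem_colonSum {X : Type*} [AddCommGroup X] [Module B X] {b : B} {a : X} :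
    a ∈ colonSum X b ↔ ∃ w, b • (a - b • w) = 0 := by
  rw [colonSum, Submodule.mem_sup]
  constructor
  · rintro ⟨y, hy, z, hz, rfl⟩
    obtain ⟨w, -, rfl⟩ := (Submodule.mem_smul_pointwise_iff_exists _ _ _).1 hy
    exact ⟨w, by rw [add_sub_cancel_left]; exact hz⟩
  · rintro ⟨w, hw⟩
    exact ⟨b • w, Submodule.smul_mem_pointwise_smul w b ⊤ trivial, a - b • w, hw, by abel⟩

namespace IsChart

section

variable {X Z : Type*} [AddCommGroup X] [Module B X]
  [AddCommGroup Z] [Module B Z] [Module A Z] [IsScalarTower B A Z] {φ : X →ₗ[B] Z} {s n : ℕ}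

theorem eq_zero_of_smul (h : IsChart x f c i d φ) {y : X} (hy : x (f i) • y = 0) : φ y = 0 :=
  h.regular i le_rfl (by omega) _ (by rw [← map_smul, hy, map_zero])

theorem pow_mem_closure {E Γ : Finset ℕ} {p : ℕ}
    (hE : ∀ l < d, f (i + l + 1) ∈ E ∧ f (i + l + 1) ∉ Γ ∧ p ≤ f (i + l + 1)) (t : ℕ) :
    (∏ l ∈ Finset.range d, x (f (i + l + 1))) ^ t ∈
      Submonoid.closure {b | ∃ j ∈ E, p ≤ j ∧ j ∉ Γ ∧ x j = b} := by
  refine pow_mem (Submonoid.prod_mem _ fun l hl => Submonoid.subset_closure ?_) t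
  obtain ⟨h1, h2, h3⟩ := hE l (Finset.mem_range.1 hl)
  exact ⟨_, h1, h3, h2, rfl⟩

theorem pivot_le (hc : IsCoordinate x f c i d) (hi : f i < i) {k : ℕ} (hk : i ≤ k)
    (hk' : k ≤ i + d) : f i ≤ f k := by
  have := hc.pivot_mem hk hk'
  simp only [Finset.mem_insert, Finset.mem_Ico] at this
  omega

theorem range_subset (hdn : i + d ≤ n) {k : ℕ} (hk : k < i + d) :
    indices f i k ⊆ insert (f i) (Finset.Ico i n) :=
  Finset.insert_subset_insert _ (Finset.Ico_subset_Ico_right (by omega))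

/-- The coordinate `c i` acts as zero on the quotient, so stability under the remaining coordinates
suffices. -/
theorem span_quotient (h : IsChart x f c i (d + 1) φ) {K : Submodule B X}
    (φ' : (X ⧸ K) →ₗ[B] QuotSMulTop (c i) Z)
    (hφ' : ∀ y, φ' (Submodule.Quotient.mk y) = Submodule.Quotient.mk (φ y))
    (P : Submodule B (QuotSMulTop (c i) Z))
    (hP : LinearMap.range φ' ≤ P)
    (hPc : ∀ k, i + 1 ≤ k → k < i + 1 + d → ∀ z ∈ P, c k • z ∈ P) : P = ⊤ := by
  have hcomap : P.comap ((c i • (⊤ : Submodule A Z)).mkQ.restrictScalars B) = ⊤ := by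
    refine h.span _ ?_ ?_
    · rintro _ ⟨y, rfl⟩
      exact hP ⟨Submodule.Quotient.mk y, hφ' y⟩
    · intro k hk hk' z hz
      rcases hk.eq_or_lt with rfl | hk
      · have : (c i • (⊤ : Submodule A Z)).mkQ (c i • z) = 0 := by
          rw [Submodule.mkQ_apply, Submodule.Quotient.mk_eq_zero]
          exact Submodule.smul_mem_pointwise_smul _ (c i) ⊤ trivial
        change (c i • (⊤ : Submodule A Z)).mkQ (c i • z) ∈ P
        rw [this]
        exact zero_mem _
      · exact hPc k (by omega) (by omega) _ hz
  refine eq_top_iff.2 fun z _ => ?_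
  obtain ⟨z, rfl⟩ := Submodule.Quotient.mk_surjective _ z
  have : z ∈ P.comap ((c i • (⊤ : Submodule A Z)).mkQ.restrictScalars B) := by
    rw [hcomap]; trivial
  exact this

/-- Dividing a chart by a coordinate which is not a pivot. -/
theorem quotient_of_eq (hc : IsCoordinate x f c i (d + 1)) (h : IsChart x f c i (d + 1) φ)
    (hi : f i < i) (hdn : i + (d + 1) ≤ n)
    (hX : IsStrongDSeq X x (insert (f i) (Finset.Ico i n)))
    (hfi : f (i + 1) = f i) (hci : c i * algebraMap B A (x (f i)) = algebraMap B A (x i)) :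
    IsSMulRegular Z (c i) ∧ ∃ φ' : (X ⧸ x i • (⊤ : Submodule B X)) →ₗ[B] QuotSMulTop (c i) Z,
      IsChart x f c (i + 1) d φ' := by
  set p := f i with hp
  set E := insert p (Finset.Ico i n) with hE
  set g := ∏ l ∈ Finset.range (d + 1), x (f (i + l + 1)) with hg
  have hcz : ∀ z : Z, c i • x p • z = x i • z := fun z => by
    rw [← algebraMap_smul A (x p), smul_smul, hci, algebraMap_smul]
  have hiE : i ∈ E := Finset.mem_insert_of_mem (Finset.mem_Ico.2 ⟨le_rfl, by omega⟩)
  have hpE : p ∈ E := Finset.mem_insert_self _ _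
  have hpi : p ∉ ({i} : Finset ℕ) := by
    rw [Finset.mem_singleton]; exact hi.ne
  have hpivE : ∀ k, i + 1 ≤ k → k ≤ i + (d + 1) → f k ∈ E ∧ f k ∉ ({i} : Finset ℕ) ∧ p ≤ f k := by
    intro k hk hk'
    have h1 := hc.tail.pivot_mem (k := k) hk (by omega)
    rw [hfi] at h1
    have h2 := pivot_le hc hi (k := k) (by omega) hk'
    simp only [Finset.mem_insert, Finset.mem_Ico] at h1
    refine ⟨?_, ?_, h2⟩
    · simp only [hE, Finset.mem_insert, Finset.mem_Ico]; omega
    · rw [Finset.mem_singleton]; omega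
  have hgcl := fun t => pow_mem_closure (x := x) (f := f) (E := E) (Γ := {i}) (i := i) (d := d + 1)
    (p := p) (fun l hl => hpivE (i + l + 1) (by omega) (by omega)) t
  have hcol : ColonAt X x E (fun _ => 1) {i} p :=
    hX _ (fun _ => one_ne_zero) _ (Finset.singleton_subset_iff.2 hiE) p hpE hpi
  have hcol₀ : ColonAt X x E (fun _ => 1) ∅ p :=
    hX _ (fun _ => one_ne_zero) _ (Finset.empty_subset _) p hpE (Finset.notMem_empty _)
  -- `c i • z = φ y / u` forces `x p • y ∈ x i • X`
  have hdiv : ∀ (b : B),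
      b ∈ Submonoid.closure {b | ∃ j ∈ E, p ≤ j ∧ j ∉ ({i} : Finset ℕ) ∧ x j = b} →
      ∀ (y : X) (z : Z), b • φ y = c i • z → ∃ w, x p • y = x i • w := by
    intro b hb y z hyz
    obtain ⟨t, y', -, e'⟩ := h.exists_pow_smul_eq hc z
    rw [← hg] at e'
    have h1 : φ (x p • (b * g ^ t) • y - x i • y') = 0 := by
      rw [map_sub, map_smul, map_smul, map_smul, ← e', ← hcz, mul_comm, mul_smul, hyz,
        ← algebraMap_smul A (g ^ t), ← algebraMap_smul A (x p), ← algebraMap_smul A (g ^ t) z]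
      module
    have h2 := h.ker _ h1
    refine mem_powerSum_singleton.1 (hcol.smul_mem_of_mem_closure (b := x p * (b * g ^ t))
      (mul_mem (Submonoid.subset_closure ⟨p, hpE, le_rfl, hpi, rfl⟩) (mul_mem hb (hgcl t))) ?_)
    refine mem_powerSum_singleton.2 ⟨x p • y', ?_⟩
    rw [smul_sub, sub_eq_zero] at h2
    rw [mul_smul, h2, smul_comm]
  constructor
  -- Write `z = φ y / g ^ t`. Then `c i • z = 0` gives `φ (x i • y) = 0`, so `x p • x i • y = 0`, so
  -- `x p • y = 0` by the colon condition at `p`; as `x p` is regular on `Z`, `φ y = 0`.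
  · refine isSMulRegular_iff_right_eq_zero_of_smul.2 fun z hz => ?_
    obtain ⟨t, y, -, e⟩ := h.exists_pow_smul_eq hc z
    rw [← hg] at e
    have h1 : φ (x i • y) = 0 := by
      rw [map_smul, ← e, ← hcz, smul_comm (x p), ← algebraMap_smul A (g ^ t), smul_comm (c i),
        ← algebraMap_smul A (x p), smul_comm (c i), hz, smul_zero, smul_zero]
    have h2 : x p • y = 0 := by
      have := hcol₀ i hiE hi.le (Finset.notMem_empty _) y
      rw [h.ker _ h1, powerSum, varSum_empty, Submodule.mem_bot, Submodule.mem_bot] at this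
      exact this rfl
    rw [h.eq_zero_of_smul h2] at e
    exact h.smul_pow_eq_zero t e
  · refine ⟨Submodule.mapQ _ ((c i • (⊤ : Submodule A Z)).restrictScalars B) φ ?_, ?_, ?_, ?_⟩
    · intro y hy
      obtain ⟨w, -, rfl⟩ := (Submodule.mem_smul_pointwise_iff_exists _ _ _).1 hy
      rw [Submodule.mem_comap, map_smul, ← hcz]
      exact Submodule.smul_mem_pointwise_smul _ (c i) ⊤ trivial
    · intro k hk hk' z hz
      obtain ⟨z, rfl⟩ := Submodule.Quotient.mk_surjective _ z
      rw [← Submodule.Quotient.mk_smul, Submodule.Quotient.mk_eq_zero] at hz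
      obtain ⟨z', -, hz'⟩ := (Submodule.mem_smul_pointwise_iff_exists _ _ _).1 hz
      rw [Submodule.Quotient.mk_eq_zero]
      obtain ⟨t, y, hy, e⟩ := h.exists_pow_smul_eq hc z
      rw [← hg] at e
      obtain ⟨hk1, hk2, hk3⟩ := hpivE k (by omega) (by omega)
      obtain ⟨w₀, hw₀⟩ := hdiv (x (f k)) (Submonoid.subset_closure ⟨f k, hk1, hk3, hk2, rfl⟩) y
        (g ^ t • z') (by
          rw [← e, smul_comm, ← hz', ← algebraMap_smul A (g ^ t), smul_comm, algebraMap_smul])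
      -- `x p • y = x i • w₀` lies in the tower with one extra power of the first ideal, so `w₀` can
      -- be exchanged for an element `w` of the tower itself. Dividing `φ w` by `g ^ t` produces an
      -- element `z''` of `Z` with `x p • (z - c i • z'')` killed by `g ^ t`.
      have hgood := ((hX.isGoodFamily i).powSum_tower (F := indices f i) (t := t) (k := i) (d := d)
        indices_mono (fun l => (le_or_gt i l).imp
          (fun hl => Finset.mem_insert_of_mem (Finset.mem_Ico.2 ⟨le_rfl, by omega⟩)) id)
        (fun l hl => range_subset (i := i) (d := d + 1) (by omega) (by omega)))
      have hmem : x p • y ∈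
          powSum x (indices f i i) (tower X x (indices f i) t (i + 1) d) (t + 1) := by
        rw [powSum_succ]
        exact smul_mem_varSum (Finset.mem_insert_self _ _) hy
      rw [hw₀] at hmem
      obtain ⟨w, hw, hww⟩ := hgood.inter t w₀ hmem
      obtain ⟨z'', hz''⟩ := map_tower_eq (d := d + 1) hc φ (t := t) (y := w) hw
      rw [← hg] at hz''
      have h3 : g ^ t • (x p • (z - c i • z'')) = 0 := by
        have h4 : x p • φ y = x i • φ w := by rw [← map_smul, ← map_smul, hw₀, hww]
        rw [hz'', ← e, ← hcz] at h4
        rw [smul_sub, smul_sub, smul_comm, h4, sub_eq_zero, ← algebraMap_smul A (g ^ t),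
          ← algebraMap_smul A (x p), ← algebraMap_smul A (x p), ← algebraMap_smul A (g ^ t)]
        module
      have h5 := h.regular i le_rfl (by omega) _ (h.smul_pow_eq_zero t h3)
      rw [sub_eq_zero.1 h5]
      exact Submodule.smul_mem_pointwise_smul _ (c i) ⊤ trivial
    · intro y hy
      obtain ⟨y, rfl⟩ := Submodule.Quotient.mk_surjective _ y
      have hy' : φ y ∈ c i • (⊤ : Submodule A Z) :=
        (Submodule.Quotient.mk_eq_zero (c i • (⊤ : Submodule A Z))).1 hy
      obtain ⟨z, -, hz⟩ := (Submodule.mem_smul_pointwise_iff_exists _ _ _).1 hy'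
      obtain ⟨w, hw⟩ := hdiv 1 (one_mem _) y z (by rw [one_smul, hz])
      rw [hfi, ← Submodule.Quotient.mk_smul, Submodule.Quotient.mk_eq_zero, hw]
      exact Submodule.smul_mem_pointwise_smul w (x i) ⊤ trivial
    · exact span_quotient h _ fun y => rfl

/-- Dividing a chart by a coordinate which is a pivot. -/
theorem quotient_of_pivot (hc : IsCoordinate x f c i (d + 1)) (h : IsChart x f c i (d + 1) φ)
    (hi : f i < i) (hdn : i + (d + 1) ≤ n)
    (hX : IsStrongDSeq X x (insert (f i) (Finset.Ico i n)))
    (hfi : f (i + 1) = i) (hci : c i * algebraMap B A (x i) = algebraMap B A (x (f i))) :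
    IsSMulRegular Z (c i) ∧ ∃ φ' : (X ⧸ colonSum X (x (f i))) →ₗ[B] QuotSMulTop (c i) Z,
      IsChart x f c (i + 1) d φ' := by
  set p := f i with hp
  set E := insert p (Finset.Ico i n) with hE
  set g := ∏ l ∈ Finset.range (d + 1), x (f (i + l + 1)) with hg
  have hcz : ∀ z : Z, c i • x i • z = x p • z := fun z => by
    rw [← algebraMap_smul A (x i), smul_smul, hci, algebraMap_smul]
  have hiE : i ∈ E := Finset.mem_insert_of_mem (Finset.mem_Ico.2 ⟨le_rfl, by omega⟩)
  have hpE : p ∈ E := Finset.mem_insert_self _ _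
  have hiE' : i ∈ E.erase p := Finset.mem_erase.2 ⟨hi.ne', hiE⟩
  have hpivE : ∀ k, i + 1 ≤ k → k ≤ i + (d + 1) →
      f k ∈ E.erase p ∧ f k ∉ (∅ : Finset ℕ) ∧ i ≤ f k := by
    intro k hk hk'
    have h1 := hc.tail.pivot_mem (k := k) hk (by omega)
    rw [hfi] at h1
    simp only [Finset.mem_insert, Finset.mem_Ico] at h1
    refine ⟨?_, Finset.notMem_empty _, by omega⟩
    simp only [hE, Finset.mem_insert, Finset.mem_Ico, Finset.mem_erase]; omega
  have hgcl := fun t => pow_mem_closure (x := x) (f := f) (E := E.erase p) (Γ := ∅)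
    (p := i) (fun l hl => hpivE (i + l + 1) (by omega) (by omega)) (i := i) (d := d + 1) t
  have hQ := hX.quotient_colonSum hpE
  have hcol : ColonAt (X ⧸ colonSum X (x p)) x (E.erase p) (fun _ => 1) ∅ i :=
    hQ _ (fun _ => one_ne_zero) _ (Finset.empty_subset _) i hiE' (Finset.notMem_empty _)
  -- If a product of later pivots carries `φ y` into `c i Z`, then clearing denominators gives the
  -- corresponding relation modulo `x p X + (0 : x p)`, and the colon condition at `i` in that
  -- quotient removes the product.
  have hdiv : ∀ (b : B), b ∈ Submonoid.closure
        {b | ∃ j ∈ E.erase p, i ≤ j ∧ j ∉ (∅ : Finset ℕ) ∧ x j = b} →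
      ∀ (y : X) (z : Z), b • φ y = c i • z → x i • y ∈ colonSum X (x p) := by
    intro b hb y z hyz
    obtain ⟨t, y', -, e'⟩ := h.exists_pow_smul_eq hc z
    rw [← hg] at e'
    have h1 : φ (x i • (b * g ^ t) • y - x p • y') = 0 := by
      rw [map_sub, map_smul, map_smul, map_smul, ← e', ← hcz, mul_comm, mul_smul, hyz,
        ← algebraMap_smul A (g ^ t), ← algebraMap_smul A (x i), ← algebraMap_smul A (g ^ t) z]
      module
    have h2 : x i • (b * g ^ t) • y ∈ colonSum X (x p) := mem_colonSum.2 ⟨y', h.ker _ h1⟩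
    have h3 := hcol.smul_mem_of_mem_closure (b := b * g ^ t) (mul_mem hb (hgcl t))
      (a := Submodule.Quotient.mk y) (by
        rw [← Submodule.Quotient.mk_smul, ← Submodule.Quotient.mk_smul,
          (Submodule.Quotient.mk_eq_zero _).2 h2]
        exact zero_mem _)
    rwa [powerSum, varSum_empty, Submodule.mem_bot, ← Submodule.Quotient.mk_smul,
      Submodule.Quotient.mk_eq_zero] at h3
  constructor
  · refine isSMulRegular_iff_right_eq_zero_of_smul.2 fun z hz => ?_
    refine h.regular i le_rfl (by omega) z ?_
    rw [← hp, ← hcz, ← algebraMap_smul A (x i), smul_comm, hz, smul_zero]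
  · refine ⟨Submodule.mapQ _ ((c i • (⊤ : Submodule A Z)).restrictScalars B) φ ?_, ?_, ?_, ?_⟩
    · intro y hy
      obtain ⟨w, hw⟩ := mem_colonSum.1 hy
      have hw' := h.eq_zero_of_smul hw
      rw [map_sub, sub_eq_zero] at hw'
      rw [Submodule.mem_comap, hw', map_smul, ← hcz]
      exact Submodule.smul_mem_pointwise_smul _ (c i) ⊤ trivial
    · intro k hk hk' z hz
      obtain ⟨z, rfl⟩ := Submodule.Quotient.mk_surjective _ z
      rw [← Submodule.Quotient.mk_smul, Submodule.Quotient.mk_eq_zero] at hz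
      obtain ⟨z', -, hz'⟩ := (Submodule.mem_smul_pointwise_iff_exists _ _ _).1 hz
      rw [Submodule.Quotient.mk_eq_zero]
      obtain ⟨t, y, hy, e⟩ := h.exists_pow_smul_eq hc z
      rw [← hg] at e
      obtain ⟨hk1, hk2, hk3⟩ := hpivE k (by omega) (by omega)
      have hyc := hdiv (x (f k)) (Submonoid.subset_closure ⟨f k, hk1, hk3, hk2, rfl⟩) y
        (g ^ t • z') (by
          rw [← e, smul_comm, ← hz', ← algebraMap_smul A (g ^ t), smul_comm, algebraMap_smul])
      obtain ⟨w₀, hw₀⟩ := mem_colonSum.1 hyc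
      -- The relation `x i • y = x p • w₀` holds only up to `(0 : x p)`. The good family is
      -- therefore taken on `X / K`; towers map onto towers, so the corrected cofactor lifts back to
      -- `X`, and `K` is killed by `φ`.
      set K := LinearMap.ker (LinearMap.lsmul B X (x p)) with hK
      have hgood := ((hX.isGoodFamily_quotient hpE).powSum_tower (F := indices f i) (t := t)
        (k := i) (d := d) indices_mono (fun l => Or.inl (Finset.mem_insert_self _ _))
        (fun l hl => range_subset (i := i) (d := d + 1) (by omega) (by omega)))
      have hyK : K.mkQ y ∈ tower (X ⧸ K) x (indices f i) t i (d + 1) := by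
        rw [← map_tower K.mkQ (Submodule.mkQ_surjective K)]
        exact Submodule.mem_map_of_mem hy
      have hmem : x i • K.mkQ y ∈
          powSum x (indices f i i) (tower (X ⧸ K) x (indices f i) t (i + 1) d) (t + 1) := by
        rw [powSum_succ]
        exact smul_mem_varSum (Finset.mem_insert_of_mem (by simp)) hyK
      have hw₀' : x i • K.mkQ y = x p • K.mkQ w₀ := by
        rw [← map_smul, ← map_smul, ← sub_eq_zero, ← map_sub, Submodule.mkQ_apply,
          Submodule.Quotient.mk_eq_zero]
        exact hw₀
      rw [hw₀'] at hmem
      obtain ⟨w, hw, hww⟩ := hgood.inter t _ hmem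
      change w ∈ tower (X ⧸ K) x (indices f i) t i (d + 1) at hw
      rw [← map_tower K.mkQ (Submodule.mkQ_surjective K)] at hw
      obtain ⟨w, hw, rfl⟩ := hw
      rw [← hw₀', ← map_smul, ← map_smul, ← sub_eq_zero, ← map_sub, Submodule.mkQ_apply,
        Submodule.Quotient.mk_eq_zero] at hww
      have h4 := h.eq_zero_of_smul hww
      obtain ⟨z'', hz''⟩ := map_tower_eq (d := d + 1) hc φ (t := t) (y := w) hw
      rw [← hg] at hz''
      have h3 : g ^ t • (x i • (z - c i • z'')) = 0 := by
        rw [map_sub, map_smul, map_smul, hz'', ← e, ← hcz] at h4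
        rw [← h4, ← algebraMap_smul A (g ^ t), ← algebraMap_smul A (x i),
          ← algebraMap_smul A (x i), ← algebraMap_smul A (g ^ t), ← algebraMap_smul A (g ^ t)]
        module
      have h5 := h.smul_pow_eq_zero t h3
      have h6 := h.regular (i + 1) (by omega) (by omega) (z - c i • z'') (by rw [hfi]; exact h5)
      rw [sub_eq_zero.1 h6]
      exact Submodule.smul_mem_pointwise_smul _ (c i) ⊤ trivial
    · intro y hy
      obtain ⟨y, rfl⟩ := Submodule.Quotient.mk_surjective _ y
      have hy' : φ y ∈ c i • (⊤ : Submodule A Z) :=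
        (Submodule.Quotient.mk_eq_zero (c i • (⊤ : Submodule A Z))).1 hy
      obtain ⟨z, -, hz⟩ := (Submodule.mem_smul_pointwise_iff_exists _ _ _).1 hy'
      rw [hfi, ← Submodule.Quotient.mk_smul, Submodule.Quotient.mk_eq_zero]
      exact hdiv 1 (one_mem _) y z (by rw [one_smul, hz])
    · exact span_quotient h _ fun y => rfl

/-- The terms of a chart form a weakly regular sequence. -/
theorem isWeaklyRegular {B A : Type*} [CommRing B] [CommRing A] [Algebra B A]
    {x : ℕ → B} {f : ℕ → ℕ} {c : ℕ → A} {d i s n : ℕ} {X Z : Type*} [AddCommGroup X] [Module B X]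
    [AddCommGroup Z] [Module B Z] [Module A Z] [IsScalarTower B A Z] (φ : X →ₗ[B] Z)
    (hc : IsCoordinate x f c i d) (h : IsChart x f c i d φ)
    (hi : f i < i) (hs : i + d = s) (hsn : s ≤ n)
    (hX : IsAdmissible X x (insert (f i) (Finset.Ico i n)) s) :
    RingTheory.Sequence.IsWeaklyRegular Z ((List.range' i d).map c ++
      (algebraMap B A (x (f s)) ::
        (List.range' s (n - s)).map (fun k => algebraMap B A (x k)))) := by
  induction d generalizing i X Z with
  | zero =>
    rw [add_zero] at hs
    subst hs
    set p := f i with hp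
    rw [List.range'_zero, List.map_nil, List.nil_append,
      RingTheory.Sequence.isWeaklyRegular_cons_iff]
    have hsurj : Function.Surjective φ := by
      rw [← LinearMap.range_eq_top]
      exact h.span _ le_rfl (fun k hk hk' => by omega)
    have hreg := h.regular i le_rfl (by omega)
    refine ⟨isSMulRegular_iff_right_eq_zero_of_smul.2 fun z hz => hreg z (by
      rwa [algebraMap_smul] at hz), ?_⟩
    -- No coordinates are left, so `φ` is surjective. Its kernel is `(0 : x p)` because `x p` is
    -- regular on `Z`, and hence `Z / x p Z` is `X` modulo `colonSum`, where the tail is still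
    -- regular.
    have hQ := hX.quotient_colonSum (Finset.mem_insert_self _ _) hi
    rw [Finset.erase_insert (by simp [hi])] at hQ
    have hw := hQ.isWeaklyRegular
    let ψ : X →ₗ[B] QuotSMulTop (algebraMap B A (x p)) Z :=
      ((algebraMap B A (x p) • (⊤ : Submodule A Z)).mkQ.restrictScalars B) ∘ₗ φ
    have hψ : Function.Surjective ψ := (Submodule.mkQ_surjective _).comp hsurj
    have hker : colonSum X (x p) = LinearMap.ker ψ := by
      ext y
      rw [LinearMap.mem_ker, mem_colonSum]
      change _ ↔ Submodule.Quotient.mk (φ y) = (0 : QuotSMulTop (algebraMap B A (x p)) Z)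
      rw [Submodule.Quotient.mk_eq_zero]
      constructor
      · rintro ⟨w, hw⟩
        have := h.eq_zero_of_smul hw
        rw [map_sub, sub_eq_zero, map_smul, ← algebraMap_smul A (x p)] at this
        rw [this]
        exact Submodule.smul_mem_pointwise_smul _ _ ⊤ trivial
      · intro hy
        obtain ⟨z, -, hz⟩ := (Submodule.mem_smul_pointwise_iff_exists _ _ _).1 hy
        obtain ⟨w, rfl⟩ := hsurj z
        refine ⟨w, h.ker _ ?_⟩
        rw [map_sub, map_smul, ← hz, algebraMap_smul, sub_self]
    let e := (Submodule.quotEquivOfEq _ _ hker).trans (ψ.quotKerEquivOfSurjective hψ)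
    rw [e.isWeaklyRegular_congr, ← RingTheory.Sequence.isWeaklyRegular_map_algebraMap_iff (S := A),
      List.map_map] at hw
    exact hw
  | succ d ih =>
    rw [List.range'_succ, List.map_cons, List.cons_append,
      RingTheory.Sequence.isWeaklyRegular_cons_iff]
    have hp := Finset.mem_insert_self (f i) (Finset.Ico i n)
    rcases hc i le_rfl (by omega) with ⟨hfi, hci⟩ | ⟨hfi, hci⟩
    · obtain ⟨hreg, φ', hφ'⟩ := quotient_of_eq hc h hi (by omega) hX.strong hfi hci
      refine ⟨hreg, ih φ' hc.tail hφ' (by omega) (by omega) ?_⟩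
      have := hX.quotient_smul (p := i) (by simp; omega) (by omega)
      have hset : (insert (f i) (Finset.Ico i n)).erase i =
          insert (f (i + 1)) (Finset.Ico (i + 1) n) := by
        ext k
        simp only [Finset.mem_insert, Finset.mem_Ico, Finset.mem_erase]
        omega
      rwa [hset] at this
    · obtain ⟨hreg, φ', hφ'⟩ := quotient_of_pivot hc h hi (by omega) hX.strong hfi hci
      refine ⟨hreg, ih φ' hc.tail hφ' (by omega) (by omega) ?_⟩
      have := hX.quotient_colonSum hp (by omega)
      have hset : (insert (f i) (Finset.Ico i n)).erase (f i) =
          insert (f (i + 1)) (Finset.Ico (i + 1) n) := by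
        ext k
        simp only [Finset.mem_insert, Finset.mem_Ico, Finset.mem_erase]
        omega
      rwa [hset] at this

end

end IsChart

end

end VarSum

/-! ### Cocycles as maps out of homology and of left derived functors. -/

namespace HomologicalComplex

variable {𝒟 : Type*} [Category* 𝒟] [Abelian 𝒟] {ι : Type*} {c : ComplexShape ι}
  (K K' : HomologicalComplex 𝒟 c) {i j : ι} {W W' : 𝒟}

/-- The morphism from the homology that is induced by a morphism from the `i`-th term that
vanishes on boundaries. -/
noncomputable def descHomology (f : K.X i ⟶ W) (hj : c.prev i = j) (hf : K.d j i ≫ f = 0) :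
    K.homology i ⟶ W :=
  K.homologyι i ≫ K.descOpcycles f j hj hf

theorem descHomology_comp (f : K.X i ⟶ W) (hj : c.prev i = j) (hf : K.d j i ≫ f = 0)
    (g : W ⟶ W') {f' : K.X i ⟶ W'} (h : f ≫ g = f') :
    K.descHomology f hj hf ≫ g =
      K.descHomology f' hj (by rw [← h, reassoc_of% hf, Limits.zero_comp]) := by
  subst h
  simp only [descHomology, Category.assoc]
  rw [descOpcycles_comp]

variable {K K'} in
theorem homologyMap_comp_descHomology (φ : K' ⟶ K) (f : K.X i ⟶ W) (hj : c.prev i = j)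
    (hf : K.d j i ≫ f = 0) {f' : K'.X i ⟶ W} (h : φ.f i ≫ f = f') :
    homologyMap φ i ≫ K.descHomology f hj hf =
      K'.descHomology f' hj (by rw [← h, ← φ.comm_assoc, hf, Limits.comp_zero]) := by
  subst h
  simp [descHomology]

/-- Homology is the kernel of the map from the opcycles to the next term. A map on opcycles that
vanishes there factors through the image in the next term, and extends by injectivity of `W`. -/
theorem exists_d_comp_eq_of_descHomology_eq_zero (hj : c.prev i = j) [Injective W]
    (f : K.X i ⟶ W) (hf : K.d j i ≫ f = 0)
    (h : K.descHomology f hj hf = 0) :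
    ∃ g : K.X (c.next i) ⟶ W, K.d i (c.next i) ≫ g = f := by
  let S := ShortComplex.mk (K.homologyι i) (K.fromOpcycles i (c.next i))
    (K.homologyι_comp_fromOpcycles i _)
  have hS : S.Exact := S.exact_of_f_is_kernel (K.homologyIsKernel i _ rfl)
  refine ⟨hS.descToInjective (K.descOpcycles f j hj hf) h, ?_⟩
  have := congr(K.pOpcycles i ≫ $(hS.comp_descToInjective (K.descOpcycles f j hj hf) h))
  simpa [S] using this

end HomologicalComplex

namespace CategoryTheory.ProjectiveResolution

section

variable {C 𝒟 : Type*} [Category* C] [Category* 𝒟] [Abelian C] [Abelian 𝒟]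
  [HasProjectiveResolutions C] {X X' : C} (P : ProjectiveResolution X)
  (P' : ProjectiveResolution X') (F : C ⥤ 𝒟) [F.Additive] {i : ℕ} {W W' : 𝒟}

/-- The morphism from the left derived functor that is induced by a morphism from the `i`-th term
of a projective resolution. -/
noncomputable def descLeftDerived (f : F.obj (P.complex.X i) ⟶ W)
    (hf : F.map (P.complex.d (i + 1) i) ≫ f = 0) : (F.leftDerived i).obj X ⟶ W :=
  (P.isoLeftDerivedObj F i).hom ≫
    ((F.mapHomologicalComplex _).obj P.complex).descHomology f (by simp) hf

theorem descLeftDerived_comp (f : F.obj (P.complex.X i) ⟶ W)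
    (hf : F.map (P.complex.d (i + 1) i) ≫ f = 0) (g : W ⟶ W') {f' : F.obj (P.complex.X i) ⟶ W'}
    (h : f ≫ g = f') :
    P.descLeftDerived F f hf ≫ g =
      P.descLeftDerived F f' (by rw [← h, reassoc_of% hf, Limits.zero_comp]) :=
  (Category.assoc _ _ _).trans (congrArg (_ ≫ ·) (HomologicalComplex.descHomology_comp _ _ _ _ _ h))

variable {P P'} in
theorem map_comp_descLeftDerived {g : X' ⟶ X} (φ : ProjectiveResolution.Hom P' P g)
    (f : F.obj (P.complex.X i) ⟶ W) (hf : F.map (P.complex.d (i + 1) i) ≫ f = 0)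
    {f' : F.obj (P'.complex.X i) ⟶ W} (h : F.map (φ.hom.f i) ≫ f = f') :
    (F.leftDerived i).map g ≫ P.descLeftDerived F f hf =
      P'.descLeftDerived F f' (by
        rw [← h, ← Category.assoc, ← F.map_comp, ← φ.hom.comm, F.map_comp, Category.assoc, hf,
          Limits.comp_zero]) := by
  have h' := ProjectiveResolution.isoLeftDerivedObj_hom_naturality g P' P φ.hom
    (by simpa using φ.hom_f_zero_comp_π_f_zero) F i
  exact (Category.assoc _ _ _).symm.trans ((congrArg (· ≫ _) h').trans
    ((Category.assoc _ _ _).trans (congrArg (_ ≫ ·)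
      (HomologicalComplex.homologyMap_comp_descHomology _ _ _ _ h))))

theorem exists_map_d_comp_eq_of_descLeftDerived_eq_zero [Injective W]
    (f : F.obj (P.complex.X i) ⟶ W) (hf : F.map (P.complex.d (i + 1) i) ≫ f = 0)
    (h : P.descLeftDerived F f hf = 0) :
    ∃ g : F.obj (P.complex.X ((ComplexShape.down ℕ).next i)) ⟶ W,
      F.map (P.complex.d i _) ≫ g = f :=
  HomologicalComplex.exists_d_comp_eq_of_descHomology_eq_zero _ _ _ _
    ((cancel_epi (P.isoLeftDerivedObj F i).hom).1 (h.trans Limits.comp_zero.symm))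

end

end CategoryTheory.ProjectiveResolution

/-! ### Classes of cocycles in the derived functors that define local cohomology. -/

namespace LocalCohomology

open Limits ModuleCat

section

variable {R : Type u} [CommRing R]

section

variable {X X' N : ModuleCat.{u} R} (P : ProjectiveResolution X) (P' : ProjectiveResolution X')

/-- The functor `Hom(-, N)` with values in the opposite category. -/
abbrev homFunctor (N : ModuleCat.{u} R) : ModuleCat.{u} R ⥤ (ModuleCat.{u} R)ᵒᵖ :=
  ((linearYoneda R (ModuleCat.{u} R)).obj N).rightOp

/-- A morphism `Y ⟶ N` as an element of `Hom(Y, N)`. -/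
noncomputable def homElement {Y : ModuleCat.{u} R} (f : Y ⟶ N) :
    (homFunctor N).obj Y ⟶ op (ModuleCat.of R R) :=
  (ModuleCat.ofHom (LinearMap.toSpanSingleton R (Y ⟶ N) f)).op

theorem map_comp_homElement {Y Y' : ModuleCat.{u} R} (g : Y' ⟶ Y) (f : Y ⟶ N) :
    (homFunctor N).map g ≫ homElement f = homElement (g ≫ f) := by
  apply Quiver.Hom.unop_inj
  ext
  change g ≫ ((1 : R) • f) = (1 : R) • (g ≫ f)
  simp

theorem homElement_zero {Y : ModuleCat.{u} R} : homElement (0 : Y ⟶ N) = 0 := by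
  apply Quiver.Hom.unop_inj
  ext
  change (1 : R) • (0 : Y ⟶ N) = 0
  simp

theorem homElement_smul {Y : ModuleCat.{u} R} (c : R) (f : Y ⟶ N) :
    homElement (c • f) =
      homElement f ≫ (ModuleCat.ofHom (LinearMap.toSpanSingleton R R c)).op := by
  apply Quiver.Hom.unop_inj
  ext
  change (1 : R) • (c • f) = ((1 : R) • c) • f
  simp

theorem exists_homElement_eq {Y : ModuleCat.{u} R}
    (g : (homFunctor N).obj Y ⟶ op (ModuleCat.of R R)) : ∃ f : Y ⟶ N, homElement f = g := by
  refine ⟨g.unop.hom (1 : R), Quiver.Hom.unop_inj ?_⟩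
  ext
  exact one_smul R _

theorem homElement_injective {Y : ModuleCat.{u} R} :
    Function.Injective (homElement : (Y ⟶ N) → _) := by
  intro f g h
  have h := congr($(h).unop.hom (1 : R))
  change (1 : R) • f = (1 : R) • g at h
  simpa using h

variable {i : ℕ} (f : P.complex.X i ⟶ N) (hf : P.complex.d (i + 1) i ≫ f = 0)

include hf in
theorem map_d_comp_homElement :
    (homFunctor N).map (P.complex.d (i + 1) i) ≫ homElement f = 0 := by
  rw [map_comp_homElement, hf, homElement_zero]

/-- The class in the derived functor of a cocycle. -/
noncomputable def cocycleClass :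
    (((homFunctor N).leftDerived i).obj X).unop :=
  (P.descLeftDerived (homFunctor N) (homElement f) (map_d_comp_homElement P f hf)).unop.hom (1 : R)

theorem exists_d_comp_eq_of_cocycleClass_eq_zero (h : cocycleClass P f hf = 0) :
    ∃ g : P.complex.X ((ComplexShape.down ℕ).next i) ⟶ N, P.complex.d i _ ≫ g = f := by
  have h' : P.descLeftDerived (homFunctor N) (homElement f) (map_d_comp_homElement P f hf) = 0 := by
    refine Quiver.Hom.unop_inj (ModuleCat.hom_ext (LinearMap.ext_ring h))
  -- The target `op R` is injective in the opposite category because `R` is projective.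
  obtain ⟨g, hg⟩ := P.exists_map_d_comp_eq_of_descLeftDerived_eq_zero _ _ _ h'
  obtain ⟨g, rfl⟩ := exists_homElement_eq g
  exact ⟨g, homElement_injective ((map_comp_homElement _ _).symm.trans hg)⟩

theorem cocycleClass_smul (c : R) :
    cocycleClass P (c • f) (by rw [Linear.comp_smul, hf, smul_zero]) =
      c • cocycleClass P f hf := by
  have h := P.descLeftDerived_comp (homFunctor N) (homElement f) (map_d_comp_homElement P f hf) _
    (homElement_smul c f).symm
  have h' := congr($(h).unop.hom (1 : R))
  refine h'.symm.trans ?_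
  change (P.descLeftDerived (homFunctor N) (homElement f) (map_d_comp_homElement P f hf)).unop.hom
    ((1 : R) • c) = _
  rw [smul_eq_mul, mul_comm, ← smul_eq_mul, LinearMap.map_smul]
  rfl

theorem map_cocycleClass (g : X' ⟶ X) (φ : ProjectiveResolution.Hom P' P g) :
    (((homFunctor N).leftDerived i).map g).unop.hom (cocycleClass P f hf) =
      cocycleClass P' (φ.hom.f i ≫ f) (by rw [← φ.hom.comm_assoc, hf, comp_zero]) :=
  congr($(ProjectiveResolution.map_comp_descLeftDerived (homFunctor N) φ (homElement f)
    (map_d_comp_homElement P f hf) (map_comp_homElement _ _)).unop.hom (1 : R))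

end

end

end LocalCohomology

/-! ### From annihilators of local cohomology to multipliers on systems of Ext groups. -/

namespace LocalCohomology

open Limits ModuleCat

variable {R : Type u} [CommRing R] (J : Ideal R)

/-- The restriction map `R ⧸ J ^ n' ⟶ R ⧸ J ^ n` for `n ≤ n'`. -/
noncomputable def transition {n n' : ℕ} (h : n ≤ n') :
    ModuleCat.of R (R ⧸ J ^ n') ⟶ ModuleCat.of R (R ⧸ J ^ n) :=
  ModuleCat.ofHom (Submodule.mapQ _ _ LinearMap.id (Ideal.pow_le_pow_right h))

theorem transition_comp {n n' n'' : ℕ} (h : n ≤ n') (h' : n' ≤ n'') :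
    transition J h' ≫ transition J h = transition J (h.trans h') := by
  ext
  rfl

/-- The element `c` kills the direct limit over `n` of `Ext^i(R ⧸ J ^ n, N)`. -/
def Kills (i : ℕ) (c : R) (N : ModuleCat.{u} R) : Prop :=
  ∀ (n : ℕ) (ξ : Abelian.Ext (ModuleCat.of R (R ⧸ J ^ n)) N i),
    ∃ (n' : ℕ) (h : n ≤ n'),
      c • (Abelian.Ext.mk₀ (transition J h)).comp ξ (zero_add i) = 0

/-- Local cohomology is a filtered colimit of Ext modules, and evaluation at `N` preserves it. A
class that dies in a filtered colimit of modules already dies at a finite stage. -/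
theorem exists_map_eq_zero_of_mem_annihilator {i : ℕ} {c : R} {N : ModuleCat.{u} R}
    (hc : c ∈ Module.annihilator R ((localCohomology J i).obj N)) (n : ℕ)
    (e : ((Ext R (ModuleCat.{u} R) i).obj (op (ModuleCat.of R (R ⧸ J ^ n)))).obj N) :
    ∃ (n' : ℕ) (h : n ≤ n'),
      (((Ext R (ModuleCat.{u} R) i).map (transition J h).op).app N).hom (c • e) = 0 := by
  let D := localCohomology.diagram (localCohomology.idealPowersDiagram J) i
  have h1 := isColimitOfPreserves ((evaluation _ _).obj N) (colimit.isColimit D)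
  have h2 : (((evaluation _ _).obj N).mapCocone (colimit.cocone D)).ι.app (op (op n)) (c • e) =
      (((evaluation _ _).obj N).mapCocone (colimit.cocone D)).ι.app (op (op n)) (0 : _) := by
    rw [map_zero]
    refine (LinearMap.map_smul _ _ _).trans ?_
    exact Module.mem_annihilator.1 hc _
  have : PreservesFilteredColimitsOfSize.{0, 0} (forget (ModuleCat.{u} R)) :=
    preservesFilteredColimitsOfSize_shrink.{0, u, 0, u} _
  obtain ⟨k, f, g, h⟩ := Concrete.isColimit_exists_of_rep_eq _ h1 _ _ h2
  rw [map_zero] at h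
  exact ⟨k.unop.unop, leOfHom f.unop.unop, h⟩

/-- This compares the derived functor in the definition of local cohomology with the Ext groups that
carry long exact sequences. On both sides a class is given by a cocycle on a projective resolution,
transported along a lift of the transition map; once `c` times this cocycle is a coboundary, it
vanishes on both sides. -/
theorem Kills.of_mem_annihilator {i : ℕ} {c : R} {N : ModuleCat.{u} R}
    (hc : c ∈ Module.annihilator R ((localCohomology J i).obj N)) : Kills J i c N := by
  intro n ξ
  obtain ⟨P⟩ : Nonempty (ProjectiveResolution (ModuleCat.of R (R ⧸ J ^ n))) :=
    ⟨CategoryTheory.projectiveResolution _⟩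
  obtain ⟨f, hf, rfl⟩ := P.extMk_surjective ξ (i + 1) rfl
  obtain ⟨n', h, h0⟩ := exists_map_eq_zero_of_mem_annihilator J hc n (cocycleClass P f hf)
  refine ⟨n', h, ?_⟩
  obtain ⟨P'⟩ : Nonempty (ProjectiveResolution (ModuleCat.of R (R ⧸ J ^ n'))) :=
    ⟨CategoryTheory.projectiveResolution _⟩
  let φ : ProjectiveResolution.Hom P' P (transition J h) :=
    ⟨ProjectiveResolution.lift (transition J h) P' P,
      (ProjectiveResolution.lift_commutes_zero _ _ _).trans (by simp)⟩
  rw [ProjectiveResolution.mk₀_comp_extMk f _ rfl hf φ, Abelian.Ext.smul_eq_comp_mk₀,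
    ProjectiveResolution.extMk_comp_mk₀]
  have hφ : P'.complex.d (i + 1) i ≫ φ.hom.f i ≫ f = 0 := by
    rw [← φ.hom.comm_assoc, hf, comp_zero]
  have h1 : cocycleClass P' (c • φ.hom.f i ≫ f) (by rw [Linear.comp_smul, hφ, smul_zero]) = 0 := by
    rw [cocycleClass_smul P' _ hφ, ← map_cocycleClass P P' f hf _ φ, ← LinearMap.map_smul]
    exact h0
  obtain ⟨g, hg⟩ := exists_d_comp_eq_of_cocycleClass_eq_zero _ _ _ h1
  have h2 : (φ.hom.f i ≫ f) ≫ (c • 𝟙 N) = c • φ.hom.f i ≫ f := by simp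
  -- In degree `0` the coboundary condition uses a zero differential, so the cocycle itself
  -- vanishes. In degree `p + 1` the index after it in the descending complex is `p`.
  obtain _ | p := i
  · have h3 : c • φ.hom.f 0 ≫ f = 0 := by
      rw [← hg, P'.complex.shape _ _ (by simp), zero_comp]
    simp only [h2, h3, ProjectiveResolution.extMk_zero]
  · rw [ProjectiveResolution.extMk_eq_zero_iff _ _ _ _ _ p rfl, h2]
    have h4 := ChainComplex.next_nat_succ p
    revert g hg
    rw [h4]
    intro g hg
    exact ⟨g, hg⟩

end LocalCohomology

/-! ### Multipliers in exact sequences, and vanishing for power torsion modules. -/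

namespace LocalCohomology

open Limits ModuleCat Abelian

variable {R : Type u} [CommRing R] {J : Ideal R}

theorem transition_comp_transition_comp {n n' n'' i : ℕ} (h : n ≤ n') (h' : n' ≤ n'')
    {N : ModuleCat.{u} R} (ξ : Ext (ModuleCat.of R (R ⧸ J ^ n)) N i) :
    (Ext.mk₀ (transition J h')).comp ((Ext.mk₀ (transition J h)).comp ξ (zero_add i))
      (zero_add i) = (Ext.mk₀ (transition J (h.trans h'))).comp ξ (zero_add i) := by
  rw [Ext.mk₀_comp_mk₀_assoc, transition_comp]

theorem smul_transition_comp_eq_zero {n n' n'' i : ℕ} {c : R} (h : n ≤ n') (h' : n' ≤ n'')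
    {N : ModuleCat.{u} R} (ξ : Ext (ModuleCat.of R (R ⧸ J ^ n)) N i)
    (h0 : c • (Ext.mk₀ (transition J h)).comp ξ (zero_add i) = 0) :
    c • (Ext.mk₀ (transition J (h.trans h'))).comp ξ (zero_add i) = 0 := by
  rw [← transition_comp_transition_comp h h', ← Ext.comp_smul, h0, Ext.comp_zero]

theorem Kills.mul_left {i : ℕ} {c : R} {N : ModuleCat.{u} R} (h : Kills J i c N) (a : R) :
    Kills J i (a * c) N := fun n ξ => by
  obtain ⟨n', hn, h0⟩ := h n ξ
  exact ⟨n', hn, by rw [mul_smul, h0, smul_zero]⟩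

theorem Kills.add {i : ℕ} {c d : R} {N : ModuleCat.{u} R} (h : Kills J i c N)
    (h' : Kills J i d N) : Kills J i (c + d) N := fun n ξ => by
  obtain ⟨n₁, h₁, e₁⟩ := h n ξ
  obtain ⟨n₂, h₂, e₂⟩ := h' n ξ
  refine ⟨max n₁ n₂, h₁.trans (le_max_left _ _), ?_⟩
  rw [add_smul, smul_transition_comp_eq_zero h₁ (le_max_left _ _) ξ e₁,
    smul_transition_comp_eq_zero h₂ (le_max_right _ _) ξ e₂, add_zero]

theorem Kills.zero (i : ℕ) (N : ModuleCat.{u} R) : Kills J i 0 N := fun n _ =>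
  ⟨n, le_rfl, zero_smul _ _⟩

/-- After a transition, `b • ξ` becomes zero in the Ext group of `X₃`, so it comes from the Ext
group of `X₁`; a second transition followed by `a` kills this preimage. -/
theorem Kills.middle {S : ShortComplex (ModuleCat.{u} R)} (hS : S.ShortExact) {i : ℕ} {a b : R}
    (ha : Kills J i a S.X₁) (hb : Kills J i b S.X₃) : Kills J i (a * b) S.X₂ := by
  intro n ξ
  obtain ⟨n', h, h0⟩ := hb n (ξ.comp (Ext.mk₀ S.g) (add_zero i))
  obtain ⟨η, hη⟩ := Ext.covariant_sequence_exact₂ _ hS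
    (b • (Ext.mk₀ (transition J h)).comp ξ (zero_add i)) (by
      rw [Ext.smul_comp, ← h0, Ext.comp_assoc_of_third_deg_zero])
  obtain ⟨n'', h', h1⟩ := ha n' η
  refine ⟨n'', h.trans h', ?_⟩
  rw [mul_smul, ← transition_comp_transition_comp h h', ← Ext.comp_smul _ _ _ b, ← hη,
    ← Ext.comp_assoc_of_third_deg_zero, ← Ext.smul_comp, h1, Ext.zero_comp]

/-- The same two transitions, with the connecting map in place of the map to `X₃`; this is why the
multiplier for `X₁` is one degree higher. -/
theorem Kills.right {S : ShortComplex (ModuleCat.{u} R)} (hS : S.ShortExact) {i : ℕ} {a b : R}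
    (ha : Kills J i a S.X₂) (hb : Kills J (i + 1) b S.X₁) : Kills J i (a * b) S.X₃ := by
  intro n ξ
  obtain ⟨n', h, h0⟩ := hb n (ξ.comp hS.extClass rfl)
  obtain ⟨η, hη⟩ := Ext.covariant_sequence_exact₃ _ hS
    (b • (Ext.mk₀ (transition J h)).comp ξ (zero_add i)) rfl (by
      rw [Ext.smul_comp, ← h0, Ext.comp_assoc (α := Ext.mk₀ (transition J h)) (β := ξ)
        (h₁₂ := zero_add i) (h₂₃ := rfl) (h := by lia)])
  obtain ⟨n'', h', h1⟩ := ha n' η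
  refine ⟨n'', h.trans h', ?_⟩
  rw [mul_smul, ← transition_comp_transition_comp h h', ← Ext.comp_smul _ _ _ b, ← hη,
    ← Ext.comp_assoc_of_third_deg_zero, ← Ext.smul_comp, h1, Ext.zero_comp]

theorem Kills.of_sum {i : ℕ} {c : R} {N : ModuleCat.{u} R} {ι : Type*} [Fintype ι]
    {Y : ι → ModuleCat.{u} R} (f : ∀ k, N ⟶ Y k) (g : ∀ k, Y k ⟶ N)
    (hfg : ∑ k, f k ≫ g k = 𝟙 N) (h : ∀ k, Kills J i c (Y k)) : Kills J i c N := by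
  intro n ξ
  choose n' hn h0 using fun k => h k n (ξ.comp (Ext.mk₀ (f k)) (add_zero i))
  have hle (k : ι) : n' k ≤ max n (Finset.univ.sup n') :=
    (Finset.le_sup (Finset.mem_univ k)).trans (le_max_right _ _)
  refine ⟨max n (Finset.univ.sup n'), le_max_left _ _, ?_⟩
  have h1 : ξ = ∑ k, (ξ.comp (Ext.mk₀ (f k)) (add_zero i)).comp (Ext.mk₀ (g k)) (add_zero i) := by
    conv_lhs => rw [← Ext.comp_mk₀_id ξ, ← hfg, Ext.mk₀_sum, Ext.comp_sum]
    refine Finset.sum_congr rfl fun k _ => ?_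
    rw [Ext.comp_assoc_of_third_deg_zero, Ext.mk₀_comp_mk₀]
  rw [h1, Ext.comp_sum, Finset.smul_sum]
  refine Finset.sum_eq_zero fun k _ => ?_
  rw [← Ext.comp_assoc_of_third_deg_zero, ← Ext.smul_comp,
    smul_transition_comp_eq_zero (hn k) (hle k) _ (h0 k), Ext.zero_comp]

/-- The module `N` is `J`-power torsion. -/
def IsPowTorsion (J : Ideal R) (N : Type*) [AddCommGroup N] [Module R N] : Prop :=
  ∀ t : N, ∃ n : ℕ, ∀ r ∈ J ^ n, r • t = 0

theorem exists_eq_zero_of_fg {N : Type*} [AddCommGroup N] [Module R N]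
    (hN : IsPowTorsion J N) {P : Submodule R N} (hP : P.FG) :
    ∃ n : ℕ, ∀ r ∈ J ^ n, ∀ t ∈ P, r • t = 0 := by
  refine Submodule.fg_induction (motive := fun P _ => ∃ n : ℕ, ∀ r ∈ J ^ n, ∀ t ∈ P, r • t = 0)
    ?_ ?_ P hP
  · intro x
    obtain ⟨n, hn⟩ := hN x
    refine ⟨n, fun r hr t ht => ?_⟩
    obtain ⟨a, rfl⟩ := Submodule.mem_span_singleton.1 ht
    rw [smul_comm, hn r hr, smul_zero]
  · rintro P Q _ _ ⟨n, hn⟩ ⟨m, hm⟩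
    refine ⟨max n m, fun r hr t ht => ?_⟩
    obtain ⟨p, hp, q, hq, rfl⟩ := Submodule.mem_sup.1 ht
    rw [smul_add, hn r (Ideal.pow_le_pow_right (le_max_left _ _) hr) p hp,
      hm r (Ideal.pow_le_pow_right (le_max_right _ _) hr) q hq, add_zero]

section

variable {T : ModuleCat.{u} R} {j : ℕ}

theorem mk₀_comp_eq_zero_of_range_le {A A' : Type u} [AddCommGroup A] [Module R A]
    [AddCommGroup A'] [Module R A'] {P : Submodule R A} (f : A' →ₗ[R] A)
    (hf : LinearMap.range f ≤ P) (η : Ext (ModuleCat.of R A) T j)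
    (h : (Ext.mk₀ (ModuleCat.ofHom P.subtype)).comp η (zero_add j) = 0) :
    (Ext.mk₀ (ModuleCat.ofHom f)).comp η (zero_add j) = 0 := by
  have h1 : ModuleCat.ofHom f = ModuleCat.ofHom (f.codRestrict P fun x => hf ⟨x, rfl⟩) ≫
      ModuleCat.ofHom P.subtype := rfl
  rw [h1, ← Ext.mk₀_comp_mk₀_assoc, h, Ext.comp_zero]

/-- Compatible surjections induce the zero map on the connecting class of `η` if the induced map
between the kernels does. -/
theorem mk₀_comp_extClass_comp_eq_zero {F F' A A' : Type u} [AddCommGroup F] [Module R F]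
    [AddCommGroup F'] [Module R F'] [AddCommGroup A] [Module R A] [AddCommGroup A'] [Module R A']
    {p : F →ₗ[R] A} {p' : F' →ₗ[R] A'} (hp : Function.Surjective p)
    (hp' : Function.Surjective p') (u : F' →ₗ[R] F) (v : A' →ₗ[R] A) (huv : p ∘ₗ u = v ∘ₗ p')
    (η : Ext (ModuleCat.of R (LinearMap.ker p)) T j) {P : Submodule R (LinearMap.ker p)}
    (hu : ∀ x ∈ LinearMap.ker p', ∃ y ∈ P, y.1 = u x)
    (h : (Ext.mk₀ (ModuleCat.ofHom P.subtype)).comp η (zero_add j) = 0) {k : ℕ} (hk : 1 + j = k) :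
    (Ext.mk₀ (ModuleCat.ofHom v)).comp
      ((LinearMap.shortExact_shortComplexKer hp).extClass.comp η hk) (zero_add k) = 0 := by
  have hu' (x) (hx : x ∈ LinearMap.ker p') : u x ∈ LinearMap.ker p := by
    obtain ⟨y, -, hy⟩ := hu x hx
    exact hy ▸ y.2
  let φ : p'.shortComplexKer ⟶ p.shortComplexKer :=
    { τ₁ := ModuleCat.ofHom (u.restrict hu')
      τ₂ := ModuleCat.ofHom u
      τ₃ := ModuleCat.ofHom v
      comm₁₂ := rfl
      comm₂₃ := congrArg ModuleCat.ofHom huv }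
  have h1 := ShortComplex.ShortExact.extClass_naturality
    (LinearMap.shortExact_shortComplexKer hp') (LinearMap.shortExact_shortComplexKer hp) φ
  have h2 : (Ext.mk₀ φ.τ₁).comp η (zero_add j) = 0 := by
    refine mk₀_comp_eq_zero_of_range_le _ ?_ η h
    rintro _ ⟨x, rfl⟩
    obtain ⟨y, hy, hyx⟩ := hu x.1 x.2
    convert hy
    exact Subtype.ext hyx.symm
  have h3 := Ext.comp_assoc (Ext.mk₀ φ.τ₃) (LinearMap.shortExact_shortComplexKer hp).extClass η
    (zero_add 1) hk (by lia : 0 + 1 + j = k)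
  refine h3.symm.trans ?_
  rw [← h1, Ext.comp_assoc_of_second_deg_zero, h2, Ext.comp_zero]

variable [IsNoetherianRing R]

/-- In degree `0` the image of the finite module `A` is finite and torsion, hence killed by a power
of `J`. In higher degrees one shifts along a finite free cover `F` of `A` with kernel `K`, and the
Artin-Rees lemma puts `K ∩ J ^ (m + l) F` into `J ^ m K`, on which the shifted class vanishes for
suitable `m`. -/
theorem exists_mk₀_comp_eq_zero (hT : IsPowTorsion J T) (A : Type u) [AddCommGroup A] [Module R A]
    [Module.Finite R A] (ξ : Ext (ModuleCat.of R A) T j) :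
    ∃ n : ℕ, (Ext.mk₀ (ModuleCat.ofHom (J ^ n • ⊤ : Submodule R A).subtype)).comp ξ
      (zero_add j) = 0 := by
  induction j generalizing A with
  | zero =>
    obtain ⟨φ, rfl⟩ := (Ext.mk₀_bijective _ _).2 ξ
    obtain ⟨n, hn⟩ := exists_eq_zero_of_fg hT (Submodule.FG.map φ.hom Module.Finite.fg_top)
    refine ⟨n, ?_⟩
    rw [Ext.mk₀_comp_mk₀, Ext.mk₀_eq_zero_iff]
    ext x
    have hx := x.2
    change φ.hom x.1 = 0
    refine Submodule.smul_induction_on hx (fun r hr a _ => ?_) fun a b ha hb => ?_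
    · rw [map_smul, hn r hr _ ⟨a, trivial, rfl⟩]
    · rw [map_add, ha, hb, add_zero]
  | succ j ih =>
    obtain ⟨k, p, hp⟩ := Module.Finite.exists_fin' R A
    have : Projective (p.shortComplexKer).X₂ := ModuleCat.projective_of_free (Pi.basisFun R (Fin k))
    obtain ⟨η, rfl⟩ := Ext.contravariant_sequence_exact₃ (LinearMap.shortExact_shortComplexKer hp)
      T ξ (Ext.eq_zero_of_projective _) (add_comm 1 j)
    obtain ⟨m, hm⟩ := ih (LinearMap.ker p) η
    obtain ⟨l, hl⟩ := Ideal.exists_pow_inf_eq_pow_smul J (LinearMap.ker p)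
    refine ⟨m + l, ?_⟩
    have hmap : ∀ x ∈ (J ^ (m + l) • ⊤ : Submodule R (Fin k → R)),
        p x ∈ (J ^ (m + l) • ⊤ : Submodule R A) := by
      intro x hx
      have := Submodule.mem_map_of_mem (f := p) hx
      rw [Submodule.map_smul''] at this
      exact Submodule.smul_mono le_rfl le_top this
    refine mk₀_comp_extClass_comp_eq_zero (p' := p.restrict hmap) hp ?_
      (Submodule.subtype _) (Submodule.subtype _) rfl η ?_ hm (add_comm 1 j)
    · rintro ⟨y, hy⟩
      rw [← LinearMap.range_eq_top.2 hp, LinearMap.range_eq_map, ← Submodule.map_smul''] at hy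
      obtain ⟨x, hx, rfl⟩ := hy
      exact ⟨⟨x, hx⟩, rfl⟩
    · rintro ⟨x, hx⟩ hx'
      have h0 : p x = 0 := congrArg Subtype.val hx'
      have h1 : x ∈ J ^ (m + l) • ⊤ ⊓ LinearMap.ker p := ⟨hx, h0⟩
      rw [hl _ (by lia), Nat.add_sub_cancel] at h1
      have h2 : x ∈ J ^ m • LinearMap.ker p := Submodule.smul_mono le_rfl inf_le_right h1
      have h3 := Submodule.map_smul'' (J ^ m) ⊤ (LinearMap.ker p).subtype
      rw [Submodule.map_top, Submodule.range_subtype] at h3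
      rw [← h3] at h2
      obtain ⟨y, hy, hyx⟩ := h2
      exact ⟨y, hy, hyx⟩

/-- Local cohomology of a power torsion module vanishes in positive degrees. A class on `R ⧸ J ^ n`
comes by the connecting map from a class on the kernel `J ^ n`, which dies on `J ^ m · J ^ n = J ^
(m + n)` for some `m`. -/
theorem kills_one_of_isPowTorsion (hT : IsPowTorsion J T) : Kills J (j + 1) 1 T := by
  intro n ξ
  have hp : Function.Surjective (Submodule.mkQ (J ^ n)) := Submodule.mkQ_surjective _
  have : Projective ((Submodule.mkQ (J ^ n)).shortComplexKer).X₂ :=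
    ModuleCat.projective_of_free (Module.Basis.singleton Unit R)
  obtain ⟨η, rfl⟩ := Ext.contravariant_sequence_exact₃ (LinearMap.shortExact_shortComplexKer hp)
    T ξ (Ext.eq_zero_of_projective _) (add_comm 1 j)
  obtain ⟨m, hm⟩ := exists_mk₀_comp_eq_zero hT _ η
  refine ⟨m + n, by lia, ?_⟩
  rw [one_smul]
  refine mk₀_comp_extClass_comp_eq_zero (p' := Submodule.mkQ (J ^ (m + n))) hp
    (Submodule.mkQ_surjective _) LinearMap.id _ rfl η ?_ hm (add_comm 1 j)
  intro x hx
  have h1 : LinearMap.ker (Submodule.mkQ (J ^ (m + n))) =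
      J ^ m • LinearMap.ker (Submodule.mkQ (J ^ n)) := by
    rw [Submodule.ker_mkQ, Submodule.ker_mkQ, pow_add, smul_eq_mul]
  have h3 := Submodule.map_smul'' (J ^ m) ⊤ (LinearMap.ker (Submodule.mkQ (J ^ n))).subtype
  rw [Submodule.map_top, Submodule.range_subtype, ← h1] at h3
  rw [← h3] at hx
  obtain ⟨y, hy, hyx⟩ := hx
  exact ⟨y, hy, hyx⟩

end

/-- A multiplier of the zeroth local cohomology kills the power torsion elements. -/
theorem Kills.smul_eq_zero {c : R} {N : ModuleCat.{u} R} (h : Kills J 0 c N) {n : ℕ} {t : N}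
    (ht : ∀ r ∈ J ^ n, r • t = 0) : c • t = 0 := by
  let φ : ModuleCat.of R (R ⧸ J ^ n) ⟶ N :=
    ModuleCat.ofHom (Submodule.liftQ _ (LinearMap.toSpanSingleton R N t) fun r hr => ht r hr)
  obtain ⟨n', hn, h0⟩ := h n (Ext.mk₀ φ)
  rw [Ext.mk₀_comp_mk₀, ← Ext.mk₀_smul, Ext.mk₀_eq_zero_iff] at h0
  have := congr($(h0).hom (Submodule.Quotient.mk 1))
  have h1 : φ.hom (Submodule.Quotient.mk 1) = t := one_smul R t
  rw [← h1]
  exact this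

theorem Kills.of_injective {c : R} {N N' : ModuleCat.{u} R} (h : Kills J 0 c N) (f : N' ⟶ N)
    [Mono f] : Kills J 0 c N' := by
  intro n ξ
  obtain ⟨φ, rfl⟩ := (Ext.mk₀_bijective _ _).2 ξ
  obtain ⟨n', hn, h0⟩ := h n (Ext.mk₀ (φ ≫ f))
  refine ⟨n', hn, ?_⟩
  rw [Ext.mk₀_comp_mk₀, ← Ext.mk₀_smul, Ext.mk₀_eq_zero_iff] at h0 ⊢
  rw [← cancel_mono f, zero_comp, ← h0]
  simp

end LocalCohomology

/-! ### Ideals of multipliers, and complexes with torsion cohomology. -/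

namespace LocalCohomology

open Limits ModuleCat Abelian

variable {R : Type u} [CommRing R] (J : Ideal R)

/-- The ideal of multipliers that kill the `i`-th local cohomology. -/
def killIdeal (i : ℕ) (N : Type u) [AddCommGroup N] [Module R N] : Ideal R where
  carrier := {c | Kills J i c (ModuleCat.of R N)}
  zero_mem' := Kills.zero i _
  add_mem' := Kills.add
  smul_mem' a _ h := h.mul_left a

section

variable {X Y Z : Type u} [AddCommGroup X] [Module R X] [AddCommGroup Y] [Module R Y]
  [AddCommGroup Z] [Module R Z]

theorem shortExact_of_exact {f : X →ₗ[R] Y} {g : Y →ₗ[R] Z} (hf : Function.Injective f)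
    (hfg : Function.Exact f g) (hg : Function.Surjective g) :
    (ShortComplex.mk (ModuleCat.ofHom f) (ModuleCat.ofHom g)
      (ModuleCat.hom_ext hfg.linearMap_comp_eq_zero)).ShortExact where
  exact := (ShortComplex.ShortExact.moduleCat_exact_iff_function_exact _).2 hfg
  mono_f := (ModuleCat.mono_iff_injective _).2 hf
  epi_g := (ModuleCat.epi_iff_surjective _).2 hg

theorem killIdeal_mul_le_middle {f : X →ₗ[R] Y} {g : Y →ₗ[R] Z} (hf : Function.Injective f)
    (hfg : Function.Exact f g) (hg : Function.Surjective g) (i : ℕ) :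
    killIdeal J i X * killIdeal J i Z ≤ killIdeal J i Y :=
  Ideal.mul_le.2 fun _ ha _ hb => Kills.middle (shortExact_of_exact hf hfg hg) ha hb

theorem killIdeal_mul_le_right {f : X →ₗ[R] Y} {g : Y →ₗ[R] Z} (hf : Function.Injective f)
    (hfg : Function.Exact f g) (hg : Function.Surjective g) (i : ℕ) :
    killIdeal J i Y * killIdeal J (i + 1) X ≤ killIdeal J i Z :=
  Ideal.mul_le.2 fun _ ha _ hb => Kills.right (shortExact_of_exact hf hfg hg) ha hb

theorem killIdeal_le_of_sum {ι : Type*} [Fintype ι] (f : ι → X →ₗ[R] Y) (g : ι → Y →ₗ[R] X)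
    (h : ∀ x, ∑ k, g k (f k x) = x) (i : ℕ) : killIdeal J i Y ≤ killIdeal J i X := by
  intro c hc
  refine Kills.of_sum (fun k => ModuleCat.ofHom (f k)) (fun k => ModuleCat.ofHom (g k)) ?_
    fun _ => hc
  ext x
  refine (congrFun (congrArg DFunLike.coe (ModuleCat.hom_sum _ _)) x).trans ?_
  rw [LinearMap.sum_apply]
  exact h x

theorem le_killIdeal_prod {K : Ideal R} {i : ℕ} (hX : K ≤ killIdeal J i X)
    (hY : K ≤ killIdeal J i Y) : K ≤ killIdeal J i (X × Y) := by
  intro c hc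
  let W : Bool → ModuleCat.{u} R := fun b => bif b then ModuleCat.of R X else ModuleCat.of R Y
  refine Kills.of_sum (ι := Bool) (Y := W)
    (fun b => match b with
      | true => ModuleCat.ofHom (LinearMap.fst R X Y)
      | false => ModuleCat.ofHom (LinearMap.snd R X Y))
    (fun b => match b with
      | true => ModuleCat.ofHom (LinearMap.inl R X Y)
      | false => ModuleCat.ofHom (LinearMap.inr R X Y)) ?_ ?_
  · rw [Fintype.sum_bool]
    refine ModuleCat.hom_ext (LinearMap.ext fun x => ?_)
    change (x.1, (0 : Y)) + ((0 : X), x.2) = x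
    simp
  · rintro (_ | _)
    · exact hY hc
    · exact hX hc

theorem killIdeal_of_equiv (e : X ≃ₗ[R] Y) (i : ℕ) : killIdeal J i Y ≤ killIdeal J i X :=
  killIdeal_le_of_sum (ι := Unit) J (fun _ => e.toLinearMap) (fun _ => e.symm.toLinearMap)
    (by simp) i

theorem killIdeal_of_subsingleton [Subsingleton X] (i : ℕ) : killIdeal J i X = ⊤ := by
  refine (Ideal.eq_top_iff_one _).2 fun n ξ => ⟨n, le_rfl, ?_⟩
  have : IsZero (ModuleCat.of R X) := ModuleCat.isZero_of_subsingleton _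
  rw [← Ext.comp_mk₀_id ξ, this.eq_of_src (𝟙 _) 0, Ext.mk₀_zero, Ext.comp_zero, Ext.comp_zero,
    smul_zero]

theorem killIdeal_zero_le_of_injective {f : X →ₗ[R] Y} (hf : Function.Injective f) :
    killIdeal J 0 Y ≤ killIdeal J 0 X := by
  intro c hc
  have : Mono (ModuleCat.ofHom f) := (ModuleCat.mono_iff_injective _).2 hf
  exact Kills.of_injective hc (ModuleCat.ofHom f)

theorem killIdeal_succ_eq_top [IsNoetherianRing R] (hX : IsPowTorsion J X) (i : ℕ) :
    killIdeal J (i + 1) X = ⊤ :=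
  (Ideal.eq_top_iff_one _).2 (kills_one_of_isPowTorsion (T := ModuleCat.of R X) hX)

end

/-- In a complex with power torsion cohomology, the product of multipliers that kill the local
cohomology of the terms kills the cohomology. -/
theorem smul_mem_of_isPowTorsion [IsNoetherianRing R] {V : Type u} [AddCommGroup V] [Module R V]
    (d : V →ₗ[R] V) (gr : ℤ → Submodule R V) (hd : ∀ v, d (d v) = 0)
    (hgr : ∀ q, ∀ v ∈ gr q, d v ∈ gr (q + 1)) (hneg : gr (-1) = ⊥)
    (htors : ∀ q, ∀ v ∈ gr q, d v = 0 → ∃ n : ℕ, ∀ r ∈ J ^ n, ∃ w ∈ gr (q - 1), d w = r • v)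
    (a : ℕ → Ideal R) (ha : ∀ i q, a i ≤ killIdeal J i (gr q)) (j : ℕ) {c : R}
    (hc : c ∈ ∏ i ∈ Finset.range (j + 1), a i) {v : V} (hv : v ∈ gr j) (hdv : d v = 0) :
    ∃ w ∈ gr (j - 1), d w = c • v := by
  -- cycles and boundaries
  let Z (q : ℤ) : Submodule R V := gr q ⊓ LinearMap.ker d
  let B (q : ℤ) : Submodule R V := (gr (q - 1)).map d
  have hBZ (q) : B q ≤ Z q := by
    rintro _ ⟨w, hw, rfl⟩
    exact ⟨by simpa using hgr _ w hw, hd w⟩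
  let H (q : ℤ) : Type u := Z q ⧸ LinearMap.range (Submodule.inclusion (hBZ q))
  have hH (q) : IsPowTorsion J (H q) := by
    intro t
    obtain ⟨⟨z, hz⟩, rfl⟩ := Submodule.mkQ_surjective _ t
    obtain ⟨n, hn⟩ := htors q z hz.1 hz.2
    refine ⟨n, fun r hr => ?_⟩
    obtain ⟨w, hw, h⟩ := hn r hr
    rw [← map_smul, Submodule.mkQ_apply, Submodule.Quotient.mk_eq_zero]
    exact ⟨⟨d w, w, hw, rfl⟩, Subtype.ext h⟩
  have hinj (q) : Function.Injective (Submodule.inclusion (hBZ q)) :=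
    Submodule.inclusion_injective _
  have hex (q) : Function.Exact (Submodule.inclusion (hBZ q))
      (Submodule.mkQ (LinearMap.range (Submodule.inclusion (hBZ q)))) :=
    LinearMap.exact_iff.2 (Submodule.ker_mkQ _)
  -- In positive degrees the torsion quotient of cycles by boundaries needs no multiplier.
  have hZ (q : ℤ) (i : ℕ) : killIdeal J (i + 1) (B q) ≤ killIdeal J (i + 1) (Z q) := by
    have := killIdeal_mul_le_middle J (hinj q) (hex q) (Submodule.mkQ_surjective _) (i + 1)
    have h := killIdeal_succ_eq_top J (hH q) i
    rw [h, Ideal.mul_top] at this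
    exact this
  -- The differential presents the boundaries of degree `q + 1` as the quotient of `gr q` by its
  -- cycles.
  have hB (q : ℤ) (i : ℕ) :
      killIdeal J i (gr q) * killIdeal J (i + 1) (Z q) ≤ killIdeal J i (B (q + 1)) := by
    let e : gr q →ₗ[R] B (q + 1) := d.restrict fun v hv => ⟨v, by simpa using hv, rfl⟩
    refine killIdeal_mul_le_right J (f := Submodule.inclusion (inf_le_left : Z q ≤ gr q)) (g := e)
      (Submodule.inclusion_injective _) ?_ ?_ i
    · rintro ⟨x, hx⟩
      refine ⟨fun h => ⟨⟨x, hx, congrArg Subtype.val h⟩, rfl⟩, ?_⟩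
      rintro ⟨y, hy⟩
      refine Subtype.ext ?_
      have : y.1 = x := congrArg Subtype.val hy
      exact this ▸ y.2.2
    · rintro ⟨_, w, hw, rfl⟩
      exact ⟨⟨w, by simpa using hw⟩, rfl⟩
  -- Each step down the complex raises the degree of local cohomology by one and costs one factor;
  -- the recursion stops at degree `0`, where there are no boundaries.
  have key (q i : ℕ) : ∏ t ∈ Finset.range q, a (i + t) ≤ killIdeal J i (B q) := by
    induction q generalizing i with
    | zero =>
      have : Subsingleton (B (0 : ℕ)) := by
        refine (Submodule.subsingleton_iff_eq_bot).2 ?_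
        change (gr ((0 : ℕ) - 1)).map d = ⊥
        simp [hneg]
      rw [killIdeal_of_subsingleton]
      exact le_top
    | succ q ih =>
      rw [Finset.prod_range_succ', mul_comm]
      refine (Ideal.mul_mono (ha _ q) ?_).trans (hB q i)
      refine le_trans ?_ (hZ q i)
      refine le_trans (le_of_eq ?_) (ih (i + 1))
      exact Finset.prod_congr rfl fun t _ => congrArg a (by ring)
  have h0 : c ∈ killIdeal J 0 (H j) := by
    refine killIdeal_mul_le_right J (hinj j) (hex j) (Submodule.mkQ_surjective _) 0
      (Ideal.mul_mono ((ha 0 j).trans (killIdeal_zero_le_of_injective J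
        (Submodule.inclusion_injective (inf_le_left : Z j ≤ gr j)))) (key j 1) ?_)
    rw [Finset.prod_range_succ', mul_comm] at hc
    have : ∏ k ∈ Finset.range j, a (k + 1) = ∏ t ∈ Finset.range j, a (0 + 1 + t) :=
      Finset.prod_congr rfl fun t _ => congrArg a (by ring)
    rwa [this] at hc
  -- The cohomology is power torsion, so it coincides with its zeroth local cohomology; a multiplier
  -- that kills the latter kills the class itself.
  obtain ⟨n, hn⟩ := hH j (Submodule.Quotient.mk ⟨v, hv, hdv⟩)
  have h1 := Kills.smul_eq_zero (N := ModuleCat.of R (H j)) h0 hn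
  obtain ⟨⟨_, w, hw, rfl⟩, h⟩ := (Submodule.Quotient.mk_eq_zero _).1 h1
  exact ⟨w, hw, congrArg Subtype.val h⟩

end LocalCohomology

/-! ### Koszul complexes as iterated cones, and annihilation of colon modules. -/

namespace LocalCohomology

set_option linter.unusedSectionVars false

variable {R B : Type u} [CommRing R] [CommRing B] [Algebra R B] (J : Ideal R)

/-- The properties of the Koszul cochain complex of a sequence on a module `N` that are used in
bounding annihilators. -/
structure IsKoszul (N : Type u) [AddCommGroup N] [Module R N] [Module B N] (zs : List B)
    {V : Type u} [AddCommGroup V] [Module R V] [Module B V] [IsScalarTower R B V]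
    (d : V →ₗ[B] V) (gr : ℤ → Submodule B V) (τ : N →ₗ[B] V) : Prop where
  d_d (v : V) : d (d v) = 0
  d_mem (q : ℤ) : ∀ v ∈ gr q, d v ∈ gr (q + 1)
  neg (q : ℤ) (hq : q < 0) : gr q = ⊥
  pos (q : ℤ) (hq : zs.length < q) : gr q = ⊥
  kill (i : ℕ) (q : ℤ) : killIdeal J i N ≤ killIdeal J i (gr q)
  homotopy : ∀ z ∈ zs, ∃ h : V →ₗ[B] V, (∀ q, ∀ v ∈ gr q, h v ∈ gr (q - 1)) ∧
    ∀ v, d (h v) + h (d v) = z • v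
  annihilator (b : B) (hb : ∀ n : N, b • n = 0) (v : V) : b • v = 0
  injective : Function.Injective τ
  top : gr zs.length = LinearMap.range τ
  boundary : (gr (zs.length - 1)).map d = (Ideal.span {z | z ∈ zs} • ⊤ : Submodule B N).map τ

section

variable {N : Type u} [AddCommGroup N] [Module R N] [Module B N] [IsScalarTower R B N]

variable (R B N) in
theorem isKoszul_nil : IsKoszul J N ([] : List B) (0 : N →ₗ[B] N)
    (fun q => if q = 0 then ⊤ else ⊥) LinearMap.id where
  d_d _ := rfl
  d_mem _ _ _ := zero_mem _
  neg q hq := if_neg hq.ne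
  pos q hq := if_neg (by simpa using hq.ne')
  kill i q := by
    by_cases hq : q = 0
    · rw [if_pos hq]
      exact killIdeal_of_equiv J ((Submodule.topEquiv (R := B) (M := N)).restrictScalars R) i
    · rw [if_neg hq]
      exact le_top.trans_eq (killIdeal_of_subsingleton (X := (⊥ : Submodule B N)) J i).symm
  homotopy _ h := by simp at h
  annihilator _ hb v := hb v
  injective := Function.injective_id
  top := by simp
  boundary := by simp

variable {V : Type u} [AddCommGroup V] [Module R V] [Module B V] [IsScalarTower R B V]
  {d : V →ₗ[B] V} {gr : ℤ → Submodule B V} {zs : List B} {τ : N →ₗ[B] V}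

/-- The differential of the cone of multiplication by `z`. -/
def coneD (d : V →ₗ[B] V) (z : B) : V × V →ₗ[B] V × V :=
  (d ∘ₗ LinearMap.fst B V V).prod (z • LinearMap.fst B V V - d ∘ₗ LinearMap.snd B V V)

theorem coneD_apply (d : V →ₗ[B] V) (z : B) (v : V × V) :
    coneD d z v = (d v.1, z • v.1 - d v.2) := rfl

/-- The grading of the cone of multiplication by `z`. -/
def coneGr (gr : ℤ → Submodule B V) (q : ℤ) : Submodule B (V × V) := (gr q).prod (gr (q - 1))

variable {J}

theorem IsKoszul.mem_gr (h : IsKoszul J N zs d gr τ) (n : N) : τ n ∈ gr zs.length :=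
  h.top ▸ LinearMap.mem_range_self τ n

theorem IsKoszul.d_top (h : IsKoszul J N zs d gr τ) (n : N) : d (τ n) = 0 := by
  have h1 := h.d_mem _ (τ n) (h.mem_gr n)
  rwa [h.pos _ (by lia), Submodule.mem_bot] at h1

/-- The cone has the old complex twice, the second copy shifted by one degree. For the new element
`z` the homotopy moves the second component to the first. An old homotopy `s` acts as `s` and `-s`,
because the cone differential carries the opposite sign on the second component. -/
theorem IsKoszul.cons (h : IsKoszul J N zs d gr τ) (z : B) :
    IsKoszul J N (z :: zs) (coneD d z) (coneGr gr) (LinearMap.inr B V V ∘ₗ τ) where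
  d_d v := by simp [coneD_apply, h.d_d]
  d_mem q v hv := by
    refine ⟨h.d_mem q _ hv.1, ?_⟩
    rw [add_sub_cancel_right]
    refine sub_mem (Submodule.smul_mem _ _ hv.1) ?_
    simpa using h.d_mem _ _ hv.2
  neg q hq := by
    rw [coneGr, h.neg q hq, h.neg (q - 1) (by lia), Submodule.prod_bot]
  pos q hq := by
    rw [List.length_cons] at hq
    rw [coneGr, h.pos q (by push_cast at hq; lia), h.pos (q - 1) (by push_cast at hq; lia),
      Submodule.prod_bot]
  kill i q := by
    refine (le_killIdeal_prod J (h.kill i q) (h.kill i (q - 1))).trans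
      (killIdeal_of_equiv J
        { toFun := fun v => (⟨v.1.1, v.2.1⟩, ⟨v.1.2, v.2.2⟩)
          invFun := fun v => ⟨(v.1.1, v.2.1), v.1.2, v.2.2⟩
          map_add' := fun _ _ => rfl
          map_smul' := fun _ _ => rfl } i)
  homotopy y hy := by
    rcases List.mem_cons.1 hy with rfl | hy
    · refine ⟨LinearMap.inl B V V ∘ₗ LinearMap.snd B V V, fun q v hv => ⟨hv.2, zero_mem _⟩,
        fun v => ?_⟩
      ext <;> simp [coneD_apply]
    · obtain ⟨s, hs, hs'⟩ := h.homotopy y hy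
      refine ⟨s.prodMap (-s), fun q v hv => ⟨hs q _ hv.1, neg_mem (hs _ _ hv.2)⟩, fun v => ?_⟩
      ext
      · simp [coneD_apply, hs']
      · simp [coneD_apply, ← hs']
        abel
  annihilator b hb v := Prod.ext (h.annihilator b hb v.1) (h.annihilator b hb v.2)
  injective := LinearMap.inr_injective.comp h.injective
  top := by
    rw [coneGr, List.length_cons]
    push_cast
    rw [add_sub_cancel_right, h.top, h.pos _ (by lia), LinearMap.range_comp]
    ext v
    simp [Submodule.mem_prod]
  boundary := by
    have hspan : Ideal.span {y | y ∈ z :: zs} = Ideal.span {z} ⊔ Ideal.span {y | y ∈ zs} := by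
      rw [← Ideal.span_union]
      congr 1
      ext
      simp
    rw [coneGr, List.length_cons, hspan, Submodule.sup_smul, Submodule.map_comp, Submodule.map_sup,
      ← h.boundary]
    push_cast
    rw [add_sub_cancel_right, h.top]
    ext ⟨v, w⟩
    constructor
    · rintro ⟨⟨_, b⟩, ⟨⟨n, rfl⟩, hb⟩, hv⟩
      rw [coneD_apply, Prod.mk.injEq] at hv
      simp only [h.d_top] at hv
      refine ⟨w, ?_, Prod.ext hv.1 rfl⟩
      rw [← hv.2]
      refine sub_mem (Submodule.mem_sup_left ⟨z • n, ?_, map_smul _ _ _⟩)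
        (Submodule.mem_sup_right ⟨b, hb, rfl⟩)
      exact Submodule.smul_mem_smul (Ideal.mem_span_singleton_self z) trivial
    · rintro ⟨w', hw, hv⟩
      obtain ⟨_, ⟨x, hx, rfl⟩, _, ⟨b, hb, rfl⟩, rfl⟩ := Submodule.mem_sup.1 hw
      rw [Submodule.ideal_span_singleton_smul] at hx
      obtain ⟨n, -, rfl⟩ := hx
      refine ⟨(τ n, -b), ⟨⟨n, rfl⟩, neg_mem hb⟩, ?_⟩
      rw [← hv, coneD_apply]
      ext
      · simp [h.d_top]
      · simp

variable (R N J) in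
theorem exists_isKoszul (zs : List B) : ∃ (V : Type u) (_ : AddCommGroup V) (_ : Module R V)
    (_ : Module B V) (_ : IsScalarTower R B V) (d : V →ₗ[B] V) (gr : ℤ → Submodule B V)
    (τ : N →ₗ[B] V), IsKoszul J N zs d gr τ := by
  induction zs with
  | nil => exact ⟨N, _, _, _, ‹_›, _, _, _, isKoszul_nil R B J N⟩
  | cons z zs ih =>
    obtain ⟨V, _, _, _, _, d, gr, τ, h⟩ := ih
    exact ⟨V × V, inferInstance, inferInstance, inferInstance, inferInstance, _, _, _, h.cons z⟩

/-- The elements of the ring that act homotopically trivially. -/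
theorem IsKoszul.exists_homotopy (h : IsKoszul J N zs d gr τ) {b : B}
    (hb : b ∈ Module.annihilator B N ⊔ Ideal.span {z | z ∈ zs}) :
    ∃ s : V →ₗ[B] V, (∀ q, ∀ v ∈ gr q, s v ∈ gr (q - 1)) ∧ ∀ v, d (s v) + s (d v) = b • v := by
  obtain ⟨a, ha, c, hc, rfl⟩ := Submodule.mem_sup.1 hb
  have h1 : ∃ s : V →ₗ[B] V, (∀ q, ∀ v ∈ gr q, s v ∈ gr (q - 1)) ∧
      ∀ v, d (s v) + s (d v) = c • v := by
    clear hb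
    induction hc using Submodule.span_induction with
    | mem z hz => exact h.homotopy z hz
    | zero => exact ⟨0, fun q v _ => zero_mem _, by simp⟩
    | add x y _ _ hx hy =>
      obtain ⟨s, hs, hs'⟩ := hx
      obtain ⟨t, ht, ht'⟩ := hy
      refine ⟨s + t, fun q v hv => add_mem (hs q v hv) (ht q v hv), fun v => ?_⟩
      rw [add_smul, ← hs', ← ht']
      simp only [LinearMap.add_apply, map_add]
      abel
    | smul x y _ hy =>
      obtain ⟨s, hs, hs'⟩ := hy
      refine ⟨x • s, fun q v hv => Submodule.smul_mem _ _ (hs q v hv), fun v => ?_⟩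
      rw [smul_eq_mul, mul_smul, ← hs']
      simp
  obtain ⟨s, hs, hs'⟩ := h1
  refine ⟨s, hs, fun v => ?_⟩
  rw [hs', add_smul, h.annihilator a (Module.mem_annihilator.1 ha), zero_add]

/-- A product of multipliers that kill the local cohomology of `N` kills
`((z₁, …, z_{l-1})N : z_l) / (z₁, …, z_{l-1})N`. -/
theorem smul_mem_of_smul_mem [IsNoetherianRing R] (z : B) (zs : List B) {n : ℕ}
    (hn : (J ^ n).map (algebraMap R B) ≤
      Module.annihilator B N ⊔ Ideal.span {y | y ∈ z :: zs}) {c : R}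
    (hc : c ∈ ∏ i ∈ Finset.range (zs.length + 1), killIdeal J i N) {a : N}
    (ha : z • a ∈ (Ideal.span {y | y ∈ zs} • ⊤ : Submodule B N)) :
    c • a ∈ (Ideal.span {y | y ∈ zs} • ⊤ : Submodule B N) := by
  obtain ⟨V, _, _, _, _, d, gr, τ, h⟩ := exists_isKoszul R J N zs
  have h' := h.cons z
  have h1 : τ (z • a) ∈ (gr (zs.length - 1)).map d := h.boundary ▸ ⟨_, ha, rfl⟩
  obtain ⟨b, hb, hba⟩ := h1
  -- By `hn`, the images of the elements of `J ^ n` act null-homotopically on the Koszul complex of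
  -- `z :: zs`, so its cohomology is torsion.
  have htors : ∀ q, ∀ v ∈ coneGr gr q, coneD d z v = 0 →
      ∃ n : ℕ, ∀ r ∈ J ^ n, ∃ w ∈ coneGr gr (q - 1), coneD d z w = r • v := by
    intro q v hv hdv
    refine ⟨n, fun r hr => ?_⟩
    obtain ⟨s, hs, hs'⟩ := h'.exists_homotopy (hn (Ideal.mem_map_of_mem _ hr))
    refine ⟨s v, hs q v hv, ?_⟩
    have := hs' v
    rw [hdv, map_zero, add_zero, algebraMap_smul] at this
    exact this
  -- The relation `z • a ∈ (zs) N` makes `(τ a, b)` a cycle of degree `zs.length`, one below the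
  -- top. The first component of a primitive of its multiple by `c` exhibits `c • a` as an element
  -- of `(zs) N`.
  obtain ⟨w, hw, hcw⟩ := smul_mem_of_isPowTorsion (R := R) J ((coneD d z).restrictScalars R)
    (fun q => (coneGr gr q).restrictScalars R) h'.d_d h'.d_mem
    (by rw [h'.neg _ (by norm_num), Submodule.restrictScalars_bot]) htors
    (fun i => killIdeal J i N) h'.kill zs.length hc (v := (τ a, b))
    ⟨h.mem_gr a, hb⟩ (Prod.ext (h.d_top a) (by simp [coneD_apply, hba]))
  have h2 : d w.1 = τ (c • a) := by
    have := congrArg Prod.fst hcw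
    rw [Prod.smul_fst, ← algebraMap_smul B c (τ a), ← map_smul, algebraMap_smul] at this
    exact this
  have h3 : τ (c • a) ∈ (Ideal.span {z | z ∈ zs} • ⊤ : Submodule B N).map τ :=
    h.boundary ▸ ⟨w.1, hw.1, h2⟩
  obtain ⟨x, hx, hxa⟩ := h3
  exact h.injective hxa ▸ hx

end

end LocalCohomology

/-! ### Regular sequences with exponents. -/

namespace VarSum

open scoped Pointwise

set_option linter.unusedSectionVars false

section

variable {B X : Type*} [CommRing B] [AddCommGroup X] [Module B X] {x : ℕ → B} {E S : Finset ℕ}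

/-- Induction on the sum of the exponents. If the exponent at `l` is `m + 2`, the case `m + 1` gives
`a = x l ^ (m + 1) • b + u'`. Powers of `x l` can be cancelled modulo the remaining terms, so `x j •
b` is a multiple of `x l` modulo these; the case of exponent `1` then makes `b` such a multiple, and
`a` acquires the missing factor. -/
theorem mem_powerSum_of_smul_mem
    (h : ∀ Γ ⊆ E, S ⊆ Γ → ∀ j ∈ E, j ∉ Γ → ∀ a : X, x j • a ∈ powerSum X x (fun _ => 1) Γ →
      a ∈ powerSum X x (fun _ => 1) Γ)
    {e : ℕ → ℕ} (he : ∀ k, e k ≠ 0) (heS : ∀ k ∈ S, e k = 1) {Γ : Finset ℕ} (hΓ : Γ ⊆ E)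
    (hS : S ⊆ Γ) {j : ℕ} (hj : j ∈ E) (hjΓ : j ∉ Γ) {a : X}
    (ha : x j • a ∈ powerSum X x e Γ) : a ∈ powerSum X x e Γ := by
  induction hμ : ∑ l ∈ Γ, e l using Nat.strong_induction_on generalizing e Γ j a with
  | _ μ IH =>
  subst hμ
  by_cases h1 : ∀ k ∈ Γ, e k = 1
  · rw [powerSum_congr (e' := fun _ => 1) h1] at ha ⊢
    exact h Γ hΓ hS j hj hjΓ a ha
  push Not at h1
  obtain ⟨l, hl, hel⟩ := h1
  have hlS : l ∉ S := fun h => hel (heS l h)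
  obtain ⟨Γ₀, hl₀, rfl⟩ : ∃ Γ₀, l ∉ Γ₀ ∧ Γ = insert l Γ₀ :=
    ⟨Γ.erase l, Finset.notMem_erase _ _, (Finset.insert_erase hl).symm⟩
  have hSΓ : S ⊆ Γ₀ := fun k hk =>
      (Finset.mem_insert.1 (hS hk)).resolve_left fun h : k = l => hlS (h ▸ hk)
  have hΓ₀ : Γ₀ ⊆ E := (Finset.subset_insert _ _).trans hΓ
  have hlE : l ∈ E := hΓ (Finset.mem_insert_self _ _)
  obtain ⟨m, hm⟩ : ∃ m, e l = m + 2 := ⟨e l - 2, by have := he l; lia⟩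
  have hupd (p : ℕ) (hp : p ≠ 0) (k : ℕ) : Function.update e l p k ≠ 0 := by
    by_cases hk : k = l
    · subst hk; rwa [Function.update_self]
    · rw [Function.update_of_ne hk]; exact he k
  have hupdS (p : ℕ) (k : ℕ) (hk : k ∈ S) : Function.update e l p k = 1 := by
    rw [Function.update_of_ne fun h : k = l => hlS (h ▸ hk)]; exact heS k hk
  have hsum (p : ℕ) : ∑ k ∈ insert l Γ₀, Function.update e l p k = p + ∑ k ∈ Γ₀, e k := by
    rw [Finset.sum_insert hl₀, Function.update_self]
    exact congrArg _ (Finset.sum_congr rfl fun k hk => Function.update_of_ne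
      (fun h : k = l => hl₀ (h ▸ hk)) _ _)
  have hsum₀ : ∑ k ∈ insert l Γ₀, e k = m + 2 + ∑ k ∈ Γ₀, e k := by
    rw [Finset.sum_insert hl₀, hm]
  have step (p : ℕ) (hp : p ≠ 0) (hpm : p < m + 2) {j : ℕ} (hj : j ∈ E) (hjΓ : j ∉ insert l Γ₀)
      {a : X} (ha : ∃ n, ∃ b ∈ powerSum X x e Γ₀, x l ^ p • n + b = x j • a) :
      ∃ n, ∃ b ∈ powerSum X x e Γ₀, x l ^ p • n + b = a :=
    (mem_powerSum_update hl₀).1 (IH _ (by rw [hsum, hsum₀]; lia) (hupd p hp) (hupdS p) hΓ hS hj hjΓ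
      ((mem_powerSum_update hl₀).2 ha) rfl)
  have cancel (q : ℕ) {t : X} (ht : x l ^ q • t ∈ powerSum X x e Γ₀) : t ∈ powerSum X x e Γ₀ := by
    induction q generalizing t with
    | zero => simpa using ht
    | succ q ih =>
      rw [pow_succ, mul_smul] at ht
      exact IH _ (by rw [hsum₀]; lia) he heS hΓ₀ hSΓ hlE hl₀ (ih ht) rfl
  obtain ⟨t, u, hu, e₁⟩ := mem_powerSum_insert.1 ha
  rw [hm] at e₁
  obtain ⟨b, u', hu', e₂⟩ := step (m + 1) (by lia) (by lia) hj hjΓ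
    ⟨x l • t, u, hu, by rw [← e₁, smul_smul, ← pow_succ]⟩
  have h2 : x j • b - x l • t ∈ powerSum X x e Γ₀ := by
    refine cancel (m + 1) ?_
    have : x l ^ (m + 1) • (x j • b - x l • t) = u - x j • u' := by
      have e₄ : x l ^ (m + 1) • (x j • b - x l • t) =
          x j • (x l ^ (m + 1) • b + u') - (x l ^ (m + 2) • t + u) + u - x j • u' := by module
      rw [e₄, e₁, e₂, sub_self, zero_add]
    rw [this]
    exact sub_mem hu (Submodule.smul_mem _ _ hu')
  obtain ⟨c, v, hv, e₃⟩ := step 1 one_ne_zero (by lia) hj hjΓ (a := b)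
    ⟨t, _, h2, by rw [pow_one]; abel⟩
  refine mem_powerSum_insert.2 ⟨c, x l ^ (m + 1) • v + u', add_mem (Submodule.smul_mem _ _ hv) hu',
    ?_⟩
  rw [hm, ← e₂, ← e₃]
  module

end

end VarSum

/-! ### Unitriangular changes of a sequence, and coordinates on `B ⊗ M`. -/

namespace LocalCohomology

set_option linter.unusedSectionVars false

open VarSum TensorProduct

section

variable {R B : Type*} [CommRing R] [CommRing B] [Algebra R B]

/-- The sequence `x` in the algebra `B` is obtained from the sequence `x₀` in the base ring by
adding combinations of the preceding terms to the first `s` terms. -/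
structure IsUnitriangular (x₀ : ℕ → R) (x : ℕ → B) (s : ℕ) : Prop where
  sub_mem (k : ℕ) (hk : k < s) :
    x k - algebraMap R B (x₀ k) ∈ (Ideal.span (x₀ '' Set.Iio k)).map (algebraMap R B)
  eq (k : ℕ) (hk : s ≤ k) : x k = algebraMap R B (x₀ k)

/-- The correction to a term of index below `s` is a combination of preceding terms. The condition
on `Γ` says that these are present with exponent `1`, so the correction belongs to the ideal
already. -/
theorem IsUnitriangular.span_eq {x₀ : ℕ → R} {x : ℕ → B} {s : ℕ} (h : IsUnitriangular x₀ x s)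
    {e : ℕ → ℕ} {Γ : Set ℕ} (hΓ : ∀ k ∈ Γ, k < s → e k = 1 ∧ ∀ l < k, l ∈ Γ) :
    Ideal.span ((fun k => x k ^ e k) '' Γ) =
      (Ideal.span ((fun k => x₀ k ^ e k) '' Γ)).map (algebraMap R B) := by
  have hsub (k : ℕ) (hk : k ∈ Γ) (hks : k < s) :
      Ideal.span (x₀ '' Set.Iio k) ≤ Ideal.span ((fun k => x₀ k ^ e k) '' Γ) := by
    refine Ideal.span_le.2 ?_
    rintro _ ⟨l, hl, rfl⟩
    have hl' := (hΓ k hk hks).2 l hl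
    refine Ideal.subset_span ⟨l, hl', ?_⟩
    simp only [(hΓ l hl' (lt_trans hl hks)).1, pow_one]
  apply le_antisymm
  · refine Ideal.span_le.2 ?_
    rintro _ ⟨k, hk, rfl⟩
    have h1 : algebraMap R B (x₀ k ^ e k) ∈
        (Ideal.span ((fun k => x₀ k ^ e k) '' Γ)).map (algebraMap R B) :=
      Ideal.mem_map_of_mem _ (Ideal.subset_span ⟨k, hk, rfl⟩)
    by_cases hks : k < s
    · have h2 := Ideal.map_mono (f := algebraMap R B) (hsub k hk hks) (h.sub_mem k hks)
      have := add_mem h2 h1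
      simpa [(hΓ k hk hks).1] using this
    · simpa [h.eq k (not_lt.1 hks)] using h1
  · rw [Ideal.map_span, Ideal.span_le]
    rintro _ ⟨_, ⟨k, hk, rfl⟩, rfl⟩
    have hx {k : ℕ} (hk : k ∈ Γ) : x k ^ e k ∈ Ideal.span ((fun k => x k ^ e k) '' Γ) :=
      Ideal.subset_span ⟨k, hk, rfl⟩
    induction k using Nat.strong_induction_on with
    | _ k ih =>
    by_cases hks : k < s
    · have h2 : (Ideal.span (x₀ '' Set.Iio k)).map (algebraMap R B) ≤
          Ideal.span ((fun k => x k ^ e k) '' Γ) := by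
        rw [Ideal.map_span, Ideal.span_le]
        rintro _ ⟨_, ⟨l, hl, rfl⟩, rfl⟩
        have hl' := (hΓ k hk hks).2 l hl
        have := ih l hl hl'
        simpa [(hΓ l hl' (lt_trans hl hks)).1] using this
      have := Submodule.sub_mem _ (hx hk) (h2 (by simpa [(hΓ k hk hks).1] using h.sub_mem k hks))
      simpa [(hΓ k hk hks).1] using this
    · have := hx hk
      simpa [h.eq k (not_lt.1 hks)] using this

end

section

variable {R : Type*} {B : Type*} [CommRing R] [CommRing B] [Algebra R B] {ι : Type*} [Fintype ι]
  (b : Module.Basis ι R B) (M : Type*) [AddCommGroup M] [Module R M]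

/-- The coordinates of an element of `B ⊗ M` with respect to a basis of `B`. -/
noncomputable def tensorCoord (k : ι) : B ⊗[R] M →ₗ[R] M :=
  (TensorProduct.lid R M).toLinearMap ∘ₗ (b.coord k).rTensor M

theorem tensorCoord_tmul (k : ι) (β : B) (m : M) :
    tensorCoord b M k (β ⊗ₜ m) = b.repr β k • m := by
  simp [tensorCoord]

theorem sum_tmul_tensorCoord (t : B ⊗[R] M) : ∑ k, b k ⊗ₜ tensorCoord b M k t = t := by
  induction t using TensorProduct.induction_on with
  | zero => simp
  | tmul β m =>
    simp only [tensorCoord_tmul, ← TensorProduct.smul_tmul, ← TensorProduct.sum_tmul, b.sum_repr]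
  | add s t hs ht => simp only [map_add, TensorProduct.tmul_add, Finset.sum_add_distrib, hs, ht]

/-- A basis of `B` makes `B ⊗ M` a direct sum of copies of `M`, and extended ideals act on each copy
separately. -/
theorem mem_map_smul_top_iff {I : Ideal R} {t : B ⊗[R] M} :
    t ∈ (I.map (algebraMap R B) • ⊤ : Submodule B (B ⊗[R] M)) ↔
      ∀ k, tensorCoord b M k t ∈ (I • ⊤ : Submodule R M) := by
  rw [← Submodule.restrictScalars_mem R, Ideal.smul_restrictScalars, Submodule.restrictScalars_top]
  constructor
  · intro h k
    have := Submodule.mem_map_of_mem (f := tensorCoord b M k) h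
    rw [Submodule.map_smul''] at this
    exact Submodule.smul_mono le_rfl le_top this
  · intro h
    rw [← sum_tmul_tensorCoord b M t]
    refine sum_mem fun k _ => ?_
    have := Submodule.mem_map_of_mem (f := TensorProduct.mk R B M (b k)) (h k)
    rw [Submodule.map_smul''] at this
    exact Submodule.smul_mono le_rfl le_top this

end

end LocalCohomology

/-! ### Secant systems give strong d-sequences, also after finite free base change. -/

namespace LocalCohomology

set_option linter.unusedSectionVars false

open VarSum TensorProduct IsLocalRing

theorem mkQ_smul_eq_of_sub_smul_mem {B X : Type*} [CommRing B] [AddCommGroup X] [Module B X]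
    {K : Submodule B X} {x y : B} {a : X} (h : (x - y) • a ∈ K) :
    K.mkQ (x • a) = y • K.mkQ a := by
  rw [← map_smul, ← sub_eq_zero, ← map_sub, ← sub_smul]
  exact (Submodule.Quotient.mk_eq_zero K).2 h

variable {R : Type u} [CommRing R] [IsLocalRing R]

/-- The numerical and cohomological properties of a CM-secant sequence `x 0, …, x (s - 1)`, followed
by a maximal regular sequence `x s, …, x (n - 1)` on the Cohen-Macaulay quotient. -/
structure IsSecantSystem (M : Type u) [AddCommGroup M] [Module R M] (x : ℕ → R) (s n : ℕ) :
    Prop where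
  mem_maximalIdeal (k : ℕ) : x k ∈ maximalIdeal R
  kill (k : ℕ) (hk : k < s) : x k ∈ ∏ i ∈ Finset.range (n - k), killIdeal (maximalIdeal R) i
    (M ⧸ (Ideal.span (x '' Set.Iio k) • ⊤ : Submodule R M))
  regular : ∀ Γ ⊆ Finset.range n, Finset.range s ⊆ Γ → ∀ j ∈ Finset.range n, j ∉ Γ → ∀ a : M,
    x j • a ∈ powerSum M x (fun _ => 1) Γ → a ∈ powerSum M x (fun _ => 1) Γ
  torsion : ∃ N, maximalIdeal R ^ N ≤ Module.annihilator R M ⊔ Ideal.span (x '' Set.Iio n)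

namespace IsSecantSystem

variable {M : Type u} [AddCommGroup M] [Module R M] {x₀ : ℕ → R} {s n : ℕ}
  {B : Type u} [CommRing B] [Algebra R B] [Module.Free R B] [Module.Finite R B] {x : ℕ → B}

/-- All terms of index below `s` are present with exponent `1`, so the submodule is extended from
`M`. Coordinates reduce the claim to the regular sequence on the Cohen-Macaulay quotient, with
exponents. -/
theorem smul_mem_of_le [IsNoetherianRing R] (h : IsSecantSystem M x₀ s n)
    (hx : IsUnitriangular x₀ x s) {e : ℕ → ℕ} (he : ∀ k, e k ≠ 0) {Γ : Finset ℕ}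
    (hΓ : Γ ⊆ Finset.range n) (heΓ : ∀ l < s, l ∈ Γ ∧ e l = 1) {j : ℕ} (hj : j ∈ Finset.range n)
    (hjΓ : j ∉ Γ) {a : B ⊗[R] M} (ha : x j • a ∈ powerSum (B ⊗[R] M) x e Γ) :
    a ∈ powerSum (B ⊗[R] M) x e Γ := by
  let b := Module.Free.chooseBasis R B
  have hspan := hx.span_eq (e := e) (Γ := (Γ : Set ℕ)) fun k _ hks =>
    ⟨(heΓ k hks).2, fun l hl => (heΓ l (hl.trans hks)).1⟩
  have hmem (t : B ⊗[R] M) : t ∈ powerSum (B ⊗[R] M) x e Γ ↔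
      ∀ k, tensorCoord b M k t ∈ powerSum M x₀ e Γ := by
    rw [powerSum, varSum_eq_span_smul, hspan, mem_map_smul_top_iff b M]
    exact forall_congr' fun k => by rw [powerSum, varSum_eq_span_smul]
  rw [hmem] at ha ⊢
  have hjs : s ≤ j := not_lt.1 fun hjs => hjΓ (heΓ j hjs).1
  intro k
  refine mem_powerSum_of_smul_mem (S := Finset.range s) h.regular he
    (fun k hk => (heΓ k (Finset.mem_range.1 hk)).2) hΓ
    (fun k hk => (heΓ k (Finset.mem_range.1 hk)).1) hj hjΓ ?_
  have := ha k
  rwa [hx.eq j hjs, algebraMap_smul, map_smul] at this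

/-- The quotient of `B ⊗ M` by `I (B ⊗ M)` is a sum of copies of `M ⧸ I M`. -/
theorem killIdeal_le_quotient (J I : Ideal R) (i : ℕ) :
    killIdeal J i (M ⧸ (I • ⊤ : Submodule R M)) ≤
      killIdeal J i ((B ⊗[R] M) ⧸ (I.map (algebraMap R B) • ⊤ : Submodule B (B ⊗[R] M))) := by
  let b := Module.Free.chooseBasis R B
  let K : Submodule B (B ⊗[R] M) := I.map (algebraMap R B) • ⊤
  let f (k) : ((B ⊗[R] M) ⧸ K) →ₗ[R] M ⧸ (I • ⊤ : Submodule R M) :=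
    Submodule.liftQ (K.restrictScalars R) (Submodule.mkQ _ ∘ₗ tensorCoord b M k) (fun t ht => by
      rw [LinearMap.mem_ker, LinearMap.comp_apply, Submodule.mkQ_apply,
        Submodule.Quotient.mk_eq_zero]
      exact (mem_map_smul_top_iff b M).1 ht k)
  let g (k) : (M ⧸ (I • ⊤ : Submodule R M)) →ₗ[R] ((B ⊗[R] M) ⧸ K) :=
    Submodule.liftQ _ (K.mkQ.restrictScalars R ∘ₗ TensorProduct.mk R B M (b k)) (fun t ht => by
      rw [LinearMap.mem_ker]
      change K.mkQ (b k ⊗ₜ t) = 0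
      rw [Submodule.mkQ_apply, Submodule.Quotient.mk_eq_zero]
      refine (mem_map_smul_top_iff b M).2 fun l => ?_
      rw [tensorCoord_tmul]
      exact Submodule.smul_mem _ _ ht)
  refine killIdeal_le_of_sum J f g (fun t => ?_) i
  obtain ⟨t, rfl⟩ := K.mkQ_surjective t
  have h1 (k) : g k (f k (K.mkQ t)) = K.mkQ (b k ⊗ₜ tensorCoord b M k t) := rfl
  simp only [h1]
  rw [← map_sum, sum_tmul_tensorCoord]

/-- Divide by the terms of index below `i`. What remains are the `n - i - 1` other terms and `x j ^
e j`, together `n - i` elements generating an ideal with the required torsion property. The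
annihilation of colon modules applies to any element of the product over the degrees below `n - i`,
and `x₀ i` is one by assumption; on this quotient it acts as `x i`. -/
theorem smul_mem_of_pow_smul_mem [IsNoetherianRing R] (h : IsSecantSystem M x₀ s n)
    (hx : IsUnitriangular x₀ x s) {e : ℕ → ℕ} {i : ℕ} (his : i < s)
    (hei : ∀ l < i, e l = 1) {j : ℕ} (hij : i ≤ j) (hj : j < n) {a : B ⊗[R] M}
    (ha : x j ^ e j • a ∈ powerSum (B ⊗[R] M) x e ((Finset.range n).erase j)) :
    x i • a ∈ powerSum (B ⊗[R] M) x e ((Finset.range n).erase j) := by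
  let I₀ := Ideal.span (x₀ '' Set.Iio i)
  let K : Submodule B (B ⊗[R] M) := I₀.map (algebraMap R B) • ⊤
  let N := (B ⊗[R] M) ⧸ K
  let zs : List B := ((Finset.Ico i n).erase j).toList.map fun k => x k ^ e k
  have hzs : Ideal.span {y | y ∈ zs} = Ideal.span ((fun k => x k ^ e k) ''
      ((Finset.Ico i n).erase j : Finset ℕ)) := by
    congr 1
    ext y
    simp [zs, and_comm]
  have hI₀ : I₀.map (algebraMap R B) = Ideal.span ((fun k => x k ^ e k) '' (Finset.range i)) := by
    rw [hx.span_eq]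
    · rw [Finset.coe_range]
      exact congrArg (fun T => (Ideal.span T).map (algebraMap R B))
        (Set.image_congr fun k hk => by rw [hei k hk, pow_one])
    · exact fun k hk _ => ⟨hei k (by simpa using hk), fun l hl => by
        simp at hk ⊢; exact hl.trans hk⟩
  have hsplit : (Finset.range n).erase j = (Finset.Ico i n).erase j ∪ Finset.range i := by
    ext k
    simp only [Finset.mem_erase, Finset.mem_range, Finset.mem_union, Finset.mem_Ico]
    lia
  have hmem (t : B ⊗[R] M) : K.mkQ t ∈ (Ideal.span {y | y ∈ zs} • ⊤ : Submodule B N) ↔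
      t ∈ powerSum (B ⊗[R] M) x e ((Finset.range n).erase j) := by
    rw [hzs, ← varSum_eq_span_smul, mkQ_mem_varSum_iff, powerSum, hsplit, varSum_eq_span_smul,
      varSum_eq_span_smul, ← Submodule.sup_smul, hI₀, ← Ideal.span_union, ← Set.image_union,
      Finset.coe_union]
  have hlen : zs.length + 1 = n - i := by
    simp only [zs, List.length_map, Finset.length_toList]
    rw [Finset.card_erase_of_mem (Finset.mem_Ico.2 ⟨hij, hj⟩), Nat.card_Ico]
    lia
  have hc : x₀ i ∈ ∏ t ∈ Finset.range (zs.length + 1), killIdeal (maximalIdeal R) t N := by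
    rw [hlen]
    exact Finset.prod_le_prod' (fun t _ => killIdeal_le_quotient _ _ _) (h.kill i his)
  obtain ⟨P, hP⟩ := h.torsion
  have htors : ∃ N', ((maximalIdeal R) ^ N').map (algebraMap R B) ≤
      Module.annihilator B N ⊔ Ideal.span {y | y ∈ x j ^ e j :: zs} := by
    have h1 : (maximalIdeal R).map (algebraMap R B) ≤
        (Module.annihilator B N ⊔ Ideal.span {y | y ∈ x j ^ e j :: zs}).radical := by
      have h2 : Module.annihilator R M ⊔ Ideal.span (x₀ '' Set.Iio n) ≤
          ((Module.annihilator B N ⊔ Ideal.span {y | y ∈ x j ^ e j :: zs}).radical).comap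
            (algebraMap R B) := by
        refine sup_le (fun r hr => ?_) ?_
        · refine Ideal.le_radical (Ideal.mem_sup_left (Module.mem_annihilator.2 fun t => ?_))
          obtain ⟨t, rfl⟩ := K.mkQ_surjective t
          rw [← map_smul, algebraMap_smul]
          have : r • t = 0 := by
            induction t using TensorProduct.induction_on with
            | zero => rw [smul_zero]
            | tmul β m => rw [← TensorProduct.tmul_smul, Module.mem_annihilator.1 hr,
                TensorProduct.tmul_zero]
            | add s t hs ht => rw [smul_add, hs, ht, add_zero]
          rw [this, map_zero]
        · rw [← Ideal.map_le_iff_le_comap]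
          have h3 := hx.span_eq (e := fun _ => 1) (Γ := Set.Iio n)
            fun k hk _ => ⟨rfl, fun l hl => lt_trans hl hk⟩
          simp only [pow_one] at h3
          rw [← h3, Ideal.span_le]
          rintro _ ⟨k, hk, rfl⟩
          by_cases hki : k < i
          · refine Ideal.le_radical (Ideal.mem_sup_left (Module.mem_annihilator.2 fun t => ?_))
            obtain ⟨t, rfl⟩ := K.mkQ_surjective t
            rw [← map_smul, Submodule.mkQ_apply, Submodule.Quotient.mk_eq_zero]
            refine Submodule.smul_mem_smul ?_ trivial
            rw [hI₀]
            exact Ideal.subset_span ⟨k, by simpa using hki, by simp [hei k hki]⟩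
          · refine ⟨e k, Ideal.mem_sup_right (Ideal.subset_span ?_)⟩
            by_cases hkj : k = j
            · subst hkj; exact List.mem_cons_self
            · refine List.mem_cons_of_mem _ (List.mem_map.2 ⟨k, ?_, rfl⟩)
              rw [Finset.mem_toList, Finset.mem_erase, Finset.mem_Ico]
              exact ⟨hkj, not_lt.1 hki, hk⟩
      rw [Ideal.map_le_iff_le_comap]
      intro r hr
      have h3 := h2 (hP (Ideal.pow_mem_pow hr P))
      rw [Ideal.mem_comap, map_pow] at h3
      exact Ideal.mem_radical_of_pow_mem h3
    have : IsNoetherianRing B := IsNoetherianRing.of_finite R B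
    obtain ⟨N', hN'⟩ := Ideal.exists_pow_le_of_le_radical_of_fg h1 (IsNoetherian.noetherian _)
    exact ⟨N', by rwa [Ideal.map_pow]⟩
  obtain ⟨N', hN'⟩ := htors
  have := smul_mem_of_smul_mem (N := N) (x j ^ e j) zs hN' hc (a := K.mkQ a) (by
    rw [← map_smul, hmem]; exact ha)
  rw [← hmem]
  have h4 : K.mkQ (x i • a) = x₀ i • K.mkQ a := by
    have h5 : (x i - algebraMap R B (x₀ i)) • a ∈ K :=
      Submodule.smul_mem_smul (hx.sub_mem i his) trivial
    rw [← algebraMap_smul B (x₀ i) (K.mkQ a)]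
    exact mkQ_smul_eq_of_sub_smul_mem h5
  rwa [h4]

/-- Terms with exponent `P` contribute only elements of `𝔪 ^ P (B ⊗ M)`, so Krull's intersection
theorem in the quotient by the remaining terms removes them. -/
theorem mem_powerSum_of_forall [IsNoetherianRing R] [Module.Finite R M]
    (h : IsSecantSystem M x₀ s n) (hx : IsUnitriangular x₀ x s) {e : ℕ → ℕ} {Γ E : Finset ℕ}
    {a : B ⊗[R] M} (ha : ∀ P : ℕ, P ≠ 0 →
      a ∈ powerSum (B ⊗[R] M) x (fun k => if k ∈ Γ then e k else P) E) :
    a ∈ powerSum (B ⊗[R] M) x e Γ := by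
  set U := powerSum (B ⊗[R] M) x e Γ
  have hx' (k : ℕ) : x k ∈ (maximalIdeal R).map (algebraMap R B) := by
    have h1 : algebraMap R B (x₀ k) ∈ (maximalIdeal R).map (algebraMap R B) :=
      Ideal.mem_map_of_mem _ (h.mem_maximalIdeal k)
    by_cases hks : k < s
    · have h2 : Ideal.span (x₀ '' Set.Iio k) ≤ maximalIdeal R :=
        Ideal.span_le.2 (by rintro _ ⟨l, -, rfl⟩; exact h.mem_maximalIdeal l)
      have := add_mem (Ideal.map_mono h2 (hx.sub_mem k hks)) h1
      simpa using this
    · rwa [hx.eq k (not_lt.1 hks)]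
  have hle (P : ℕ) : powerSum (B ⊗[R] M) x (fun k => if k ∈ Γ then e k else P) E ≤
      U ⊔ ((maximalIdeal R) ^ P).map (algebraMap R B) • ⊤ := by
    refine varSum_le_iff.2 fun k _ t _ => ?_
    beta_reduce
    split_ifs with hk
    · exact Submodule.mem_sup_left (smul_mem_varSum hk trivial)
    · refine Submodule.mem_sup_right (Submodule.smul_mem_smul ?_ trivial)
      rw [Ideal.map_pow]
      exact Ideal.pow_mem_pow (hx' k) P
  have hfin : Module.Finite R ((B ⊗[R] M) ⧸ U) :=
    Module.Finite.of_surjective (U.mkQ.restrictScalars R) U.mkQ_surjective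
  have h0 := Ideal.iInf_pow_smul_eq_bot_of_isLocalRing (M := (B ⊗[R] M) ⧸ U) (maximalIdeal R)
    (maximalIdeal.isMaximal R).ne_top
  have h1 : U.mkQ a ∈ (⨅ i : ℕ, (maximalIdeal R) ^ i • ⊤ : Submodule R ((B ⊗[R] M) ⧸ U)) := by
    rw [Submodule.mem_iInf]
    intro P
    refine Submodule.smul_mono (Ideal.pow_le_pow_right (Nat.le_succ P)) le_rfl ?_
    obtain ⟨u, hu, v, hv, rfl⟩ := Submodule.mem_sup.1 (hle _ (ha (P + 1) (Nat.succ_ne_zero P)))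
    rw [map_add, (Submodule.Quotient.mk_eq_zero U).2 hu |> (show U.mkQ u = 0 from ·), zero_add]
    have h2 : v ∈ (((maximalIdeal R) ^ (P + 1)).map (algebraMap R B) • ⊤ :
        Submodule B (B ⊗[R] M)).restrictScalars R := hv
    rw [Ideal.smul_restrictScalars] at h2
    have h3 := Submodule.mem_map_of_mem (f := U.mkQ.restrictScalars R) h2
    rw [Submodule.map_smul''] at h3
    exact Submodule.smul_mono le_rfl le_top h3
  rw [h0] at h1
  exact (Submodule.Quotient.mk_eq_zero U).1 h1

/-- The annihilation result requires all indices except `j` to be present. The missing ones are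
added with a large exponent `P`, and Krull's theorem lets `P` tend to infinity; the exponent `p` of
`x j` is arbitrary. Applying this to `x i • a` with `x j` leads to `x i • x i • a`, and a second
application with `x i ^ 2` removes the extra factor. -/
theorem colonAt [IsNoetherianRing R] [Module.Finite R M]
    (h : IsSecantSystem M x₀ s n) (hx : IsUnitriangular x₀ x s) {e : ℕ → ℕ}
    {Γ : Finset ℕ} (hΓ : Γ ⊆ Finset.range n) {i : ℕ} (hi : i ∈ Finset.range n)
    (hiΓ : i ∉ Γ) (hei : ∀ l < i, l ∈ Γ ∧ e l = 1) (his : i < s) :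
    ColonAt (B ⊗[R] M) x (Finset.range n) e Γ i := by
  have key (j : ℕ) (hij : i ≤ j) (hj : j < n) (hjΓ : j ∉ Γ) (p : ℕ)
      (a : B ⊗[R] M)
      (ha : x j ^ p • a ∈ powerSum (B ⊗[R] M) x e Γ) : x i • a ∈ powerSum (B ⊗[R] M) x e Γ := by
    refine h.mem_powerSum_of_forall hx (E := (Finset.range n).erase j) fun P hP => ?_
    have hcongr : powerSum (B ⊗[R] M) x (fun k => if k ∈ Γ then e k else P)
        ((Finset.range n).erase j) = powerSum (B ⊗[R] M) x
          (fun k => if k ∈ Γ then e k else if k = j then p else P) ((Finset.range n).erase j) :=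
      powerSum_congr fun k hk => by simp [Finset.ne_of_mem_erase hk]
    rw [hcongr]
    refine h.smul_mem_of_pow_smul_mem hx his (fun l hl => by simp [hei l hl]) hij hj ?_
    simp only [hjΓ, if_false, if_true]
    rw [powerSum_congr (e' := fun k => if k ∈ Γ then e k else if k = j then p else P)
      (fun k hk => by simp [hk])] at ha
    exact powerSum_mono (fun k hk => Finset.mem_erase.2 ⟨fun h : k = j => hjΓ (h ▸ hk), hΓ hk⟩) ha
  have sq (a : B ⊗[R] M) (ha : x i • x i • a ∈ powerSum (B ⊗[R] M) x e Γ) :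
      x i • a ∈ powerSum (B ⊗[R] M) x e Γ :=
    key i le_rfl (Finset.mem_range.1 hi) hiΓ 2 a (by rwa [pow_two, mul_smul])
  intro j hj hij hjΓ a ha
  refine sq a (key j hij (Finset.mem_range.1 hj) hjΓ 1 _ ?_)
  rwa [pow_one, smul_comm]

theorem isAdmissible [IsNoetherianRing R] [Module.Finite R M]
    (h : IsSecantSystem M x₀ s n) (hx : IsUnitriangular x₀ x s) :
    IsAdmissible (B ⊗[R] M) x (Finset.range n) s where
  strong := by
    refine isStrongDSeq_of_initial fun e he Γ hΓ i hi hiΓ hei => ?_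
    by_cases his : i < s
    · exact h.colonAt hx hΓ hi hiΓ hei his
    · refine fun j hj hij hjΓ a ha => h.smul_mem_of_le hx he hΓ
        (fun l hl => hei l (hl.trans_le (not_lt.1 his))) hj hjΓ ?_
      rwa [smul_comm]
  regular i hi his a ha := by
    have hf : (Finset.range n).filter (· < i) = Finset.range i := by
      ext k
      simp only [Finset.mem_filter, Finset.mem_range] at hi ⊢
      lia
    rw [hf] at ha ⊢
    refine h.smul_mem_of_le hx (fun _ => one_ne_zero) ?_ (fun l hl => ⟨?_, rfl⟩) hi ?_ ha
    · exact Finset.range_mono (Finset.mem_range.1 hi).le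
    · exact Finset.mem_range.2 (hl.trans_le his)
    · simp

end IsSecantSystem

end LocalCohomology

/-! ### Finite dimension and existence of maximal regular sequences. -/

namespace CohenMacaulay

set_option linter.unusedSectionVars false

open IsLocalRing RingTheory.Sequence

section

variable {R : Type*} [CommRing R] [IsLocalRing R] [IsNoetherianRing R]
  (N : Type*) [AddCommGroup N] [Module R N] [Module.Finite R N]

theorem exists_supportDim_eq [Nontrivial N] : ∃ d : ℕ, Module.supportDim R N = d := by
  have h1 := (Module.supportDim_le_ringKrullDim R N).trans_lt ringKrullDim_lt_top
  have h2 := Module.supportDim_ne_bot_of_nontrivial R N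
  generalize Module.supportDim R N = d at h1 h2
  induction d using WithBot.recBotCoe with
  | bot => exact absurd rfl h2
  | coe d =>
    induction d using ENat.recTopCoe with
    | top => exact absurd h1 (lt_irrefl _)
    | coe d => exact ⟨d, rfl⟩

variable {N}

/-- Depth is a supremum of natural numbers; being equal to the finite value `d`, it is reached, and
a longer sequence can be truncated. -/
theorem exists_isWeaklyRegular [Nontrivial N] (h : IsCohenMacaulayModule R N) {d : ℕ}
    (hd : Module.supportDim R N = d) : ∃ ys : List R, ys.length = d ∧
      (∀ y ∈ ys, y ∈ maximalIdeal R) ∧ IsWeaklyRegular N ys := by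
  obtain h | h := h
  · exact absurd h (not_subsingleton N)
  have h' : depth R N = d := by
    rw [hd] at h
    exact_mod_cast h
  suffices h : ∃ ys : List R, d ≤ ys.length ∧ (∀ y ∈ ys, y ∈ maximalIdeal R) ∧
      IsWeaklyRegular N ys by
    obtain ⟨ys, h1, h2, h3⟩ := h
    refine ⟨ys.take d, by simp [h1], fun y hy => h2 y (List.mem_of_mem_take hy), ?_⟩
    rw [← List.take_append_drop d ys] at h3
    exact ((isWeaklyRegular_append_iff _ _ _).1 h3).1
  by_contra! hcon
  obtain _ | d := d
  · exact hcon [] le_rfl (by simp) (IsWeaklyRegular.nil R N)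
  have h1 : depth R N ≤ (d : ℕ) := by
    refine iSup_le fun ys => iSup_le fun h2 => iSup_le fun h3 => ?_
    have : ys.length ≤ d := by
      by_contra! hlt
      exact hcon ys hlt h2 h3
    exact_mod_cast this
  rw [h'] at h1
  have : d + 1 ≤ d := by exact_mod_cast h1
  lia

end

end CohenMacaulay

/-! ### CM-secant sequences extend to secant systems. -/

namespace CMSecant

set_option linter.unusedSectionVars false

open VarSum LocalCohomology IsLocalRing RingTheory.Sequence CohenMacaulay

section

variable {R : Type u} [CommRing R] {s : ℕ}

theorem initialIdeal_eq (r : Fin s → R) {x : ℕ → R} (hx : ∀ i : Fin s, x i = r i) {k : ℕ}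
    (hk : k ≤ s) : initialIdeal r k = Ideal.span (x '' Set.Iio k) := by
  refine congrArg Ideal.span (Set.ext fun a => ⟨?_, ?_⟩)
  · rintro ⟨j, hj, rfl⟩
    exact ⟨j, hj, hx j⟩
  · rintro ⟨j, hj, rfl⟩
    exact ⟨⟨j, lt_of_lt_of_le hj hk⟩, hj, (hx ⟨j, _⟩).symm⟩

variable [IsLocalRing R] [IsNoetherianRing R] {M : Type u} [AddCommGroup M] [Module R M]
  [Module.Finite R M]

theorem nontrivial_quotient [Nontrivial M] {I : Ideal R} (hI : I ≤ maximalIdeal R) :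
    Nontrivial (M ⧸ (I • ⊤ : Submodule R M)) :=
  Submodule.Quotient.nontrivial_iff.mpr (Submodule.top_ne_ideal_smul_of_le_jacobson_annihilator
    (hI.trans (maximalIdeal_le_jacobson _))).symm

theorem initialIdeal_le {r : Fin s → R} (hr : ∀ i, r i ∈ maximalIdeal R) (k : ℕ) :
    initialIdeal r k ≤ maximalIdeal R :=
  Ideal.span_le.2 (by rintro _ ⟨j, -, rfl⟩; exact hr j)

/-- Each secant term lowers the dimension by at least one. A lower bound is all that is needed: a
product of ideals over more degrees is contained in the product over fewer. -/
theorem le_supportDim [Nontrivial M] {r : Fin s → R} (h : IsSecant r M) {e : ℕ}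
    (he : Module.supportDim R (initialQuotient r M s) = e) {k : ℕ} (hk : k ≤ s) :
    ∃ d : ℕ, Module.supportDim R (initialQuotient r M k) = d ∧ s - k + e ≤ d := by
  induction hk using Nat.decreasingInduction with
  | self => exact ⟨e, he, by lia⟩
  | of_succ k hk ih =>
    obtain ⟨d, hd, hle⟩ := ih
    have : Nontrivial (initialQuotient r M k) := nontrivial_quotient (initialIdeal_le h.1 k)
    obtain ⟨d', hd'⟩ := exists_supportDim_eq (R := R) (initialQuotient r M k)
    have h2 := h.2 ⟨k, hk⟩
    simp only at h2
    rw [hd, hd'] at h2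
    have h3 : d < d' := by exact_mod_cast h2
    exact ⟨d', hd', by lia⟩

/-- The appended terms form a maximal regular sequence on the Cohen-Macaulay quotient. Regularity
modulo any subset of them holds because regular sequences in a local ring may be permuted. Dividing
by all of them leaves dimension zero, which gives the power of the maximal ideal. -/
theorem exists_isSecantSystem [Nontrivial M] {r : Fin s → R} (h : IsCMSecant r M) :
    ∃ (x : ℕ → R) (n : ℕ), s ≤ n ∧ (∀ i : Fin s, x i = r i) ∧ IsSecantSystem M x s n := by
  have hr := h.isSecant.1
  have : Nontrivial (initialQuotient r M s) := nontrivial_quotient (initialIdeal_le hr s)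
  obtain ⟨e, he⟩ := exists_supportDim_eq (R := R) (initialQuotient r M s)
  obtain ⟨ys, hlen, hys, hreg⟩ := exists_isWeaklyRegular h.isCohenMacaulay he
  let x : ℕ → R := fun k => if hk : k < s then r ⟨k, hk⟩ else ys.getD (k - s) 0
  have hx (i : Fin s) : x i = r i := by simp [x]
  have hmem (k : ℕ) : x k ∈ maximalIdeal R := by
    by_cases hk : k < s
    · simpa [x, hk] using hr _
    · simp only [x, hk, dif_neg, not_false_eq_true]
      by_cases hk' : k - s < ys.length
      · rw [List.getD_eq_getElem _ _ hk']
        exact hys _ (List.getElem_mem _)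
      · rw [List.getD_eq_default _ _ (not_lt.1 hk')]
        exact zero_mem _
  have hys' : ys = (List.range' s e).map x := by
    refine List.ext_getElem (by simp [hlen]) fun k hk hk' => ?_
    simp [x, hk]
  let K : Submodule R M := Ideal.span (x '' Set.Iio s) • ⊤
  have hK : (initialIdeal r s • ⊤ : Submodule R M) = K := by
    rw [initialIdeal_eq r hx le_rfl]
  have hreg' : IsWeaklyRegular (M ⧸ K) ((List.range' s e).map x) := by
    rw [← hys']
    exact hK ▸ hreg
  refine ⟨x, s + e, Nat.le_add_right _ _, hx, hmem, fun k hk => ?_, ?_, ?_⟩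
  · obtain ⟨d, hd, hle⟩ := le_supportDim h.isSecant he hk.le
    have h1 := h.mem ⟨k, hk⟩
    rw [← hx, cohomologyAnnihilator] at h1
    simp only [hd] at h1
    change x k ∈ ∏ j ∈ Finset.range d, _ at h1
    rw [← initialIdeal_eq r hx hk.le]
    have h2 : ∏ j ∈ Finset.range d, Module.annihilator R
        ((localCohomology (maximalIdeal R) j).obj (ModuleCat.of R (initialQuotient r M k))) ≤
        ∏ i ∈ Finset.range (s + e - k), killIdeal (maximalIdeal R) i (initialQuotient r M k) := by
      obtain ⟨p, hp⟩ := Nat.exists_eq_add_of_le (show s + e - k ≤ d by lia)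
      rw [hp, Finset.prod_range_add]
      exact (Ideal.mul_le_inf.trans inf_le_left).trans (Finset.prod_le_prod' fun i _ c hc =>
        Kills.of_mem_annihilator _ hc)
    exact h2 h1
  · intro Γ hΓ hsΓ j hj hjΓ a ha
    let A := Γ \ Finset.range s
    have hA : Γ = A ∪ Finset.range s := (Finset.sdiff_union_of_subset hsΓ).symm
    have hjs : s ≤ j := not_lt.1 fun h => hjΓ (hsΓ (Finset.mem_range.2 h))
    let D := (Finset.Ico s (s + e)) \ insert j A
    -- The elements of `Γ` come first and `j` directly after them, so that regularity of the
    -- permuted sequence at `j` is the claim.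
    have hperm : (List.range' s e).Perm (A.toList ++ j :: D.toList) := by
      refine (List.perm_ext_iff_of_nodup List.nodup_range' ?_).2 fun k => ?_
      · rw [List.nodup_append, List.nodup_cons]
        refine ⟨Finset.nodup_toList _, ⟨by simp [D], Finset.nodup_toList _⟩, ?_⟩
        intro p hp q hq
        rw [Finset.mem_toList] at hp
        rintro rfl
        rcases List.mem_cons.1 hq with rfl | hq
        · exact hjΓ (Finset.mem_sdiff.1 hp).1
        · rw [Finset.mem_toList] at hq
          exact (Finset.mem_sdiff.1 hq).2 (Finset.mem_insert_of_mem hp)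
      · have := Finset.mem_range.1 hj
        have hk : k ∈ Γ → k < s + e := fun h => Finset.mem_range.1 (hΓ h)
        simp only [List.mem_range'_1, List.mem_append, List.mem_cons, Finset.mem_toList, D, A,
          Finset.mem_sdiff, Finset.mem_insert, Finset.mem_range, Finset.mem_Ico]
        by_cases hkj : k = j
        · subst hkj; simp; lia
        · by_cases hkΓ : k ∈ Γ
          · have := hk hkΓ
            simp [hkj, hkΓ]
            lia
          · simp [hkj, hkΓ]
    have h1 := isWeaklyRegular_of_perm_of_subset_maximalIdeal hreg' (hperm.map x) (by
      intro y hy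
      obtain ⟨k, -, rfl⟩ := List.mem_map.1 hy
      exact hmem k)
    rw [List.map_append, List.map_cons, isWeaklyRegular_append_iff, isWeaklyRegular_cons_iff] at h1
    have h2 := h1.2.1
    have h3 (t : M) : K.mkQ t ∈ (Ideal.ofList (A.toList.map x) • ⊤ : Submodule R (M ⧸ K)) ↔
        t ∈ powerSum M x (fun _ => 1) Γ := by
      have : Ideal.ofList (A.toList.map x) = Ideal.span ((fun k => x k ^ 1) '' (A : Set ℕ)) := by
        refine congrArg Ideal.span (Set.ext fun y => ?_)
        simp
      rw [this, ← varSum_eq_span_smul, mkQ_mem_varSum_iff, powerSum, hA, varSum_eq_span_smul,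
        varSum_eq_span_smul, ← Submodule.sup_smul, ← Ideal.span_union, Finset.coe_union,
        Set.image_union, Finset.coe_range]
      simp only [pow_one]
    rw [← h3] at ha ⊢
    rw [isSMulRegular_iff_right_eq_zero_of_smul] at h2
    refine (Submodule.Quotient.mk_eq_zero _).1 (h2 _ ?_)
    rw [map_smul] at ha
    exact (Submodule.Quotient.mk_eq_zero _).2 ha
  · have : Nontrivial (M ⧸ K) := hK ▸ this
    have h1 := Module.supportDim_add_length_eq_supportDim_of_isRegular _
      (IsRegular.of_isWeaklyRegular_of_mem_maximalIdeal _ (by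
        intro y hy
        obtain ⟨k, -, rfl⟩ := List.mem_map.1 hy
        exact hmem k) hreg')
    have h2 : Module.supportDim R (M ⧸ K) = e := hK ▸ he
    rw [h2, List.length_map, List.length_range'] at h1
    have h3 : Module.supportDim R
        ((M ⧸ K) ⧸ Ideal.ofList ((List.range' s e).map x) • (⊤ : Submodule R (M ⧸ K))) = 0 := by
      generalize Module.supportDim R
        ((M ⧸ K) ⧸ Ideal.ofList ((List.range' s e).map x) • (⊤ : Submodule R (M ⧸ K))) = d at h1
      induction d using WithBot.recBotCoe with
      | bot => exact absurd h1 (by simp)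
      | coe d =>
        induction d using ENat.recTopCoe with
        | top =>
          have : (⊤ : ℕ∞) + e = e := by exact_mod_cast h1
          simp at this
        | coe d =>
          have : d + e = e := by exact_mod_cast h1
          have : d = 0 := by lia
          subst this
          rfl
    have h4 := support_of_supportDim_eq_zero _ _ h3
    rw [Module.support_quotient, Module.support_quotient, Module.support_eq_zeroLocus,
      ← PrimeSpectrum.zeroLocus_sup, ← PrimeSpectrum.zeroLocus_sup] at h4
    have h5 := (PrimeSpectrum.zeroLocus_subset_zeroLocus_iff _ _).1 h4.le
    obtain ⟨P, hP⟩ := Ideal.exists_pow_le_of_le_radical_of_fg h5 (IsNoetherian.noetherian _)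
    refine ⟨P, hP.trans (sup_le (sup_le le_sup_left (le_sup_of_le_right (Ideal.span_mono
      (Set.image_mono fun k hk => lt_of_lt_of_le hk (Nat.le_add_right _ _)))))
      (le_sup_of_le_right (Ideal.span_mono ?_)))⟩
    intro y hy
    obtain ⟨k, hk, rfl⟩ := List.mem_map.1 hy
    exact ⟨k, (List.mem_range'_1.1 hk).2, rfl⟩

end

end CMSecant

/-! ### Weakly regular sequences of products, and splitting of monic polynomials. -/

namespace RingTheory.Sequence.IsWeaklyRegular

open scoped Pointwise

variable {A : Type*} [CommRing A]

theorem of_retract {X Y : Type*} [AddCommGroup X] [Module A X] [AddCommGroup Y] [Module A Y]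
    {rs : List A} (h : IsWeaklyRegular Y rs) (i : X →ₗ[A] Y) (p : Y →ₗ[A] X)
    (hpi : p ∘ₗ i = LinearMap.id) : IsWeaklyRegular X rs := by
  induction rs generalizing X Y with
  | nil => exact .nil A X
  | cons r rs ih =>
    rw [isWeaklyRegular_cons_iff] at h ⊢
    have hi : Function.Injective i :=
      Function.LeftInverse.injective (g := p) fun x => LinearMap.congr_fun hpi x
    refine ⟨h.1.of_injective i hi, ih h.2 (QuotSMulTop.map r i) (QuotSMulTop.map r p) ?_⟩
    rw [← QuotSMulTop.map_comp, hpi, QuotSMulTop.map_id]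

/-- Regularity of the first term on `W` keeps the sequence exact on the left after division by it,
so the induction continues on the quotients. -/
theorem of_exact {X Y W : Type*} [AddCommGroup X] [Module A X] [AddCommGroup Y] [Module A Y]
    [AddCommGroup W] [Module A W] {rs : List A} {i : X →ₗ[A] Y} {p : Y →ₗ[A] W}
    (hX : IsWeaklyRegular X rs) (hW : IsWeaklyRegular W rs) (hi : Function.Injective i)
    (hip : Function.Exact i p) (hp : Function.Surjective p) : IsWeaklyRegular Y rs := by
  induction rs generalizing X Y W with
  | nil => exact .nil A Y
  | cons r rs ih =>
    rw [isWeaklyRegular_cons_iff] at hX hW ⊢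
    have hreg : IsSMulRegular Y r := by
      refine isSMulRegular_iff_right_eq_zero_of_smul.2 fun y hy => ?_
      have h1 : p y = 0 := isSMulRegular_iff_right_eq_zero_of_smul.1 hW.1 _ (by
        rw [← map_smul, hy, map_zero])
      obtain ⟨x, rfl⟩ := (hip y).1 h1
      rw [isSMulRegular_iff_right_eq_zero_of_smul.1 hX.1 x (hi (by
        rw [map_smul, hy, map_zero])), map_zero]
    refine ⟨hreg, ih hX.2 hW.2 (i := QuotSMulTop.map r i) (p := QuotSMulTop.map r p) ?_
      (QuotSMulTop.map_exact r hip hp) (QuotSMulTop.map_surjective r hp)⟩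
    rw [← LinearMap.ker_eq_bot, LinearMap.ker_eq_bot']
    intro x hx
    obtain ⟨x, rfl⟩ := Submodule.Quotient.mk_surjective _ x
    have hx' : i x ∈ r • (⊤ : Submodule A Y) :=
      (Submodule.Quotient.mk_eq_zero (r • (⊤ : Submodule A Y))).1 hx
    obtain ⟨y, -, hy⟩ := (Submodule.mem_smul_pointwise_iff_exists _ _ _).1 hx'
    have h1 : p y = 0 := isSMulRegular_iff_right_eq_zero_of_smul.1 hW.1 _ (by
      rw [← map_smul, hy, (hip _).2 ⟨x, rfl⟩])
    obtain ⟨x', rfl⟩ := (hip y).1 h1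
    rw [← map_smul] at hy
    rw [← hi hy]
    exact (Submodule.Quotient.mk_eq_zero _).2 (Submodule.smul_mem_pointwise_smul _ _ ⊤ trivial)

/-- Multiplication by `a` gives the exact sequence `0 → Z / b Z → Z / a b Z → Z / a Z → 0`. -/
theorem mul_cons {Z : Type*} [AddCommGroup Z] [Module A Z] {a b : A} {rs : List A}
    (ha : IsWeaklyRegular Z (a :: rs)) (hb : IsWeaklyRegular Z (b :: rs)) :
    IsWeaklyRegular Z ((a * b) :: rs) := by
  rw [isWeaklyRegular_cons_iff] at ha hb ⊢
  refine ⟨ha.1.mul hb.1, ?_⟩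
  let i : QuotSMulTop b Z →ₗ[A] QuotSMulTop (a * b) Z :=
    Submodule.mapQ _ _ (LinearMap.lsmul A Z a) (by
      intro z hz
      obtain ⟨y, -, rfl⟩ := (Submodule.mem_smul_pointwise_iff_exists _ _ _).1 hz
      rw [Submodule.mem_comap, LinearMap.lsmul_apply, ← mul_smul]
      exact Submodule.smul_mem_pointwise_smul _ _ ⊤ trivial)
  let p : QuotSMulTop (a * b) Z →ₗ[A] QuotSMulTop a Z :=
    Submodule.mapQ _ _ LinearMap.id (by
      intro z hz
      obtain ⟨y, -, rfl⟩ := (Submodule.mem_smul_pointwise_iff_exists _ _ _).1 hz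
      rw [Submodule.mem_comap, LinearMap.id_apply, mul_smul]
      exact Submodule.smul_mem_pointwise_smul _ _ ⊤ trivial)
  refine of_exact hb.2 ha.2 (i := i) (p := p) ?_ ?_ ?_
  · rw [← LinearMap.ker_eq_bot, LinearMap.ker_eq_bot']
    intro z hz
    obtain ⟨z, rfl⟩ := Submodule.Quotient.mk_surjective _ z
    have hz' : a • z ∈ (a * b) • (⊤ : Submodule A Z) :=
      (Submodule.Quotient.mk_eq_zero ((a * b) • (⊤ : Submodule A Z))).1 hz
    obtain ⟨y, -, hy⟩ := (Submodule.mem_smul_pointwise_iff_exists _ _ _).1 hz'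
    rw [mul_smul] at hy
    rw [← ha.1 hy]
    exact (Submodule.Quotient.mk_eq_zero _).2 (Submodule.smul_mem_pointwise_smul _ _ ⊤ trivial)
  · intro z
    obtain ⟨z, rfl⟩ := Submodule.Quotient.mk_surjective _ z
    constructor
    · intro hz
      have hz' : z ∈ a • (⊤ : Submodule A Z) :=
        (Submodule.Quotient.mk_eq_zero (a • (⊤ : Submodule A Z))).1 hz
      obtain ⟨y, -, rfl⟩ := (Submodule.mem_smul_pointwise_iff_exists _ _ _).1 hz'
      exact ⟨Submodule.Quotient.mk y, rfl⟩
    · rintro ⟨y, hy⟩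
      obtain ⟨y, rfl⟩ := Submodule.Quotient.mk_surjective _ y
      rw [← hy]
      exact (Submodule.Quotient.mk_eq_zero _).2 (Submodule.smul_mem_pointwise_smul _ _ ⊤ trivial)
  · intro z
    obtain ⟨z, rfl⟩ := Submodule.Quotient.mk_surjective _ z
    exact ⟨Submodule.Quotient.mk z, rfl⟩

theorem prod_cons {Z : Type*} [AddCommGroup Z] [Module A Z] {l rs : List A} (hl : l ≠ [])
    (h : ∀ a ∈ l, IsWeaklyRegular Z (a :: rs)) : IsWeaklyRegular Z (l.prod :: rs) := by
  induction l with
  | nil => exact absurd rfl hl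
  | cons a l ih =>
    rw [List.prod_cons]
    by_cases hl' : l = []
    · subst hl'
      rw [List.prod_nil, mul_one]
      exact h a (by simp)
    · exact (h a (by simp)).mul_cons (ih hl' fun b hb => h b (by simp [hb]))

/-- If all sequences obtained by choosing a factor of each of the terms of a sequence of products
are weakly regular, then so is the sequence of products. -/
theorem map_prod_append {ι : Type*} [DecidableEq ι] {L : ι → List A} {ks : List ι} {rs : List A}
    (hks : ks.Nodup)
    {Z : Type*} [AddCommGroup Z] [Module A Z] (hL : ∀ k, L k ≠ [])
    (h : ∀ u : ι → A, (∀ k, u k ∈ L k) → IsWeaklyRegular Z (ks.map u ++ rs)) :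
    IsWeaklyRegular Z (ks.map (fun k => (L k).prod) ++ rs) := by
  have hu0 : ∃ u : ι → A, ∀ k, u k ∈ L k :=
    ⟨fun k => (L k).head (hL k), fun k => List.head_mem _⟩
  induction ks generalizing Z with
  | nil =>
    obtain ⟨u, hu⟩ := hu0
    exact h u hu
  | cons k ks ih =>
    rw [List.nodup_cons] at hks
    rw [List.map_cons, List.cons_append]
    refine prod_cons (hL k) fun a ha => ?_
    have key : ∀ u : ι → A, (∀ k, u k ∈ L k) → IsWeaklyRegular Z (a :: (ks.map u ++ rs)) := by
      intro u hu
      have := h (Function.update u k a) fun j => by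
        by_cases hj : j = k
        · subst hj; simpa using ha
        · rw [Function.update_of_ne hj]; exact hu j
      rwa [List.map_cons, Function.update_self, List.cons_append,
        List.map_congr_left (g := u)] at this
      intro j hj
      exact Function.update_of_ne (fun e : j = k => hks.1 (e ▸ hj)) _ _
    obtain ⟨u, hu⟩ := hu0
    rw [isWeaklyRegular_cons_iff]
    refine ⟨((isWeaklyRegular_cons_iff _ _ _).1 (key u hu)).1, ih hks.2 fun u hu => ?_⟩
    exact ((isWeaklyRegular_cons_iff _ _ _).1 (key u hu)).2

end RingTheory.Sequence.IsWeaklyRegular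

/-- A monic polynomial splits over a finite free extension of the coefficient ring. -/
theorem Polynomial.Monic.exists_map_eq_prod {R : Type u} [CommRing R] [Nontrivial R]
    {h : R[X]} (hh : h.Monic) :
    ∃ (B : Type u) (_ : CommRing B) (_ : Algebra R B) (_ : Module.Finite R B) (_ : Module.Free R B)
      (_ : Nontrivial B) (l : List B), l.length = h.natDegree ∧
        h.map (algebraMap R B) = (l.map fun a => X - C a).prod := by
  obtain ⟨B, _, _, _, _, _, hB⟩ := hh.exists_splits_map
  obtain ⟨m, hm⟩ := Polynomial.splits_iff_exists_multiset.1 hB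
  rw [(hh.map _).leadingCoeff, C_1, one_mul] at hm
  refine ⟨B, ‹_›, ‹_›, ‹_›, ‹_›, ‹_›, m.toList, ?_, ?_⟩
  · rw [Multiset.length_toList, ← hh.natDegree_map (algebraMap R B), hm,
      Polynomial.natDegree_multiset_prod_X_sub_C_eq_card]
  · rw [hm]
    conv_lhs => rw [← Multiset.coe_toList m]
    rw [Multiset.map_coe, Multiset.prod_coe]

/-! ### Affine charts and translation of their coordinates. -/

namespace VarSum

open scoped TensorProduct

variable {R A M M' : Type*} [CommRing R] [CommRing A] [Algebra R A]
  [AddCommGroup M] [Module R M] [AddCommGroup M'] [Module R M'] [Module A M'] [IsScalarTower R A M']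

/-- An affine chart, with pivots `f k` and coordinates `c k`, of the blowing up of `M` along the
product of the ideals generated by initial segments of `x 0, …, x (s - 1)`. -/
structure IsAffineChart (x : ℕ → R) (f : ℕ → ℕ) (c : ℕ → A) (s : ℕ) (φ : M →ₗ[R] M') : Prop where
  start : f 1 = 0
  coordinate : IsCoordinate x f c 1 (s - 1)
  regular : ∀ k, 1 ≤ k → k ≤ s → ∀ z : M', x (f k) • z = 0 → z = 0
  ker : ∀ y, φ y = 0 → ∃ q, (∏ k ∈ Finset.Icc 1 s, x (f k)) ^ q • y = 0
  adjoin : Algebra.adjoin R {a | ∃ k, 1 ≤ k ∧ k < s ∧ c k = a} = ⊤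
  span : Submodule.span A (Set.range φ) = ⊤

namespace IsCoordinate

variable {x : ℕ → R} {f : ℕ → ℕ} {c : ℕ → A} {s : ℕ}

theorem lt_of_start (hf : f 1 = 0) (h : IsCoordinate x f c 1 (s - 1)) {k : ℕ} (hk : 1 ≤ k)
    (hks : k ≤ s) : f k < k := by
  have := h.pivot_mem hk (by omega)
  simp only [hf, Finset.mem_insert, Finset.mem_Ico] at this
  omega

theorem pivot_eq (hf : f 1 = 0) (h : IsCoordinate x f c 1 (s - 1)) {k : ℕ} (hk : 1 ≤ k)
    (hks : k ≤ s) : f k = 0 ∨ (1 ≤ f k ∧ f (f k + 1) = f k) := by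
  induction k, hk using Nat.le_induction with
  | base => exact .inl hf
  | succ k hk ih =>
    rcases h k hk (by omega) with ⟨e, -⟩ | ⟨e, -⟩
    · rw [e]; exact ih (by omega)
    · rw [e]; exact .inr ⟨hk, e⟩

/-- A positive index becomes a pivot only where the pivot changes. Coordinates are translated only
where the pivot is kept, so pivots are unaffected by translation. -/
theorem ne_of_pivot (hf : f 1 = 0) (h : IsCoordinate x f c 1 (s - 1)) {k : ℕ} (hk : 1 ≤ k)
    (hks : k ≤ s) : ¬ (1 ≤ f k ∧ f (f k + 1) = f (f k)) := by
  rintro ⟨h1, h2⟩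
  have h3 := h.lt_of_start hf hk hks
  have h4 := h.lt_of_start hf h1 (by omega)
  rcases h.pivot_eq hf hk hks with h5 | ⟨-, h5⟩ <;> omega

end IsCoordinate

theorem IsAdmissible.smul_eq_zero_of_mem_closure {B X : Type*} [CommRing B] [AddCommGroup X]
    [Module B X] {x : ℕ → B} {n s : ℕ} (h : IsAdmissible X x (Finset.range n) s) {g : B}
    (hg : g ∈ Submonoid.closure (x '' (Finset.range n : Set ℕ))) (y : X) (hy : g • y = 0) :
    0 < n → x 0 • y = 0 := by
  intro hn
  have hcol := h.strong (fun _ => 1) (fun _ => one_ne_zero) ∅ (Finset.empty_subset _) 0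
    (Finset.mem_range.2 hn) (Finset.notMem_empty _)
  have hbot (a : X) : a ∈ powerSum X x (fun _ => 1) ∅ ↔ a = 0 := by
    rw [powerSum, varSum_eq_span_smul]
    simp
  induction hg using Submonoid.closure_induction generalizing y with
  | mem g hg =>
    obtain ⟨j, hj, rfl⟩ := hg
    exact (hbot _).1 (hcol.smul_mem_of_le (Finset.mem_coe.1 hj) (Nat.zero_le _)
      (Finset.notMem_empty _) ((hbot _).2 hy))
  | one => rw [one_smul] at hy; rw [hy, smul_zero]
  | mul g g' _ _ hg hg' =>
    have h1 := hg (g' • y) (by rwa [mul_smul] at hy)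
    rw [smul_comm] at h1
    have h2 := hg' _ h1
    exact (hbot _).1 (hcol.smul_mem_of_pow (m := 1) (Finset.mem_range.2 hn)
      (Finset.notMem_empty _) ((hbot _).2 (by rw [pow_two, mul_smul, h2])))

section BaseChange

variable {x₀ : ℕ → R} {f : ℕ → ℕ} {c : ℕ → A} {s : ℕ} {φ : M →ₗ[R] M'}
  {B : Type*} [CommRing B] [Algebra R B]

attribute [local instance] Algebra.TensorProduct.rightAlgebra

/-- The sequence `x₀ k - τ k * x₀ (f k)`. -/
def translate (x₀ : ℕ → R) (f : ℕ → ℕ) (τ : ℕ → B) (k : ℕ) : B :=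
  algebraMap R B (x₀ k) - τ k * algebraMap R B (x₀ (f k))

variable {τ : ℕ → B}

/-- The pivot index satisfies `f k < k`, so the correction is a multiple of a preceding term. -/
theorem isUnitriangular_translate (hτ : ∀ k, τ k ≠ 0 → 1 ≤ k ∧ k < s ∧ f (k + 1) = f k)
    (hf : f 1 = 0) (h : IsCoordinate x₀ f c 1 (s - 1)) :
    LocalCohomology.IsUnitriangular x₀ (translate x₀ f τ) s where
  sub_mem k hk := by
    rw [translate, sub_sub_cancel_left]
    by_cases h0 : τ k = 0
    · simp [h0]
    · obtain ⟨h1, h2, -⟩ := hτ k h0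
      exact neg_mem (Ideal.mul_mem_left _ _ (Ideal.mem_map_of_mem _ (Ideal.subset_span
        ⟨f k, h.lt_of_start hf h1 h2.le, rfl⟩)))
  eq k hk := by
    have : τ k = 0 := by
      by_contra h0
      have := (hτ k h0).2.1
      omega
    rw [translate, this, zero_mul, sub_zero]

theorem translate_pivot (hτ : ∀ k, τ k ≠ 0 → 1 ≤ k ∧ k < s ∧ f (k + 1) = f k) (hf : f 1 = 0)
    (h : IsCoordinate x₀ f c 1 (s - 1)) {k : ℕ} (hk : 1 ≤ k) (hks : k ≤ s) :
    translate x₀ f τ (f k) = algebraMap R B (x₀ (f k)) := by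
  have : τ (f k) = 0 := by
    by_contra h0
    obtain ⟨h1, h2, h3⟩ := hτ _ h0
    exact h.ne_of_pivot hf hk hks ⟨h1, h3⟩
  rw [translate, this, zero_mul, sub_zero]

/-- If `c k = x k / x (f k)`, then `c k - τ k` is the quotient of `x k - τ k x (f k)` by the
unchanged pivot; where the pivot changes, nothing is translated. -/
theorem isCoordinate_translate (hτ : ∀ k, τ k ≠ 0 → 1 ≤ k ∧ k < s ∧ f (k + 1) = f k)
    (hf : f 1 = 0) (h : IsCoordinate x₀ f c 1 (s - 1)) :
    IsCoordinate (translate x₀ f τ) f (fun k => (c k ⊗ₜ 1 - 1 ⊗ₜ τ k : A ⊗[R] B)) 1 (s - 1) := by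
  intro k hk hks
  have hR (r : R) : algebraMap B (A ⊗[R] B) (algebraMap R B r) =
      algebraMap A (A ⊗[R] B) (algebraMap R A r) := by
    rw [← IsScalarTower.algebraMap_apply, ← IsScalarTower.algebraMap_apply]
  have hA (a : A) : (a ⊗ₜ 1 : A ⊗[R] B) = algebraMap A (A ⊗[R] B) a := rfl
  have hB (b : B) : (1 ⊗ₜ b : A ⊗[R] B) = algebraMap B (A ⊗[R] B) b := rfl
  have hp := translate_pivot hτ hf h hk (by omega : k ≤ s)
  rcases h k hk hks with ⟨h1, h2⟩ | ⟨h1, h2⟩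
  · refine .inl ⟨h1, ?_⟩
    beta_reduce
    rw [hp, translate, map_sub, map_mul, hR, hR, hA, hB, sub_mul, ← map_mul, h2]
  · have h0 : τ k = 0 := by
      by_contra h0
      have := (hτ k h0).2.2
      have := h.lt_of_start hf hk (by omega)
      omega
    refine .inr ⟨h1, ?_⟩
    beta_reduce
    rw [hp, translate, h0, zero_mul, sub_zero, hR, hR, hA, TensorProduct.tmul_zero, sub_zero,
      ← map_mul, h2]

end BaseChange

end VarSum

/-! ### Regular sequences on affine charts after base change. -/

namespace VarSum

open scoped TensorProduct

open LocalCohomology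

set_option linter.unusedSectionVars false

section BaseChange

attribute [local instance] Algebra.TensorProduct.rightAlgebra

variable {R A M M' : Type*} [CommRing R] [CommRing A] [Algebra R A]
  [AddCommGroup M] [Module R M] [AddCommGroup M'] [Module R M'] [Module A M'] [IsScalarTower R A M']
  {x₀ : ℕ → R} {f : ℕ → ℕ} {c : ℕ → A} {s n : ℕ} {φ : M →ₗ[R] M'}
  {B : Type*} [CommRing B] [Algebra R B] {τ : ℕ → B}
  {Z : Type*} [AddCommGroup Z] [Module A Z] [Module B Z] [Module (A ⊗[R] B) Z]
  [IsScalarTower A (A ⊗[R] B) Z] [IsScalarTower B (A ⊗[R] B) Z]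
  {ι : Type*} [Fintype ι] [DecidableEq ι]

/-- The module `Z` stands for the base change of `M'` to `B` and enters only through its coordinates
`κ` in `M'`. Regularity of the pivots and the kernel condition are checked coordinatewise; an
element killed by a product of pivots is killed by `x 0`, by the strong d-sequence property.
Translated and original coordinates generate the same algebra over `B`. -/
theorem IsAffineChart.isChart_translate (h : IsAffineChart x₀ f c s φ) (hs : 1 ≤ s) (hsn : s ≤ n)
    (hτ : ∀ k, τ k ≠ 0 → 1 ≤ k ∧ k < s ∧ f (k + 1) = f k)
    (hX : IsAdmissible (B ⊗[R] M) (translate x₀ f τ) (Finset.range n) s)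
    (j : M' →ₗ[A] Z) (κ : ι → Z →ₗ[A] M')
    (b : Module.Basis ι R B) (hκ : ∀ k β m, κ k (β • j m) = b.repr β k • m)
    (hZ : ∀ z, z = ∑ k, b k • j (κ k z)) (ψ : B ⊗[R] M →ₗ[B] Z)
    (hψ : ∀ β m, ψ (β ⊗ₜ m) = β • j (φ m)) :
    IsChart (translate x₀ f τ) f (fun k => (c k ⊗ₜ 1 - 1 ⊗ₜ τ k : A ⊗[R] B)) 1 (s - 1) ψ := by
  have hcoord (k : ι) (t : B ⊗[R] M) : κ k (ψ t) = φ (tensorCoord b M k t) := by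
    induction t using TensorProduct.induction_on with
    | zero => simp
    | tmul β m => rw [hψ, hκ, tensorCoord_tmul, map_smul]
    | add t t' ht ht' => simp only [map_add, ht, ht']
  have hR (r : R) (z : Z) : algebraMap R B r • z = algebraMap R A r • z := by
    rw [← algebraMap_smul (A ⊗[R] B) (algebraMap R B r), ← algebraMap_smul (A ⊗[R] B)
      (algebraMap R A r), ← IsScalarTower.algebraMap_apply, ← IsScalarTower.algebraMap_apply]
  refine ⟨fun k hk hks z hz => ?_, fun y hy => ?_, fun P hP hc => ?_⟩
  · rw [translate_pivot hτ h.start h.coordinate hk (by omega), hR] at hz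
    rw [hZ z]
    refine Finset.sum_eq_zero fun l _ => ?_
    rw [h.regular k hk (by omega) (κ l z) (by
      rw [← algebraMap_smul A (x₀ (f k)), ← map_smul, hz, map_zero]), map_zero, smul_zero]
  · have h0 (k : ι) : φ (tensorCoord b M k y) = 0 := by rw [← hcoord, hy, map_zero]
    choose q hq using fun k => h.ker _ (h0 k)
    set g := ∏ k ∈ Finset.Icc 1 s, x₀ (f k) with hg
    have hgy : algebraMap R B (g ^ ∑ k, q k) • y = 0 := by
      rw [← sum_tmul_tensorCoord b M y, Finset.smul_sum]
      refine Finset.sum_eq_zero fun k _ => ?_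
      obtain ⟨t, ht⟩ : ∃ t, ∑ l, q l = t + q k :=
        ⟨_, (Finset.sum_erase_add _ _ (Finset.mem_univ k)).symm⟩
      rw [algebraMap_smul, ← TensorProduct.tmul_smul, ht, pow_add, mul_smul, hq k, smul_zero,
        TensorProduct.tmul_zero]
    rw [h.start]
    refine hX.smul_eq_zero_of_mem_closure ?_ y hgy (by omega)
    rw [map_pow, hg, map_prod]
    refine pow_mem (Submonoid.prod_mem _ fun k hk => ?_) _
    obtain ⟨hk, hks⟩ := Finset.mem_Icc.1 hk
    rw [← translate_pivot hτ h.start h.coordinate hk hks]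
    have := h.coordinate.lt_of_start h.start hk hks
    exact Submonoid.subset_closure ⟨f k, Finset.mem_coe.2 (Finset.mem_range.2 (by omega)), rfl⟩
  · have hA (a : A) (z : Z) : (a ⊗ₜ 1 : A ⊗[R] B) • z = a • z := algebraMap_smul (A ⊗[R] B) a z
    have hB (β : B) (z : Z) : (1 ⊗ₜ β : A ⊗[R] B) • z = β • z := algebraMap_smul (A ⊗[R] B) β z
    let S : Subalgebra R A :=
      { carrier := {a | ∀ z ∈ P, a • z ∈ P}
        mul_mem' := fun {a a'} ha ha' z hz => by rw [mul_smul]; exact ha _ (ha' z hz)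
        one_mem' := fun z hz => by rwa [one_smul]
        add_mem' := fun {a a'} ha ha' z hz => by rw [add_smul]; exact add_mem (ha z hz) (ha' z hz)
        zero_mem' := fun z hz => by rw [zero_smul]; exact zero_mem _
        algebraMap_mem' := fun r z hz => by rw [← hR]; exact P.smul_mem _ hz }
    have hS : S = ⊤ := by
      rw [← top_le_iff, ← h.adjoin]
      refine Algebra.adjoin_le ?_
      rintro _ ⟨k, hk, hks, rfl⟩ z hz
      have := hc k hk (by omega) z hz
      rw [sub_smul, hA, hB] at this
      simpa using add_mem this (P.smul_mem (τ k) hz)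
    have hAP (a : A) {z : Z} (hz : z ∈ P) : a • z ∈ P := by
      have : a ∈ S := by rw [hS]; trivial
      exact this z hz
    have hjP (m : M') : j m ∈ P := by
      have : m ∈ Submodule.span A (Set.range φ) := by rw [h.span]; trivial
      induction this using Submodule.span_induction with
      | mem m hm =>
        obtain ⟨m, rfl⟩ := hm
        exact hP ⟨1 ⊗ₜ m, by rw [hψ, one_smul]⟩
      | zero => rw [map_zero]; exact zero_mem _
      | add m m' _ _ hm hm' => rw [map_add]; exact add_mem hm hm'
      | smul a m _ hm => rw [map_smul]; exact hAP a hm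
    rw [eq_top_iff]
    intro z _
    rw [hZ z]
    exact sum_mem fun k _ => P.smul_mem _ (hjP _)

end BaseChange

section

attribute [local instance] Algebra.TensorProduct.rightAlgebra

variable {R : Type u} [CommRing R] [IsNoetherianRing R] [IsLocalRing R]
  {M : Type u} [AddCommGroup M] [Module R M] [Module.Finite R M]
  {A M' : Type*} [CommRing A] [Algebra R A]
  [AddCommGroup M'] [Module R M'] [Module A M'] [IsScalarTower R A M']
  {x : ℕ → R} {f : ℕ → ℕ} {c : ℕ → A} {s n : ℕ} {φ : M →ₗ[R] M'}

/-- On an affine chart the coordinates with pivot index, the values of a monic polynomial at the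
other coordinates, and the remaining parameters form a weakly regular sequence. -/
theorem IsAffineChart.isWeaklyRegular (h : IsAffineChart x f c s φ) (hM : IsSecantSystem M x s n)
    (hs : 1 ≤ s) (hsn : s ≤ n) {p : R[X]} (hp : p.Monic) (hp0 : p.natDegree ≠ 0) :
    RingTheory.Sequence.IsWeaklyRegular M'
      ((List.range' 1 (s - 1)).map (fun k => if f (k + 1) = f k then p.aeval (c k) else c k) ++
        (x (f s) :: (List.range' s (n - s)).map x).map (algebraMap R A)) := by
  obtain ⟨B, _, _, _, _, _, l, hl, hpl⟩ := hp.exists_map_eq_prod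
  let b := Module.Free.chooseBasis R B
  let bA : Module.Basis _ A (A ⊗[R] B) := b.baseChange A
  have : IsScalarTower B (A ⊗[R] B) ((A ⊗[R] B) ⊗[A] M') := inferInstance
  have : IsScalarTower R B ((A ⊗[R] B) ⊗[A] M') := inferInstance
  let j : M' →ₗ[A] (A ⊗[R] B) ⊗[A] M' := TensorProduct.mk A (A ⊗[R] B) M' 1
  let κ := tensorCoord bA M'
  have hBj (β : B) (m : M') : β • j m = (1 ⊗ₜ β : A ⊗[R] B) ⊗ₜ m := by
    rw [TensorProduct.mk_apply, TensorProduct.smul_tmul', Algebra.smul_def, mul_one]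
    rfl
  have hκ (k) (β : B) (m : M') : κ k (β • j m) = b.repr β k • m := by
    rw [hBj, tensorCoord_tmul]
    simp [bA]
  have hZ (z : (A ⊗[R] B) ⊗[A] M') : z = ∑ k, b k • j (κ k z) := by
    conv_lhs => rw [← sum_tmul_tensorCoord bA M' z]
    refine Finset.sum_congr rfl fun k _ => ?_
    rw [hBj]
    simp [bA, κ]
  let ψ : B ⊗[R] M →ₗ[B] (A ⊗[R] B) ⊗[A] M' :=
    LinearMap.liftBaseChange B ((j.restrictScalars R) ∘ₗ φ)
  have hψ (β : B) (m : M) : ψ (β ⊗ₜ m) = β • j (φ m) := by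
    simp [ψ]
  have hne : Nonempty (Module.Free.ChooseBasisIndex R B) := inferInstance
  obtain ⟨k₀⟩ := hne
  -- A basis vector of `B` embeds `M'` as a direct summand of its base change, so regularity may be
  -- tested there.
  refine RingTheory.Sequence.IsWeaklyRegular.of_retract (Y := (A ⊗[R] B) ⊗[A] M') ?_
    ((TensorProduct.mk A (A ⊗[R] B) M' (1 ⊗ₜ b k₀))) (κ k₀) (by
      ext m
      have := hκ k₀ (b k₀) m
      rw [hBj] at this
      simpa using this)
  rw [← RingTheory.Sequence.isWeaklyRegular_map_algebraMap_iff (S := A ⊗[R] B), List.map_append,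
    List.map_map]
  -- The linear factors of `p` at `c k` where the pivot is kept, and `c k` alone otherwise. The
  -- range condition ensures that indices outside the chart are not translated.
  let L (k : ℕ) : List (A ⊗[R] B) := if 1 ≤ k ∧ k < s ∧ f (k + 1) = f k then
    l.map (fun a => c k ⊗ₜ 1 - 1 ⊗ₜ a) else [c k ⊗ₜ 1]
  have hL (k : ℕ) : L k ≠ [] := by
    have : l ≠ [] := by
      rintro rfl
      exact hp0 hl.symm
    dsimp only [L]
    split_ifs <;> simp [this]
  have hprod (k : ℕ) (hk : k ∈ List.range' 1 (s - 1)) :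
      (algebraMap A (A ⊗[R] B) ∘ fun k => if f (k + 1) = f k then p.aeval (c k) else c k) k =
        (L k).prod := by
    rw [List.mem_range'_1] at hk
    dsimp only [L, Function.comp_apply]
    by_cases hfk : f (k + 1) = f k
    · rw [if_pos hfk, if_pos ⟨hk.1, by omega, hfk⟩]
      have := congrArg (fun q => Polynomial.aeval (c k ⊗ₜ 1 : A ⊗[R] B) q) hpl
      rw [Polynomial.aeval_map_algebraMap, map_list_prod, List.map_map] at this
      rw [← Polynomial.aeval_algebraMap_apply]
      refine this.trans (congrArg List.prod (List.map_congr_left fun a _ => ?_))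
      simp
      rfl
    · rw [if_neg hfk, if_neg fun h => hfk h.2.2, List.prod_singleton]
      rfl
  rw [List.map_congr_left hprod]
  -- One linear factor is selected for each coordinate; the choices `τ` define a translated
  -- sequence, and the selected factors are the coordinates of the corresponding chart.
  refine RingTheory.Sequence.IsWeaklyRegular.map_prod_append List.nodup_range' hL fun u hu => ?_
  have hu' (k : ℕ) : ∃ τ : B, (τ ≠ 0 → 1 ≤ k ∧ k < s ∧ f (k + 1) = f k) ∧
      u k = c k ⊗ₜ 1 - 1 ⊗ₜ τ := by
    have := hu k
    dsimp only [L] at this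
    split_ifs at this with hk
    · obtain ⟨a, -, ha⟩ := List.mem_map.1 this
      exact ⟨a, fun _ => hk, ha.symm⟩
    · exact ⟨0, fun h => absurd rfl h, by
        rw [TensorProduct.tmul_zero, sub_zero]; exact List.mem_singleton.1 this⟩
  choose τ hτ hτu using hu'
  obtain rfl : u = fun k => c k ⊗ₜ 1 - 1 ⊗ₜ τ k := funext hτu
  have hX := hM.isAdmissible (isUnitriangular_translate hτ h.start h.coordinate)
  have hchart := h.isChart_translate hs hsn hτ hX j κ b hκ hZ ψ hψ
  have hset : insert (f 1) (Finset.Ico 1 n) = Finset.range n := by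
    rw [h.start]
    ext k
    simp only [Finset.mem_insert, Finset.mem_Ico, Finset.mem_range]
    omega
  have := hchart.isWeaklyRegular ψ (isCoordinate_translate hτ h.start h.coordinate)
    (by rw [h.start]; exact Nat.one_pos) (by omega) hsn (hset.symm ▸ hX)
  convert this using 2
  rw [List.map_map, List.map_cons, List.map_map, translate_pivot hτ h.start h.coordinate hs le_rfl]
  congr 1
  · simp only [Function.comp_apply]
    rw [← IsScalarTower.algebraMap_apply, ← IsScalarTower.algebraMap_apply]
  · refine List.map_congr_left fun k hk => ?_
    rw [List.mem_range'_1] at hk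
    rw [(isUnitriangular_translate hτ h.start h.coordinate).eq k hk.1]
    simp only [Function.comp_apply]
    rw [← IsScalarTower.algebraMap_apply, ← IsScalarTower.algebraMap_apply]

end

end VarSum

/-! ### Cohen-Macaulay modules over local rings: criteria, quotients and localization. -/

namespace CohenMacaulay

open IsLocalRing RingTheory.Sequence

open scoped Pointwise

section

variable {R : Type*} [CommRing R] [IsLocalRing R] [IsNoetherianRing R]
  {N : Type*} [AddCommGroup N] [Module R N] [Module.Finite R N]

theorem length_le_supportDim [Nontrivial N] {rs : List R} (hm : ∀ r ∈ rs, r ∈ maximalIdeal R)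
    (h : IsWeaklyRegular N rs) : (rs.length : WithBot ℕ∞) ≤ Module.supportDim R N := by
  have hr := IsRegular.of_isWeaklyRegular_of_mem_maximalIdeal N hm h
  rw [← Module.supportDim_add_length_eq_supportDim_of_isRegular rs hr]
  have : Nontrivial (N ⧸ (Ideal.ofList rs • ⊤ : Submodule R N)) := hr.quot_ofList_smul_nontrivial ⊤
  obtain ⟨d, hd⟩ := exists_supportDim_eq (R := R) (N ⧸ (Ideal.ofList rs • ⊤ : Submodule R N))
  rw [hd]
  exact_mod_cast Nat.le_add_left _ _

theorem isCohenMacaulayModule_of_le_length [Nontrivial N] {rs : List R}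
    (hm : ∀ r ∈ rs, r ∈ maximalIdeal R) (h : IsWeaklyRegular N rs)
    (hd : Module.supportDim R N ≤ rs.length) : IsCohenMacaulayModule R N := by
  refine .inr (le_antisymm ?_ ?_)
  · obtain ⟨d, hd'⟩ := exists_supportDim_eq (R := R) N
    have : depth R N ≤ d := by
      refine iSup_le fun ys => iSup_le fun h2 => iSup_le fun h3 => ?_
      have := length_le_supportDim h2 h3
      rw [hd'] at this
      exact_mod_cast this
    rw [hd']
    exact_mod_cast this
  · refine hd.trans ?_
    have : (rs.length : ℕ∞) ≤ depth R N :=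
      le_iSup_of_le rs (le_iSup_of_le hm (le_iSup_of_le h le_rfl))
    exact_mod_cast this

theorem isCohenMacaulayModule_of_supportDim_quotient [Nontrivial N] {rs : List R}
    (hm : ∀ r ∈ rs, r ∈ maximalIdeal R) (h : IsWeaklyRegular N rs)
    (hd : Module.supportDim R (N ⧸ (Ideal.ofList rs • ⊤ : Submodule R N)) ≤ 0) :
    IsCohenMacaulayModule R N := by
  refine isCohenMacaulayModule_of_le_length hm h ?_
  rw [← Module.supportDim_add_length_eq_supportDim_of_isRegular rs
    (IsRegular.of_isWeaklyRegular_of_mem_maximalIdeal N hm h)]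
  calc _ ≤ (0 : WithBot ℕ∞) + (rs.length : WithBot ℕ∞) := by gcongr
    _ = _ := zero_add _

theorem _root_.Ideal.ringKrullDim_quotient_add_one_le {R : Type*} [CommRing R] {P Q : Ideal R}
    [P.IsPrime] (h : P < Q) : ringKrullDim (R ⧸ Q) + 1 ≤ ringKrullDim (R ⧸ P) := by
  obtain ⟨x, hxQ, hxP⟩ := SetLike.exists_of_lt h
  have hx : Ideal.Quotient.mk P x ∈ nonZeroDivisors (R ⧸ P) := by
    rw [mem_nonZeroDivisors_iff_ne_zero, Ne, Ideal.Quotient.eq_zero_iff_mem]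
    exact hxP
  refine le_trans ?_ (ringKrullDim_quotient_succ_le_of_nonZeroDivisor hx)
  gcongr
  let g : (R ⧸ P) ⧸ Ideal.span {Ideal.Quotient.mk P x} →+* R ⧸ Q :=
    Ideal.Quotient.lift _ (Ideal.Quotient.factor h.le) (by
      suffices h : Ideal.span {Ideal.Quotient.mk P x} ≤
          RingHom.ker (Ideal.Quotient.factor h.le) from
        fun a ha => h ha
      rw [Ideal.span_singleton_le_iff_mem, RingHom.mem_ker, Ideal.Quotient.factor_mk,
        Ideal.Quotient.eq_zero_iff_mem]
      exact hxQ)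
  refine ringKrullDim_le_of_surjective g fun y => ?_
  obtain ⟨y, rfl⟩ := Ideal.Quotient.mk_surjective y
  exact ⟨Ideal.Quotient.mk _ (Ideal.Quotient.mk P y), rfl⟩

/-- Let `x` be the first term and `U ≠ 0` the submodule of elements killed by `P`. If `U` were
contained in `x N`, regularity of `x` would give `U = x U`, contradicting the Nakayama lemma. An
element of `U` outside `x N` provides an associated prime of `N / x N` that contains `P` and `x`,
hence is strictly larger than `P`; the induction continues with it. -/
theorem length_le_ringKrullDim_quotient {P : Ideal R} (hP : IsAssociatedPrime P N) {rs : List R}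
    (hm : ∀ r ∈ rs, r ∈ maximalIdeal R) (h : IsWeaklyRegular N rs) :
    (rs.length : WithBot ℕ∞) ≤ ringKrullDim (R ⧸ P) := by
  induction rs generalizing N P with
  | nil =>
    have := hP.isPrime
    rw [List.length_nil, Nat.cast_zero]
    exact ringKrullDim_nonneg_of_nontrivial
  | cons x rs ih =>
    rw [isWeaklyRegular_cons_iff] at h
    have hPp := hP.isPrime
    have hxm : x ∈ maximalIdeal R := hm x (by simp)
    obtain ⟨-, u₀, hu₀⟩ := isAssociatedPrime_iff.1 hP
    have hPu₀ (a : R) : a ∈ P ↔ a • u₀ = 0 := by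
      rw [hu₀, Submodule.mem_colon_singleton, Submodule.mem_bot]
    have hu₀0 : u₀ ≠ 0 := by
      rintro rfl
      exact hPp.one_notMem ((hPu₀ 1).2 (smul_zero _))
    have hxP : x ∉ P := fun hx =>
      hu₀0 (isSMulRegular_iff_right_eq_zero_of_smul.1 h.1 _ ((hPu₀ x).1 hx))
    let U : Submodule R N :=
      { carrier := {n | ∀ a ∈ P, a • n = 0}
        zero_mem' := fun a _ => smul_zero a
        add_mem' := fun {n n'} hn hn' a ha => by rw [smul_add, hn a ha, hn' a ha, add_zero]
        smul_mem' := fun r n hn a ha => by rw [smul_comm, hn a ha, smul_zero] }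
    have hU : ∃ n ∈ U, n ∉ x • (⊤ : Submodule R N) := by
      by_contra! hcon
      have hfg : U.FG := IsNoetherian.noetherian U
      have hbot : U = ⊥ := by
        refine Submodule.eq_bot_of_le_smul_of_le_jacobson_bot (Ideal.span {x}) U hfg
          (fun n hn => ?_) ?_
        · obtain ⟨m, -, rfl⟩ := (Submodule.mem_smul_pointwise_iff_exists _ _ _).1 (hcon n hn)
          refine Submodule.smul_mem_smul (Ideal.mem_span_singleton_self x) fun a ha => ?_
          exact isSMulRegular_iff_right_eq_zero_of_smul.1 h.1 _ (by rw [smul_comm]; exact hn a ha)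
        · rw [IsLocalRing.jacobson_eq_maximalIdeal ⊥ bot_ne_top]
          exact (Ideal.span_singleton_le_iff_mem _).2 hxm
      have : u₀ ∈ U := fun a ha => (hPu₀ a).1 ha
      rw [hbot] at this
      exact hu₀0 this
    obtain ⟨n, hn, hnx⟩ := hU
    obtain ⟨Q, hQ, hle⟩ := exists_le_isAssociatedPrime_of_isNoetherianRing R
      (Submodule.Quotient.mk n : QuotSMulTop x N) (by rwa [Ne, Submodule.Quotient.mk_eq_zero])
    have hPQ : P ≤ Q := fun a ha => hle (by
      rw [Submodule.mem_colon_singleton, Submodule.mem_bot, ← Submodule.Quotient.mk_smul, hn a ha,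
        Submodule.Quotient.mk_zero])
    have hxQ : x ∈ Q := hle (by
      rw [Submodule.mem_colon_singleton, Submodule.mem_bot, ← Submodule.Quotient.mk_smul,
        Submodule.Quotient.mk_eq_zero]
      exact Submodule.smul_mem_pointwise_smul _ _ ⊤ trivial)
    have hlen := ih hQ (fun r hr => hm r (by simp [hr])) h.2
    have hQp := hQ.isPrime
    have hlt : P < Q := lt_of_le_of_ne hPQ fun e => hxP (e ▸ hxQ)
    rw [List.length_cons, Nat.cast_succ]
    refine (add_le_add_left hlen 1).trans ?_
    exact Ideal.ringKrullDim_quotient_add_one_le hlt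

end

section

variable {R : Type u} [CommRing R] [IsLocalRing R] [IsNoetherianRing R]

/-- A maximal regular sequence need not begin with `x`, so depth is measured by vanishing of Ext
from the residue field. The long exact sequence of multiplication by `x` loses exactly one degree.
-/
theorem IsCohenMacaulayModule.quotSMulTop {N : Type u} [AddCommGroup N] [Module R N]
    [Module.Finite R N] (h : IsCohenMacaulayModule R N) {x : R} (hx : x ∈ maximalIdeal R)
    (hreg : IsSMulRegular N x) : IsCohenMacaulayModule R (QuotSMulTop x N) := by
  by_cases hN : Subsingleton N
  · exact .inl inferInstance
  rw [not_subsingleton_iff_nontrivial] at hN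
  have hQ : Nontrivial (QuotSMulTop x N) := nontrivial_quotSMulTop_of_mem_maximalIdeal N hx
  obtain ⟨d, hd⟩ := exists_supportDim_eq (R := R) (QuotSMulTop x N)
  have hd' : Module.supportDim R N = (d + 1 : ℕ) := by
    rw [← Module.supportDim_quotSMulTop_succ_eq_supportDim hreg hx, hd]
    rfl
  obtain ⟨ys, hl, hym, hy⟩ := exists_isWeaklyRegular h hd'
  have hlt (L : Type u) [AddCommGroup L] [Module R L] [Module.Finite R L] [Nontrivial L] :
      maximalIdeal R • (⊤ : Submodule R L) < ⊤ :=
    lt_top_iff_ne_top.2 (Submodule.top_ne_ideal_smul_of_le_jacobson_annihilator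
      (maximalIdeal_le_jacobson _)).symm
  have hseq : ∃ rs : List R, rs.length = d + 1 ∧ (∀ r ∈ rs, r ∈ maximalIdeal R) ∧
      IsRegular N rs := ⟨ys, hl, hym, IsRegular.of_isWeaklyRegular_of_mem_maximalIdeal N hym hy⟩
  have hExt : ∀ i < d + 1, Subsingleton (Abelian.Ext
      (ModuleCat.of R (Shrink.{u} (R ⧸ maximalIdeal R))) (ModuleCat.of R N) i) :=
    ((ModuleCat.exists_isRegular_tfae (maximalIdeal R) (d + 1) (ModuleCat.of R N)
    (hlt N)).out 3 1).1 hseq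
  have hExt' : ∃ rs : List R, rs.length = d ∧ (∀ r ∈ rs, r ∈ maximalIdeal R) ∧
      IsRegular (QuotSMulTop x N) rs := ((ModuleCat.exists_isRegular_tfae (maximalIdeal R) d
    (ModuleCat.of R (QuotSMulTop x N)) (hlt _)).out 1 3).1 fun i hi => by
      have h0 : Subsingleton (Abelian.Ext (ModuleCat.of R (Shrink.{u} (R ⧸ maximalIdeal R)))
        ((ModuleCat.of R N).smulShortComplex x).X₂ i) := hExt i (by lia)
      have h1 : Subsingleton (Abelian.Ext (ModuleCat.of R (Shrink.{u} (R ⧸ maximalIdeal R)))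
        ((ModuleCat.of R N).smulShortComplex x).X₁ (i + 1)) := hExt (i + 1) (by lia)
      have hS := (show IsSMulRegular (ModuleCat.of R N) x from hreg).smulShortComplex_shortExact
      refine subsingleton_of_forall_eq 0 fun ξ => ?_
      obtain ⟨η, rfl⟩ := Abelian.Ext.covariant_sequence_exact₃ _ hS ξ (show i + 1 = i + 1 from rfl)
        (Subsingleton.elim _ _)
      rw [Subsingleton.elim η 0, Abelian.Ext.zero_comp]
      rfl
  obtain ⟨zs, hzl, hzm, hz⟩ := hExt'
  exact isCohenMacaulayModule_of_le_length hzm hz.1 (by rw [hd, hzl])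

end

section

variable {R : Type*} [CommRing R] (S : Submonoid R) {R' : Type*} [CommRing R'] [Algebra R R']
  {N N' : Type*} [AddCommGroup N] [Module R N] [AddCommGroup N'] [Module R N']
  [Module R' N'] [IsScalarTower R R' N']

theorem exists_isLocalizedModule_quotSMulTop [IsLocalization S R'] (f : N →ₗ[R] N')
    [IsLocalizedModule S f] (x : R) :
    ∃ g : QuotSMulTop x N →ₗ[R] QuotSMulTop (algebraMap R R' x) N', IsLocalizedModule S g := by
  have hle : (x • (⊤ : Submodule R N)) ≤
      ((algebraMap R R' x • (⊤ : Submodule R' N')).restrictScalars R).comap f := by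
    intro n hn
    obtain ⟨m, -, rfl⟩ := (Submodule.mem_smul_pointwise_iff_exists _ _ _).1 hn
    change f (x • m) ∈ algebraMap R R' x • (⊤ : Submodule R' N')
    rw [map_smul, ← algebraMap_smul R' x]
    exact Submodule.smul_mem_pointwise_smul _ _ ⊤ trivial
  let g : QuotSMulTop x N →ₗ[R] QuotSMulTop (algebraMap R R' x) N' :=
    Submodule.liftQ _ (((algebraMap R R' x • (⊤ : Submodule R' N')).mkQ.restrictScalars R) ∘ₗ f)
      (hle.trans (by
        intro n hn
        rw [LinearMap.mem_ker]
        exact (Submodule.Quotient.mk_eq_zero _).2 hn))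
  have hg (n : N) : g (Submodule.Quotient.mk n) = Submodule.Quotient.mk (f n) := rfl
  refine ⟨g, ⟨fun s => ?_, fun y => ?_, fun {y₁ y₂} h => ?_⟩⟩
  · have hu := (IsLocalization.map_units R' s).map
      (Module.toModuleEnd R' (S := R') (QuotSMulTop (algebraMap R R' x) N'))
    rw [Module.End.isUnit_iff] at hu ⊢
    convert hu using 1
    ext y
    exact (algebraMap_smul R' (s : R) y).symm
  · obtain ⟨y, rfl⟩ := Submodule.Quotient.mk_surjective _ y
    obtain ⟨⟨n, s⟩, hn⟩ := IsLocalizedModule.surj S f y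
    exact ⟨⟨Submodule.Quotient.mk n, s⟩, by rw [hg, ← hn]; rfl⟩
  · obtain ⟨n₁, rfl⟩ := Submodule.Quotient.mk_surjective _ y₁
    obtain ⟨n₂, rfl⟩ := Submodule.Quotient.mk_surjective _ y₂
    rw [hg, hg, Submodule.Quotient.eq, ← map_sub] at h
    obtain ⟨z, -, hz⟩ := (Submodule.mem_smul_pointwise_iff_exists _ _ _).1 h
    obtain ⟨⟨m, s⟩, hm⟩ := IsLocalizedModule.surj S f z
    have h1 : f (s • (n₁ - n₂)) = f (x • m) := by
      dsimp only at hm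
      rw [Submonoid.smul_def] at hm
      rw [Submonoid.smul_def, map_smul, ← hz, map_smul, ← hm, algebraMap_smul, smul_comm]
    obtain ⟨t, ht⟩ := (IsLocalizedModule.eq_iff_exists S f).1 h1
    refine ⟨t * s, ?_⟩
    rw [Submonoid.smul_def, ← Submodule.Quotient.mk_smul, Submonoid.smul_def,
      ← Submodule.Quotient.mk_smul, Submodule.Quotient.eq, ← smul_sub, ← Submonoid.smul_def,
      mul_smul,
      ht, Submonoid.smul_def, smul_comm]
    exact Submodule.smul_mem_pointwise_smul _ _ ⊤ trivial

end

section

variable {R : Type u} [CommRing R] [IsLocalRing R] [IsNoetherianRing R]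

/-- Localizations of Cohen-Macaulay modules are Cohen-Macaulay. -/
theorem IsCohenMacaulayModule.of_isLocalizedModule {N : Type u} [AddCommGroup N] [Module R N]
    [Module.Finite R N] (h : IsCohenMacaulayModule R N) (p : Ideal R) [p.IsPrime] {R' : Type*}
    [CommRing R'] [Algebra R R'] [IsLocalization.AtPrime R' p] [IsLocalRing R'] {N' : Type*}
    [AddCommGroup N'] [Module R N'] [Module R' N'] [IsScalarTower R R' N'] (f : N →ₗ[R] N')
    [IsLocalizedModule p.primeCompl f] : IsCohenMacaulayModule R' N' := by
  by_cases hN' : Subsingleton N'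
  · exact .inl hN'
  rw [not_subsingleton_iff_nontrivial] at hN'
  have hnoeth : IsNoetherianRing R' := IsLocalization.isNoetherianRing p.primeCompl R' inferInstance
  have hfin : Module.Finite R' N' := Module.Finite.of_isLocalizedModule p.primeCompl f
  have hN : Nontrivial N := by
    by_contra hN
    rw [not_nontrivial_iff_subsingleton] at hN
    obtain ⟨y, hy⟩ := exists_ne (0 : N')
    obtain ⟨⟨n, t⟩, hn⟩ := IsLocalizedModule.surj p.primeCompl f y
    rw [Subsingleton.elim n 0, map_zero] at hn
    exact hy (IsLocalizedModule.smul_injective f t (hn.trans (smul_zero t).symm))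
  obtain ⟨d, hd⟩ := exists_supportDim_eq (R := R) N
  induction d using Nat.strong_induction_on generalizing N N' with
  | _ d ih =>
  -- If `p` contains a regular element, divide by it and use induction on the dimension. Otherwise
  -- prime avoidance puts `p` inside an associated prime, and the localization has dimension zero.
  by_cases hx : ∃ x ∈ p, IsSMulRegular N x
  · obtain ⟨x, hxp, hx⟩ := hx
    have hxm : x ∈ maximalIdeal R := le_maximalIdeal (Ideal.IsPrime.ne_top inferInstance) hxp
    have hQ : Nontrivial (QuotSMulTop x N) := nontrivial_quotSMulTop_of_mem_maximalIdeal N hxm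
    obtain ⟨e, he⟩ := exists_supportDim_eq (R := R) (QuotSMulTop x N)
    have hde : d = e + 1 := by
      have := Module.supportDim_quotSMulTop_succ_eq_supportDim hx hxm
      rw [hd, he] at this
      exact_mod_cast this.symm
    have hxm' : algebraMap R R' x ∈ maximalIdeal R' := by
      rwa [IsLocalization.AtPrime.to_map_mem_maximal_iff R' p]
    have hxreg : IsSMulRegular N' (algebraMap R R' x) := by
      have := (IsWeaklyRegular.cons hx (IsWeaklyRegular.nil R _)).of_isLocalizedModule R'
        p.primeCompl f
      exact ((isWeaklyRegular_cons_iff _ _ _).1 this).1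
    have hQ' : Nontrivial (QuotSMulTop (algebraMap R R' x) N') :=
      nontrivial_quotSMulTop_of_mem_maximalIdeal N' hxm'
    obtain ⟨g, hg⟩ := exists_isLocalizedModule_quotSMulTop p.primeCompl (R' := R') f x
    have hCM := ih e (by lia) (h.quotSMulTop hxm hx) g hQ' inferInstance hQ he
    obtain ⟨e', he'⟩ := exists_supportDim_eq (R := R') (QuotSMulTop (algebraMap R R' x) N')
    obtain ⟨ys, hl, hym, hy⟩ := exists_isWeaklyRegular hCM he'
    refine isCohenMacaulayModule_of_le_length (rs := algebraMap R R' x :: ys) ?_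
      (IsWeaklyRegular.cons hxreg hy) ?_
    · exact List.forall_mem_cons.2 ⟨hxm', hym⟩
    · rw [← Module.supportDim_quotSMulTop_succ_eq_supportDim hxreg hxm', he', List.length_cons, hl]
      rfl
  · push Not at hx
    have hsub : (p : Set R) ⊆ ⋃ P ∈ associatedPrimes R N, P := by
      rw [biUnion_associatedPrimes_eq_zero_divisors]
      intro x hxp
      have := hx x hxp
      rw [isSMulRegular_iff_right_eq_zero_of_smul] at this
      push Not at this
      obtain ⟨n, h1, h2⟩ := this
      exact ⟨n, h2, h1⟩
    obtain ⟨P, hP, hpP⟩ := (Ideal.subset_union_prime_finite (associatedPrimes.finite R N) ⊥ ⊥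
      (fun P hP _ _ => IsAssociatedPrime.isPrime hP)).1 hsub
    obtain ⟨ys, hl, hym, hy⟩ := exists_isWeaklyRegular h hd
    have hdP := length_le_ringKrullDim_quotient hP hym hy
    -- A prime in the support of `N'` contracts into `p ≤ P`. If the contraction were strictly
    -- smaller than `P`, its quotient would have dimension at least `d + 1`, since `d ≤ dim (R /
    -- P)`; this exceeds the dimension of `N`.
    have key (q : Ideal R') [q.IsPrime] (hq : Module.annihilator R' N' ≤ q) :
        q.comap (algebraMap R R') = P := by
      have hle : q.comap (algebraMap R R') ≤ p := by
        rw [← IsLocalization.AtPrime.under_maximalIdeal R' p]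
        exact Ideal.comap_mono (le_maximalIdeal (Ideal.IsPrime.ne_top inferInstance))
      by_contra hne
      have hlt := Ideal.ringKrullDim_quotient_add_one_le (lt_of_le_of_ne (hle.trans hpP) hne)
      have hann : Module.annihilator R N ≤ q.comap (algebraMap R R') := by
        intro a ha
        refine hq (Module.mem_annihilator.2 fun y => ?_)
        obtain ⟨⟨n, t⟩, hn⟩ := IsLocalizedModule.surj p.primeCompl f y
        refine IsLocalizedModule.smul_injective f t ?_
        dsimp only at hn ⊢
        rw [algebraMap_smul, smul_comm, hn, ← map_smul, Module.mem_annihilator.1 ha, map_zero,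
          smul_zero]
      have h2 : ringKrullDim (R ⧸ q.comap (algebraMap R R')) ≤ d := by
        rw [← hd, Module.supportDim_eq_ringKrullDim_quotient_annihilator]
        exact ringKrullDim_le_of_surjective (Ideal.Quotient.factor hann)
          (Ideal.Quotient.factor_surjective hann)
      rw [hl] at hdP
      have h3 : ((d : WithBot ℕ∞) + 1) ≤ d := ((add_le_add_left hdP 1).trans hlt).trans h2
      have h4 : d + 1 ≤ d := by exact_mod_cast h3
      lia
    refine isCohenMacaulayModule_of_le_length (rs := []) (by simp) (.nil _ _) ?_
    have hss : Subsingleton (Module.support R' N') := by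
      refine ⟨fun q₁ q₂ => ?_⟩
      have hq (q : Module.support R' N') : q.1.asIdeal.comap (algebraMap R R') = P := by
        obtain ⟨q, hq⟩ := q
        rw [Module.support_eq_zeroLocus] at hq
        exact key _ hq
      refine Subtype.ext (PrimeSpectrum.localization_comap_injective R' p.primeCompl ?_)
      exact PrimeSpectrum.ext ((hq q₁).trans (hq q₂).symm)
    rw [List.length_nil, Nat.cast_zero]
    exact Order.krullDim_nonpos_of_subsingleton

end

end CohenMacaulay

/-! ### Cohen-Macaulayness of affine charts at closed points. -/

namespace VarSum

open LocalCohomology IsLocalRing RingTheory.Sequence CohenMacaulay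

set_option linter.unusedSectionVars false

section

variable {R A M M' : Type*} [CommRing R] [CommRing A] [Algebra R A]
  [AddCommGroup M] [Module R M] [AddCommGroup M'] [Module R M'] [Module A M'] [IsScalarTower R A M']
  {x : ℕ → R} {f : ℕ → ℕ} {c : ℕ → A} {s n : ℕ} {φ : M →ₗ[R] M'}

namespace IsAffineChart

theorem finiteType (h : IsAffineChart x f c s φ) : Algebra.FiniteType R A := by
  classical
  have hset : {a | ∃ k, 1 ≤ k ∧ k < s ∧ c k = a} = ((Finset.Ico 1 s).image c : Set A) := by
    ext a
    simp [and_assoc]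
  exact ⟨⟨(Finset.Ico 1 s).image c, by rw [← hset, h.adjoin]⟩⟩

theorem finite [Module.Finite R M] (h : IsAffineChart x f c s φ) : Module.Finite A M' := by
  obtain ⟨S, hS⟩ := Module.Finite.fg_top (R := R) (M := M)
  classical
  refine ⟨⟨S.image φ, ?_⟩⟩
  rw [eq_top_iff, ← h.span, Submodule.span_le]
  rintro _ ⟨m, rfl⟩
  have hm : m ∈ Submodule.span R (S : Set M) := by rw [hS]; trivial
  have := Submodule.mem_map_of_mem (f := φ) hm
  rw [Submodule.map_span, ← Finset.coe_image] at this
  exact Submodule.span_le_restrictScalars R A _ this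

theorem algebraMap_mem_annihilator (h : IsAffineChart x f c s φ) {a : R}
    (ha : a ∈ Module.annihilator R M) : algebraMap R A a ∈ Module.annihilator A M' := by
  refine Module.mem_annihilator.2 fun z => ?_
  have hz : z ∈ Submodule.span A (Set.range φ) := by rw [h.span]; trivial
  induction hz using Submodule.span_induction with
  | mem z hz =>
    obtain ⟨m, rfl⟩ := hz
    rw [algebraMap_smul, ← map_smul, Module.mem_annihilator.1 ha, map_zero]
  | zero => exact smul_zero _
  | add z z' _ _ hz hz' => rw [smul_add, hz, hz', add_zero]
  | smul b z _ hz => rw [smul_comm, hz, smul_zero]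

end IsAffineChart

/-- An algebra of finite type over a local ring is integral modulo a maximal ideal over the maximal
ideal. -/
theorem _root_.IsLocalRing.isIntegral_quotient_of_finiteType [IsLocalRing R]
    [Algebra.FiniteType R A]
    (q : Ideal A) [q.IsMaximal] (hq : (maximalIdeal R).map (algebraMap R A) ≤ q) :
    Algebra.IsIntegral R (A ⧸ q) := by
  let _ : Field (A ⧸ q) := Ideal.Quotient.field q
  let g : ResidueField R →+* A ⧸ q := Ideal.Quotient.lift _ (algebraMap R (A ⧸ q)) fun a ha =>
    Ideal.Quotient.eq_zero_iff_mem.2 (hq (Ideal.mem_map_of_mem _ ha))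
  let _ : Algebra (ResidueField R) (A ⧸ q) := g.toAlgebra
  have : IsScalarTower R (ResidueField R) (A ⧸ q) := .of_algebraMap_eq fun r => rfl
  have : Algebra.FiniteType R (A ⧸ q) := inferInstance
  have : Algebra.FiniteType (ResidueField R) (A ⧸ q) :=
    .of_restrictScalars_finiteType R _ _
  have : Module.Finite (ResidueField R) (A ⧸ q) := finite_of_finite_type_of_isJacobsonRing _ _
  have : Module.Finite R (ResidueField R) := inferInstance
  have : Module.Finite R (A ⧸ q) := .trans (ResidueField R) _
  infer_instance

theorem _root_.CohenMacaulay.supportDim_nonpos {R N : Type*} [CommRing R] [AddCommGroup N]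
    [Module R N] [Module.Finite R N] {q : Ideal R}
    (h : ∀ p : Ideal R, p.IsPrime → Module.annihilator R N ≤ p → p = q) :
    Module.supportDim R N ≤ 0 := by
  have : Subsingleton (Module.support R N) := by
    refine ⟨fun p₁ p₂ => Subtype.ext (PrimeSpectrum.ext ?_)⟩
    have hq (p : Module.support R N) : p.1.asIdeal = q := by
      obtain ⟨p, hp⟩ := p
      rw [Module.support_eq_zeroLocus] at hp
      exact h _ p.2 hp
    rw [hq, hq]
  exact Order.krullDim_nonpos_of_subsingleton

end

section

variable {R : Type u} [CommRing R] [IsNoetherianRing R] [IsLocalRing R]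
  {M : Type u} [AddCommGroup M] [Module R M] [Module.Finite R M]
  {A M' : Type*} [CommRing A] [Algebra R A]
  [AddCommGroup M'] [Module R M'] [Module A M'] [IsScalarTower R A M']
  {x : ℕ → R} {f : ℕ → ℕ} {c : ℕ → A} {s n : ℕ} {φ : M →ₗ[R] M'}

/-- The integrality of an algebra generated by integral elements, modulo an ideal. -/
theorem isIntegral_quotient_of_adjoin {R A : Type*} [CommRing R] [CommRing A] [Algebra R A]
    {T : Set A} (hT : Algebra.adjoin R T = ⊤) {Q : Ideal A}
    (hQ : ∀ a ∈ T, IsIntegral R (Ideal.Quotient.mk Q a)) :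
    Algebra.IsIntegral R (A ⧸ Q) := by
  refine ⟨fun y => ?_⟩
  obtain ⟨a, rfl⟩ := Ideal.Quotient.mk_surjective y
  have ha : a ∈ Algebra.adjoin R T := by rw [hT]; trivial
  induction ha using Algebra.adjoin_induction with
  | mem a ha => exact hQ a ha
  | algebraMap r => exact isIntegral_algebraMap
  | add a b _ _ ha hb => rw [map_add]; exact ha.add hb
  | mul a b _ _ ha hb => rw [map_mul]; exact ha.mul hb

/-- A weakly regular sequence `L` in a maximal ideal of a finite type algebra over a local ring
whose quotient is finite over the base and supported on the closed fibre makes a module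
Cohen-Macaulay at this maximal ideal. -/
theorem isCohenMacaulayModule_of_isWeaklyRegular [Algebra.FiniteType R A] [Module.Finite A M']
    {T : Set A} (hT : Algebra.adjoin R T = ⊤) {J : Ideal R}
    (hJ : ∃ t, maximalIdeal R ^ t ≤ Module.annihilator R M ⊔ J) (q : Ideal A) [q.IsMaximal]
    {L : List A} (hL : ∀ a ∈ L, a ∈ q) (hreg : IsWeaklyRegular M' L)
    (hLT : ∀ a ∈ T, ∃ P : R[X], P.Monic ∧ P.aeval a ∈ Ideal.ofList L)
    (hLJ : J.map (algebraMap R A) ≤ Ideal.ofList L)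
    (hann : ∀ a ∈ Module.annihilator R M, algebraMap R A a ∈ Module.annihilator A M')
    {A' : Type*} [CommRing A'] [Algebra A A'] [IsLocalization.AtPrime A' q] [IsLocalRing A']
    {N : Type*} [AddCommGroup N] [Module A N] [Module A' N] [IsScalarTower A A' N]
    (g : M' →ₗ[A] N) [IsLocalizedModule q.primeCompl g] :
    IsCohenMacaulayModule A' N := by
  by_cases hN : Subsingleton N
  · exact .inl hN
  rw [not_subsingleton_iff_nontrivial] at hN
  have : IsNoetherianRing A := Algebra.FiniteType.isNoetherianRing R A
  have : IsNoetherianRing A' := IsLocalization.isNoetherianRing q.primeCompl A' inferInstance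
  have : Module.Finite A' N := Module.Finite.of_isLocalizedModule q.primeCompl g
  have hreg' := hreg.of_isLocalizedModule A' q.primeCompl g
  have hm' : ∀ a ∈ L.map (algebraMap A A'), a ∈ maximalIdeal A' := by
    intro a ha
    obtain ⟨b, hb, rfl⟩ := List.mem_map.1 ha
    rw [IsLocalization.AtPrime.to_map_mem_maximal_iff A' q]
    exact hL b hb
  -- It suffices that the quotient by `L` is supported only at the maximal ideal. A prime in the
  -- support contracts to some `Q` containing `L`, hence `J`, and the annihilator of `M`, hence the
  -- maximal ideal of `R`. The monic equations make `A / Q` integral over `R`, so `Q` is maximal and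
  -- equal to `q`.
  refine isCohenMacaulayModule_of_supportDim_quotient hm' hreg'
    (supportDim_nonpos (q := maximalIdeal A') fun Q' hQ' hann' => ?_)
  set Q := Q'.comap (algebraMap A A') with hQ
  have hLQ : Ideal.ofList L ≤ Q := by
    refine Ideal.span_le.2 fun a ha => hann' (Module.mem_annihilator.2 fun z => ?_)
    obtain ⟨z, rfl⟩ := Submodule.Quotient.mk_surjective _ z
    rw [← Submodule.Quotient.mk_smul, Submodule.Quotient.mk_eq_zero]
    exact Submodule.smul_mem_smul (Ideal.subset_span (List.mem_map_of_mem ha)) trivial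
  have hannQ (a : R) (ha : a ∈ Module.annihilator R M) : algebraMap R A a ∈ Q := by
    refine hann' (Module.mem_annihilator.2 fun z => ?_)
    obtain ⟨z, rfl⟩ := Submodule.Quotient.mk_surjective _ z
    rw [← Submodule.Quotient.mk_smul]
    obtain ⟨⟨m, t⟩, hm⟩ := IsLocalizedModule.surj q.primeCompl g z
    have : algebraMap A A' (algebraMap R A a) • z = 0 := by
      refine IsLocalizedModule.smul_injective g t ?_
      dsimp only at hm ⊢
      rw [algebraMap_smul, smul_comm, hm, ← map_smul,
        Module.mem_annihilator.1 (hann a ha), map_zero, smul_zero]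
    rw [this, Submodule.Quotient.mk_zero]
  have hQp : Q.IsPrime := hQ'.comap _
  have hmQ : maximalIdeal R ≤ Q.comap (algebraMap R A) := by
    obtain ⟨t, ht⟩ := hJ
    exact Ideal.IsPrime.le_of_pow_le (n := t)
      (ht.trans (sup_le (fun a ha => hannQ a ha) (Ideal.map_le_iff_le_comap.1 (hLJ.trans hLQ))))
  have hint' : Algebra.IsIntegral R (A ⧸ Q) := isIntegral_quotient_of_adjoin hT fun a ha => by
    obtain ⟨P, hP, hPa⟩ := hLT a ha
    refine ⟨P, hP, ?_⟩
    have := hLQ hPa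
    rw [← Ideal.Quotient.eq_zero_iff_mem, ← Ideal.Quotient.mkₐ_eq_mk R,
      ← Polynomial.aeval_algHom_apply] at this
    exact this
  have hQmax : Q.IsMaximal := by
    have hcomap : ((⊥ : Ideal (A ⧸ Q)).comap (algebraMap R (A ⧸ Q))) = maximalIdeal R := by
      refine ((maximalIdeal.isMaximal R).eq_of_le (Ideal.IsPrime.ne_top inferInstance)
        fun a ha => ?_).symm
      exact Ideal.Quotient.eq_zero_iff_mem.2 (hmQ ha)
    exact (Ideal.bot_quotient_isMaximal_iff Q).1
      (Ideal.isMaximal_of_isIntegral_of_isMaximal_comap (R := R) ⊥ (by rw [hcomap]; infer_instance))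
  have hQq : Q = q := by
    refine hQmax.eq_of_le (Ideal.IsPrime.ne_top inferInstance) ?_
    rw [← IsLocalization.AtPrime.under_maximalIdeal A' q]
    exact Ideal.comap_mono (le_maximalIdeal hQ'.ne_top)
  rw [← IsLocalization.map_under q.primeCompl A' Q', show Ideal.under A Q' = q from hQq,
    IsLocalization.AtPrime.map_eq_maximalIdeal q A']

theorem _root_.LocalCohomology.IsSecantSystem.isWeaklyRegular (h : IsSecantSystem M x 0 n) :
    IsWeaklyRegular M ((List.range n).map x) := by
  have h1 := h.isAdmissible (B := R) (x := x)
    ⟨fun k hk => by simp, fun k hk => rfl⟩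
  rw [Finset.range_eq_Ico] at h1
  have h2 := h1.isWeaklyRegular
  rw [Nat.sub_zero, ← List.range_eq_range'] at h2
  exact ((TensorProduct.lid R M).isWeaklyRegular_congr _).1 h2

/-- Affine charts of the blowing up are Cohen-Macaulay at the closed points of the closed fibre at
which the coordinates with pivot index vanish. -/
theorem IsAffineChart.isCohenMacaulayModule (h : IsAffineChart x f c s φ)
    (hM : IsSecantSystem M x s n) (hsn : s ≤ n) (q : Ideal A) [q.IsMaximal]
    (hq : (maximalIdeal R).map (algebraMap R A) ≤ q)
    (hcq : ∀ k, 1 ≤ k → k < s → f (k + 1) ≠ f k → c k ∈ q)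
    {A' : Type*} [CommRing A'] [Algebra A A'] [IsLocalization.AtPrime A' q] [IsLocalRing A']
    {N : Type*} [AddCommGroup N] [Module A N] [Module A' N] [IsScalarTower A A' N]
    (g : M' →ₗ[A] N) [IsLocalizedModule q.primeCompl g] :
    IsCohenMacaulayModule A' N := by
  have := h.finiteType
  have := h.finite
  have hmap {L : List A} (hL : ∀ l < n, algebraMap R A (x l) ∈ Ideal.ofList L) :
      (Ideal.span (x '' Set.Iio n)).map (algebraMap R A) ≤ Ideal.ofList L := by
    rw [Ideal.map_le_iff_le_comap, Ideal.span_le]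
    rintro _ ⟨l, hl, rfl⟩
    exact hL l hl
  -- For `s = 0` there are no coordinates and `φ` is an isomorphism, so the chart inherits the
  -- regular sequence of `M`.
  rcases Nat.eq_zero_or_pos s with rfl | hs
  · refine isCohenMacaulayModule_of_isWeaklyRegular h.adjoin hM.torsion q
      (L := ((List.range n).map x).map (algebraMap R A)) (fun a ha => ?_) ?_
      (fun a ⟨k, hk, hk', _⟩ => absurd hk' (by omega)) (hmap fun l hl => ?_)
      (fun a ha => h.algebraMap_mem_annihilator ha) g
    · obtain ⟨r, hr, rfl⟩ := List.mem_map.1 ha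
      obtain ⟨k, -, rfl⟩ := List.mem_map.1 hr
      exact hq (Ideal.mem_map_of_mem _ (hM.mem_maximalIdeal _))
    · rw [isWeaklyRegular_map_algebraMap_iff]
      refine ((LinearEquiv.ofBijective φ ⟨?_, ?_⟩).isWeaklyRegular_congr _).1 hM.isWeaklyRegular
      · refine (injective_iff_map_eq_zero φ).2 fun y hy => ?_
        obtain ⟨k, hk⟩ := h.ker y hy
        simpa using hk
      · intro z
        have hz : z ∈ Submodule.span A (Set.range φ) := by rw [h.span]; trivial
        induction hz using Submodule.span_induction with
        | mem z hz => exact hz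
        | zero => exact ⟨0, map_zero φ⟩
        | add z z' _ _ hz hz' =>
          obtain ⟨y, rfl⟩ := hz
          obtain ⟨y', rfl⟩ := hz'
          exact ⟨y + y', map_add φ y y'⟩
        | smul a z _ hz =>
          obtain ⟨y, rfl⟩ := hz
          have ha : a ∈ Algebra.adjoin R {a | ∃ k, 1 ≤ k ∧ k < 0 ∧ c k = a} := by
            rw [h.adjoin]; trivial
          rw [show {a | ∃ k, 1 ≤ k ∧ k < 0 ∧ c k = a} = ∅ by simp, Algebra.adjoin_empty] at ha
          obtain ⟨r, rfl⟩ := Algebra.mem_bot.1 ha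
          exact ⟨r • y, by rw [map_smul, algebraMap_smul]⟩
    · exact Ideal.subset_span (List.mem_map_of_mem (List.mem_map_of_mem (List.mem_range.2 hl)))
  have hint := IsLocalRing.isIntegral_quotient_of_finiteType q hq
  choose p hp hpc using fun k => hint.isIntegral (Ideal.Quotient.mk q (c k))
  have hp' : (Polynomial.X * ∏ k ∈ Finset.Ico 1 s, p k).Monic :=
    Polynomial.monic_X.mul (Polynomial.monic_prod_of_monic _ _ fun k _ => hp k)
  -- One polynomial serves for all coordinates: it is divisible by an integral equation of each `c
  -- k` modulo `q`. The factor `X` guarantees positive degree, also when there are no coordinates.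
  set P : R[X] := Polynomial.X * ∏ k ∈ Finset.Ico 1 s, p k with hP
  have hP0 : P.natDegree ≠ 0 := by
    rw [hP, Polynomial.monic_X.natDegree_mul
      (Polynomial.monic_prod_of_monic _ _ fun k _ => hp k), Polynomial.natDegree_X]
    omega
  have hPc (k : ℕ) (hk : 1 ≤ k) (hks : k < s) : P.aeval (c k) ∈ q := by
    rw [hP, map_mul, map_prod]
    refine Ideal.mul_mem_left _ _ (Ideal.mem_of_dvd _ (Finset.dvd_prod_of_mem _
      (Finset.mem_Ico.2 ⟨hk, hks⟩)) ?_)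
    rw [← Ideal.Quotient.eq_zero_iff_mem, ← Ideal.Quotient.mkₐ_eq_mk R,
      ← Polynomial.aeval_algHom_apply]
    exact hpc k
  have hreg := h.isWeaklyRegular hM hs hsn hp' hP0
  set L := ((List.range' 1 (s - 1)).map (fun k => if f (k + 1) = f k then P.aeval (c k) else c k) ++
        (x (f s) :: (List.range' s (n - s)).map x).map (algebraMap R A)) with hL
  refine isCohenMacaulayModule_of_isWeaklyRegular h.adjoin hM.torsion q (L := L) (fun a ha => ?_)
    hreg ?_ (hmap fun l hl => ?_) (fun a ha => h.algebraMap_mem_annihilator ha) g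
  · rcases List.mem_append.1 ha with ha | ha
    · obtain ⟨k, hk, rfl⟩ := List.mem_map.1 ha
      rw [List.mem_range'_1] at hk
      split_ifs with hf
      · exact hPc k hk.1 (by omega)
      · exact hcq k hk.1 (by omega) hf
    · obtain ⟨r, hr, rfl⟩ := List.mem_map.1 ha
      refine hq (Ideal.mem_map_of_mem _ ?_)
      rcases List.mem_cons.1 hr with rfl | hr
      · exact hM.mem_maximalIdeal _
      · obtain ⟨k, -, rfl⟩ := List.mem_map.1 hr
        exact hM.mem_maximalIdeal _
  · rintro _ ⟨k, hk, hks, rfl⟩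
    have hk' : k ∈ List.range' 1 (s - 1) := by rw [List.mem_range'_1]; omega
    have : (if f (k + 1) = f k then P.aeval (c k) else c k) ∈ Ideal.ofList L :=
      Ideal.subset_span (List.mem_append_left _ (List.mem_map_of_mem hk'))
    split_ifs at this with hf
    · exact ⟨P, hp', this⟩
    · exact ⟨Polynomial.X, Polynomial.monic_X, by rwa [Polynomial.aeval_X]⟩
  · by_cases hls : l < s
    -- The last pivot divides all `x l` with `l < s`, so it replaces them in the sequence.
    · obtain ⟨b, hb⟩ := h.coordinate.exists_eq hs (by omega) l (by
        rw [h.start, Finset.mem_insert, Finset.mem_Ico]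
        omega)
      rw [hb]
      refine Ideal.mul_mem_left _ _ (Ideal.subset_span (List.mem_append_right _ ?_))
      exact List.mem_map_of_mem List.mem_cons_self
    · refine Ideal.subset_span (List.mem_append_right _ (List.mem_map_of_mem (List.mem_cons_of_mem _
        (List.mem_map_of_mem ?_))))
      rw [List.mem_range'_1]
      omega

end

end VarSum

/-! ### Passing from a prime ideal to a smaller one. -/

section

variable {A : Type*} [CommRing A] {p q : Ideal A} [p.IsPrime] [q.IsPrime]
  {A' S : Type*} [CommRing A'] [CommRing S] [Algebra A A'] [Algebra A S] [Algebra A' S]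
  [IsScalarTower A A' S] [IsLocalRing S]
  {X Y Z : Type*} [AddCommGroup X] [AddCommGroup Y] [AddCommGroup Z] [Module A X] [Module A Y]
  [Module A Z] [Module A' Y] [Module A' Z] [Module S Z] [IsScalarTower A A' Y]
  [IsScalarTower A A' Z]
  [IsScalarTower A' S Z]

/-- A localization at a prime ideal `p ≤ q` is a localization of the localization at `q`. -/
theorem IsLocalizedModule.atPrime_of_le (hpq : p ≤ q) [IsLocalization.AtPrime S p]
    (fY : X →ₗ[A] Y) [IsLocalizedModule q.primeCompl fY]
    (fZ : X →ₗ[A] Z) [IsLocalizedModule p.primeCompl fZ] (g : Y →ₗ[A'] Z)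
    (hg : ∀ x, g (fY x) = fZ x) :
    IsLocalizedModule ((IsLocalRing.maximalIdeal S).comap (algebraMap A' S)).primeCompl g := by
  have hmem (t : A) (ht : t ∉ p) :
      algebraMap A A' t ∈ ((IsLocalRing.maximalIdeal S).comap (algebraMap A' S)).primeCompl := by
    intro h
    rw [SetLike.mem_coe, Ideal.mem_comap, ← IsScalarTower.algebraMap_apply] at h
    exact h (IsLocalization.map_units S (⟨t, ht⟩ : p.primeCompl))
  refine ⟨fun t => ?_, fun z => ?_, fun {y₁ y₂} h => ?_⟩
  · have hu : IsUnit (algebraMap A' S t) := by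
      by_contra h
      exact t.2 h
    have hu' := hu.map (Module.toModuleEnd S (S := S) Z)
    rw [Module.End.isUnit_iff] at hu' ⊢
    convert hu' using 1
    ext z
    exact (algebraMap_smul S (t : A') z).symm
  · obtain ⟨⟨x, t⟩, hx⟩ := IsLocalizedModule.surj p.primeCompl fZ z
    refine ⟨⟨fY x, ⟨_, hmem t t.2⟩⟩, ?_⟩
    rw [hg, ← hx, Submonoid.smul_def]
    exact algebraMap_smul A' (t : A) z
  · obtain ⟨⟨x, s⟩, hx⟩ := IsLocalizedModule.surj q.primeCompl fY (y₁ - y₂)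
    dsimp only at hx
    have h0 : fZ x = fZ 0 := by
      rw [← hg, ← hx, Submonoid.smul_def, ← algebraMap_smul A' (s : A), map_smul, map_sub, h,
        sub_self, smul_zero, map_zero]
    obtain ⟨t, ht⟩ := (IsLocalizedModule.eq_iff_exists p.primeCompl fZ).1 h0
    refine ⟨⟨algebraMap A A' (t * s), hmem _ (mul_mem t.2 (fun h => s.2 (hpq h) :
      (s : A) ∈ p.primeCompl))⟩, ?_⟩
    rw [Submonoid.smul_def, Submonoid.smul_def, ← sub_eq_zero, ← smul_sub]
    dsimp only
    rw [algebraMap_smul, mul_smul, ← Submonoid.smul_def s, hx, ← map_smul,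
      ← Submonoid.smul_def t, ht,
      smul_zero, map_zero]

end

/-- If a module is Cohen-Macaulay at a prime ideal, then it is so at all smaller prime ideals. -/
theorem CohenMacaulay.IsCohenMacaulayModule.of_le {A : Type u} [CommRing A] [IsNoetherianRing A]
    {X : Type u} [AddCommGroup X] [Module A X] [Module.Finite A X] {p q : Ideal A} [p.IsPrime]
    [q.IsPrime] (hpq : p ≤ q)
    (h : IsCohenMacaulayModule (Localization.AtPrime q) (LocalizedModule q.primeCompl X))
    {S : Type*} [CommRing S] [IsLocalRing S] [Algebra A S] [IsLocalization.AtPrime S p]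
    {Z : Type*} [AddCommGroup Z] [Module A Z] [Module S Z] [IsScalarTower A S Z]
    (f : X →ₗ[A] Z) [IsLocalizedModule p.primeCompl f] : IsCohenMacaulayModule S Z := by
  let A' := Localization.AtPrime q
  have hle : q.primeCompl ≤ p.primeCompl := fun a ha h => ha (hpq h)
  let φ : A' →+* S := IsLocalization.lift (M := q.primeCompl) (g := algebraMap A S)
    fun y => IsLocalization.map_units S (⟨y, hle y.2⟩ : p.primeCompl)
  let _ : Algebra A' S := φ.toAlgebra
  have h1 : IsScalarTower A A' S := .of_algebraMap_eq fun a => (IsLocalization.lift_eq _ a).symm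
  let _ : Module A' Z := Module.compHom Z φ
  have h2 : IsScalarTower A' S Z := ⟨fun a s z => by rw [Algebra.smul_def, mul_smul]; rfl⟩
  have h3 : IsScalarTower A A' Z := ⟨fun a b z => by
    rw [Algebra.smul_def, ← algebraMap_smul S (algebraMap A A' a * b), map_mul, mul_smul,
      algebraMap_smul S b, ← IsScalarTower.algebraMap_apply, algebraMap_smul]⟩
  have h4 : IsNoetherianRing A' := IsLocalization.isNoetherianRing q.primeCompl A' inferInstance
  let fY := LocalizedModule.mkLinearMap q.primeCompl X
  have h5 : Module.Finite A' (LocalizedModule q.primeCompl X) :=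
    Module.Finite.of_isLocalizedModule q.primeCompl fY
  have hu (y : q.primeCompl) : IsUnit (algebraMap A (Module.End A Z) y) :=
    IsLocalizedModule.map_units f (⟨y, hle y.2⟩ : p.primeCompl)
  let g₀ : LocalizedModule q.primeCompl X →ₗ[A] Z := IsLocalizedModule.lift q.primeCompl fY f hu
  let g : LocalizedModule q.primeCompl X →ₗ[A'] Z :=
    g₀.extendScalarsOfIsLocalization q.primeCompl A'
  have hg (x : X) : g (fY x) = f x := IsLocalizedModule.lift_apply q.primeCompl fY f hu x
  have h6 := IsLocalizedModule.atPrime_of_le (S := S) hpq fY f g hg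
  have h7 := IsLocalizedModule.atPrime_of_le (S := S) hpq (Algebra.linearMap A A')
    (Algebra.linearMap A S) (Algebra.linearMap A' S)
    fun a => (IsScalarTower.algebraMap_apply A A' S a).symm
  have h8 : IsLocalization.AtPrime S ((IsLocalRing.maximalIdeal S).comap (algebraMap A' S)) :=
    (isLocalizedModule_iff_isLocalization' _ _).1 h7
  exact h.of_isLocalizedModule ((IsLocalRing.maximalIdeal S).comap (algebraMap A' S)) g

namespace VarSum

open LocalCohomology IsLocalRing CohenMacaulay

/-- Affine charts of the blowing up are Cohen-Macaulay at all points that specialize to a closed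
point of the closed fibre at which the coordinates with pivot index vanish. -/
theorem IsAffineChart.isCohenMacaulayModule_of_le {R : Type u} [CommRing R] [IsNoetherianRing R]
    [IsLocalRing R] {M : Type u} [AddCommGroup M] [Module R M] [Module.Finite R M]
    {A M' : Type u} [CommRing A] [Algebra R A]
    [AddCommGroup M'] [Module R M'] [Module A M'] [IsScalarTower R A M']
    {x : ℕ → R} {f : ℕ → ℕ} {c : ℕ → A} {s n : ℕ} {φ : M →ₗ[R] M'}
    (h : IsAffineChart x f c s φ)
    (hM : IsSecantSystem M x s n) (hsn : s ≤ n) {p q : Ideal A} [p.IsPrime]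
    [q.IsMaximal] (hpq : p ≤ q)
    (hq : (maximalIdeal R).map (algebraMap R A) ≤ q)
    (hcq : ∀ k, 1 ≤ k → k < s → f (k + 1) ≠ f k → c k ∈ q)
    {A' : Type*} [CommRing A'] [Algebra A A'] [IsLocalization.AtPrime A' p] [IsLocalRing A']
    {N : Type*} [AddCommGroup N] [Module A N] [Module A' N] [IsScalarTower A A' N]
    (g : M' →ₗ[A] N) [IsLocalizedModule p.primeCompl g] :
    IsCohenMacaulayModule A' N := by
  have := h.finiteType
  have := h.finite
  have : IsNoetherianRing A := Algebra.FiniteType.isNoetherianRing R A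
  exact (h.isCohenMacaulayModule hM hsn q hq hcq
    (LocalizedModule.mkLinearMap q.primeCompl M')).of_le hpq g

end VarSum

/-! ### Recognizing the sheaf associated with a module on an affine scheme. -/

noncomputable section

namespace AlgebraicGeometry.Scheme.Modules

variable {B : CommRingCat.{u}} {G : (Spec B).Modules} {P : ModuleCat.{u} B}

theorem Hom.app_smul_Spec {F : (Spec B).Modules} (θ : F ⟶ G) {U : (Spec B).Opens} (b : B)
    (t : Γ(F, U)) : θ.app U (b • t) = b • θ.app U t := by
  rw [smul_Spec_def, Hom.app_smul, ← smul_Spec_def]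

/-- The basic open subset of `Spec B` associated with `b`. -/
def specBasicOpen (b : B) : (Spec B).Opens :=
  PrimeSpectrum.basicOpen b

theorem specBasicOpen_mul_le_left (b c : B) : specBasicOpen (b * c) ≤ specBasicOpen b :=
  PrimeSpectrum.basicOpen_mul_le_left b c

theorem specBasicOpen_mul_le_right (b c : B) : specBasicOpen (b * c) ≤ specBasicOpen c :=
  PrimeSpectrum.basicOpen_mul_le_right b c

/-- The map from a module to the sections of the associated quasi-coherent sheaf. -/
def toOpen (P : ModuleCat.{u} B) (U : (Spec B).Opens) : P →ₗ[B] Γ(tilde P, U) :=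
  (tilde.toOpen P U).hom

theorem exists_toOpen_eq_pow_smul {b : B} (t : Γ(tilde P, specBasicOpen b)) :
    ∃ (k : ℕ) (p : P), toOpen P (specBasicOpen b) p = b ^ k • t := by
  obtain ⟨⟨p, ⟨_, k, rfl⟩⟩, h⟩ := IsLocalizedModule.surj (Submonoid.powers b)
    (tilde.toOpen P (PrimeSpectrum.basicOpen b)).hom t
  exact ⟨k, p, h.symm⟩

theorem exists_hom_toOpen (ψ : P →ₗ[B] Γ(G, ⊤)) :
    ∃ θ : tilde P ⟶ G, ∀ (U : (Spec B).Opens) (p : P),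
      θ.app U (toOpen P U p) = G.presheaf.map (homOfLE le_top : U ⟶ ⊤).op (ψ p) := by
  let ψ' : P ⟶ (modulesSpecToSheaf.obj G).presheaf.obj (.op ⊤) :=
    ModuleCat.ofHom (Y := (modulesSpecToSheaf.obj G).presheaf.obj (.op ⊤)) ψ
  refine ⟨tilde.map ψ' ≫ G.fromTildeΓ, fun U p => ?_⟩
  have h1 := tilde.toOpen_map_app ψ' U
  have h2 := toOpen_fromTildeΓ_app G U
  have h3 : tilde.toOpen P U ≫ (modulesSpecToSheaf.map (tilde.map ψ')).1.app (op U) ≫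
      (modulesSpecToSheaf.map G.fromTildeΓ).1.app (op U) =
      ψ' ≫ (modulesSpecToSheaf.obj G).1.map (homOfLE le_top).op := by
    rw [← h2, ← Category.assoc, h1, Category.assoc]
  exact DFunLike.congr_fun (congrArg ModuleCat.Hom.hom h3) p

/-- A linear map from `P` to the global sections of `G` that is locally an isomorphism
up to denominators. -/
structure IsLocalizing (ψ : P →ₗ[B] Γ(G, ⊤)) : Prop where
  exists_eq_smul : ∀ (y : Spec B) (U : (Spec B).Opens), y ∈ U → ∀ z : Γ(G, U), ∃ b ∉ y.asIdeal,
    ∃ (p : P) (V : (Spec B).Opens) (i : V ⟶ U), y ∈ V ∧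
      G.presheaf.map (homOfLE le_top : V ⟶ ⊤).op (ψ p) = b • G.presheaf.map i.op z
  exists_smul_eq_zero : ∀ (y : Spec B) (U : (Spec B).Opens), y ∈ U → ∀ p : P,
    G.presheaf.map (homOfLE le_top : U ⟶ ⊤).op (ψ p) = 0 → ∃ b ∉ y.asIdeal, b • p = 0

theorem eq_zero_of_smul {F : (Spec B).Modules} {U : (Spec B).Opens} {b : B}
    (hU : U ≤ specBasicOpen b) {t : Γ(F, U)} (h : b • t = 0) : t = 0 :=
  F.isSMulRegular_of_le_basicOpen hU (show b • t = b • 0 by rw [h, smul_zero])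

/-- The two conditions express bijectivity on stalks, which suffices for sheaves. -/
theorem isIso_of_locally_bijective {X : Scheme.{u}} {F G : X.Modules} (θ : F ⟶ G)
    (hinj : ∀ (y : X) (U : X.Opens), y ∈ U → ∀ t : Γ(F, U), θ.app U t = 0 →
      ∃ (V : X.Opens) (i : V ⟶ U), y ∈ V ∧ F.presheaf.map i.op t = 0)
    (hsurj : ∀ (y : X) (U : X.Opens), y ∈ U → ∀ z : Γ(G, U),
      ∃ (V : X.Opens) (i : V ⟶ U), y ∈ V ∧ ∃ t : Γ(F, V), θ.app V t = G.presheaf.map i.op z) :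
    IsIso θ := by
  suffices hst : ∀ y : X, IsIso ((TopCat.Presheaf.stalkFunctor Ab.{u} y).map θ.mapPresheaf) by
    let F' : TopCat.Sheaf Ab.{u} X := ⟨F.presheaf, F.isSheaf⟩
    let G' : TopCat.Sheaf Ab.{u} X := ⟨G.presheaf, G.isSheaf⟩
    let θ' : F' ⟶ G' := ⟨θ.mapPresheaf⟩
    have : ∀ y, IsIso ((TopCat.Presheaf.stalkFunctor Ab.{u} y).map θ'.hom) := hst
    have h1 : IsIso θ' := TopCat.Presheaf.isIso_of_stalkFunctor_map_iso θ'
    have h2 : IsIso θ'.hom := (TopCat.Sheaf.forget Ab.{u} X).map_isIso θ'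
    have h3 : IsIso ((Scheme.Modules.toPresheaf X).map θ) := h2
    exact isIso_of_reflects_iso θ (Scheme.Modules.toPresheaf X)
  intro y
  have hmap (U : X.Opens) (hy : y ∈ U) (t : Γ(F, U)) :
      (TopCat.Presheaf.stalkFunctor Ab.{u} y).map θ.mapPresheaf (F.presheaf.germ U y hy t) =
        G.presheaf.germ U y hy (θ.app U t) :=
    TopCat.Presheaf.stalkFunctor_map_germ_apply U y hy θ.mapPresheaf t
  rw [ConcreteCategory.isIso_iff_bijective]
  constructor
  · refine (injective_iff_map_eq_zero
      ((TopCat.Presheaf.stalkFunctor Ab.{u} y).map θ.mapPresheaf).hom).2 fun z hz => ?_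
    obtain ⟨U, hy, t, rfl⟩ := TopCat.Presheaf.exists_germ_eq F.presheaf z
    have hz' : G.presheaf.germ U y hy (θ.app U t) = G.presheaf.germ U y hy 0 :=
      (hmap U hy t).symm.trans (hz.trans (map_zero (G.presheaf.germ U y hy).hom).symm)
    obtain ⟨W, hyW, i, j, hW⟩ := TopCat.Presheaf.germ_eq _ _ _ _ _ _ hz'
    obtain ⟨V, k, hyV, hV⟩ := hinj y W hyW (F.presheaf.map i.op t) (by
      have := congr($(θ.mapPresheaf.naturality i.op) t)
      refine this.trans (hW.trans (map_zero (G.presheaf.map j.op).hom)))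
    rw [← TopCat.Presheaf.germ_res_apply F.presheaf i y hyW t,
      ← TopCat.Presheaf.germ_res_apply F.presheaf k y hyV, hV]
    exact map_zero (F.presheaf.germ V y hyV).hom
  · intro z
    obtain ⟨U, hy, t, rfl⟩ := TopCat.Presheaf.exists_germ_eq G.presheaf z
    obtain ⟨V, i, hyV, t', ht'⟩ := hsurj y U hy t
    refine ⟨F.presheaf.germ V y hyV t', ?_⟩
    rw [hmap, ht']
    exact TopCat.Presheaf.germ_res_apply G.presheaf i y hyV t

theorem exists_basicOpen_le {U : (Spec B).Opens} {y : Spec B} (hy : y ∈ U) :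
    ∃ b ∉ y.asIdeal, specBasicOpen b ≤ U := by
  obtain ⟨_, ⟨_, ⟨b, rfl⟩, rfl⟩, hb, hU⟩ :=
    PrimeSpectrum.isBasis_basic_opens.exists_subset_of_mem_open hy U.2
  exact ⟨b, hb, hU⟩

namespace IsLocalizing

variable {ψ : P →ₗ[B] Γ(G, ⊤)}

/-- The map `ψ` extends to a morphism from `tilde P`. On a basic open set, sections of `tilde P`
have a numerator in `P`: the torsion condition on `ψ` gives local injectivity, and the existence of
numerators for sections of `G` gives local surjectivity. -/
theorem nonempty_iso (h : IsLocalizing ψ) : Nonempty (tilde P ≅ G) := by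
  obtain ⟨θ, hθ⟩ := exists_hom_toOpen ψ
  suffices IsIso θ from ⟨asIso θ⟩
  have hres {U V : (Spec B).Opens} (i : V ⟶ U) (t : Γ(tilde P, U)) :
      θ.app V ((tilde P).presheaf.map i.op t) = G.presheaf.map i.op (θ.app U t) :=
    congr($(θ.mapPresheaf.naturality i.op) t)
  refine isIso_of_locally_bijective θ (fun y U hy t ht => ?_) fun y U hy z => ?_
  · obtain ⟨b, hb, hbU⟩ := exists_basicOpen_le hy
    obtain ⟨k, p, hp⟩ := exists_toOpen_eq_pow_smul ((tilde P).presheaf.map (homOfLE hbU).op t)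
    obtain ⟨c, hc, hcp⟩ := h.exists_smul_eq_zero y (specBasicOpen b) hb p (by
      rw [← hθ, hp, Hom.app_smul_Spec, hres, ht, map_zero, smul_zero])
    have hle : specBasicOpen (c * b ^ k * b) ≤
        specBasicOpen b := specBasicOpen_mul_le_right _ b
    refine ⟨specBasicOpen (c * b ^ k * b), homOfLE (hle.trans hbU),
      y.2.mul_notMem (y.2.mul_notMem hc fun h => hb (y.2.mem_of_pow_mem _ h)) hb,
      eq_zero_of_smul (b := c * b ^ k) (specBasicOpen_mul_le_left _ _) ?_⟩
    have h1 := congrArg ((tilde P).presheaf.map (homOfLE hle).op) (congrArg (c • ·) hp)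
    beta_reduce at h1
    rw [← LinearMap.map_smul, hcp, map_zero, map_zero, map_smul_Spec, map_smul_Spec] at h1
    rw [mul_smul, h1]
    exact congr(c • b ^ k • $((tilde P).presheaf.map_comp_apply (homOfLE hbU).op
      (homOfLE hle).op t))
  · obtain ⟨b, hb, p, V, i, hyV, hV⟩ := h.exists_eq_smul y U hy z
    obtain ⟨c, hc, hcV⟩ := exists_basicOpen_le hyV
    set W := specBasicOpen (b * c) with hW
    have hWV : W ≤ V := (specBasicOpen_mul_le_right b c).trans hcV
    have hWb : W ≤ specBasicOpen b := specBasicOpen_mul_le_left b c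
    -- On an open subset of the basic open set of `b`, multiplication by `b` is bijective on
    -- sections of `tilde P`, so the numerator `p` can be divided by `b` there.
    have hu := (tilde P).isUnit_algebraMap_end_of_le_basicOpen b hWb
    rw [Module.End.isUnit_iff] at hu
    obtain ⟨t, ht⟩ := hu.2 (toOpen P W p)
    rw [Module.algebraMap_end_apply] at ht
    refine ⟨W, homOfLE hWV ≫ i, y.2.mul_notMem hb hc, t, sub_eq_zero.1 (eq_zero_of_smul hWb ?_)⟩
    rw [smul_sub, ← Hom.app_smul_Spec, ht, hθ, ← map_smul_Spec, sub_eq_zero]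
    have h1 := congrArg (G.presheaf.map (homOfLE hWV).op) hV
    rw [map_smul_Spec] at h1
    have h2 := G.presheaf.map_comp_apply (homOfLE le_top : V ⟶ ⊤).op (homOfLE hWV).op (ψ p)
    have h3 := G.presheaf.map_comp_apply i.op (homOfLE hWV).op z
    rw [op_comp, map_smul_Spec]
    exact h2.trans (h1.trans congr(b • $(h3.symm)))

end IsLocalizing

end AlgebraicGeometry.Scheme.Modules

end

/-! ### Local Noetherianity, quasi-coherence and finite type from affine covers. -/

noncomputable section

namespace AlgebraicGeometry.Scheme.Modules

theorem exists_isFinite_presentation_tilde {B : CommRingCat.{u}} [IsNoetherianRing B]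
    (P : ModuleCat.{u} B) [Module.Finite B P] :
    ∃ p : SheafOfModules.Presentation.{u} (tilde P), p.IsFinite := by
  obtain ⟨s, hs⟩ := Module.Finite.fg_top (R := B) (M := P)
  have h : _root_.IsNoetherian B ((s : Set P) →₀ B) := inferInstance
  obtain ⟨t, ht⟩ := h.noetherian
    (LinearMap.ker (Finsupp.linearCombination B (fun x : (s : Set P) => (x : P))))
  refine ⟨presentationTilde P s hs t ht, ⟨⟨?_⟩, ⟨?_⟩⟩⟩
  · exact inferInstanceAs (Finite (s : Set P))
  · exact inferInstanceAs (Finite (t : Set ((s : Set P) →₀ B)))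

theorem exists_isFinite_presentation_map {X Y : Scheme.{u}} (f : Y ⟶ X) [IsOpenImmersion f]
    {F : X.Modules} (p : SheafOfModules.Presentation.{u} F) (hp : p.IsFinite) :
    ∃ p : SheafOfModules.Presentation.{u} (F.restrict f), p.IsFinite :=
  ⟨presentationRestrict f p, ⟨⟨hp.isFiniteType_generators.finite⟩,
    ⟨hp.isFiniteType_relations.finite⟩⟩⟩

theorem exists_isFinite_presentation_of_iso {X : Scheme.{u}} {F G : X.Modules} (e : F ≅ G)
    (p : SheafOfModules.Presentation.{u} F) (hp : p.IsFinite) :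
    ∃ p : SheafOfModules.Presentation.{u} G, p.IsFinite :=
  have : @IsIso (SheafOfModules X.ringCatSheaf) _ _ _ e.hom := inferInstanceAs (IsIso e.hom)
  ⟨@SheafOfModules.Presentation.ofIsIso _ _ _ _ _ _ _ _ e.hom this p,
    ⟨⟨hp.isFiniteType_generators.finite⟩, ⟨hp.isFiniteType_relations.finite⟩⟩⟩

/-- Quasi-coherence is formulated with the slice site of `U`, while the presentation lives on the
open subscheme. The two module categories are equivalent; the equivalence preserves colimits and, up
to isomorphism, the structure sheaf, so presentations transport. -/
theorem exists_isFinite_presentation_over {X : Scheme.{u}} (F : X.Modules) (U : X.Opens)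
    (p : SheafOfModules.Presentation.{u} (F.restrict U.ι)) (hp : p.IsFinite) :
    ∃ p : SheafOfModules.Presentation.{u} (SheafOfModules.over F U), p.IsFinite := by
  let e₁ : (overEquiv U).functor.obj (SheafOfModules.unit.{u} (X.ringCatSheaf.over U)) ≅
      restrict (SheafOfModules.unit.{u} X.ringCatSheaf) U.ι :=
    (overFunctorEquiv U).app (SheafOfModules.unit.{u} X.ringCatSheaf)
  let η : SheafOfModules.unit.{u} (X.ringCatSheaf.over U) ≅
      (overEquiv U).inverse.obj (SheafOfModules.unit.{u} U.toScheme.ringCatSheaf) :=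
    (overEquiv U).unitIso.app _ ≪≫ (overEquiv U).inverse.mapIso (e₁ ≪≫ restrictUnitIso U.ι)
  let H : SheafOfModules.{u} U.toScheme.ringCatSheaf ⥤ SheafOfModules.{u} (X.ringCatSheaf.over U) :=
    (overEquiv U).inverse
  have h1 : Limits.PreservesColimitsOfSize.{u, u} H :=
    (overEquiv U).symm.toAdjunction.leftAdjoint_preservesColimits
  let q := p.map H η
  let e : (overEquiv U).inverse.obj (F.restrict U.ι) ≅ SheafOfModules.over F U :=
    (overEquiv U).inverse.mapIso ((overFunctorEquiv U).symm.app F) ≪≫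
      ((overEquiv U).unitIso.app _).symm
  exact ⟨SheafOfModules.Presentation.ofIsIso.{u, u, u} e.hom q,
    ⟨⟨hp.isFiniteType_generators.finite⟩, ⟨hp.isFiniteType_relations.finite⟩⟩⟩

theorem isFinitePresentation_of_cover {X : Scheme.{u}} (F : X.Modules)
    (h : ∀ x : X, ∃ (B : CommRingCat.{u}) (f : Spec B ⟶ X) (_ : IsOpenImmersion f) (y : Spec B)
      (p : SheafOfModules.Presentation.{u} (F.restrict f)), f y = x ∧ p.IsFinite) :
    SheafOfModules.IsFinitePresentation.{u, u, u} F := by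
  have key (x : X) : ∃ (U : X.Opens)
      (p : SheafOfModules.Presentation.{u} (SheafOfModules.over F U)),
      x ∈ U ∧ p.IsFinite := by
    obtain ⟨B, f, hf, y, p, rfl, hp⟩ := h x
    obtain ⟨p', hp'⟩ := exists_isFinite_presentation_map f.isoOpensRange.inv p hp
    obtain ⟨p'', hp''⟩ := exists_isFinite_presentation_of_iso
      ((restrictFunctorComp f.isoOpensRange.inv f).symm.app F ≪≫
        (restrictFunctorCongr f.isoOpensRange_inv_comp).app F) p' hp'
    obtain ⟨q, hq⟩ := exists_isFinite_presentation_over F f.opensRange p'' hp''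
    exact ⟨f.opensRange, q, ⟨y, rfl⟩, hq⟩
  choose U p hU hp using key
  let G : SheafOfModules.{u} X.ringCatSheaf := F
  have hU' : (Opens.grothendieckTopology X).CoversTop U := by
    rw [Opens.coversTop_iff, IsOpenCover, eq_top_iff]
    exact fun x _ => Opens.mem_iSup.2 ⟨x, hU x⟩
  let q : G.QuasicoherentData := { I := X, X := U, coversTop := hU', presentation := p }
  have hq : q.IsFinitePresentation := { isFinite_presentation := hp }
  exact SheafOfModules.IsFinitePresentation.mk (M := G) ⟨q, hq⟩

/-- A finite module over a Noetherian ring is finitely presented, and local finite presentations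
yield both quasi-coherence and finite type. -/
theorem isQuasicoherent_of_cover {X : Scheme.{u}} (F : X.Modules)
    (h : ∀ x : X, ∃ (B : CommRingCat.{u}) (f : Spec B ⟶ X) (_ : IsOpenImmersion f) (y : Spec B)
      (P : ModuleCat.{u} B), f y = x ∧ IsNoetherianRing B ∧ Module.Finite B P ∧
        Nonempty (tilde P ≅ F.restrict f)) :
    IsLocallyNoetherian X ∧ F.IsQuasicoherent ∧ F.IsFiniteType := by
  have : SheafOfModules.IsFinitePresentation.{u, u, u} F :=
      isFinitePresentation_of_cover F fun x => by
    obtain ⟨B, f, hf, y, P, hy, hB, hP, ⟨e⟩⟩ := h x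
    obtain ⟨p, hp⟩ := exists_isFinite_presentation_tilde P
    obtain ⟨q, hq⟩ := exists_isFinite_presentation_of_iso e p hp
    exact ⟨B, f, hf, y, q, hy, hq⟩
  refine ⟨?_, ?_, ?_⟩
  rotate_left
  · exact @SheafOfModules.instIsQuasicoherentOfIsFinitePresentation _ _ _ _ _ _ F this
  · exact @SheafOfModules.instIsFiniteTypeOfIsFinitePresentation _ _ _ _ _ _ F this
  choose B f hf y P hy hB hP e using h
  exact isLocallyNoetherian_of_affine_cover
    (S := fun x => ⟨(f x).opensRange, isAffineOpen_opensRange (f x)⟩)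
    (eq_top_iff.2 fun x _ => Opens.mem_iSup.2 ⟨x, y x, hy x⟩) fun x =>
      isNoetherianRing_of_ringEquiv (B x)
        ((Scheme.ΓSpecIso (B x)).symm ≪≫ ((f x).appIso ⊤).symm ≪≫
          X.presheaf.mapIso (eqToIso (by simp)).op).commRingCatIsoToRingEquiv

end AlgebraicGeometry.Scheme.Modules

end

/-! ### Stalks at points of an affine open subset. -/

noncomputable section

namespace AlgebraicGeometry.Scheme.Modules

open CohenMacaulay

theorem germ_smul {X : Scheme.{u}} (F : X.Modules) (x : X) (U : X.Opens) (hx : x ∈ U)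
    (r : Γ(X, U)) (m : Γ(F, U)) :
    F.presheaf.germ U x hx (r • m) = X.presheaf.germ U x hx r • F.presheaf.germ U x hx m :=
  PresheafOfModules.germ_smul (R := X.presheaf) (M := F.val) x U hx r m

variable {X : Scheme.{u}} {B : CommRingCat.{u}} (f : Spec B ⟶ X) [IsOpenImmersion f]

theorem mem_image {y : Spec B} {U : (Spec B).Opens} (hy : y ∈ U) : f y ∈ f ''ᵁ U :=
  ⟨y, hy, rfl⟩

theorem mem_image_top (y : Spec B) : f y ∈ f ''ᵁ ⊤ :=
  mem_image f trivial

/-- The map from the ring of functions on an affine open subset to the stalk. -/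
def toStalk (y : Spec B) : B ⟶ X.presheaf.stalk (f y) :=
  (ΓSpecIso B).inv ≫ (f.appIso ⊤).inv ≫ X.presheaf.germ (f ''ᵁ ⊤) (f y) (mem_image_top f y)

/-- An open immersion is an isomorphism on stalks, and the stalk of `Spec B` at `y` is the
localization of `B`; the work lies in matching the maps from `B`. -/
theorem isLocalization_toStalk (y : Spec B) :
    letI := (toStalk f y).hom.toAlgebra
    haveI := y.2
    IsLocalization.AtPrime (X.presheaf.stalk (f y)) y.asIdeal := by
  let _ := (toStalk f y).hom.toAlgebra
  have hy : y.asIdeal.IsPrime := y.2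
  have h1 : toStalk f y ≫ f.stalkMap y =
      CommRingCat.ofHom (algebraMap B (Localization.AtPrime y.asIdeal)) ≫
        (Spec.stalkIso B y).inv := by
    refine Eq.trans ?_ (Spec.algebraMap_stalkIso_inv y).symm
    simp only [toStalk, Category.assoc]
    rw [Scheme.Hom.germ_stalkMap, Scheme.Hom.appIso_inv_app_assoc]
    congr 1
    exact TopCat.Presheaf.germ_res (Spec B).presheaf _ y _
  have h2 : CommRingCat.ofHom (algebraMap B (Localization.AtPrime y.asIdeal)) ≫
      ((Spec.stalkIso B y).symm ≪≫ (asIso (f.stalkMap y)).symm).hom = toStalk f y := by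
    simp [← reassoc_of% h1]
  let e : Localization.AtPrime y.asIdeal ≃ₐ[B] X.presheaf.stalk (f y) :=
    AlgEquiv.ofRingEquiv (f := ((Spec.stalkIso B y).symm ≪≫
      (asIso (f.stalkMap y)).symm).commRingCatIsoToRingEquiv) fun b => congr($h2 b)
  exact IsLocalization.isLocalization_of_algEquiv y.asIdeal.primeCompl e

theorem toStalk_eq_germ {y : Spec B} {U : (Spec B).Opens} (hy : y ∈ U) (b : B) :
    toStalk f y b = X.presheaf.germ (f ''ᵁ U) (f y) (mem_image f hy)
      ((f.appIso U).inv ((Spec B).presheaf.map U.leTop.op ((ΓSpecIso B).inv b))) := by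
  have h := f.appIso_inv_naturality U.leTop.op
  have : toStalk f y = (ΓSpecIso B).inv ≫ (Spec B).presheaf.map U.leTop.op ≫ (f.appIso U).inv ≫
      X.presheaf.germ (f ''ᵁ U) (f y) (mem_image f hy) := by
    rw [reassoc_of% h, toStalk]
    congr 2
    exact (TopCat.Presheaf.germ_res' X.presheaf _ _ _).symm
  exact congr($this b)

/-- The two conditions on `ψ` say, after taking germs, that the stalk of `F` is the localization of
`P` at `y`. -/
theorem IsLocalizing.isCohenMacaulayModule [IsNoetherianRing B] {P : ModuleCat.{u} B}
    [Module.Finite B P] {F : X.Modules} {ψ : P →ₗ[B] Γ(F.restrict f, ⊤)} (h : IsLocalizing ψ)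
    (y : Spec B) (hy : haveI := y.2
      IsCohenMacaulayModule (Localization.AtPrime y.asIdeal)
        (LocalizedModule y.asIdeal.primeCompl P)) :
    IsCohenMacaulayModule (X.presheaf.stalk (f y)) (F.presheaf.stalk (f y)) := by
  let _ := (toStalk f y).hom.toAlgebra
  have hy' : y.asIdeal.IsPrime := y.2
  have h1 := isLocalization_toStalk f y
  let _ : Module B (F.presheaf.stalk (f y)) := Module.compHom _ (toStalk f y).hom
  have h2 : IsScalarTower B (X.presheaf.stalk (f y)) (F.presheaf.stalk (f y)) :=
    .of_algebraMap_smul fun _ _ => rfl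
  have hsmul (U : (Spec B).Opens) (hyU : y ∈ U) (b : B) (z : Γ(F.restrict f, U)) :
      F.presheaf.germ (f ''ᵁ U) (f y) (mem_image f hyU) ((F.restrictAppIso f U).hom (b • z)) =
      b • F.presheaf.germ (f ''ᵁ U) (f y) (mem_image f hyU) ((F.restrictAppIso f U).hom z) := by
    refine Eq.trans ?_ (Eq.refl (toStalk f y b •
      F.presheaf.germ (f ''ᵁ U) (f y) (mem_image f hyU) ((F.restrictAppIso f U).hom z)))
    rw [toStalk_eq_germ f hyU, smul_Spec_def]
    exact germ_smul F (f y) (f ''ᵁ U) (mem_image f hyU) _ _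
  have hres {U V : (Spec B).Opens} (i : V ⟶ U) (hyV : y ∈ V) (z : Γ(F.restrict f, U)) :
      F.presheaf.germ (f ''ᵁ V) (f y) (mem_image f hyV)
        ((F.restrictAppIso f V).hom ((F.restrict f).presheaf.map i.op z)) =
      F.presheaf.germ (f ''ᵁ U) (f y) (mem_image f (i.le hyV)) ((F.restrictAppIso f U).hom z) := by
    rw [← TopCat.Presheaf.germ_res_apply F.presheaf (f.opensFunctor.map i) (f y) (mem_image f hyV)]
    rfl
  let g : P →ₗ[B] F.presheaf.stalk (f y) :=
    { toFun := fun p => F.presheaf.germ (f ''ᵁ ⊤) (f y) (mem_image_top f y)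
        ((F.restrictAppIso f ⊤).hom (ψ p))
      map_add' := fun p p' => by simp only [map_add]
      map_smul' := fun b p => by rw [LinearMap.map_smul, hsmul ⊤ trivial]; rfl }
  have hg : IsLocalizedModule y.asIdeal.primeCompl g := by
    refine ⟨fun b => ?_, fun z => ?_, fun {p p'} hp => ?_⟩
    · have hu := (IsLocalization.map_units (X.presheaf.stalk (f y)) b).map
        (Module.toModuleEnd (X.presheaf.stalk (f y)) (S := X.presheaf.stalk (f y))
          (F.presheaf.stalk (f y)))
      rw [Module.End.isUnit_iff] at hu ⊢
      exact hu
    · obtain ⟨U, hyU, z, rfl⟩ := TopCat.Presheaf.exists_germ_eq F.presheaf z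
      have hle : f ''ᵁ (f ⁻¹ᵁ U) ≤ U := f.image_preimage_le U
      obtain ⟨b, hb, p, V, i, hyV, hV⟩ := h.exists_eq_smul y (f ⁻¹ᵁ U) hyU
        ((F.restrictAppIso f _).inv (F.presheaf.map (homOfLE hle).op z))
      refine ⟨⟨p, ⟨b, hb⟩⟩, ?_⟩
      have h3 := congrArg (fun t => F.presheaf.germ (f ''ᵁ V) (f y) (mem_image f hyV)
        ((F.restrictAppIso f V).hom t)) hV
      beta_reduce at h3
      rw [hsmul V hyV, hres i hyV, hres _ hyV] at h3
      refine Eq.trans (congrArg (fun t : F.presheaf.stalk (f y) => b • t) ?_) h3.symm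
      exact (TopCat.Presheaf.germ_res_apply F.presheaf (homOfLE hle) (f y)
        (mem_image f (U := f ⁻¹ᵁ U) hyU) z).symm
    · have hz : g (p - p') = F.presheaf.germ (f ''ᵁ ⊤) (f y) (mem_image_top f y) 0 := by
        rw [map_sub, hp, sub_self, map_zero]
      obtain ⟨W, hyW, i, j, hW⟩ := TopCat.Presheaf.germ_eq F.presheaf (f y) (mem_image_top f y)
        (mem_image_top f y) ((F.restrictAppIso f ⊤).hom (ψ (p - p'))) 0 hz
      have hle : f ''ᵁ (f ⁻¹ᵁ W) ≤ W := f.image_preimage_le W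
      obtain ⟨b, hb, hbp⟩ := h.exists_smul_eq_zero y (f ⁻¹ᵁ W) hyW (p - p') (by
        rw [map_zero] at hW
        have h4 := congrArg (F.presheaf.map (homOfLE hle).op) hW
        rw [map_zero, ← F.presheaf.map_comp_apply] at h4
        exact h4)
      exact ⟨⟨b, hb⟩, sub_eq_zero.1 ((smul_sub _ _ _).symm.trans hbp)⟩
  -- The statement about smaller primes is used with equal primes, in order to pass from the
  -- standard localizations to the stalks.
  exact hy.of_le le_rfl g

end AlgebraicGeometry.Scheme.Modules

end

/-! ### Degree-zero localizations of graded modules and sections over `Proj`. -/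

noncomputable section

namespace ProjModule

set_option linter.unusedSectionVars false

variable {A σ τ : Type u} [CommRing A] [SetLike σ A] [AddSubgroupClass σ A]
  (𝒜 : ℕ → σ) [GradedRing 𝒜] {N : Type u} [AddCommGroup N] [Module A N] [SetLike τ N]
  [AddSubgroupClass τ N] (𝒩 : ℕ → τ) [SetLike.GradedSMul 𝒜 𝒩]

/-- A localization of a module is a module over the degree `0` part of the localized ring. -/
instance moduleHomogeneousLocalization (S : Submonoid A) :
    Module (HomogeneousLocalization 𝒜 S) (LocalizedModule S N) :=
  Module.compHom _ (algebraMap (HomogeneousLocalization 𝒜 S) (Localization S))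

theorem smul_def {S : Submonoid A} (b : HomogeneousLocalization 𝒜 S) (z : LocalizedModule S N) :
    b • z = b.val • z :=
  rfl

theorem mk_smul_mk {S : Submonoid A} (b : HomogeneousLocalization.NumDenSameDeg 𝒜 S) (n : N)
    (s : S) : HomogeneousLocalization.mk b • LocalizedModule.mk n s =
      LocalizedModule.mk (b.num.1 • n) (⟨b.den.1, b.den_mem⟩ * s) := by
  rw [smul_def, HomogeneousLocalization.val_mk, LocalizedModule.mk_smul_mk]

/-- The degree `0` part of the localization of a graded module. -/
def degreeZero (S : Submonoid A) :
    Submodule (HomogeneousLocalization 𝒜 S) (LocalizedModule S N) where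
  carrier := {z | ∃ (d : ℕ) (n : 𝒩 d) (s : S), s.1 ∈ 𝒜 d ∧ z = LocalizedModule.mk n.1 s}
  zero_mem' := ⟨0, ⟨0, zero_mem _⟩, 1, SetLike.GradedOne.one_mem, by simp⟩
  add_mem' := by
    rintro _ _ ⟨d, n, s, hs, rfl⟩ ⟨d', n', s', hs', rfl⟩
    refine ⟨d + d', ⟨s'.1 • n.1 + s.1 • n'.1, add_mem ?_ ?_⟩, s * s',
      SetLike.mul_mem_graded hs hs', LocalizedModule.mk_add_mk⟩
    · rw [add_comm d d']
      exact SetLike.GradedSMul.smul_mem hs' n.2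
    · exact SetLike.GradedSMul.smul_mem hs n'.2
  smul_mem' := by
    rintro b _ ⟨d, n, s, hs, rfl⟩
    obtain ⟨b, rfl⟩ := HomogeneousLocalization.mk_surjective b
    exact ⟨b.deg + d, ⟨b.num.1 • n.1, SetLike.GradedSMul.smul_mem b.num.2 n.2⟩,
      ⟨b.den.1, b.den_mem⟩ * s, SetLike.mul_mem_graded b.den.2 hs, mk_smul_mk 𝒜 b n.1 s⟩

variable {𝒜 𝒩}

theorem mk_mem_degreeZero {S : Submonoid A} {d : ℕ} {n : N} (hn : n ∈ 𝒩 d) {s : S}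
    (hs : s.1 ∈ 𝒜 d) : LocalizedModule.mk n s ∈ degreeZero 𝒜 𝒩 S :=
  ⟨d, ⟨n, hn⟩, s, hs, rfl⟩

theorem liftOfLE_mk {S T : Submonoid A} (h : S ≤ T) (n : N) (s : S) :
    LocalizedModule.liftOfLE S T h (LocalizedModule.mk n s) =
      LocalizedModule.mk n ⟨s.1, h s.2⟩ := by
  rw [IsLocalizedModule.mk_eq_mk', IsLocalizedModule.mk_eq_mk', LocalizedModule.liftOfLE,
    IsLocalizedModule.liftOfLE_mk']

theorem liftOfLE_smul {S T : Submonoid A} (h : S ≤ T) (b : HomogeneousLocalization 𝒜 S)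
    (z : LocalizedModule S N) : LocalizedModule.liftOfLE S T h (b • z) =
      HomogeneousLocalization.mapId 𝒜 h b • LocalizedModule.liftOfLE S T h z := by
  obtain ⟨b, rfl⟩ := HomogeneousLocalization.mk_surjective b
  induction z using LocalizedModule.induction_on with
  | h n s =>
    rw [mk_smul_mk, liftOfLE_mk, liftOfLE_mk]
    exact (mk_smul_mk 𝒜 ⟨b.deg, b.num, b.den, h b.den_mem⟩ n ⟨s.1, h s.2⟩).symm

/-- A homogeneous element is killed by a homogeneous element outside of a homogeneous prime ideal
as soon as it is killed by some element outside of it. -/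
theorem exists_homogeneous_smul_eq_zero [DirectSum.Decomposition 𝒩] {x : ProjectiveSpectrum.top 𝒜}
    {d : ℕ} {n : N} (hn : n ∈ 𝒩 d) {c : A} (hc : c ∈ compl 𝒜 x) (h : c • n = 0) :
    ∃ (i : ℕ) (a : 𝒜 i), a.1 ∈ compl 𝒜 x ∧ a.1 • n = 0 := by
  classical
  by_contra! hcon
  refine hc ?_
  rw [← DirectSum.sum_support_decompose 𝒜 c]
  refine Ideal.sum_mem _ fun i _ => ?_
  by_contra hi
  refine hcon i (DirectSum.decompose 𝒜 c i) hi ?_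
  have h1 : (DirectSum.decompose 𝒩 (c • n) (i + d) : N) = (DirectSum.decompose 𝒜 c i).1 • n := by
    conv_lhs => rw [← DirectSum.sum_support_decompose 𝒜 c, Finset.sum_smul, DirectSum.decompose_sum]
    rw [DFinsupp.finsetSum_apply, AddSubmonoidClass.coe_finsetSum]
    rw [Finset.sum_eq_single i]
    · exact DirectSum.decompose_of_mem_same 𝒩
        (SetLike.GradedSMul.smul_mem (DirectSum.decompose 𝒜 c i).2 hn)
    · intro j _ hj
      exact DirectSum.decompose_of_mem_ne 𝒩
        (SetLike.GradedSMul.smul_mem (DirectSum.decompose 𝒜 c j).2 hn) (by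
          rw [vadd_eq_add]; omega)
    · intro hi
      rw [DFinsupp.notMem_support_iff.1 hi, ZeroMemClass.coe_zero, zero_smul,
        DirectSum.decompose_zero]
      rfl
  rw [← h1, h, DirectSum.decompose_zero]
  rfl

section Sections

variable [DirectSum.Decomposition 𝒩] {U V : (Proj 𝒜).Opens}

/-- The value of a section of the sheaf associated with a graded module at a point. -/
def value (t : Γ(associatedSheaf 𝒜 𝒩, U)) (x : U) : Localizations 𝒜 N x.1 :=
  (show (sheafInType 𝒜 𝒩).obj.obj (op U) from t).1 x

theorem value_ext {t t' : Γ(associatedSheaf 𝒜 𝒩, U)} (h : ∀ x, value t x = value t' x) : t = t' :=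
  Subtype.ext (funext h)

theorem exists_value_eq (t : Γ(associatedSheaf 𝒜 𝒩, U)) (x : U) :
    ∃ (V : (Proj 𝒜).Opens) (i : V ⟶ U) (_ : x.1 ∈ V) (d : ℕ) (n : 𝒩 d) (s : 𝒜 d), ∀ y : V,
      ∃ hs : s.1 ∈ compl 𝒜 y.1, value t ⟨y.1, i.le y.2⟩ = LocalizedModule.mk n.1 ⟨s.1, hs⟩ := by
  obtain ⟨V, hx, i, d, n, s, h⟩ := (show (sheafInType 𝒜 𝒩).obj.obj (op U) from t).2 x
  exact ⟨V, i, hx, d, n, s, h⟩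

variable {f : A}

theorem powers_le_compl {x : ProjectiveSpectrum.top 𝒜} (hx : x ∈ Proj.basicOpen 𝒜 f) :
    Submonoid.powers f ≤ compl 𝒜 x :=
  Submonoid.powers_le.2 hx

/-- The section of the sheaf associated with a graded module given by a fraction whose denominator
is a power of `f`. -/
def awaySection (hU : U ≤ Proj.basicOpen 𝒜 f) :
    degreeZero 𝒜 𝒩 (Submonoid.powers f) →+ Γ(associatedSheaf 𝒜 𝒩, U) where
  toFun z := show (sheafInType 𝒜 𝒩).obj.obj (op U) from
    ⟨fun x => LocalizedModule.liftOfLE _ _ (powers_le_compl (hU x.2)) z.1, fun x => by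
      obtain ⟨_, d, n, s, hs, rfl⟩ := z
      exact ⟨U, x.2, 𝟙 _, d, n, ⟨s.1, hs⟩, fun y => ⟨powers_le_compl (hU y.2) s.2,
        liftOfLE_mk _ _ _⟩⟩⟩
  map_zero' := value_ext fun x => map_zero _
  map_add' z z' := value_ext fun x => map_add _ _ _

theorem value_awayToSection_smul (hU : U ≤ Proj.basicOpen 𝒜 f)
    (b : HomogeneousLocalization.Away 𝒜 f) (t : Γ(associatedSheaf 𝒜 𝒩, U)) (x : U) :
    value ((Proj 𝒜).presheaf.map (homOfLE hU).op (Proj.awayToSection 𝒜 f b) • t) x =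
      (HomogeneousLocalization.mapId 𝒜 (powers_le_compl (hU x.2)) b).val • value t x :=
  rfl

end Sections

end ProjModule

end

/-! ### The associated sheaf on affine charts of `Proj`. -/

noncomputable section

namespace ProjModule

set_option linter.unusedSectionVars false

variable {A σ τ : Type u} [CommRing A] [SetLike σ A] [AddSubgroupClass σ A]
  {𝒜 : ℕ → σ} [GradedRing 𝒜] {N : Type u} [AddCommGroup N] [Module A N] [SetLike τ N]
  [AddSubgroupClass τ N] {𝒩 : ℕ → τ} [SetLike.GradedSMul 𝒜 𝒩]
  {f : A} {m : ℕ} (f_deg : f ∈ 𝒜 m) (hm : 0 < m)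

variable (𝒜 f) in
/-- The ring of functions on the basic open subset of `f`. -/
def awayRing : CommRingCat.{u} :=
  .of (HomogeneousLocalization.Away 𝒜 f)

variable (𝒜 𝒩 f) in
/-- The degree `0` part of the localization of a graded module at the powers of `f`. -/
def awayModule : ModuleCat.{u} (awayRing 𝒜 f) :=
  ModuleCat.of (HomogeneousLocalization.Away 𝒜 f) (degreeZero 𝒜 𝒩 (Submonoid.powers f))

/-- The open immersion of the affine chart associated with `f`. -/
def chart : Spec (awayRing 𝒜 f) ⟶ Proj 𝒜 :=
  Proj.awayι 𝒜 f f_deg hm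

instance : IsOpenImmersion (chart f_deg hm) :=
  inferInstanceAs (IsOpenImmersion (Proj.awayι 𝒜 f f_deg hm))

theorem opensRange_chart : (chart f_deg hm).opensRange = Proj.basicOpen 𝒜 f :=
  Proj.opensRange_awayι 𝒜 f f_deg hm

theorem chart_image_le (U : (Spec (awayRing 𝒜 f)).Opens) :
    chart f_deg hm ''ᵁ U ≤ Proj.basicOpen 𝒜 f :=
  ((chart f_deg hm).image_le_opensRange U).trans_eq (opensRange_chart f_deg hm)

theorem chart_preimage_top : ⊤ ≤ chart f_deg hm ⁻¹ᵁ Proj.basicOpen 𝒜 f := by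
  rw [← opensRange_chart f_deg hm, Scheme.Hom.preimage_opensRange]

theorem awayToSection_appLE :
    Proj.awayToSection 𝒜 f ≫ (chart f_deg hm).appLE (Proj.basicOpen 𝒜 f) ⊤
      (chart_preimage_top f_deg hm) = (Scheme.ΓSpecIso (awayRing 𝒜 f)).inv := by
  have h1 : (Scheme.ΓSpecIso (awayRing 𝒜 f)).inv ≫ (Proj.basicOpenToSpec 𝒜 f).app ⊤ =
      Proj.awayToSection 𝒜 f ≫ (Proj.basicOpen 𝒜 f).topIso.inv :=
    (Iso.inv_comp_eq _).2 (Proj.basicOpenToSpec_app_top 𝒜 f)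
  have h2 : (chart f_deg hm).appLE (Proj.basicOpen 𝒜 f) ⊤
      (chart_preimage_top f_deg hm) = (Proj.basicOpen 𝒜 f).topIso.inv ≫
        (Proj.basicOpenIsoSpec 𝒜 f f_deg hm).inv.appTop := by
    have h4 : (Proj.basicOpen 𝒜 f).topIso.inv =
        (Proj.basicOpen 𝒜 f).ι.appLE (Proj.basicOpen 𝒜 f) ⊤ (by simp) := by
      simp only [Scheme.Opens.topIso, Scheme.Hom.appLE, Scheme.Opens.ι_app]
      rfl
    have h5 : (Proj.basicOpenIsoSpec 𝒜 f f_deg hm).inv.appTop =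
        (Proj.basicOpenIsoSpec 𝒜 f f_deg hm).inv.appLE ⊤ ⊤ le_rfl :=
      (Scheme.Hom.appLE_eq_app _).symm
    rw [h4, h5]
    exact (Scheme.Hom.appLE_comp_appLE (Proj.basicOpenIsoSpec 𝒜 f f_deg hm).inv
      (Proj.basicOpen 𝒜 f).ι _ _ _ _ _).symm
  have h3 : (Proj.basicOpenToSpec 𝒜 f).app ⊤ ≫
      (Proj.basicOpenIsoSpec 𝒜 f f_deg hm).inv.appTop = 𝟙 _ := by
    rw [← Proj.basicOpenIsoSpec_hom 𝒜 f f_deg hm]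
    exact (Scheme.Hom.comp_appTop _ _).symm.trans
      (by rw [Iso.inv_hom_id]; exact Scheme.Hom.id_app _)
  rw [h2]
  exact congr($h1.symm ≫ (Proj.basicOpenIsoSpec 𝒜 f f_deg hm).inv.appTop).trans
    (congr((Scheme.ΓSpecIso (awayRing 𝒜 f)).inv ≫ $h3).trans (Category.comp_id _))

theorem appIso_inv_chart (U : (Spec (awayRing 𝒜 f)).Opens) :
    (Scheme.ΓSpecIso (awayRing 𝒜 f)).inv ≫
      (Spec (awayRing 𝒜 f)).presheaf.map U.leTop.op ≫ ((chart f_deg hm).appIso U).inv =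
    Proj.awayToSection 𝒜 f ≫ (Proj 𝒜).presheaf.map (homOfLE (chart_image_le f_deg hm U)).op := by
  let a : awayRing 𝒜 f ⟶ Γ(Proj 𝒜, Proj.basicOpen 𝒜 f) := Proj.awayToSection 𝒜 f
  have ha : a ≫ (chart f_deg hm).appLE (Proj.basicOpen 𝒜 f) ⊤ (chart_preimage_top f_deg hm) =
      (Scheme.ΓSpecIso (awayRing 𝒜 f)).inv := awayToSection_appLE f_deg hm
  change _ = a ≫ _
  rw [← ha, Category.assoc, Scheme.Hom.appLE_map_assoc, Scheme.Hom.appLE_appIso_inv]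

variable [DirectSum.Decomposition 𝒩]

theorem value_smul_restrict {U : (Spec (awayRing 𝒜 f)).Opens}
    (b : awayRing 𝒜 f)
    (z : Γ((associatedSheaf 𝒜 𝒩).restrict (chart f_deg hm), U))
    (x : ↥(chart f_deg hm ''ᵁ U)) :
    value (U := chart f_deg hm ''ᵁ U)
      (((associatedSheaf 𝒜 𝒩).restrictAppIso (chart f_deg hm) U).hom (b • z)) x =
    HomogeneousLocalization.mapId 𝒜 (powers_le_compl (chart_image_le f_deg hm U x.2)) b •
      value (U := chart f_deg hm ''ᵁ U)
      (((associatedSheaf 𝒜 𝒩).restrictAppIso (chart f_deg hm) U).hom z) x := by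
  refine Eq.trans ?_ (value_awayToSection_smul (chart_image_le f_deg hm U) b
    (((associatedSheaf 𝒜 𝒩).restrictAppIso (chart f_deg hm) U).hom z) x)
  have := congr($(appIso_inv_chart f_deg hm U) b)
  rw [Scheme.Modules.smul_Spec_def]
  exact congr(value (U := chart f_deg hm ''ᵁ U) ($this •
    (((associatedSheaf 𝒜 𝒩).restrictAppIso (chart f_deg hm) U).hom z)) x)

variable (𝒩) in
/-- The map from the degree `0` part of the localization of a graded module at the powers of `f`
to the sections of the associated sheaf over the basic open subset of `f`. -/
def awayHom : awayModule 𝒜 𝒩 f →ₗ[awayRing 𝒜 f]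
    Γ((associatedSheaf 𝒜 𝒩).restrict (chart f_deg hm), ⊤) where
  toFun z := ((associatedSheaf 𝒜 𝒩).restrictAppIso (chart f_deg hm) ⊤).inv
    (awaySection (chart_image_le f_deg hm ⊤) z)
  map_add' z z' :=
    congrArg ((associatedSheaf 𝒜 𝒩).restrictAppIso (chart f_deg hm) ⊤).inv
      (map_add (awaySection (chart_image_le f_deg hm ⊤)) z z')
  map_smul' b z := by
    refine value_ext (U := chart f_deg hm ''ᵁ ⊤) fun x => ?_
    refine Eq.trans ?_ (value_smul_restrict f_deg hm b _ x).symm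
    exact liftOfLE_smul _ b z.1

theorem mem_compl_of_mem_image {U : (Spec (awayRing 𝒜 f)).Opens}
    {x : Proj 𝒜} (hx : x ∈ chart f_deg hm ''ᵁ U) : f ∈ compl 𝒜 x :=
  chart_image_le f_deg hm U hx

theorem value_awayHom {U : (Spec (awayRing 𝒜 f)).Opens}
    (z : awayModule 𝒜 𝒩 f) (x : ↥(chart f_deg hm ''ᵁ U)) :
    value (U := chart f_deg hm ''ᵁ U)
      (((associatedSheaf 𝒜 𝒩).restrict (chart f_deg hm)).presheaf.map
        (homOfLE le_top : U ⟶ ⊤).op (awayHom 𝒩 f_deg hm z)) x =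
    LocalizedModule.liftOfLE _ _ (powers_le_compl (chart_image_le f_deg hm U x.2)) z.1 :=
  rfl

theorem isLocalizationElem_notMem {g : A} {d : ℕ} (hg : g ∈ 𝒜 d) (hd : 0 < d)
    {y : Spec (awayRing 𝒜 f)}
    (h : g ∈ compl 𝒜 (chart f_deg hm y)) :
    HomogeneousLocalization.Away.isLocalizationElem f_deg hg ∉ y.asIdeal := by
  have h1 : y ∈ chart f_deg hm ⁻¹ᵁ Proj.basicOpen 𝒜 g := h
  exact (Proj.awayι_preimage_basicOpen 𝒜 f_deg hm hg hd).le h1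

/-- Multiplying numerator and denominator by `f` makes the degree of the denominator positive, as
required to describe its basic open set on the chart. -/
theorem exists_value_eq_of_pos (hf : f ∈ 𝒜 m) (hm : 0 < m)
    {U : (Proj 𝒜).Opens} (hU : U ≤ Proj.basicOpen 𝒜 f)
    (t : Γ(associatedSheaf 𝒜 𝒩, U)) (x : U) :
    ∃ (V : (Proj 𝒜).Opens) (i : V ⟶ U) (_ : x.1 ∈ V) (d : ℕ) (_ : 0 < d) (n : 𝒩 d) (s : 𝒜 d),
      ∀ y : V, ∃ hs : s.1 ∈ compl 𝒜 y.1,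
        value t ⟨y.1, i.le y.2⟩ = LocalizedModule.mk n.1 ⟨s.1, hs⟩ := by
  obtain ⟨V, i, hx, d, n, s, h⟩ := exists_value_eq t x
  refine ⟨V, i, hx, m + d, by omega, ⟨f • n.1, SetLike.GradedSMul.smul_mem hf n.2⟩,
    ⟨f * s.1, SetLike.mul_mem_graded hf s.2⟩, fun y => ?_⟩
  obtain ⟨hs, e⟩ := h y
  have hf' : f ∈ compl 𝒜 y.1 := hU (i.le y.2)
  exact ⟨mul_mem hf' hs,
    e.trans (LocalizedModule.mk_cancel_common_left ⟨f, hf'⟩ ⟨s.1, hs⟩ n.1).symm⟩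

/-- A local section `n / s` of degree `d`, multiplied by `s ^ m / f ^ d`, becomes `s ^ (m - 1) n / f
^ d`, which is defined on the whole chart. If `n / f ^ k` vanishes at a point, then `n` is killed by
a homogeneous `a` outside the corresponding prime; `f a` has positive degree and supplies the
required function on the chart. -/
theorem isLocalizing_awayHom :
    Scheme.Modules.IsLocalizing (awayHom 𝒩 f_deg hm) := by
  constructor
  · intro y U hy z
    obtain ⟨V, i, hx, d, hd, n, s, h⟩ := exists_value_eq_of_pos f_deg hm (chart_image_le f_deg hm U)
      (((associatedSheaf 𝒜 𝒩).restrictAppIso (chart f_deg hm) U).hom z)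
      ⟨chart f_deg hm y, Scheme.Modules.mem_image _ hy⟩
    have hVU : chart f_deg hm ⁻¹ᵁ V ≤ U := fun w hw => by
      obtain ⟨w', hw', e⟩ := i.le (show chart f_deg hm w ∈ V from hw)
      rwa [← (chart f_deg hm).isOpenEmbedding.injective e]
    have hp : s.1 ^ (m - 1) • n.1 ∈ 𝒩 (m * d) := by
      have := SetLike.GradedSMul.smul_mem (SetLike.pow_mem_graded (m - 1) s.2) n.2
      rwa [smul_eq_mul, vadd_eq_add, ← Nat.succ_mul, Nat.succ_eq_add_one,
        Nat.sub_add_cancel hm] at this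
    have hfd : f ^ d ∈ 𝒜 (m * d) := by
      rw [mul_comm]
      exact SetLike.pow_mem_graded d f_deg
    refine ⟨HomogeneousLocalization.Away.isLocalizationElem f_deg s.2,
      isLocalizationElem_notMem f_deg hm s.2 hd (h ⟨_, hx⟩).1,
      ⟨_, mk_mem_degreeZero hp (s := (⟨f ^ d, d, rfl⟩ : Submonoid.powers f)) hfd⟩,
      chart f_deg hm ⁻¹ᵁ V, homOfLE hVU, hx, ?_⟩
    refine value_ext (U := chart f_deg hm ''ᵁ (chart f_deg hm ⁻¹ᵁ V))
      fun x => ?_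
    refine (value_awayHom f_deg hm _ x).trans
      (Eq.trans ?_ (value_smul_restrict f_deg hm _ _ x).symm)
    obtain ⟨hs, e⟩ := h ⟨x.1, (chart f_deg hm).image_preimage_le V x.2⟩
    refine Eq.trans ?_ (congrArg (HomogeneousLocalization.mapId 𝒜 (powers_le_compl
      (chart_image_le f_deg hm _ x.2))
        (HomogeneousLocalization.Away.isLocalizationElem f_deg s.2) • ·) e.symm)
    refine (liftOfLE_mk _ _ _).trans (Eq.trans ?_ (mk_smul_mk 𝒜 ⟨m * d, ⟨s.1 ^ m, by
      rw [mul_comm m d]; rw [mul_comm]; exact SetLike.pow_mem_graded m s.2⟩, ⟨f ^ d, hfd⟩,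
        pow_mem (mem_compl_of_mem_image f_deg hm x.2) d⟩ n.1 ⟨s.1, hs⟩).symm)
    rw [LocalizedModule.mk_eq]
    refine ⟨1, ?_⟩
    simp only [one_smul, Submonoid.smul_def, Submonoid.coe_mul, smul_smul]
    congr 1
    obtain ⟨k, rfl⟩ := Nat.exists_eq_add_of_lt hm
    simp only [Nat.zero_add, Nat.add_sub_cancel]
    ring
  · intro y U hy ⟨_, d, n, ⟨_, k, rfl⟩, hs, rfl⟩ h
    let x : ↥(chart f_deg hm ''ᵁ U) :=
      ⟨chart f_deg hm y, Scheme.Modules.mem_image _ hy⟩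
    have h1 : LocalizedModule.liftOfLE _ _ (powers_le_compl (chart_image_le f_deg hm U x.2))
        (LocalizedModule.mk n.1 (⟨f ^ k, k, rfl⟩ : Submonoid.powers f)) = 0 :=
      congr(value (U := chart f_deg hm ''ᵁ U) $h x)
    rw [liftOfLE_mk, ← LocalizedModule.zero_mk 1, LocalizedModule.mk_eq] at h1
    obtain ⟨⟨c, hc⟩, hcn⟩ := h1
    rw [one_smul, smul_zero, smul_zero] at hcn
    obtain ⟨i, a, ha, han⟩ := exists_homogeneous_smul_eq_zero n.2 hc hcn
    have hfa : f * a.1 ∈ compl 𝒜 (chart f_deg hm y) :=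
      mul_mem (mem_compl_of_mem_image f_deg hm x.2) ha
    refine ⟨_, isLocalizationElem_notMem f_deg hm (SetLike.mul_mem_graded f_deg a.2)
      (by omega) hfa, Subtype.ext ?_⟩
    refine (mk_smul_mk 𝒜 _ n.1 _).trans ?_
    have : (f * a.1) ^ m • n.1 = 0 := by
      obtain ⟨l, rfl⟩ := Nat.exists_eq_add_of_lt hm
      rw [zero_add, pow_succ, mul_smul, mul_smul, han, smul_zero, smul_zero]
    exact (congrArg (fun t => LocalizedModule.mk t _) this).trans (LocalizedModule.zero_mk _)

end ProjModule

end

/-! ### Blowing up a product of initial ideals: pivots and coordinates. -/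

namespace VarSum

set_option linter.unusedSectionVars false

variable {R A M M' : Type*} [CommRing R] [CommRing A] [Algebra R A]
  [AddCommGroup M] [Module R M] [AddCommGroup M'] [Module R M'] [Module A M'] [IsScalarTower R A M']

/-- The ring `A` is the subring `R[I / g]` of `R_g`, and `M'` is the submodule generated by the
quotients `I ^ k M / g ^ k` of `M_g`. -/
structure IsBlowupChart (A : Type*) [CommRing A] [Algebra R A] (I : Ideal R) (g : R)
    (φ : M →ₗ[R] M') : Prop where
  smul_eq_zero : ∀ z : M', g • z = 0 → z = 0
  mul_eq_zero : ∀ y : A, algebraMap R A g * y = 0 → y = 0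
  exists_mul_eq : ∀ a ∈ I, ∃ y : A, algebraMap R A g * y = algebraMap R A a
  exists_pow_mul_eq : ∀ y : A, ∃ k, ∃ a ∈ I ^ k, algebraMap R A g ^ k * y = algebraMap R A a
  exists_pow_smul_eq : ∀ z : M', ∃ k, ∃ m ∈ (I ^ k • ⊤ : Submodule R M), g ^ k • z = φ m
  ker : ∀ m, φ m = 0 → ∃ k, g ^ k • m = 0

theorem lt_of_pivot {f : ℕ → ℕ} {s : ℕ} (hf : f 1 = 0)
    (hf' : ∀ k, 1 ≤ k → k < s → f (k + 1) = f k ∨ f (k + 1) = k) {k : ℕ} (hk : 1 ≤ k)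
    (hks : k ≤ s) : f k < k := by
  induction k, hk using Nat.le_induction with
  | base => omega
  | succ k hk ih =>
    have := ih (by omega)
    rcases hf' k hk (by omega) with h | h <;> omega

theorem prod_ite_mul {B : Type*} [CommMonoid B] (y : ℕ → B) (b : B) {s k : ℕ} (hks : k < s) :
    (∏ i ∈ Finset.Icc 1 s, if i = k + 1 then b else y i) * y (k + 1) =
      (∏ i ∈ Finset.Icc 1 s, y i) * b := by
  have hk : k + 1 ∈ Finset.Icc 1 s := Finset.mem_Icc.2 ⟨by omega, hks⟩
  rw [← Finset.mul_prod_erase _ _ hk, ← Finset.mul_prod_erase _ y hk, if_pos rfl,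
    Finset.prod_congr rfl fun i hi => if_neg (Finset.ne_of_mem_erase hi), mul_right_comm,
    mul_comm b, mul_right_comm]

theorem prod_ite_eq {B : Type*} [CommMonoid B] (y : ℕ → B) (b : B) {s k : ℕ} (hks : k < s) :
    (∏ i ∈ Finset.Icc 1 s, if i = k + 1 then b else y i) =
      (∏ i ∈ Finset.Icc 1 k, y i) * b * ∏ i ∈ Finset.Icc (k + 2) s, y i := by
  have hk : k + 1 ∈ Finset.Icc 1 s := Finset.mem_Icc.2 ⟨by omega, hks⟩
  have hs : (Finset.Icc 1 s).erase (k + 1) = Finset.Icc 1 k ∪ Finset.Icc (k + 2) s := by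
    ext i
    simp only [Finset.mem_erase, Finset.mem_union, Finset.mem_Icc]
    omega
  rw [← Finset.mul_prod_erase _ _ hk, if_pos rfl,
    Finset.prod_congr rfl fun i hi => if_neg (Finset.ne_of_mem_erase hi), hs,
    Finset.prod_union (Finset.disjoint_left.2 fun i hi hi' => by
      rw [Finset.mem_Icc] at hi hi'; omega), mul_left_comm, mul_assoc]

/-- The elements of `R` whose images are divisible by `b`, with a quotient in `S`. -/
def quotientIdeal (S : Subalgebra R A) (b : A) : Ideal R where
  carrier := {a | ∃ y ∈ S, algebraMap R A a = b * y}
  zero_mem' := ⟨0, zero_mem _, by rw [map_zero, mul_zero]⟩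
  add_mem' := by
    rintro a a' ⟨y, hy, h⟩ ⟨y', hy', h'⟩
    exact ⟨y + y', add_mem hy hy', by rw [map_add, h, h', mul_add]⟩
  smul_mem' := by
    rintro r a ⟨y, hy, h⟩
    exact ⟨algebraMap R A r * y, mul_mem (S.algebraMap_mem r) hy, by
      rw [smul_eq_mul, map_mul, h, mul_left_comm]⟩

theorem quotientIdeal_mul (S : Subalgebra R A) (b b' : A) :
    quotientIdeal S b * quotientIdeal S b' ≤ quotientIdeal S (b * b') := by
  rw [Ideal.mul_le]
  rintro a ⟨y, hy, h⟩ a' ⟨y', hy', h'⟩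
  exact ⟨y * y', mul_mem hy hy', by rw [map_mul, h, h', mul_mul_mul_comm]⟩

theorem prod_le_quotientIdeal (S : Subalgebra R A) {ι : Type*} (T : Finset ι) (J : ι → Ideal R)
    (b : ι → A) (h : ∀ i ∈ T, J i ≤ quotientIdeal S (b i)) :
    ∏ i ∈ T, J i ≤ quotientIdeal S (∏ i ∈ T, b i) := by
  classical
  induction T using Finset.induction_on with
  | empty => exact fun a _ => ⟨algebraMap R A a, S.algebraMap_mem a, by simp⟩
  | insert i T hi ih =>
    rw [Finset.prod_insert hi, Finset.prod_insert hi]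
    exact (Ideal.mul_mono (h i (Finset.mem_insert_self i T))
      (ih fun j hj => h j (Finset.mem_insert_of_mem hj))).trans (quotientIdeal_mul S _ _)

theorem pow_le_quotientIdeal (S : Subalgebra R A) {J : Ideal R} {b : A}
    (h : J ≤ quotientIdeal S b) (k : ℕ) : J ^ k ≤ quotientIdeal S (b ^ k) := by
  have := prod_le_quotientIdeal S (Finset.range k) (fun _ => J) (fun _ => b) fun _ _ => h
  rwa [Finset.prod_const, Finset.prod_const, Finset.card_range] at this

/-- The coordinate relations already hold in the subalgebra generated by the coordinates, so
divisibility by the pivot can be established there and the quotients stay inside it. -/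
theorem IsCoordinate.span_le_quotientIdeal {x : ℕ → R} {f : ℕ → ℕ} {c : ℕ → A} {s : ℕ}
    (h : IsCoordinate x f c 1 (s - 1)) (hf : f 1 = 0) {k : ℕ} (hk : 1 ≤ k) (hks : k ≤ s) :
    Ideal.span (x '' Set.Iio k) ≤ quotientIdeal
      (Algebra.adjoin R {a | ∃ k, 1 ≤ k ∧ k < s ∧ c k = a}) (algebraMap R A (x (f k))) := by
  classical
  let S := Algebra.adjoin R {a | ∃ k, 1 ≤ k ∧ k < s ∧ c k = a}
  let c' : ℕ → S := fun k => if h : 1 ≤ k ∧ k < s then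
    ⟨c k, Algebra.subset_adjoin ⟨k, h.1, h.2, rfl⟩⟩ else 0
  have h' : IsCoordinate x f c' 1 (s - 1) := by
    intro l hl hls
    have hc : (c' l : A) = c l := by
      simp only [c']
      rw [dif_pos ⟨hl, by omega⟩]
    refine (h l hl hls).imp (fun h => ⟨h.1, Subtype.ext ?_⟩) fun h => ⟨h.1, Subtype.ext ?_⟩
    · exact (congrArg (· * algebraMap R A (x (f l))) hc).trans h.2
    · exact (congrArg (· * algebraMap R A (x l)) hc).trans h.2
  rw [Ideal.span_le]
  rintro _ ⟨l, hl, rfl⟩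
  obtain ⟨b, hb⟩ := h'.exists_eq hk (by omega) l (by
    rw [hf, Finset.mem_insert, Finset.mem_Ico]
    have : l < k := hl
    omega)
  exact ⟨b, b.2, (congrArg Subtype.val hb).trans (mul_comm _ _)⟩

namespace IsBlowupChart

variable {I : Ideal R} {g : R} {φ : M →ₗ[R] M'}

theorem pow_mul_eq_zero (h : IsBlowupChart A I g φ) {y : A} {k : ℕ}
    (hy : algebraMap R A g ^ k * y = 0) : y = 0 := by
  induction k with
  | zero => rwa [pow_zero, one_mul] at hy
  | succ k ih => exact ih (h.mul_eq_zero _ (by rwa [← mul_assoc, ← pow_succ']))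

theorem pow_smul_eq_zero (h : IsBlowupChart A I g φ) {z : M'} {k : ℕ}
    (hz : g ^ k • z = 0) : z = 0 := by
  induction k with
  | zero => rwa [pow_zero, one_smul] at hz
  | succ k ih => exact ih (h.smul_eq_zero _ (by rwa [← mul_smul, ← pow_succ']))

/-- The charts of the blowing up along a product of ideals generated by initial segments of a
sequence. -/
theorem exists_isAffineChart (h : IsBlowupChart A I g φ) {x : ℕ → R} {f : ℕ → ℕ} {s : ℕ}
    (hI : I = ∏ k ∈ Finset.Icc 1 s, Ideal.span (x '' Set.Iio k))
    (hg : g = ∏ k ∈ Finset.Icc 1 s, x (f k)) (hf : f 1 = 0)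
    (hf' : ∀ k, 1 ≤ k → k < s → f (k + 1) = f k ∨ f (k + 1) = k) :
    ∃ c : ℕ → A, IsAffineChart x f c s φ ∧ ∀ k, 1 ≤ k → k < s → f (k + 1) ≠ f k →
      algebraMap R A g * c k = algebraMap R A ((∏ i ∈ Finset.Icc 1 k, x (f i)) * x (f k) *
        ∏ i ∈ Finset.Icc (k + 2) s, x (f i)) := by
  classical
  -- `x (m k)` is the numerator of the coordinate `c k`, and `a k` is `g` with the pivot in position
  -- `k + 1` exchanged for it; thus `c k = a k / g` is a fraction with numerator in `I`.
  let m : ℕ → ℕ := fun k => if f (k + 1) = f k then k else f k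
  let a : ℕ → R := fun k => ∏ i ∈ Finset.Icc 1 s, if i = k + 1 then x (m k) else x (f i)
  have hlt {k : ℕ} (hk : 1 ≤ k) (hks : k ≤ s) : f k < k := lt_of_pivot hf hf' hk hks
  have ha (k : ℕ) (hk : 1 ≤ k) (hks : k < s) : a k ∈ I := by
    rw [hI]
    refine Ideal.prod_mem_prod fun i hi => Ideal.subset_span ?_
    rw [Finset.mem_Icc] at hi
    split_ifs with hik
    · refine ⟨m k, ?_, rfl⟩
      have := hlt hk hks.le
      simp only [m, Set.mem_Iio]
      split_ifs <;> omega
    · exact ⟨f i, hlt hi.1 hi.2, rfl⟩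
  have hag (k : ℕ) (hks : k < s) : a k * x (f (k + 1)) = g * x (m k) := by
    rw [hg]
    exact prod_ite_mul (fun i => x (f i)) (x (m k)) hks
  choose c hc using fun k => show ∃ y : A, 1 ≤ k → k < s →
      algebraMap R A g * y = algebraMap R A (a k) by
    by_cases hk : 1 ≤ k ∧ k < s
    · obtain ⟨y, hy⟩ := h.exists_mul_eq (a k) (ha k hk.1 hk.2)
      exact ⟨y, fun _ _ => hy⟩
    · exact ⟨0, fun h1 h2 => absurd ⟨h1, h2⟩ hk⟩
  have hcx (k : ℕ) (hk : 1 ≤ k) (hks : k < s) :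
      c k * algebraMap R A (x (f (k + 1))) = algebraMap R A (x (m k)) := by
    rw [← sub_eq_zero]
    refine h.mul_eq_zero _ ?_
    rw [mul_sub, ← mul_assoc, hc k hk hks, ← map_mul, ← map_mul, hag k hks, sub_self]
  have hcoord : IsCoordinate x f c 1 (s - 1) := by
    intro k hk hks
    have h1 := hcx k hk (by omega)
    by_cases hfk : f (k + 1) = f k
    · refine .inl ⟨hfk, ?_⟩
      simpa only [m, if_pos hfk, hfk] using h1
    · have h2 := (hf' k hk (by omega)).resolve_left hfk
      refine .inr ⟨h2, ?_⟩
      simpa only [m, if_neg hfk, h2] using h1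
  -- Every generator of `I` is `g` times an element of the algebra generated by the coordinates. As
  -- the chart consists of fractions with numerator in `I ^ k` and denominator `g ^ k`, this settles
  -- generation of both the ring and the module.
  have hIS : I ≤ quotientIdeal (Algebra.adjoin R {a | ∃ k, 1 ≤ k ∧ k < s ∧ c k = a})
      (algebraMap R A g) := by
    rw [hI, hg, map_prod]
    refine prod_le_quotientIdeal _ _ _ _ fun k hk => ?_
    rw [Finset.mem_Icc] at hk
    exact hcoord.span_le_quotientIdeal hf hk.1 hk.2
  refine ⟨c, ⟨hf, hcoord, fun k hk hks z hz => h.smul_eq_zero z ?_, fun y hy => ?_, ?_, ?_⟩,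
    fun k hk hks hfk => ?_⟩
  · rw [hg, ← Finset.prod_erase_mul _ _ (Finset.mem_Icc.2 ⟨hk, hks⟩), mul_smul, hz, smul_zero]
  · rw [← hg]
    exact h.ker y hy
  · rw [eq_top_iff]
    intro y _
    obtain ⟨k, b, hb, hy⟩ := h.exists_pow_mul_eq y
    obtain ⟨y', hy', e⟩ := pow_le_quotientIdeal _ hIS k hb
    have : y = y' := sub_eq_zero.1 (h.pow_mul_eq_zero (k := k) (by
      rw [mul_sub, hy, e, sub_self]))
    rwa [this]
  · rw [eq_top_iff]
    intro z _
    obtain ⟨k, y, hy, hz⟩ := h.exists_pow_smul_eq z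
    obtain ⟨w, hw, e⟩ : ∃ w ∈ Submodule.span A (Set.range φ), g ^ k • w = φ y := by
      refine Submodule.smul_induction_on hy (fun b hb y _ => ?_) ?_
      · obtain ⟨y', -, e⟩ := pow_le_quotientIdeal _ hIS k hb
        refine ⟨y' • φ y, Submodule.smul_mem _ _ (Submodule.subset_span ⟨y, rfl⟩), ?_⟩
        rw [map_smul, ← algebraMap_smul A (g ^ k), ← algebraMap_smul A b, ← mul_smul, map_pow, e]
      · rintro y y' ⟨w, hw, e⟩ ⟨w', hw', e'⟩
        exact ⟨w + w', add_mem hw hw', by rw [smul_add, e, e', map_add]⟩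
    have : z = w := sub_eq_zero.1 (h.pow_smul_eq_zero (k := k) (by
      rw [smul_sub, hz, e, sub_self]))
    rwa [this]
  · rw [hc k hk hks]
    congr 1
    exact (prod_ite_eq (fun i => x (f i)) (x (m k)) hks).trans (by simp only [m, if_neg hfk])

end IsBlowupChart

/-- The choice of pivots. -/
theorem exists_pivot (x : ℕ → R) (s : ℕ) {I K : Ideal R}
    (hI : I = ∏ k ∈ Finset.Icc 1 s, Ideal.span (x '' Set.Iio k)) (hIK : ¬ I ≤ K)
    (hK : ∀ a ∈ K, ∀ b ∈ I, ∀ u ∈ I, u * u = a * b → u ∈ K) :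
    ∃ f : ℕ → ℕ, f 1 = 0 ∧ (∀ k, 1 ≤ k → k < s → f (k + 1) = f k ∨ f (k + 1) = k ∧
      (∏ i ∈ Finset.Icc 1 k, x (f i)) * x (f k) * ∏ i ∈ Finset.Icc (k + 2) s, x (f i) ∈ K) ∧
      ∏ k ∈ Finset.Icc 1 s, x (f k) ∉ K := by
  classical
  let J : ℕ → Ideal R := fun k => ∏ i ∈ Finset.Icc k s, Ideal.span (x '' Set.Iio i)
  -- Pivots are chosen for the first `k` factors while the remaining factors contribute an
  -- unspecified element `w`. The pivot is changed only if keeping it would put all these products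
  -- into `K`; this later makes the coordinate vanish.
  suffices key : ∀ k ≤ s, ∃ f : ℕ → ℕ, f 1 = 0 ∧ (∀ l, 1 ≤ l → l < k → f (l + 1) = f l ∨
      f (l + 1) = l ∧ ∀ w ∈ J (l + 2), (∏ i ∈ Finset.Icc 1 l, x (f i)) * x (f l) * w ∈ K) ∧
      ∃ w ∈ J (k + 1), (∏ i ∈ Finset.Icc 1 k, x (f i)) * w ∉ K by
    obtain ⟨f, hf, hf', w, -, hw⟩ := key s le_rfl
    have hlt {k : ℕ} (hk : 1 ≤ k) (hks : k ≤ s) : f k < k :=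
      lt_of_pivot hf (fun k hk hks => (hf' k hk hks).imp_right And.left) hk hks
    refine ⟨f, hf, fun k hk hks => (hf' k hk hks).imp_right fun h => ⟨h.1, h.2 _ ?_⟩,
      fun h => hw (Ideal.mul_mem_right _ _ h)⟩
    refine Ideal.prod_mem_prod fun i hi => Ideal.subset_span ⟨f i, ?_, rfl⟩
    rw [Finset.mem_Icc] at hi
    exact hlt (by omega) hi.2
  intro k
  induction k with
  | zero =>
    intro _
    obtain ⟨w, hw, hwK⟩ := Set.not_subset.1 hIK
    exact ⟨fun _ => 0, rfl, fun l _ hl => absurd hl (Nat.not_lt_zero _), w, by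
      rw [hI] at hw; exact hw, by simpa using hwK⟩
  | succ k ih =>
    intro hks
    obtain ⟨f, hf, hf', w, hw, hwK⟩ := ih (by omega)
    have hlt {l : ℕ} (hl : 1 ≤ l) (hlk : l ≤ k) : f l < l :=
      lt_of_pivot hf (fun l hl hlk => (hf' l hl hlk).imp_right And.left) hl hlk
    -- If every generator of the next factor led into `K`, linearity would put the given product
    -- there as well.
    obtain ⟨j, hj, w, hw, hwK⟩ : ∃ j < k + 1, ∃ w ∈ J (k + 2),
        (∏ i ∈ Finset.Icc 1 k, x (f i)) * (x j * w) ∉ K := by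
      by_contra! hcon
      refine hwK ?_
      let L : Ideal R := Submodule.comap (LinearMap.mulLeft R (∏ i ∈ Finset.Icc 1 k, x (f i))) K
      have hL : J (k + 1) ≤ L := by
        have : Finset.Icc (k + 1) s = insert (k + 1) (Finset.Icc (k + 2) s) := by
          ext i
          simp only [Finset.mem_insert, Finset.mem_Icc]
          omega
        simp only [J]
        rw [this, Finset.prod_insert (by simp), Ideal.mul_le]
        intro r hr w hw
        have hle : Ideal.span (x '' Set.Iio (k + 1)) ≤
            Submodule.comap (LinearMap.mulRight R w) L := by
          rw [Ideal.span_le]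
          rintro _ ⟨j, hj, rfl⟩
          exact hcon j hj w hw
        exact hle hr
      exact hL hw
    have hext (v : ℕ) (h0 : k = 0 → v = 0) (hv : 1 ≤ k → v = f k ∨ v = k ∧ ∀ w ∈ J (k + 2),
        (∏ i ∈ Finset.Icc 1 k, x (f i)) * x (f k) * w ∈ K) {w : R} (hw : w ∈ J (k + 2))
        (hwK : (∏ i ∈ Finset.Icc 1 k, x (f i)) * (x v * w) ∉ K) :
        ∃ f : ℕ → ℕ, f 1 = 0 ∧ (∀ l, 1 ≤ l → l < k + 1 → f (l + 1) = f l ∨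
          f (l + 1) = l ∧ ∀ w ∈ J (l + 2), (∏ i ∈ Finset.Icc 1 l, x (f i)) * x (f l) * w ∈ K) ∧
          ∃ w ∈ J (k + 1 + 1), (∏ i ∈ Finset.Icc 1 (k + 1), x (f i)) * w ∉ K := by
      have hup {i : ℕ} (hi : i ≤ k) : Function.update f (k + 1) v i = f i :=
        Function.update_of_ne (by omega) _ _
      have hprod {l : ℕ} (hl : l ≤ k) : ∏ i ∈ Finset.Icc 1 l, x (Function.update f (k + 1) v i) =
          ∏ i ∈ Finset.Icc 1 l, x (f i) := Finset.prod_congr rfl fun i hi => by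
        rw [hup ((Finset.mem_Icc.1 hi).2.trans hl)]
      refine ⟨Function.update f (k + 1) v, ?_, fun l hl hlk => ?_, w, hw, ?_⟩
      · by_cases hk : k = 0
        · rw [h0 hk, hk]
          exact Function.update_self _ _ _
        · rw [hup (by omega), hf]
      · rw [hprod (by omega), hup (i := l) (by omega)]
        by_cases hl' : l = k
        · subst hl'
          rw [Function.update_self]
          exact hv hl
        · rw [hup (by omega)]
          exact hf' l hl (by omega)
      · rw [Finset.prod_Icc_succ_top (by omega), hprod le_rfl, Function.update_self, mul_assoc]
        exact hwK
    rcases Nat.eq_zero_or_pos k with rfl | hk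
    · exact hext j (fun _ => by omega) (fun h => absurd h (by omega)) hw hwK
    by_cases hB : ∀ w ∈ J (k + 2), (∏ i ∈ Finset.Icc 1 k, x (f i)) * x (f k) * w ∈ K
    · by_cases hjk : j = k
      · subst hjk
        exact hext j (fun h => absurd h hk.ne') (fun _ => .inr ⟨rfl, hB⟩) hw hwK
      -- The old pivot fails and `j` is smaller than the new index, so `x j` also lies in the
      -- preceding factor. The square of the product under consideration is then a product of two
      -- elements: one with `x j` exchanged for the old pivot, which is in `K`, and one with the old
      -- pivot exchanged for `x j`, which is in `I`. The hypothesis on squares puts the product into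
      -- `K`.
      · refine absurd ?_ hwK
        obtain ⟨k, rfl⟩ := Nat.exists_eq_add_of_lt hk
        rw [zero_add] at *
        have hsplit : I = (∏ i ∈ Finset.Icc 1 (k + 1), Ideal.span (x '' Set.Iio i)) *
            (Ideal.span (x '' Set.Iio (k + 1 + 1)) * J (k + 1 + 2)) := by
          rw [hI, ← mul_assoc, ← prod_ite_eq (fun i => Ideal.span (x '' Set.Iio i)) _ hks]
          exact Finset.prod_congr rfl fun i _ => by split_ifs with h <;> simp [h]
        have hx {j l : ℕ} (hj : j < l) : x j ∈ Ideal.span (x '' Set.Iio l) :=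
          Ideal.subset_span ⟨j, hj, rfl⟩
        have hpr {l : ℕ} (hl : l ≤ k + 1) : ∏ i ∈ Finset.Icc 1 l, x (f i) ∈
            ∏ i ∈ Finset.Icc 1 l, Ideal.span (x '' Set.Iio i) :=
          Ideal.prod_mem_prod fun i hi => by
            rw [Finset.mem_Icc] at hi
            exact hx (hlt hi.1 (hi.2.trans hl))
        refine hK _ (hB w hw) ((∏ i ∈ Finset.Icc 1 k, x (f i)) * x j * (x j * w)) ?_ _ ?_ ?_
        · rw [hsplit, Finset.prod_Icc_succ_top (by omega)]
          exact Ideal.mul_mem_mul (Ideal.mul_mem_mul (hpr (by omega)) (hx (by omega)))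
            (Ideal.mul_mem_mul (hx hj) hw)
        · rw [hsplit]
          exact Ideal.mul_mem_mul (hpr le_rfl) (Ideal.mul_mem_mul (hx hj) hw)
        · rw [Finset.prod_Icc_succ_top (by omega)]
          ring
    · push Not at hB
      obtain ⟨w, hw, hwK⟩ := hB
      exact hext (f k) (fun h => absurd h hk.ne') (fun _ => .inl rfl) hw (by rwa [← mul_assoc])

end VarSum

/-! ### Fractions on the charts of the Rees algebra and of its module. -/

noncomputable section

namespace ProjModule

variable {A σ τ : Type u} [CommRing A] [SetLike σ A] [AddSubgroupClass σ A]
  (𝒜 : ℕ → σ) [GradedRing 𝒜] {N : Type u} [AddCommGroup N] [Module A N] [SetLike τ N]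
  [AddSubgroupClass τ N] (𝒩 : ℕ → τ) [SetLike.GradedSMul 𝒜 𝒩] (f : A)

/-- The powers of `f` as elements of the submonoid of its powers. -/
abbrev genPow (k : ℕ) : Submonoid.powers f :=
  ⟨f ^ k, k, rfl⟩

/-- The embedding of the ring of an affine chart into the localized ring. -/
def awayVal : awayRing 𝒜 f →+* Localization (Submonoid.powers f) :=
  algebraMap (HomogeneousLocalization.Away 𝒜 f) _

theorem awayVal_injective : Function.Injective (awayVal 𝒜 f) :=
  HomogeneousLocalization.val_injective _

variable {𝒜 f} in
/-- The fraction `a / f ^ k`. -/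
def awayMk {m : ℕ} (hf : f ∈ 𝒜 m) (k : ℕ) {a : A} (ha : a ∈ 𝒜 (k • m)) : awayRing 𝒜 f :=
  HomogeneousLocalization.Away.mk 𝒜 hf k a ha

variable {𝒜 f} in
theorem exists_eq_awayMk {m : ℕ} (hf : f ∈ 𝒜 m) (y : awayRing 𝒜 f) :
    ∃ (k : ℕ) (a : A) (ha : a ∈ 𝒜 (k • m)), y = awayMk hf k ha := by
  obtain ⟨k, a, ha, rfl⟩ := HomogeneousLocalization.Away.mk_surjective 𝒜 hf y
  exact ⟨k, a, ha, rfl⟩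

/-- The elements of degree `0` as functions on an affine chart. -/
def awayConst : 𝒜 0 →+* awayRing 𝒜 f :=
  HomogeneousLocalization.fromZeroRingHom 𝒜 _

/-- The embedding of the module of an affine chart into the localized module. -/
def awayModuleVal : awayModule 𝒜 𝒩 f →+ LocalizedModule (Submonoid.powers f) N :=
  (degreeZero 𝒜 𝒩 (Submonoid.powers f)).subtype.toAddMonoidHom

theorem awayModuleVal_injective : Function.Injective (awayModuleVal 𝒜 𝒩 f) :=
  Subtype.val_injective

variable {f} in
/-- The fraction `n / f ^ k`. -/
def awayModuleMk {m : ℕ} (hf : f ∈ 𝒜 m) (k : ℕ) {n : N} (hn : n ∈ 𝒩 (k • m)) :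
    awayModule 𝒜 𝒩 f :=
  ⟨LocalizedModule.mk n (genPow f k), mk_mem_degreeZero hn (SetLike.pow_mem_graded k hf)⟩

theorem awayModuleVal_awayModuleMk {m : ℕ} (hf : f ∈ 𝒜 m) (k : ℕ) {n : N} (hn : n ∈ 𝒩 (k • m)) :
    awayModuleVal 𝒜 𝒩 f (awayModuleMk 𝒜 𝒩 hf k hn) = LocalizedModule.mk n (genPow f k) :=
  rfl

variable {f} in
theorem exists_eq_awayModuleMk {m : ℕ} (hf : f ∈ 𝒜 m) (z : awayModule 𝒜 𝒩 f) :
    ∃ (k : ℕ) (n : N) (hn : n ∈ 𝒩 (k • m)), z = awayModuleMk 𝒜 𝒩 hf k hn := by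
  obtain ⟨_, d, n, ⟨_, k, rfl⟩, hs, rfl⟩ := z
  -- The degree of the denominator is determined by its exponent unless `f ^ k = 0`; in that case
  -- every fraction is zero.
  by_cases h0 : f ^ k = 0
  · refine ⟨0, 0, zero_mem _, awayModuleVal_injective 𝒜 𝒩 f ?_⟩
    rw [awayModuleVal_awayModuleMk]
    refine LocalizedModule.mk_eq.2 ⟨genPow f k, ?_⟩
    simp only [Submonoid.smul_def, h0, zero_smul]
  · obtain rfl : d = k • m :=
      DirectSum.degree_eq_of_mem_mem 𝒜 hs (SetLike.pow_mem_graded k hf) h0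
    exact ⟨k, n.1, n.2, rfl⟩

end ProjModule

namespace BlowingUp

open ProjModule VarSum

set_option linter.unusedSectionVars false

variable {R : Type u} [CommRing R] {I : Ideal R}

/-- The element `a t ^ n` of the Rees algebra. -/
def reesMonomial (n : ℕ) {a : R} (ha : a ∈ I ^ n) : reesAlgebra I :=
  ⟨Polynomial.monomial n a, reesAlgebra.monomial_mem.2 ha⟩

theorem reesMonomial_mem (n : ℕ) {a : R} (ha : a ∈ I ^ n) :
    reesMonomial n ha ∈ reesGrading I n :=
  fun _ hm => Polynomial.coeff_monomial_of_ne _ hm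

theorem exists_eq_reesMonomial {n : ℕ} {y : reesAlgebra I} (hy : y ∈ reesGrading I n) :
    ∃ (a : R) (ha : a ∈ I ^ n), y = reesMonomial n ha := by
  refine ⟨y.1.coeff n, y.2 n, Subtype.ext (Polynomial.ext fun m => ?_)⟩
  by_cases h : m = n
  · subst h
    exact (Polynomial.coeff_monomial_same _ _).symm
  · exact (hy m h).trans (Polynomial.coeff_monomial_of_ne _ h).symm

theorem reesMonomial_mul {k l : ℕ} {a b : R} (ha : a ∈ I ^ k) (hb : b ∈ I ^ l)
    (hab : a * b ∈ I ^ (k + l)) :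
    reesMonomial k ha * reesMonomial l hb = reesMonomial (k + l) hab :=
  Subtype.ext (Polynomial.monomial_mul_monomial k l a b)

theorem algebraMap_mul_reesMonomial {n : ℕ} {a r : R} (ha : a ∈ I ^ n) (hra : r * a ∈ I ^ n) :
    algebraMap R (reesAlgebra I) r * reesMonomial n ha = reesMonomial n hra :=
  Subtype.ext (Polynomial.C_mul_monomial ..)

theorem reesMonomial_eq_zero {n : ℕ} {a : R} (ha : a ∈ I ^ n) :
    reesMonomial n ha = 0 ↔ a = 0 :=
  ⟨fun h => (Polynomial.monomial_eq_zero_iff a n).1 (congrArg Subtype.val h), fun h =>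
    Subtype.ext ((Polynomial.monomial_eq_zero_iff a n).2 h)⟩

theorem algebraMap_mem_reesGrading (r : R) :
    algebraMap R (reesAlgebra I) r ∈ reesGrading I 0 :=
  fun _ hm => Polynomial.coeff_C_of_ne_zero hm

section Module

variable {M : Type u} [AddCommGroup M] [Module R M]

/-- The element `m t ^ n` of the graded module `⨁ n, I ^ n M`. -/
def reesModuleMonomial (n : ℕ) {m : M} (hm : m ∈ (I ^ n • ⊤ : Submodule R M)) :
    reesModule I M :=
  ⟨PolynomialModule.single R n m, fun i => by
    rw [PolynomialModule.coeff_single, Finsupp.single_apply]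
    split_ifs with h
    · exact h ▸ hm
    · exact zero_mem _⟩

theorem reesModuleMonomial_mem (n : ℕ) {m : M} (hm : m ∈ (I ^ n • ⊤ : Submodule R M)) :
    reesModuleMonomial n hm ∈ reesModuleGrading I M n := fun i hi => by
  change (PolynomialModule.single R n m).coeff i = 0
  rw [PolynomialModule.coeff_single, Finsupp.single_eq_of_ne hi]

theorem exists_eq_reesModuleMonomial {n : ℕ} {y : reesModule I M}
    (hy : y ∈ reesModuleGrading I M n) :
    ∃ (m : M) (hm : m ∈ (I ^ n • ⊤ : Submodule R M)), y = reesModuleMonomial n hm := by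
  refine ⟨y.1.coeff n, y.2 n, Subtype.ext (PolynomialModule.ext (Finsupp.ext fun i => ?_))⟩
  change _ = (PolynomialModule.single R n _).coeff i
  by_cases h : i = n
  · subst h
    rw [PolynomialModule.coeff_single, Finsupp.single_eq_same]
  · rw [PolynomialModule.coeff_single, Finsupp.single_eq_of_ne h]
    exact hy i h

theorem reesMonomial_smul {k l : ℕ} {a : R} {m : M} (ha : a ∈ I ^ k)
    (hm : m ∈ (I ^ l • ⊤ : Submodule R M)) (ham : a • m ∈ (I ^ (k + l) • ⊤ : Submodule R M)) :
    reesMonomial k ha • reesModuleMonomial l hm = reesModuleMonomial (k + l) ham :=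
  Subtype.ext (PolynomialModule.monomial_smul_single k a l m)

theorem algebraMap_smul_reesModuleMonomial {n : ℕ} {r : R} {m : M}
    (hm : m ∈ (I ^ n • ⊤ : Submodule R M)) (hrm : r • m ∈ (I ^ n • ⊤ : Submodule R M)) :
    algebraMap R (reesAlgebra I) r • reesModuleMonomial n hm = reesModuleMonomial n hrm := by
  refine Subtype.ext (Eq.trans (PolynomialModule.monomial_smul_single 0 r n m) ?_)
  rw [zero_add]
  rfl

theorem reesModuleMonomial_eq_zero {n : ℕ} {m : M} (hm : m ∈ (I ^ n • ⊤ : Submodule R M)) :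
    reesModuleMonomial n hm = 0 ↔ m = 0 := by
  refine ⟨fun h => ?_, fun h => Subtype.ext ?_⟩
  · have := congrArg (fun y : reesModule I M => y.1.coeff n) h
    exact (Finsupp.single_eq_same (a := n) (b := m)).symm.trans this
  · change PolynomialModule.single R n m = 0
    rw [h, PolynomialModule.single_zero]

end Module

variable {g : R} (hg : g ∈ I)

/-- The element `g t` of the Rees algebra. -/
def reesGenerator : reesAlgebra I :=
  reesMonomial 1 ((pow_one I).symm ▸ hg)

theorem reesGenerator_mem : reesGenerator hg ∈ reesGrading I 1 :=
  reesMonomial_mem 1 _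

theorem reesGenerator_pow (k : ℕ) :
    reesGenerator hg ^ k = reesMonomial k (Ideal.pow_mem_pow hg k) :=
  Subtype.ext ((Polynomial.monomial_pow 1 g k).trans (by rw [one_mul]; rfl))

/-- The ring of the affine chart of the blowing up associated with `g`. -/
abbrev chartRing : CommRingCat.{u} :=
  awayRing (reesGrading I) (reesGenerator hg)

/-- The element `a / g ^ k` of the ring of an affine chart. -/
def frac (k : ℕ) {a : R} (ha : a ∈ I ^ k) : chartRing hg :=
  awayMk (reesGenerator_mem hg) k (a := reesMonomial k ha)
    (by rw [smul_eq_mul, mul_one]; exact reesMonomial_mem k ha)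

theorem exists_eq_frac (y : chartRing hg) :
    ∃ (k : ℕ) (a : R) (ha : a ∈ I ^ k), y = frac hg k ha := by
  obtain ⟨k, b, hb, rfl⟩ := exists_eq_awayMk (reesGenerator_mem hg) y
  have hb' : b ∈ reesGrading I k := by rwa [smul_eq_mul, mul_one] at hb
  obtain ⟨a, ha, rfl⟩ := exists_eq_reesMonomial hb'
  exact ⟨k, a, ha, rfl⟩

/-- The embedding of the ring of an affine chart into the localized Rees algebra. -/
abbrev chartVal : chartRing hg →+* Localization (Submonoid.powers (reesGenerator hg)) :=
  awayVal (reesGrading I) (reesGenerator hg)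

theorem chartVal_injective : Function.Injective (chartVal hg) :=
  awayVal_injective _ _

theorem chartVal_frac (k : ℕ) {a : R} (ha : a ∈ I ^ k) :
    chartVal hg (frac hg k ha) = Localization.mk (reesMonomial k ha) (genPow _ k) :=
  rfl

/-- The ring of an affine chart of the blowing up is an algebra over the base. -/
instance chartAlgebra : Algebra R (chartRing hg) :=
  ((awayConst (reesGrading I) (reesGenerator hg)).comp
    { toFun r := ⟨algebraMap R _ r, algebraMap_mem_reesGrading r⟩
      map_one' := Subtype.ext (map_one (algebraMap R (reesAlgebra I)))
      map_zero' := Subtype.ext (map_zero (algebraMap R (reesAlgebra I)))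
      map_mul' r r' := Subtype.ext (map_mul (algebraMap R (reesAlgebra I)) r r')
      map_add' r r' := Subtype.ext (map_add (algebraMap R (reesAlgebra I)) r r') }).toAlgebra

theorem chartVal_algebraMap (r : R) : chartVal hg (algebraMap R (chartRing hg) r) =
    Localization.mk (algebraMap R (reesAlgebra I) r) 1 :=
  rfl

theorem algebraMap_pow_mul_frac (k : ℕ) {a : R} (ha : a ∈ I ^ k) :
    algebraMap R (chartRing hg) g ^ k * frac hg k ha = algebraMap R (chartRing hg) a := by
  refine chartVal_injective hg ?_
  rw [← map_pow, map_mul, chartVal_frac, chartVal_algebraMap, chartVal_algebraMap,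
    Localization.mk_mul, Localization.mk_eq_mk_iff, Localization.r_iff_exists]
  refine ⟨1, ?_⟩
  simp only [Submonoid.coe_one, one_mul]
  rw [algebraMap_mul_reesMonomial ha (Ideal.mul_mem_left _ _ ha), reesGenerator_pow,
    mul_comm (reesMonomial _ _),
    algebraMap_mul_reesMonomial _ (Ideal.mul_mem_left _ _ (Ideal.pow_mem_pow hg k))]
  exact Subtype.ext congr(Polynomial.monomial k $(mul_comm _ _))

/-- In degree terms, if `(g t) ^ j` kills `g a t ^ k`, then `g ^ (j + 1) a = 0`, so `(g t) ^ (j +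
1)` kills `a t ^ k`. -/
theorem eq_zero_of_algebraMap_mul {y : chartRing hg} (h : algebraMap R (chartRing hg) g * y = 0) :
    y = 0 := by
  obtain ⟨k, a, ha, rfl⟩ := exists_eq_frac hg y
  have h1 := congrArg (chartVal hg) h
  rw [map_mul, map_zero, chartVal_frac, chartVal_algebraMap, Localization.mk_mul,
    Localization.mk_eq_mk', IsLocalization.mk'_eq_zero_iff] at h1
  obtain ⟨⟨_, j, rfl⟩, h1⟩ := h1
  refine chartVal_injective hg ?_
  rw [chartVal_frac, map_zero, Localization.mk_eq_mk', IsLocalization.mk'_eq_zero_iff]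
  refine ⟨⟨_, j + 1, rfl⟩, ?_⟩
  dsimp only at h1 ⊢
  have hpow {l : ℕ} {b : R} (hb : b ∈ I ^ k) : g ^ l * b ∈ I ^ (l + k) := by
    rw [pow_add]
    exact Ideal.mul_mem_mul (Ideal.pow_mem_pow hg l) hb
  rw [algebraMap_mul_reesMonomial ha (Ideal.mul_mem_left _ _ ha), reesGenerator_pow,
    reesMonomial_mul _ _ (hpow (Ideal.mul_mem_left _ _ ha)), reesMonomial_eq_zero] at h1
  rw [reesGenerator_pow, reesMonomial_mul _ _ (hpow ha), reesMonomial_eq_zero, pow_succ,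
    mul_assoc, h1]

variable (M : Type u) [AddCommGroup M] [Module R M]

/-- The module of the affine chart of the blowing up associated with `g`. -/
abbrev chartModule : ModuleCat.{u} (chartRing hg) :=
  awayModule (reesGrading I) (reesModuleGrading I M) (reesGenerator hg)

instance chartModuleBase : Module R (chartModule hg M) :=
  Module.compHom _ (algebraMap R (chartRing hg))

instance chartModule_isScalarTower : IsScalarTower R (chartRing hg) (chartModule hg M) :=
  .of_algebraMap_smul fun _ _ => rfl

variable {M}

/-- The embedding of the module of an affine chart into the localized module. -/
abbrev chartModuleVal : chartModule hg M →+
    LocalizedModule (Submonoid.powers (reesGenerator hg)) (reesModule I M) :=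
  awayModuleVal (reesGrading I) (reesModuleGrading I M) (reesGenerator hg)

theorem chartModuleVal_injective : Function.Injective (chartModuleVal (M := M) hg) :=
  awayModuleVal_injective _ _ _

theorem chartModuleVal_smul (r : R) (z : chartModule hg M) : chartModuleVal hg (r • z) =
    (Localization.mk (algebraMap R (reesAlgebra I) r) 1 :
      Localization (Submonoid.powers (reesGenerator hg))) • chartModuleVal hg z :=
  rfl

/-- The element `m / g ^ k` of the module of an affine chart. -/
def moduleFrac (k : ℕ) {m : M} (hm : m ∈ (I ^ k • ⊤ : Submodule R M)) : chartModule hg M :=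
  awayModuleMk (reesGrading I) (reesModuleGrading I M) (reesGenerator_mem hg) k
    (n := reesModuleMonomial k hm)
    (by rw [smul_eq_mul, mul_one]; exact reesModuleMonomial_mem k hm)

theorem chartModuleVal_moduleFrac (k : ℕ) {m : M} (hm : m ∈ (I ^ k • ⊤ : Submodule R M)) :
    chartModuleVal hg (moduleFrac hg k hm) =
      LocalizedModule.mk (reesModuleMonomial k hm) (genPow _ k) :=
  rfl

theorem exists_eq_moduleFrac (z : chartModule hg M) :
    ∃ (k : ℕ) (m : M) (hm : m ∈ (I ^ k • ⊤ : Submodule R M)), z = moduleFrac hg k hm := by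
  obtain ⟨k, n, hn, rfl⟩ := exists_eq_awayModuleMk (reesGrading I) (reesModuleGrading I M)
    (reesGenerator_mem hg) z
  have hn' : n ∈ reesModuleGrading I M k := by rwa [smul_eq_mul, mul_one] at hn
  obtain ⟨m, hm, rfl⟩ := exists_eq_reesModuleMonomial hn'
  exact ⟨k, m, hm, rfl⟩

theorem mem_pow_zero_smul_top (m : M) : m ∈ (I ^ 0 • ⊤ : Submodule R M) := by
  rw [pow_zero, Ideal.one_eq_top, Submodule.top_smul]
  trivial

variable (M) in
/-- The map from a module to the module of an affine chart of the blowing up. -/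
def chartHom : M →ₗ[R] chartModule hg M where
  toFun m := moduleFrac hg 0 (mem_pow_zero_smul_top m)
  map_add' m m' := chartModuleVal_injective hg (by
    simp only [map_add, chartModuleVal_moduleFrac]
    refine LocalizedModule.mk_eq.2 ?_ |>.trans LocalizedModule.mk_add_mk.symm
    refine ⟨1, ?_⟩
    simp only [Submonoid.smul_def, Submonoid.coe_mul, pow_zero, one_smul, mul_one]
    exact Subtype.ext (PolynomialModule.single_add ..))
  map_smul' r m := chartModuleVal_injective hg (by
    rw [RingHom.id_apply, chartModuleVal_smul, chartModuleVal_moduleFrac,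
      chartModuleVal_moduleFrac, LocalizedModule.mk_smul_mk, one_mul,
      algebraMap_smul_reesModuleMonomial])

theorem smul_mem_pow_smul_top {k l : ℕ} {a : R} {m : M} (ha : a ∈ I ^ k)
    (hm : m ∈ (I ^ l • ⊤ : Submodule R M)) : a • m ∈ (I ^ (k + l) • ⊤ : Submodule R M) := by
  rw [pow_add, mul_smul]
  exact Submodule.smul_mem_smul ha hm

theorem pow_smul_moduleFrac (k : ℕ) {m : M} (hm : m ∈ (I ^ k • ⊤ : Submodule R M)) :
    g ^ k • moduleFrac hg k hm = chartHom hg M m := by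
  refine chartModuleVal_injective hg ?_
  rw [chartModuleVal_smul, chartModuleVal_moduleFrac, LocalizedModule.mk_smul_mk, one_mul,
    algebraMap_smul_reesModuleMonomial hm (Submodule.smul_mem _ _ hm)]
  refine (LocalizedModule.mk_eq.2 ⟨1, ?_⟩).trans (chartModuleVal_moduleFrac hg 0 _).symm
  simp only [Submonoid.smul_def, one_smul, pow_zero]
  rw [reesGenerator_pow, reesMonomial_smul _ _ (smul_mem_pow_smul_top (Ideal.pow_mem_pow hg k)
    (mem_pow_zero_smul_top m))]
  rfl

theorem eq_zero_of_smul {z : chartModule hg M} (h : g • z = 0) : z = 0 := by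
  obtain ⟨k, m, hm, rfl⟩ := exists_eq_moduleFrac hg z
  have h1 := congrArg (chartModuleVal hg) h
  rw [chartModuleVal_smul, chartModuleVal_moduleFrac, LocalizedModule.mk_smul_mk, map_zero,
    ← LocalizedModule.zero_mk 1, LocalizedModule.mk_eq,
    algebraMap_smul_reesModuleMonomial hm (Submodule.smul_mem _ _ hm)] at h1
  obtain ⟨⟨_, j, rfl⟩, h1⟩ := h1
  refine chartModuleVal_injective hg ?_
  rw [chartModuleVal_moduleFrac, map_zero, ← LocalizedModule.zero_mk 1]
  refine LocalizedModule.mk_eq.2 ⟨⟨_, j + 1, rfl⟩, ?_⟩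
  simp only [Submonoid.smul_def, one_smul, smul_zero] at h1 ⊢
  rw [reesGenerator_pow, reesMonomial_smul _ _ (smul_mem_pow_smul_top (Ideal.pow_mem_pow hg j)
    (Submodule.smul_mem _ _ hm)), reesModuleMonomial_eq_zero] at h1
  rw [reesGenerator_pow, reesMonomial_smul _ _ (smul_mem_pow_smul_top (Ideal.pow_mem_pow hg _) hm),
    reesModuleMonomial_eq_zero, pow_succ, mul_smul, h1]

variable (M) in
theorem isBlowupChart : IsBlowupChart (chartRing hg) I g (chartHom hg M) where
  smul_eq_zero _ h := eq_zero_of_smul hg h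
  mul_eq_zero _ h := eq_zero_of_algebraMap_mul hg h
  exists_mul_eq a ha := by
    have ha' : a ∈ I ^ 1 := by rwa [pow_one]
    exact ⟨frac hg 1 ha', by simpa using algebraMap_pow_mul_frac hg 1 ha'⟩
  exists_pow_mul_eq y := by
    obtain ⟨k, a, ha, rfl⟩ := exists_eq_frac hg y
    exact ⟨k, a, ha, algebraMap_pow_mul_frac hg k ha⟩
  exists_pow_smul_eq z := by
    obtain ⟨k, m, hm, rfl⟩ := exists_eq_moduleFrac hg z
    exact ⟨k, m, hm, pow_smul_moduleFrac hg k hm⟩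
  ker m h := by
    have h1 := congrArg (chartModuleVal hg) h
    rw [map_zero] at h1
    have h2 := (chartModuleVal_moduleFrac hg 0 (mem_pow_zero_smul_top m)).symm.trans h1
    rw [← LocalizedModule.zero_mk 1, LocalizedModule.mk_eq] at h2
    obtain ⟨⟨_, k, rfl⟩, h2⟩ := h2
    simp only [Submonoid.smul_def, one_smul, smul_zero] at h2
    rw [reesGenerator_pow, reesMonomial_smul _ _ (smul_mem_pow_smul_top (Ideal.pow_mem_pow hg k)
      (mem_pow_zero_smul_top m)), reesModuleMonomial_eq_zero] at h2
    exact ⟨k, h2⟩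

end BlowingUp

end

/-! ### Specialization to the closed fibre in the spectrum of the Rees algebra. -/

noncomputable section

namespace ProjModule

variable {A σ : Type u} [CommRing A] [SetLike σ A] [AddSubgroupClass σ A]
  {𝒜 : ℕ → σ} [GradedRing 𝒜] {f : A}

theorem mem_of_awayMk_mem (hf : f ∈ 𝒜 1) {k : ℕ} (hk : 0 < k) {a : A} (ha : a ∈ 𝒜 (k • 1))
    {y : Spec (awayRing 𝒜 f)} (h : awayMk hf k ha ∈ y.asIdeal) :
    a ∈ (chart hf Nat.one_pos y).asHomogeneousIdeal := by
  by_contra hcon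
  have ha' : a ∈ 𝒜 k := by rwa [smul_eq_mul, mul_one] at ha
  refine isLocalizationElem_notMem hf Nat.one_pos ha' hk hcon ?_
  have e : HomogeneousLocalization.Away.isLocalizationElem hf ha' =
      HomogeneousLocalization.Away.mk 𝒜 hf k a ha :=
    HomogeneousLocalization.val_injective _
      (congrArg (fun b => Localization.mk b (genPow f k)) (pow_one a))
  rw [e]
  exact h

end ProjModule

namespace BlowingUp

open ProjModule VarSum IsLocalRing

set_option linter.unusedSectionVars false

variable {R : Type u} [CommRing R] {I : Ideal R}

/-- The elements `a` of `I ^ n` such that `a t ^ n` is in a given ideal. -/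
def degreePart (Q : Ideal (reesAlgebra I)) (n : ℕ) : Ideal R where
  carrier := {a | ∃ ha : a ∈ I ^ n, reesMonomial n ha ∈ Q}
  zero_mem' := ⟨zero_mem _, by rw [(reesMonomial_eq_zero _).2 rfl]; exact zero_mem _⟩
  add_mem' := by
    rintro a b ⟨ha, ha'⟩ ⟨hb, hb'⟩
    refine ⟨add_mem ha hb, ?_⟩
    convert add_mem ha' hb' using 1
    exact Subtype.ext (map_add (Polynomial.monomial n) a b)
  smul_mem' := by
    rintro r a ⟨ha, ha'⟩
    refine ⟨Ideal.mul_mem_left _ r ha, ?_⟩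
    rw [← algebraMap_mul_reesMonomial ha]
    exact Ideal.mul_mem_left _ _ ha'

theorem mem_degreePart {Q : Ideal (reesAlgebra I)} {n : ℕ} {a : R} (ha : a ∈ I ^ n) :
    a ∈ degreePart Q n ↔ reesMonomial n ha ∈ Q :=
  ⟨fun h => h.2, fun h => ⟨ha, h⟩⟩

theorem degreePart_mono {Q Q' : Ideal (reesAlgebra I)} (h : Q ≤ Q') (n : ℕ) :
    degreePart Q n ≤ degreePart Q' n :=
  fun _ ha => ⟨ha.1, h ha.2⟩

theorem pow_succ_le_degreePart {Q Q' : Ideal (reesAlgebra I)} {n : ℕ}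
    (h : I ≤ degreePart Q 1) (h' : I ^ n ≤ degreePart Q' n) :
    I ^ (n + 1) ≤ degreePart (Q' * Q) (n + 1) := by
  rw [pow_succ, Ideal.mul_le]
  intro a ha b hb
  have hb' : b ∈ I ^ 1 := by rwa [pow_one]
  have hab : a * b ∈ I ^ (n + 1) := by
    rw [pow_succ]
    exact Ideal.mul_mem_mul ha hb
  rw [mem_degreePart hab, ← reesMonomial_mul ha hb' hab]
  exact Ideal.mul_mem_mul ((mem_degreePart ha).1 (h' ha)) ((mem_degreePart hb').1 (h hb))

theorem pow_le_degreePart {Q : Ideal (reesAlgebra I)} (h : I ≤ degreePart Q 1) (n : ℕ) :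
    I ^ n ≤ degreePart (Q ^ n) n := by
  induction n with
  | zero => exact fun a ha => (mem_degreePart ha).2 (by rw [pow_zero, Ideal.one_eq_top]; trivial)
  | succ n ih =>
    rw [pow_succ Q]
    exact pow_succ_le_degreePart h ih

/-- The coefficient of `t ^ n` of an element of the Rees algebra. -/
def reesCoeff (n : ℕ) : reesAlgebra I →ₗ[R] R :=
  (Polynomial.lcoeff R n).comp (reesAlgebra I).val.toLinearMap

theorem reesCoeff_mem (n : ℕ) (y : reesAlgebra I) : reesCoeff n y ∈ I ^ n :=
  y.2 n

theorem reesCoeff_reesMonomial {n : ℕ} {a : R} (ha : a ∈ I ^ n) :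
    reesCoeff n (reesMonomial n ha) = a :=
  Polynomial.coeff_monomial_same n a

theorem decompose_eq_reesMonomial (n : ℕ) (y : reesAlgebra I) :
    (DirectSum.decompose (reesGrading I) y n : reesAlgebra I) =
      reesMonomial n (reesCoeff_mem n y) := by
  classical
  obtain ⟨a, ha, e⟩ := exists_eq_reesMonomial (DirectSum.decompose (reesGrading I) y n).2
  have h1 : reesCoeff n y =
      reesCoeff n (DirectSum.decompose (reesGrading I) y n : reesAlgebra I) := by
    conv_lhs => rw [← DirectSum.sum_support_decompose (reesGrading I) y]
    rw [map_sum]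
    refine Finset.sum_eq_single n (fun i _ hi => ?_) fun hn => ?_
    · exact (DirectSum.decompose (reesGrading I) y i).2 n hi.symm
    · rw [DFinsupp.notMem_support_iff.1 hn, ZeroMemClass.coe_zero, map_zero]
  rw [e] at h1 ⊢
  rw [reesCoeff_reesMonomial] at h1
  subst h1
  rfl

theorem reesCoeff_mem_degreePart {Q : Ideal (reesAlgebra I)} (hQ : Q.IsHomogeneous (reesGrading I))
    (n : ℕ) {y : reesAlgebra I} (hy : y ∈ Q) : reesCoeff n y ∈ degreePart Q n := by
  rw [mem_degreePart (reesCoeff_mem n y), ← decompose_eq_reesMonomial]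
  exact hQ n hy

theorem reesCoeff_mem_smul {J : Ideal R} (n : ℕ) {y : reesAlgebra I}
    (hy : y ∈ J.map (algebraMap R (reesAlgebra I))) : reesCoeff n y ∈ J • I ^ n := by
  have hy' : y ∈ (J • ⊤ : Submodule R (reesAlgebra I)) := by
    rw [Ideal.smul_top_eq_map]
    exact hy
  refine Submodule.smul_induction_on hy' (fun r hr z _ => ?_) fun y z hy hz => ?_
  · rw [map_smul]
    exact Submodule.smul_mem_smul hr (reesCoeff_mem n z)
  · rw [map_add]
    exact add_mem hy hz

/-- An ideal that contains the degree one part of the Rees algebra contains all positive degrees,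
since these are generated by degree one. This is what a point of `Proj` excludes. -/
theorem mem_of_mem_irrelevant {Q : Ideal (reesAlgebra I)} (h : I ≤ degreePart Q 1)
    {y : reesAlgebra I} (hy : y ∈ HomogeneousIdeal.irrelevant (reesGrading I)) : y ∈ Q := by
  classical
  have h4 (n : ℕ) : I ^ (n + 1) ≤ degreePart Q (n + 1) :=
    (pow_succ_le_degreePart (Q' := ⊤) h fun a ha => (mem_degreePart ha).2 trivial).trans
      (degreePart_mono Ideal.mul_le_right _)
  rw [← DirectSum.sum_support_decompose (reesGrading I) y]
  refine Ideal.sum_mem _ fun i _ => ?_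
  rcases i with - | i
  · have h0 : (DirectSum.decompose (reesGrading I) y 0 : reesAlgebra I) = 0 := hy
    rw [h0]
    exact zero_mem _
  · rw [decompose_eq_reesMonomial]
    exact (mem_degreePart _).1 (h4 i (reesCoeff_mem _ y))

theorem le_degreePart_of_pow {Q : Ideal (reesAlgebra I)} [Q.IsPrime] {N : ℕ}
    (h : I ^ N ≤ degreePart Q N) : I ≤ degreePart Q 1 := by
  intro a ha
  have ha' : a ∈ I ^ 1 := by rwa [pow_one]
  rw [mem_degreePart ha']
  refine Ideal.IsPrime.mem_of_pow_mem inferInstance N ?_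
  have h5 := (mem_degreePart (Ideal.pow_mem_pow ha N)).1 (h (Ideal.pow_mem_pow ha N))
  rw [← reesGenerator_pow ha N] at h5
  exact h5

/-- A homogeneous version of the Nakayama lemma. -/
theorem pow_le_degreePart_of_le_sup [IsNoetherianRing R] [IsLocalRing R]
    {Q : Ideal (reesAlgebra I)} (hQ : Q.IsHomogeneous (reesGrading I)) {N : ℕ}
    (h : I ^ N ≤ degreePart (Q ⊔ (maximalIdeal R).map (algebraMap R (reesAlgebra I))) N) :
    I ^ N ≤ degreePart Q N := by
  refine Submodule.le_of_le_smul_of_le_jacobson_bot (I := maximalIdeal R)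
    (IsNoetherian.noetherian _) (maximalIdeal_le_jacobson _) fun a ha => ?_
  -- Comparing coefficients of `t ^ N` gives `I ^ N` contained in the degree part of `Q` plus `𝔪 I ^
  -- N`, where the usual Nakayama lemma applies.
  obtain ⟨p, hp, z, hz, e⟩ := Submodule.mem_sup.1 ((mem_degreePart ha).1 (h ha))
  rw [← reesCoeff_reesMonomial ha, ← e, map_add]
  exact add_mem (Submodule.mem_sup_left (reesCoeff_mem_degreePart hQ N hp))
    (Submodule.mem_sup_right (reesCoeff_mem_smul N hz))

/-- The hypothesis places the degree one part in the radical of `Q`, and in the Noetherian Rees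
algebra a power of the radical lies in `Q`. -/
theorem exists_pow_le_degreePart [IsNoetherianRing R] {Q : Ideal (reesAlgebra I)}
    (h : ∀ P : Ideal (reesAlgebra I), P.IsPrime → Q ≤ P → I ≤ degreePart P 1) :
    ∃ N, I ^ N ≤ degreePart Q N := by
  have h1 : I ≤ degreePart Q.radical 1 := by
    intro a ha
    have ha' : a ∈ I ^ 1 := by rwa [pow_one]
    rw [mem_degreePart ha', Ideal.radical_eq_sInf, Submodule.mem_sInf]
    intro P hP
    exact (mem_degreePart ha').1 (h P hP.2 hP.1 ha)
  obtain ⟨N, hN⟩ := Ideal.exists_radical_pow_le_of_fg Q (IsNoetherian.noetherian _)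
  exact ⟨N, (pow_le_degreePart h1 N).trans (degreePart_mono hN N)⟩

/-- A point of the blowing up specializes, within the spectrum of the Rees algebra, to a point
of the closed fibre of the blowing up. -/
theorem exists_isPrime_le [IsNoetherianRing R] [IsLocalRing R]
    (X : ProjectiveSpectrum (reesGrading I)) :
    ∃ P : Ideal (reesAlgebra I), P.IsPrime ∧ X.asHomogeneousIdeal.toIdeal ≤ P ∧
      (maximalIdeal R).map (algebraMap R (reesAlgebra I)) ≤ P ∧ ¬ I ≤ degreePart P 1 := by
  -- Otherwise all primes over `X` and the maximal ideal contain the degree one part. A power of it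
  -- then lies in the sum of the two ideals, hence in `X` by Nakayama, hence the degree one part
  -- itself lies in `X`. The prime `P` that is found need not be homogeneous.
  by_contra! hcon
  have hX := X.isPrime
  obtain ⟨N, hN⟩ := exists_pow_le_degreePart (Q := X.asHomogeneousIdeal.toIdeal ⊔
    (maximalIdeal R).map (algebraMap R (reesAlgebra I)))
      fun P hP hQP => hcon P hP (le_sup_left.trans hQP) (le_sup_right.trans hQP)
  have h1 := le_degreePart_of_pow
    (pow_le_degreePart_of_le_sup X.asHomogeneousIdeal.isHomogeneous hN)
  exact X.not_irrelevant_le fun y hy => mem_of_mem_irrelevant h1 hy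

variable {g : R} (hg : g ∈ I)

/-- The ideal of an affine chart of the blowing up defined by an ideal of the Rees algebra. -/
def chartIdeal (P : Ideal (reesAlgebra I)) : Ideal (chartRing hg) :=
  (P.map (algebraMap _ (Localization (Submonoid.powers (reesGenerator hg))))).comap (chartVal hg)

variable {P : Ideal (reesAlgebra I)} [P.IsPrime]

theorem disjoint_powers (hP : reesGenerator hg ∉ P) :
    Disjoint (Submonoid.powers (reesGenerator hg) : Set (reesAlgebra I)) P := by
  refine Set.disjoint_left.2 ?_
  rintro _ ⟨k, rfl⟩ h
  exact hP (Ideal.IsPrime.mem_of_pow_mem ‹_› k h)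

theorem isPrime_chartIdeal (hP : reesGenerator hg ∉ P) : (chartIdeal hg P).IsPrime := by
  have := IsLocalization.isPrime_of_isPrime_disjoint (Submonoid.powers (reesGenerator hg))
    (Localization (Submonoid.powers (reesGenerator hg))) P ‹_› (disjoint_powers hg hP)
  exact Ideal.comap_isPrime _ _

theorem frac_mem_chartIdeal {P : Ideal (reesAlgebra I)} {k : ℕ} {a : R} (ha : a ∈ I ^ k)
    (h : reesMonomial k ha ∈ P) : frac hg k ha ∈ chartIdeal hg P := by
  rw [chartIdeal, Ideal.mem_comap, chartVal_frac, Localization.mk_eq_mk',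
    IsLocalization.mk'_mem_iff]
  exact Ideal.mem_map_of_mem _ h

theorem map_maximalIdeal_le_chartIdeal {J : Ideal R} {P : Ideal (reesAlgebra I)}
    (h : J.map (algebraMap R (reesAlgebra I)) ≤ P) :
    J.map (algebraMap R (chartRing hg)) ≤ chartIdeal hg P := by
  rw [Ideal.map_le_iff_le_comap]
  intro r hr
  rw [Ideal.mem_comap, chartIdeal, Ideal.mem_comap, chartVal_algebraMap,
    Localization.mk_one_eq_algebraMap]
  exact Ideal.mem_map_of_mem _ (h (Ideal.mem_map_of_mem _ hr))

/-- A fraction `a / g ^ k` is rewritten as `g a / g ^ (k + 1)`: in positive degree, membership in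
the prime of the chart can be read off from the homogeneous prime. -/
theorem asIdeal_le_chartIdeal {P : Ideal (reesAlgebra I)} {y : Spec (chartRing hg)}
    (hy : (chart (reesGenerator_mem hg) Nat.one_pos y).asHomogeneousIdeal.toIdeal ≤ P) :
    y.asIdeal ≤ chartIdeal hg P := by
  intro z hz
  obtain ⟨k, a, ha, rfl⟩ := exists_eq_frac hg z
  have hga : g * a ∈ I ^ (k + 1) := by
    rw [pow_succ']
    exact Ideal.mul_mem_mul hg ha
  have e : frac hg k ha = frac hg (k + 1) hga := by
    refine sub_eq_zero.1 ((isBlowupChart hg R).pow_mul_eq_zero (k := k + 1) ?_)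
    rw [mul_sub, algebraMap_pow_mul_frac, pow_succ', mul_assoc, algebraMap_pow_mul_frac, map_mul,
      sub_self]
  rw [e] at hz ⊢
  exact frac_mem_chartIdeal hg hga (hy (mem_of_awayMk_mem _ (Nat.succ_pos k) _ hz))

end BlowingUp

end

/-! ### Choice of a chart at each point, and the theorem. -/

noncomputable section

namespace BlowingUp

open ProjModule VarSum IsLocalRing CohenMacaulay LocalCohomology

set_option linter.unusedSectionVars false

variable {R : Type u} [CommRing R] {I : Ideal R}

/-- In the Rees algebra `(v t) ^ 2 = (a t) (b t)`, and `P` is prime. This is the closure property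
required for the choice of pivots. -/
theorem mem_degreePart_of_mul_self_eq {P : Ideal (reesAlgebra I)} [P.IsPrime] {a b v : R}
    (ha : a ∈ degreePart P 1) (hb : b ∈ I) (hv : v ∈ I) (e : v * v = a * b) :
    v ∈ degreePart P 1 := by
  rw [← pow_one I] at hb hv
  rw [mem_degreePart hv]
  refine (Ideal.IsPrime.mem_or_mem ‹_› (?_ : reesMonomial 1 hv * _ ∈ P)).elim id id
  have hvv : v * v ∈ I ^ (1 + 1) := by
    rw [pow_add]
    exact Ideal.mul_mem_mul hv hv
  have h1 := reesMonomial_mul ha.1 hb (e ▸ hvv)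
  have h2 : reesMonomial (1 + 1) (e ▸ hvv : a * b ∈ I ^ (1 + 1)) = reesMonomial (1 + 1) hvv := by
    congr 1
    exact e.symm
  rw [reesMonomial_mul hv hv hvv, ← h2, ← h1]
  exact Ideal.mul_mem_right _ _ ha.2

/-- Every point of the blowing up along a product of ideals generated by initial segments of a
sequence lies in an affine chart and specializes, in its spectrum, to a closed point of the closed
fibre at which the coordinates with pivot index vanish. -/
theorem exists_chart [IsNoetherianRing R] [IsLocalRing R] (x : ℕ → R) (s : ℕ)
    (hI : I = ∏ k ∈ Finset.Icc 1 s, Ideal.span (x '' Set.Iio k)) (X : blowup I)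
    (M : Type u) [AddCommGroup M] [Module R M] :
    ∃ (g : R) (hg : g ∈ I) (y : Spec (chartRing hg)),
      chart (reesGenerator_mem hg) Nat.one_pos y = X ∧ ∃ (f : ℕ → ℕ) (c : ℕ → chartRing hg),
        IsAffineChart x f c s (chartHom hg M) ∧ ∃ q : Ideal (chartRing hg), q.IsMaximal ∧
          y.asIdeal ≤ q ∧ (maximalIdeal R).map (algebraMap R (chartRing hg)) ≤ q ∧
            ∀ k, 1 ≤ k → k < s → f (k + 1) ≠ f k → c k ∈ q := by
  obtain ⟨P, hP, hXP, hmP, hIP⟩ := exists_isPrime_le X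
  obtain ⟨f, hf, hf', hfP⟩ := exists_pivot x s hI hIP
    fun a ha b hb v hv e => mem_degreePart_of_mul_self_eq ha hb hv e
  have hfd : ∀ k, 1 ≤ k → k < s → f (k + 1) = f k ∨ f (k + 1) = k :=
    fun k hk hks => (hf' k hk hks).imp_right And.left
  have hg : ∏ k ∈ Finset.Icc 1 s, x (f k) ∈ I := by
    rw [hI]
    refine Ideal.prod_mem_prod fun k hk => Ideal.subset_span ?_
    rw [Finset.mem_Icc] at hk
    exact ⟨f k, lt_of_pivot hf hfd hk.1 hk.2, rfl⟩
  have hgP : reesGenerator hg ∉ P := fun h => hfP ⟨_, h⟩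
  obtain ⟨y, hy⟩ : X ∈ (chart (reesGenerator_mem hg) Nat.one_pos).opensRange := by
    rw [opensRange_chart]
    exact fun h => hgP (hXP h)
  obtain ⟨c, hc, hcf⟩ := (isBlowupChart hg M).exists_isAffineChart hI rfl hf hfd
  have hq := isPrime_chartIdeal hg hgP
  -- The prime of the chart defined by `P` lies over the maximal ideal of `R` but need not be
  -- closed; any maximal ideal above it still contains the vanishing coordinates.
  obtain ⟨q, hqm, hPq⟩ := Ideal.exists_le_maximal _ hq.ne_top
  refine ⟨_, hg, y, hy, f, c, hc, q, hqm, (asIdeal_le_chartIdeal hg ?_).trans hPq,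
    (map_maximalIdeal_le_chartIdeal hg hmP).trans hPq, fun k hk hks hne => hPq ?_⟩
  · rw [hy]
    exact hXP
  -- Where the pivot changes, the choice of pivots puts the numerator of `c k`, as an element of
  -- degree one, into `P`.
  · obtain ⟨ha, ha'⟩ := ((hf' k hk hks).resolve_left hne).2
    have e : c k = frac hg 1 ha := by
      refine sub_eq_zero.1 ((isBlowupChart hg R).mul_eq_zero _ ?_)
      have h1 := algebraMap_pow_mul_frac hg 1 ha
      rw [pow_one] at h1
      rw [mul_sub, h1, hcf k hk hks hne, sub_self]
    rw [e]
    exact frac_mem_chartIdeal hg ha ha'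

theorem exists_isCohenMacaulayModule_chart [IsNoetherianRing R] [IsLocalRing R]
    (M : Type u) [AddCommGroup M] [Module R M] [Module.Finite R M] {s : ℕ} {r : Fin s → R}
    (hr : CMSecant.IsCMSecant r M) (X : blowup (CMSecant.productIdeal r)) :
    ∃ (g : R) (hg : g ∈ CMSecant.productIdeal r) (y : Spec (chartRing hg)),
      chart (reesGenerator_mem hg) Nat.one_pos y = X ∧ IsNoetherianRing (chartRing hg) ∧
        Module.Finite (chartRing hg) (chartModule hg M) ∧ haveI := y.2
          IsCohenMacaulayModule (Localization.AtPrime y.asIdeal)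
            (LocalizedModule y.asIdeal.primeCompl (chartModule hg M)) := by
  obtain ⟨x, hx, n, hsn, hn⟩ : ∃ x : ℕ → R, (∀ i : Fin s, x i = r i) ∧
      ∃ n, s ≤ n ∧ (Nontrivial M → IsSecantSystem M x s n) := by
    rcases subsingleton_or_nontrivial M with hM | hM
    -- For `M = 0` there is no secant system, but a chart is still needed for the Noetherian
    -- statement; any extension of the sequence will do, and the module of the chart is zero.
    · refine ⟨fun k => if hk : k < s then r ⟨k, hk⟩ else 0, fun i => dif_pos i.2, s, le_rfl,
        fun h => (not_nontrivial M h).elim⟩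
    · obtain ⟨x, n, hsn, hx, hn⟩ := CMSecant.exists_isSecantSystem hr
      exact ⟨x, hx, n, hsn, fun _ => hn⟩
  have hI : CMSecant.productIdeal r = ∏ k ∈ Finset.Icc 1 s, Ideal.span (x '' Set.Iio k) :=
    Finset.prod_congr rfl fun k hk => CMSecant.initialIdeal_eq r hx (Finset.mem_Icc.1 hk).2
  obtain ⟨g, hg, y, hy, f, c, hc, q, hq, hyq, hmq, hcq⟩ := exists_chart x s hI X M
  have := hc.finiteType
  have := y.2
  refine ⟨g, hg, y, hy, Algebra.FiniteType.isNoetherianRing R _, hc.finite, ?_⟩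
  rcases subsingleton_or_nontrivial M with hM | hM
  · have : Subsingleton (chartModule hg M) := by
      rw [← Submodule.subsingleton_iff (chartRing hg), ← subsingleton_iff_bot_eq_top, ← hc.span,
        eq_comm, Submodule.span_eq_bot]
      rintro _ ⟨m, rfl⟩
      rw [Subsingleton.elim m 0, map_zero]
    exact Or.inl inferInstance
  · exact hc.isCohenMacaulayModule_of_le (hn hM) hsn hyq hmq hcq
      (LocalizedModule.mkLinearMap y.asIdeal.primeCompl (chartModule hg M))

end BlowingUp

end

theorem mainTheorem8 {R : Type u} [CommRing R] [IsNoetherianRing R] [IsLocalRing R]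
    (M : Type u) [AddCommGroup M] [Module R M] [Module.Finite R M]
    {s : ℕ} (r : Fin s → R) (hr : CMSecant.IsCMSecant r M) :
    CohenMacaulay.IsCohenMacaulaySheaf
      (BlowingUp.blowupModule (CMSecant.productIdeal r) M) := by
  obtain ⟨h1, h2, h3⟩ := Scheme.Modules.isQuasicoherent_of_cover
    (BlowingUp.blowupModule (CMSecant.productIdeal r) M) fun X => by
      obtain ⟨g, hg, y, hy, hB, hP, -⟩ :=
        BlowingUp.exists_isCohenMacaulayModule_chart M hr X
      have hf : IsOpenImmersion
        (ProjModule.chart (BlowingUp.reesGenerator_mem hg) Nat.one_pos) := inferInstance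
      exact ⟨_, ProjModule.chart (BlowingUp.reesGenerator_mem hg) Nat.one_pos, hf, y, _,
        hy, hB, hP, (ProjModule.isLocalizing_awayHom _ _).nonempty_iso⟩
  refine ⟨h1, h2, h3, fun X => ?_⟩
  obtain ⟨g, hg, y, rfl, hB, hP, h⟩ := BlowingUp.exists_isCohenMacaulayModule_chart M hr X
  exact Scheme.Modules.IsLocalizing.isCohenMacaulayModule _
    (ProjModule.isLocalizing_awayHom (BlowingUp.reesGenerator_mem hg) Nat.one_pos) y h
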